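/- Let $G$ be a compact connected Lie group with Lie algebra $\mathfrak g$ (bracket of left invariant vector fields). Vector spaces are real. **Objects.** Let $\mathbb T\mathfrak g$ be the DG Lie algebra with generators $i(x)$ of degree $-1$ and $L(x)$ of degree $0$ ($x\in\mathfrak g$), differential $d\,i(x)=L(x)$, $d\,L(x)=0$, and the Cartan relations as brackets. We consider finite-dimensional cochain complexes $(V,\delta)$ with a representation of $\mathbb T\mathfrak g$, i.e. operators $i_x$ of degree $-1$ and $L_x$ of degree $0$, linear in $x$, with $[i_x,\delta]=L_x$, $[L_x,\delta]=0$, $[i_x,i_y]=0$, $[L_x,L_y]=L_{[x,y]}$, $[L_x,i_y]=i_{[x,y]}$ (graded commutators), whose $\mathfrak g$-representation $L$ integrates to a smooth representation $\rho_V$ of $G$ on $V$ (then $\rho_V$ is unique; if $G$ is simply connected it always exists). For $k\ge 0$ let $\Phi_V^{(k)}\in\Omega^k(G)\otimes\operatorname{End}(V)^{-k}$ be the form with $L_g^*\Phi_V^{(k)}=\rho_V(g)\circ\Phi_V^{(k)}$ and $\Phi^{(k)}_V(e)(x_1,\dots,x_k)=i_{x_k}\circ\cdots\circ i_{x_1}$,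 so that $\Phi^{(0)}_V=\rho_V$, and let $\Phi_V=\sum_k\Phi_V^{(k)}$. **Cochains.** Let $BG_p=G^p$, with faces $\varepsilon_0(g_1,\dots,g_p)=(g_2,\dots,g_p)$, $\varepsilon_i(g_1,\dots,g_p)=(g_1,\dots,g_ig_{i+1},\dots,g_p)$ for $0<i<p$, and $\varepsilon_p(g_1,\dots,g_p)=(g_1,\dots,g_{p-1})$. For objects $V,V'$ consider $$\Omega^\bullet(BG_\bullet)\otimes\operatorname{Hom}(V,V')=\bigoplus_{p,q\ge0,\;r\in\mathbb Z}\Omega^q(BG_p)\otimes\operatorname{Hom}^r(V,V')$$ with total degree $p+q+r$, with the product $$(\omega\otimes f)(\omega'\otimes f')=(-1)^{r(p'+q')+qp'}\,\big(\mathrm{pr}^*\omega\wedge\mathrm{pr}'^*\omega'\big)\otimes(f\circ f')$$ for $\omega\in\Omega^q(BG_p)$, $\omega'\in\Omega^{q'}(BG_{p'})$, $|f|=r$, where $\mathrm{pr}$ and $\mathrm{pr}'$ are the projections of $BG_{p+p'}$ to the first $p$ and the last $p'$ factors, and with the operators $\bar d=(-1)^pd$, $\partial=\sum_{i=0}^{p+1}(-1)^i\varepsilon_i^*$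 and $\bar\delta(\omega\otimes f)=(-1)^{p+q}\omega\otimes(\delta' f-(-1)^rf\delta)$. **The category $\mathbf{BSS}(G)$.** Its objects are as above, the morphisms from $V$ to $V'$ are $\Omega^\bullet(BG_\bullet)\otimes\operatorname{Hom}(V,V')$, composition is the product above, the identity of $V$ is the constant $\mathrm{id}_V$ on $BG_0$, and the differential of $\varphi$ of degree $m$ is $$\partial_{D,D'}\varphi=(\bar d+\partial+\bar\delta)\varphi+(\Phi_{V'}-\mathrm{id}_{V'})\,\varphi-(-1)^m\varphi\,(\Phi_V-\mathrm{id}_V),$$ where $\Phi_V-\mathrm{id}_V$ is placed on $BG_1=G$. **The category $\mathbf{BSS}^G(G)$.** It has the same objects, and as morphisms from $V$ to $V'$ the elements whose components $\eta$ on $BG_p$ satisfy, for every $p$ and all $g_0,\dots,g_p\in G$, $$\zeta(g_0,\dots,g_p)^*\eta=\rho_{V'}(g_0)\circ\eta\circ\rho_V(g_p)^{-1},$$ where $\zeta(g_0,\dots,g_p)(h_1,\dots,h_p)=(g_0h_1g_1^{-1},g_1h_2g_2^{-1},\dots,g_{p-1}h_pg_p^{-1})$; differential, composition and identities are those of $\mathbf{BSS}(G)$.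 **Proposition.** $\mathbf{BSS}(G)$ and $\mathbf{BSS}^G(G)$, with these data, are DG categories, and the inclusion DG functor $\mathbf{BSS}^G(G)\to\mathbf{BSS}(G)$ is a quasi-equivalence: it induces isomorphisms on the cohomology of all complexes of morphisms, and an essentially surjective functor between the homotopy categories. -/

import Mathlib

open scoped Manifold ContDiff

universe u v w

noncomputable section

/-! ### DG categories, DG functors, quasi-equivalences (over the real numbers) -/

/-- A DG category over `ℝ` with objects `Obj` and with `Hom X Y n` as the space of morphisms of
degree `n`.  Degrees are recorded by equations, so that no casts are needed. -/
structure DGCategory (Obj : Type u) (Hom : Obj → Obj → ℤ → Type v)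
    [∀ X Y n, AddCommGroup (Hom X Y n)] [∀ X Y n, Module ℝ (Hom X Y n)] where
  /-- the differential, of degree one -/
  d : ∀ {X Y : Obj} {n n' : ℤ}, n + 1 = n' → (Hom X Y n →ₗ[ℝ] Hom X Y n')
  /-- the bilinear composition `Hom Y Z m × Hom X Y n → Hom X Z (m + n)` -/
  comp : ∀ {X Y Z : Obj} {m n k : ℤ}, m + n = k →
    (Hom Y Z m →ₗ[ℝ] Hom X Y n →ₗ[ℝ] Hom X Z k)
  /-- the identity morphisms -/
  one : ∀ X : Obj, Hom X X 0
  d_d : ∀ {X Y : Obj} {n n' n'' : ℤ} (h : n + 1 = n') (h' : n' + 1 = n'') (f : Hom X Y n),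
    d h' (d h f) = 0
  comp_assoc : ∀ {X Y Z W : Obj} {l m n lm mn k : ℤ} (h₁ : l + m = lm) (h₂ : m + n = mn)
    (h₃ : lm + n = k) (h₄ : l + mn = k) (a : Hom Z W l) (b : Hom Y Z m) (c : Hom X Y n),
    comp h₃ (comp h₁ a b) c = comp h₄ a (comp h₂ b c)
  one_comp : ∀ {X Y : Obj} {n : ℤ} (h : 0 + n = n) (f : Hom X Y n), comp h (one Y) f = f
  comp_one : ∀ {X Y : Obj} {n : ℤ} (h : n + 0 = n) (f : Hom X Y n), comp h f (one X) = f
  d_one : ∀ (X : Obj) (h : (0 : ℤ) + 1 = 1), d h (one X) = 0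
  /-- composition is a morphism of complexes -/
  leibniz : ∀ {X Y Z : Obj} {m m' n n' k k' : ℤ} (h : m + n = k) (hm : m + 1 = m')
    (hn : n + 1 = n') (hk : k + 1 = k') (h₁ : m' + n = k') (h₂ : m + n' = k')
    (b : Hom Y Z m) (a : Hom X Y n),
    d hk (comp h b a) = comp h₁ (d hm b) a + m.negOnePow • comp h₂ b (d hn a)

namespace DGCategory

variable {Obj : Type u} {Hom : Obj → Obj → ℤ → Type v}
  [∀ X Y n, AddCommGroup (Hom X Y n)] [∀ X Y n, Module ℝ (Hom X Y n)]

/-- Cocycles of degree `n`. -/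
def cocycles (C : DGCategory Obj Hom) (X Y : Obj) (n : ℤ) : Submodule ℝ (Hom X Y n) :=
  LinearMap.ker (C.d (X := X) (Y := Y) (rfl : n + 1 = n + 1))

/-- Coboundaries of degree `n`. -/
def coboundaries (C : DGCategory Obj Hom) (X Y : Obj) (n : ℤ) : Submodule ℝ (Hom X Y n) :=
  LinearMap.range (C.d (X := X) (Y := Y) (sub_add_cancel n 1))

/-- The `n`-th cohomology of the complex of morphisms from `X` to `Y`. -/
abbrev cohomology (C : DGCategory Obj Hom) (X Y : Obj) (n : ℤ) : Type v :=
  C.cocycles X Y n ⧸ (C.coboundaries X Y n).comap (C.cocycles X Y n).subtype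

/-- `X` and `Y` are isomorphic in the homotopy category, whose morphisms are the degree zero
cohomology classes: there are degree zero cocycles `f : X → Y` and `g : Y → X` such that
`g ∘ f` and `f ∘ g` are cohomologous to the identities. -/
def HoIso (C : DGCategory Obj Hom) (X Y : Obj) : Prop :=
  ∃ f ∈ C.cocycles X Y 0, ∃ g ∈ C.cocycles Y X 0,
    C.comp (add_zero 0) g f - C.one X ∈ C.coboundaries X X 0 ∧
    C.comp (add_zero 0) f g - C.one Y ∈ C.coboundaries Y Y 0

end DGCategory

/-- DG functors. -/
structure DGFunctor {Obj₁ : Type u} {Hom₁ : Obj₁ → Obj₁ → ℤ → Type v}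
    [∀ X Y n, AddCommGroup (Hom₁ X Y n)] [∀ X Y n, Module ℝ (Hom₁ X Y n)]
    {Obj₂ : Type u} {Hom₂ : Obj₂ → Obj₂ → ℤ → Type v}
    [∀ X Y n, AddCommGroup (Hom₂ X Y n)] [∀ X Y n, Module ℝ (Hom₂ X Y n)]
    (C : DGCategory Obj₁ Hom₁) (D : DGCategory Obj₂ Hom₂) where
  obj : Obj₁ → Obj₂
  map : ∀ {X Y : Obj₁} {n : ℤ}, Hom₁ X Y n →ₗ[ℝ] Hom₂ (obj X) (obj Y) n
  map_d : ∀ {X Y : Obj₁} {n n' : ℤ} (h : n + 1 = n') (f : Hom₁ X Y n),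
    map (C.d h f) = D.d h (map f)
  map_comp : ∀ {X Y Z : Obj₁} {m n k : ℤ} (h : m + n = k) (g : Hom₁ Y Z m) (f : Hom₁ X Y n),
    map (C.comp h g f) = D.comp h (map g) (map f)
  map_one : ∀ X : Obj₁, map (C.one X) = D.one (obj X)

namespace DGFunctor

variable {Obj₁ : Type u} {Hom₁ : Obj₁ → Obj₁ → ℤ → Type v}
  [∀ X Y n, AddCommGroup (Hom₁ X Y n)] [∀ X Y n, Module ℝ (Hom₁ X Y n)]
  {Obj₂ : Type u} {Hom₂ : Obj₂ → Obj₂ → ℤ → Type v}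
  [∀ X Y n, AddCommGroup (Hom₂ X Y n)] [∀ X Y n, Module ℝ (Hom₂ X Y n)]
  {C : DGCategory Obj₁ Hom₁} {D : DGCategory Obj₂ Hom₂}

/-- The restriction of a DG functor to cocycles. -/
def mapCocycles (F : DGFunctor C D) (X Y : Obj₁) (n : ℤ) :
    C.cocycles X Y n →ₗ[ℝ] D.cocycles (F.obj X) (F.obj Y) n :=
  F.map.restrict fun f hf => by
    have hf' : C.d (rfl : n + 1 = n + 1) f = 0 := hf
    change D.d _ (F.map f) = 0
    rw [← F.map_d, hf', map_zero]

/-- The map induced by a DG functor on the cohomology of the complexes of morphisms. -/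
def mapCohomology (F : DGFunctor C D) (X Y : Obj₁) (n : ℤ) :
    C.cohomology X Y n →ₗ[ℝ] D.cohomology (F.obj X) (F.obj Y) n :=
  Submodule.mapQ _ _ (F.mapCocycles X Y n) <| by
    rintro ⟨f, hf⟩ ⟨g, hg⟩
    refine ⟨F.map g, ?_⟩
    rw [← F.map_d, hg]
    rfl

/-- Quasi fully faithful: a quasi-isomorphism on every complex of morphisms. -/
def QuasiFullyFaithful (F : DGFunctor C D) : Prop :=
  ∀ (X Y : Obj₁) (n : ℤ), Function.Bijective (F.mapCohomology X Y n)

/-- Quasi essentially surjective: essentially surjective on homotopy categories. -/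
def QuasiEssSurj (F : DGFunctor C D) : Prop :=
  ∀ Y : Obj₂, ∃ X : Obj₁, D.HoIso (F.obj X) Y

/-- Quasi-equivalences of DG categories. -/
def IsQuasiEquivalence (F : DGFunctor C D) : Prop :=
  F.QuasiFullyFaithful ∧ F.QuasiEssSurj

end DGFunctor

/-! ### Exterior products of alternating maps -/

section Wedge

variable {T : Type*} [AddCommGroup T] [Module ℝ T] [TopologicalSpace T]
  {F₁ F₂ F₃ : Type*} [NormedAddCommGroup F₁] [NormedSpace ℝ F₁]
  [NormedAddCommGroup F₂] [NormedSpace ℝ F₂] [NormedAddCommGroup F₃] [NormedSpace ℝ F₃]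

/-- The exterior product of two alternating maps, with coefficients multiplied by means of the
bilinear map `B` (sum over shuffles, no further sign). -/
def altWedge (B : F₁ →L[ℝ] F₂ →L[ℝ] F₃) {k l q : ℕ} (h : k + l = q)
    (a : T [⋀^Fin k]→L[ℝ] F₁) (b : T [⋀^Fin l]→L[ℝ] F₂) : T [⋀^Fin q]→L[ℝ] F₃ :=
  let c : T [⋀^Fin q]→ₗ[ℝ] F₃ :=
    ((TensorProduct.lift (B.toLinearMap₁₂)).compAlternatingMap
      (a.toAlternatingMap.domCoprod b.toAlternatingMap)).domDomCongr
        (finSumFinEquiv.trans (finCongr h))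
  { c with
    cont := by
      change Continuous fun v : Fin q → T => c v
      simp only [c, AlternatingMap.domDomCongr_apply, LinearMap.compAlternatingMap_apply,
        AlternatingMap.domCoprod_apply, sum_apply, map_sum]
      refine continuous_finsetSum _ fun σ _ => ?_
      induction σ using Quotient.inductionOn' with | _ σ
      simp only [AlternatingMap.domCoprod.summand_mk'', smul_apply,
        MultilinearMap.domDomCongr_apply, MultilinearMap.domCoprod_apply]
      have ha : Continuous fun v : Fin q → T =>
          a fun i => v (finCongr h (finSumFinEquiv (σ (Sum.inl i)))) :=
        a.cont.comp (continuous_pi fun i => continuous_apply _)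
      have hb : Continuous fun v : Fin q → T =>
          b fun i => v (finCongr h (finSumFinEquiv (σ (Sum.inr i)))) :=
        b.cont.comp (continuous_pi fun i => continuous_apply _)
      have hab := (B.continuous.comp ha).clm_apply hb
      rcases Int.units_eq_one_or (Equiv.Perm.sign σ) with hσ | hσ
      · simpa [hσ] using hab
      · exact hab.neg.congr fun v => by simp [hσ] }

end Wedge

/-! ### Differential forms on manifolds, with coefficients in a normed space -/

section Forms

variable {E : Type*} [NormedAddCommGroup E] [NormedSpace ℝ E]
  {H : Type*} [TopologicalSpace H] (I : ModelWithCorners ℝ E H)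
  (M : Type*) [TopologicalSpace M] [ChartedSpace H M]
  {E₂ : Type*} [NormedAddCommGroup E₂] [NormedSpace ℝ E₂]
  {H₂ : Type*} [TopologicalSpace H₂] (J : ModelWithCorners ℝ E₂ H₂)
  (N : Type*) [TopologicalSpace N] [ChartedSpace H₂ N]
  (F : Type*) [NormedAddCommGroup F] [NormedSpace ℝ F]

/-- Differential `q`-forms on `M` with values in `F`, without any regularity. -/
abbrev DForm (q : ℕ) : Type _ := (x : M) → TangentSpace I x [⋀^Fin q]→L[ℝ] F

namespace DForm

variable {I M J N F} {F₁ F₂ F₃ : Type*}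
  [NormedAddCommGroup F₁] [NormedSpace ℝ F₁] [NormedAddCommGroup F₂] [NormedSpace ℝ F₂]
  [NormedAddCommGroup F₃] [NormedSpace ℝ F₃]

/-- The expression of a form in the preferred chart at `x₀`, that is, its pullback by the inverse
of this chart. -/
def inChart {q : ℕ} (η : DForm I M F q) (x₀ : M) : E → E [⋀^Fin q]→L[ℝ] F := fun y =>
  (η ((extChartAt I x₀).symm y)).compContinuousLinearMap
    (mfderivWithin 𝓘(ℝ, E) I (extChartAt I x₀).symm (Set.range I) y)

/-- Smooth forms: those whose expressions in charts are smooth. -/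
def IsSmooth {q : ℕ} (η : DForm I M F q) : Prop :=
  ∀ x₀ : M, ContDiffOn ℝ ∞ (η.inChart x₀) (extChartAt I x₀).target

/-- The exterior derivative, computed at `x` in the preferred chart at `x`. -/
def extD {q : ℕ} (η : DForm I M F q) : DForm I M F (q + 1) := fun x =>
  (extDerivWithin (η.inChart x) (Set.range I) (extChartAt I x x)).compContinuousLinearMap
    (mfderiv I 𝓘(ℝ, E) (extChartAt I x) x)

/-- The pullback of a form along a map. -/
def pullback {q : ℕ} (f : M → N) (η : DForm J N F q) : DForm I M F q := fun x =>
  (η (f x)).compContinuousLinearMap (mfderiv I J f x)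

/-- The action of a linear map on the coefficients of a form. -/
def mapCoeff {q : ℕ} (A : F₁ →L[ℝ] F₂) (η : DForm I M F₁ q) : DForm I M F₂ q := fun x =>
  A.compContinuousAlternatingMap (η x)

/-- The exterior product of forms, with coefficients multiplied by means of `B`. -/
def wedge (B : F₁ →L[ℝ] F₂ →L[ℝ] F₃) {k l q : ℕ} (h : k + l = q)
    (a : DForm I M F₁ k) (b : DForm I M F₂ l) : DForm I M F₃ q := fun x =>
  altWedge B h (a x) (b x)

/-- A constant function, as a form of degree zero. -/
def const (c : F) : DForm I M F 0 := fun x =>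
  ContinuousAlternatingMap.constOfIsEmpty ℝ (TangentSpace I x) (Fin 0) c

end DForm

end Forms

/-! ### Representations of the DG Lie algebra `T𝔤` and their representation forms -/

section LieGroup

variable {E : Type v} [NormedAddCommGroup E] [NormedSpace ℝ E]
  (G : Type w) [TopologicalSpace G] [ChartedSpace E G] [Group G]

/-- The Lie algebra of the Lie group `G`, that is, the tangent space at the identity with the
bracket of left invariant vector fields. -/
abbrev LieAlg : Type v := GroupLieAlgebra 𝓘(ℝ, E) G

/-- A representation of the DG Lie algebra `T𝔤` (with generators `i x` in degree `-1` and `L x` in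
degree `0`, and `d (i x) = L x`) on a finite dimensional cochain complex of real vector spaces,
whose underlying representation of `𝔤` is integrated to the Lie group `G`.

The complex is `V = ⨁ n, gr n`.  The norm only serves to speak of smooth functions with values in
finite dimensional spaces.  For connected `G` the representation `ρ` of `G` is determined by `L`;
for simply connected `G` it exists for every representation of `T𝔤`. -/
structure TRep where
  V : Type u
  [normed : NormedAddCommGroup V]
  [normedSpace : NormedSpace ℝ V]
  [finDim : FiniteDimensional ℝ V]
  /-- the homogeneous components of the graded vector space `V` -/
  gr : ℤ → Submodule ℝ V
  gr_isInternal : DirectSum.IsInternal gr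
  /-- the differential -/
  δ : V →L[ℝ] V
  δ_mem : ∀ (n : ℤ), ∀ v ∈ gr n, δ v ∈ gr (n + 1)
  δ_δ : δ ∘L δ = 0
  /-- the contractions -/
  i : LieAlg (E := E) G →L[ℝ] V →L[ℝ] V
  i_mem : ∀ x (n : ℤ), ∀ v ∈ gr n, i x v ∈ gr (n - 1)
  /-- the Lie derivatives -/
  L : LieAlg (E := E) G →L[ℝ] V →L[ℝ] V
  L_mem : ∀ x (n : ℤ), ∀ v ∈ gr n, L x v ∈ gr n
  i_δ : ∀ x, i x ∘L δ + δ ∘L i x = L x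
  L_δ : ∀ x, L x ∘L δ - δ ∘L L x = 0
  i_i : ∀ x y, i x ∘L i y + i y ∘L i x = 0
  L_L : ∀ x y, L x ∘L L y - L y ∘L L x = L ⁅x, y⁆
  L_i : ∀ x y, L x ∘L i y - i y ∘L L x = i ⁅x, y⁆
  /-- the representation of `G` which integrates `L` -/
  ρ : G →* (V →L[ℝ] V)
  ρ_smooth : ContMDiff 𝓘(ℝ, E) 𝓘(ℝ, V →L[ℝ] V) ∞ ρ
  ρ_deriv : ∀ x : LieAlg (E := E) G,
    (mfderiv 𝓘(ℝ, E) 𝓘(ℝ, V →L[ℝ] V) ρ (1 : G) x : V →L[ℝ] V) = L x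

attribute [instance] TRep.normed TRep.normedSpace TRep.finDim

variable {G}

/-- The left Maurer-Cartan form: the derivative at `g` of `h ↦ g⁻¹ * h`, which maps the tangent
space at `g` to the tangent space at the identity. -/
def maurerCartan (g : G) : TangentSpace 𝓘(ℝ, E) g →L[ℝ] LieAlg (E := E) G :=
  mfderiv 𝓘(ℝ, E) 𝓘(ℝ, E) (fun h : G => g⁻¹ * h) g

namespace TRep

/-- The maps `f : V → W` which are homogeneous of degree `r`. -/
def HomDeg (V W : TRep.{u} (E := E) G) (r : ℤ) : Submodule ℝ (V.V →L[ℝ] W.V) where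
  carrier := {f | ∀ (n : ℤ), ∀ v ∈ V.gr n, f v ∈ W.gr (n + r)}
  add_mem' hf hg n v hv := (W.gr _).add_mem (hf n v hv) (hg n v hv)
  zero_mem' n _ _ := (W.gr (n + r)).zero_mem
  smul_mem' c _ hf n v hv := (W.gr _).smul_mem c (hf n v hv)

/-- The alternating map `(x₁, …, x_k) ↦ i x₁ ∘ ⋯ ∘ i x_k` on the Lie algebra. -/
def iAlt (V : TRep.{u} (E := E) G) (k : ℕ) :
    LieAlg (E := E) G [⋀^Fin k]→L[ℝ] (V.V →L[ℝ] V.V) :=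
  { (ContinuousMultilinearMap.mkPiAlgebraFin ℝ k (V.V →L[ℝ] V.V)).compContinuousLinearMap
      fun _ => V.i with
    map_eq_zero_of_eq' := fun v a b hab hne => by
      have hsq : ∀ x, V.i.toLinearMap x * V.i.toLinearMap x = 0 := fun x => by
        have h := V.i_i x x
        rw [← two_smul ℝ, smul_eq_zero] at h
        exact h.resolve_left two_ne_zero
      have h := congrArg (ExteriorAlgebra.lift ℝ ⟨V.i.toLinearMap, hsq⟩)
        ((ExteriorAlgebra.ιMulti ℝ k).map_eq_zero_of_eq v hab hne)
      rw [ExteriorAlgebra.ιMulti_apply, map_list_prod, List.map_ofFn, map_zero] at h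
      change ContinuousMultilinearMap.mkPiAlgebraFin ℝ k (V.V →L[ℝ] V.V) (fun j => V.i (v j)) = 0
      rw [ContinuousMultilinearMap.mkPiAlgebraFin_apply]
      simpa [Function.comp_def] using h }

/-- The component of degree `k` of the left-equivariant representation form of `V`: the form on
`G` with values in `End V` whose value at `g` is `ρ g` composed with
`(x₁, …, x_k) ↦ i x_k ∘ ⋯ ∘ i x₁ = (-1) ^ (k (k - 1) / 2) • (i x₁ ∘ ⋯ ∘ i x_k)`, where the tangent
space at `g` is identified with the Lie algebra by left translation.  The component of degree zero
is the representation `ρ` of `G`.  With this order of the contractions one has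
`d Φ^k = (-1) ^ k [δ, Φ^(k+1)]` and `μ^* Φ^k = ∑_{a + b = k} (-1) ^ (a b) π₁^* Φ^a ∧ π₂^* Φ^b`. -/
def Φ (V : TRep.{u} (E := E) G) (k : ℕ) : DForm 𝓘(ℝ, E) G (V.V →L[ℝ] V.V) k := fun g =>
  (-1 : ℝ) ^ (k * (k - 1) / 2) •
    (ContinuousLinearMap.compL ℝ V.V V.V V.V (V.ρ g)).compContinuousAlternatingMap
      ((V.iAlt k).compContinuousLinearMap (maurerCartan g))

end TRep

/-! ### The simplicial manifold `BG`, and Bott-Shulman-Stasheff cochains -/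

/-- The product model with corners for the manifold `G × ⋯ × G` (`p` factors). -/
abbrev powModel (E : Type v) [NormedAddCommGroup E] [NormedSpace ℝ E] (p : ℕ) :
    ModelWithCorners ℝ (Fin p → E) (ModelPi fun _ : Fin p => E) :=
  ModelWithCorners.pi fun _ : Fin p => 𝓘(ℝ, E)

/-- The forms of degree `q` on `BG_p = G × ⋯ × G` (`p` factors) with values in `F`. -/
abbrev BGForm (E : Type v) [NormedAddCommGroup E] [NormedSpace ℝ E]
    (G : Type w) [TopologicalSpace G] [ChartedSpace E G] (p q : ℕ)
    (F : Type*) [NormedAddCommGroup F] [NormedSpace ℝ F] : Type _ :=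
  DForm (powModel E p) (Fin p → G) F q

/-- The face maps `BG_(p+1) → BG_p`: `face 0` drops the first entry, `face (p+1)` drops the last
entry, and otherwise `face a (g₁, …, g_(p+1)) = (g₁, …, g_a * g_(a+1), …, g_(p+1))`. -/
def face {p : ℕ} (a : Fin (p + 2)) (g : Fin (p + 1) → G) : Fin p → G := fun j =>
  if (j : ℕ) + 1 < a then g j.castSucc
  else if (j : ℕ) + 1 = a then g j.castSucc * g j.succ
  else g j.succ

/-- The projection of `BG_p` to the first `p₁` factors. -/
def front {p₁ p₂ p : ℕ} (h : p₁ + p₂ = p) (g : Fin p → G) : Fin p₁ → G := fun j =>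
  g (Fin.cast h (Fin.castAdd p₂ j))

/-- The projection of `BG_p` to the last `p₂` factors. -/
def back {p₁ p₂ p : ℕ} (h : p₁ + p₂ = p) (g : Fin p → G) : Fin p₂ → G := fun j =>
  g (Fin.cast h (Fin.natAdd p₁ j))

/-- The action of `(a₀, …, a_p)` on `BG_p`, which maps `(g₁, …, g_p)` to
`(a₀ * g₁ * a₁⁻¹, a₁ * g₂ * a₂⁻¹, …, a_(p-1) * g_p * a_p⁻¹)`. -/
def zeta {p : ℕ} (a : Fin (p + 1) → G) (g : Fin p → G) : Fin p → G := fun j =>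
  a j.castSucc * g j * (a j.succ)⁻¹

/-- Families of forms `η p q` of degree `q` on `BG_p` with values in the linear maps `V → W`. -/
def Cochain (V W : TRep.{u} (E := E) G) : Type _ :=
  (p q : ℕ) → BGForm E G p q (V.V →L[ℝ] W.V)

instance (V W : TRep.{u} (E := E) G) : AddCommGroup (Cochain V W) :=
  inferInstanceAs (AddCommGroup ((p q : ℕ) → BGForm E G p q (V.V →L[ℝ] W.V)))

instance (V W : TRep.{u} (E := E) G) : Module ℝ (Cochain V W) :=
  inferInstanceAs (Module ℝ ((p q : ℕ) → BGForm E G p q (V.V →L[ℝ] W.V)))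

namespace Cochain

variable {V W X : TRep.{u} (E := E) G}

theorem zero_apply (p q : ℕ) : (0 : Cochain V W) p q = 0 := rfl

theorem add_apply (η η' : Cochain V W) (p q : ℕ) : (η + η') p q = η p q + η' p q := rfl

theorem smul_apply (c : ℝ) (η : Cochain V W) (p q : ℕ) : (c • η) p q = c • η p q := rfl

/-- The vertical differential, `(-1) ^ p` times the exterior derivative on `BG_p`. -/
def dBar (η : Cochain V W) : Cochain V W := fun p q =>
  match q with
  | 0 => 0
  | q + 1 => (-1 : ℝ) ^ p • (η p q).extD

/-- The horizontal differential, the alternating sum of the pullbacks along the face maps. -/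
def partialD (η : Cochain V W) : Cochain V W := fun p q =>
  match p with
  | 0 => 0
  | p + 1 => ∑ a : Fin (p + 2), (-1 : ℝ) ^ (a : ℕ) • (η p q).pullback (face a)

/-- The differential induced by the differentials of `V` and `W`, on cochains of total degree `m`:
on a form of degree `q` on `BG_p` with values in the maps of degree `r = m - p - q` it is
`(-1) ^ (p + q)` times `f ↦ δ ∘ f - (-1) ^ r f ∘ δ` on the coefficients. -/
def deltaBar (m : ℤ) (η : Cochain V W) : Cochain V W := fun p q =>
  (-1 : ℝ) ^ (p + q) •
    ((η p q).mapCoeff (ContinuousLinearMap.compL ℝ V.V W.V W.V W.δ) -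
      (m - p - q).negOnePow •
        (η p q).mapCoeff ((ContinuousLinearMap.compL ℝ V.V V.V W.V).flip V.δ))

/-- The product of a cochain `ψ` of total degree `m` and a cochain `φ`, induced by the cup product
`α ⌣ β = (-1) ^ (q₁ p₂) front^* α ∧ back^* β` of forms `α` of degree `q₁` on `BG_p₁` and `β` of
degree `q₂` on `BG_p₂`, and by the composition of linear maps.  As usual in a tensor product of
graded algebras, `(α ⊗ f) (β ⊗ g) = (-1) ^ (|f| |β|) (α ⌣ β) ⊗ (f ∘ g)`, with
`|β| = p₂ + q₂` and `|f| = m - p₁ - q₁`. -/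
def cup (m : ℤ) (ψ : Cochain W X) (φ : Cochain V W) : Cochain V X := fun p q =>
  ∑ s : {s // s ∈ Finset.HasAntidiagonal.antidiagonal p}, ∑ t : {t // t ∈ Finset.HasAntidiagonal.antidiagonal q},
    ((m - s.1.1 - t.1.1) * (s.1.2 + t.1.2) + t.1.1 * s.1.2 : ℤ).negOnePow •
      DForm.wedge (ContinuousLinearMap.compL ℝ V.V W.V X.V) (Finset.HasAntidiagonal.mem_antidiagonal.1 t.2)
        ((ψ s.1.1 t.1.1).pullback (front (Finset.HasAntidiagonal.mem_antidiagonal.1 s.2)))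
        ((φ s.1.2 t.1.2).pullback (back (Finset.HasAntidiagonal.mem_antidiagonal.1 s.2)))

variable (V) in
/-- The identity of `V`, as a function on `BG_0`. -/
def one : Cochain V V := fun p q =>
  match p, q with
  | 0, 0 => DForm.const (ContinuousLinearMap.id ℝ V.V)
  | _, _ => 0

variable (V) in
/-- The Maurer-Cartan element `Φ - id`, of total degree one, formed by the components of the
representation form of `V` on `BG_1 = G` and by the constant function `id` on `BG_1`. -/
def theta : Cochain V V := fun p q =>
  match p, q with
  | 1, 0 => (V.Φ 0).pullback (fun g : Fin 1 → G => g 0) -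
      DForm.const (ContinuousLinearMap.id ℝ V.V)
  | 1, q + 1 => (V.Φ (q + 1)).pullback (fun g : Fin 1 → G => g 0)
  | _, _ => 0

/-- The twisted differential `φ ↦ D ∘ φ - (-1) ^ m φ ∘ D` on cochains of total degree `m`, where
`D` stands for the total differential `dBar + partialD + deltaBar` plus the product with `theta`. -/
def twistedD (m : ℤ) (φ : Cochain V W) : Cochain V W :=
  dBar φ + partialD φ + deltaBar m φ + cup 1 (theta W) φ - m.negOnePow • cup m φ (theta V)

end Cochain

/-! ### The morphism spaces of the two categories -/

section Smooth

variable {H : Type*} [TopologicalSpace H] {I : ModelWithCorners ℝ E H}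
  {M : Type*} [TopologicalSpace M] [ChartedSpace H M]
  {F : Type*} [NormedAddCommGroup F] [NormedSpace ℝ F] {q : ℕ}

theorem DForm.IsSmooth.zero : (0 : DForm I M F q).IsSmooth := fun _ => by
  have : DForm.inChart (0 : DForm I M F q) = fun _ _ => 0 := by
    funext x y; ext v; rfl
  rw [this]
  exact contDiffOn_const

theorem DForm.IsSmooth.add {η η' : DForm I M F q} (h : η.IsSmooth) (h' : η'.IsSmooth) :
    (η + η').IsSmooth := fun x => by
  have : DForm.inChart (η + η') x = DForm.inChart η x + DForm.inChart η' x := by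
    funext y; ext v; rfl
  rw [this]
  exact (h x).add (h' x)

theorem DForm.IsSmooth.smul (c : ℝ) {η : DForm I M F q} (h : η.IsSmooth) :
    (c • η).IsSmooth := fun x => by
  have : DForm.inChart (c • η) x = c • DForm.inChart η x := by
    funext y; ext v; rfl
  rw [this]
  exact (h x).const_smul c

end Smooth

/-- The morphisms of degree `m` from `V` to `W` in the Bott-Shulman-Stasheff category: families of
smooth forms of degree `q` on `BG_p` with values in the maps `V → W` of degree `m - p - q`.  As `V`
and `W` are bounded, only finitely many of these forms are different from zero, so that this is
the component of degree `m` of `⨁ p q, Ω^q(BG_p) ⊗ Hom(V, W)`. -/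
def BSSHom (V W : TRep.{u} (E := E) G) (m : ℤ) : Submodule ℝ (Cochain V W) where
  carrier := {η | ∀ p q : ℕ, (η p q).IsSmooth ∧
    ∀ g v, η p q g v ∈ TRep.HomDeg V W (m - p - q)}
  add_mem' h h' p q := ⟨(h p q).1.add (h' p q).1,
    fun g v => Submodule.add_mem _ ((h p q).2 g v) ((h' p q).2 g v)⟩
  zero_mem' _ _ := ⟨DForm.IsSmooth.zero, fun _ _ => Submodule.zero_mem _⟩
  smul_mem' c _ h p q := ⟨(h p q).1.smul c, fun g v => Submodule.smul_mem _ c ((h p q).2 g v)⟩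

/-- Invariance of a cochain under `G × ⋯ × G` (`p + 1` factors) for all `p`: the pullback of
`η p q` by the action of `(a₀, …, a_p)` on `BG_p` is `ρ_W a₀ ∘ η p q ∘ (ρ_V a_p)⁻¹`. -/
def Cochain.IsInvariant {V W : TRep.{u} (E := E) G} (η : Cochain V W) : Prop :=
  ∀ (p q : ℕ) (a : Fin (p + 1) → G), (η p q).pullback (zeta a) =
    ((η p q).mapCoeff (ContinuousLinearMap.compL ℝ V.V W.V W.V (W.ρ (a 0)))).mapCoeff
      ((ContinuousLinearMap.compL ℝ V.V V.V W.V).flip (V.ρ ((a (Fin.last p))⁻¹)))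

/-- The morphisms of degree `m` in the invariant Bott-Shulman-Stasheff category. -/
def BSSInvHom (V W : TRep.{u} (E := E) G) (m : ℤ) : Submodule ℝ (Cochain V W) where
  carrier := {η | η ∈ BSSHom V W m ∧ η.IsInvariant}
  add_mem' h h' := ⟨(BSSHom V W m).add_mem h.1 h'.1, fun p q a => by
    funext g
    have e := congrFun (h.2 p q a) g
    have e' := congrFun (h'.2 p q a) g
    ext v : 1
    exact (congrArg₂ (· + ·) (DFunLike.congr_fun e v) (DFunLike.congr_fun e' v)).trans (by
      simp [DForm.mapCoeff, Cochain.add_apply])⟩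
  zero_mem' := ⟨(BSSHom V W m).zero_mem, fun p q a => by
    funext g; ext v : 1; simp [DForm.mapCoeff, DForm.pullback, Cochain.zero_apply]⟩
  smul_mem' c _ h := ⟨(BSSHom V W m).smul_mem c h.1, fun p q a => by
    funext g
    have e := congrFun (h.2 p q a) g
    ext v : 1
    exact (congrArg (c • ·) (DFunLike.congr_fun e v)).trans (by
      simp [DForm.mapCoeff, Cochain.smul_apply])⟩

/-- `B` is the Bott-Shulman-Stasheff DG category, or its invariant version, according to the choice
of the morphism spaces: its differential is the twisted differential, its composition is the
product of cochains, and its identities are the constant functions `id` on `BG_0`. -/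
structure IsBSSCategory
    {K : (V W : TRep.{u} (E := E) G) → ℤ → Submodule ℝ (Cochain V W)}
    (B : DGCategory (TRep.{u} (E := E) G) fun V W m => K V W m) : Prop where
  coe_d : ∀ {V W : TRep.{u} (E := E) G} {m n : ℤ} (h : m + 1 = n) (φ : K V W m),
    (B.d h φ : Cochain V W) = Cochain.twistedD m (φ : Cochain V W)
  coe_comp : ∀ {V W X : TRep.{u} (E := E) G} {m n k : ℤ} (h : m + n = k)
    (ψ : K W X m) (φ : K V W n),
    (B.comp h ψ φ : Cochain V X) = Cochain.cup m (ψ : Cochain W X) (φ : Cochain V W)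
  coe_one : ∀ V : TRep.{u} (E := E) G, (B.one V : Cochain V V) = Cochain.one V

theorem BSSInvHom_le (V W : TRep.{u} (E := E) G) (m : ℤ) : BSSInvHom V W m ≤ BSSHom V W m :=
  fun _ h => h.1

/-- The inclusion DG functor of the invariant category: the identity on objects, and the inclusion
of the invariant cochains on morphisms. -/
def BSSInclusion
    {BI : DGCategory (TRep.{u} (E := E) G) fun V W m => BSSInvHom V W m}
    {B : DGCategory (TRep.{u} (E := E) G) fun V W m => BSSHom V W m}
    (hBI : IsBSSCategory BI) (hB : IsBSSCategory B) : DGFunctor BI B where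
  obj V := V
  map {V W m} := Submodule.inclusion (BSSInvHom_le V W m)
  map_d {V W _ _} h f := Subtype.ext <| (hBI.coe_d h f).trans
    (hB.coe_d h (Submodule.inclusion (BSSInvHom_le V W _) f)).symm
  map_comp {V W X _ _ _} h g f := Subtype.ext <| (hBI.coe_comp h g f).trans
    (hB.coe_comp h (Submodule.inclusion (BSSInvHom_le W X _) g)
      (Submodule.inclusion (BSSInvHom_le V W _) f)).symm
  map_one V := Subtype.ext <| (hBI.coe_one V).trans (hB.coe_one V).symm

end LieGroup

end

/-!
A cochain is read as a family of forms whose values are alternating maps on the model space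
(`PCochain`, `PForm`). The exterior product is associative (`altWedge_assoc`), and the exterior
derivative satisfies the Leibniz rule (`ed_wd`) and commutes with pullbacks (`SmoothFormAt.ed_pb`).

*The DG categories.* Before the twist, and with the first and the last face left out of `∂`, the
differential `D1` squares to zero and is a derivation of the product (`D1_D1`, `D1_cp`). The first
and the last face are products with the constant function `id` on `BG_1` (`allD_eq`), so the
differential of the category is `φ ↦ D1 φ + Φ φ ∓ φ Φ` (`twistedD_eq`). It squares to zero by the
Maurer-Cartan equation `D1 Φ + Φ Φ = 0` (`D1_Phi`). The component of this equation on `BG_1`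
computes `d Φ` by Cartan's formula for left invariant vector fields (`TRep.ed_phi`). The one on
`BG_2` is the multiplicativity of `Φ` (`TRep.pb_phi_mul`). It rests on the equivariance
`ρ g ∘ i x = i (Ad g x) ∘ ρ g` (`TRep.rho_i`), which follows from `[L x, i y] = i [x, y]` because
`G` is connected. Invariant cochains are closed under all operations and contain `Φ`, hence form a
DG subcategory (`Inv.tD`, `Inv.cp`).

*The quasi-equivalence.* It suffices that every cochain with invariant differential is invariant up
to a coboundary (`isQuasiEquivalence_of_acyclic`). The twisted differential does not lower the
simplicial degree, and its part `LD` which preserves this degree consists of the differentials of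
forms and of coefficients. As cochains have components on finitely many `BG_p` only, it suffices to
treat each `BG_p` separately (`acyclic_of_level`). There the group `G^(p+1)` acts on forms (`act`),
with the invariant forms as fixed points. By Cartan's formula, with the operators `i` taking care of
the coefficients, the infinitesimal action is homotopic to zero (`LD_homot`). Integrating along
paths, the group acts trivially on cohomology (`isExact_act_sub`), with primitives that can be
integrated over the group. So a form minus its average over the Haar measure is exact if it is
closed, and in general it is exact up to invariant forms if the differential of the form is
invariant (`exists_invariant_add_exact`).

To keep the primitives smooth, a measure on the group is cut into pieces carried by translates of a
chart domain. On each piece the paths are segments in the chart, so that averages are integrals of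
smooth families over compact subsets of vector spaces (`isAveraging`).
-/

set_option linter.unusedSectionVars false

noncomputable section

open scoped Topology

/-! ### Tangent maps and powers of a manifold -/

section TangentMap

variable {E : Type*} [NormedAddCommGroup E] [NormedSpace ℝ E]
  {H : Type*} [TopologicalSpace H] (I : ModelWithCorners ℝ E H)
  {M : Type*} [TopologicalSpace M] [ChartedSpace H M]
  {E₂ : Type*} [NormedAddCommGroup E₂] [NormedSpace ℝ E₂]
  {H₂ : Type*} [TopologicalSpace H₂] (J : ModelWithCorners ℝ E₂ H₂)
  {N : Type*} [TopologicalSpace N] [ChartedSpace H₂ N]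
  {E₃ : Type*} [NormedAddCommGroup E₃] [NormedSpace ℝ E₃]
  {H₃ : Type*} [TopologicalSpace H₃] (K : ModelWithCorners ℝ E₃ H₃)
  {P : Type*} [TopologicalSpace P] [ChartedSpace H₃ P]

/-- The derivative of a map between manifolds, as a continuous linear map between the model vector
spaces.  Forgetting the base points of the tangent spaces makes the values of forms at different
points comparable without casts. -/
def tmap (f : M → N) (x : M) : E →L[ℝ] E₂ := mfderiv I J f x

variable {I J K}

theorem tmap_comp {g : N → P} {f : M → N} {x : M} (hg : MDifferentiableAt J K g (f x))
    (hf : MDifferentiableAt I J f x) :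
    tmap I K (g ∘ f) x = (tmap J K g (f x)).comp (tmap I J f x) :=
  mfderiv_comp x hg hf

theorem tmap_comp' {g : N → P} {f : M → N} {x : M} (hg : MDifferentiableAt J K g (f x))
    (hf : MDifferentiableAt I J f x) :
    tmap I K (fun y => g (f y)) x = (tmap J K g (f x)).comp (tmap I J f x) :=
  mfderiv_comp x hg hf

theorem tmap_id (x : M) : tmap I I (id : M → M) x = ContinuousLinearMap.id ℝ E := mfderiv_id

theorem tmap_const (c : N) (x : M) : tmap I J (fun _ : M => c) x = 0 := mfderiv_const

theorem tmap_congr {f g : M → N} {x : M} (h : f =ᶠ[𝓝 x] g) : tmap I J f x = tmap I J g x :=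
  h.mfderiv_eq

theorem tmap_eq_fderiv (f : E → E₂) (x : E) : tmap 𝓘(ℝ, E) 𝓘(ℝ, E₂) f x = fderiv ℝ f x :=
  mfderiv_eq_fderiv

theorem HasMFDerivAt.tmap_eq {f : M → N} {x : M} {f' : E →L[ℝ] E₂} (h : HasMFDerivAt I J f x f') :
    tmap I J f x = f' := h.mfderiv

end TangentMap

section Pow

variable {E : Type*} [NormedAddCommGroup E] [NormedSpace ℝ E]
  {G : Type*} [TopologicalSpace G] [ChartedSpace E G] {p : ℕ}
  {E₁ : Type*} [NormedAddCommGroup E₁] [NormedSpace ℝ E₁]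
  {H : Type*} [TopologicalSpace H] {I : ModelWithCorners ℝ E₁ H}
  {M : Type*} [TopologicalSpace M] [ChartedSpace H M]

instance powModel_boundaryless : (powModel E p).Boundaryless where
  range_eq_univ := by
    have : Function.Surjective (powModel E p) := fun y => ⟨y, rfl⟩
    exact this.range_eq

theorem mem_extChartAt_powModel_target {g : Fin p → G} {y : Fin p → E} :
    y ∈ (extChartAt (powModel E p) g).target ↔
      ∀ i, y i ∈ (extChartAt 𝓘(ℝ, E) (g i)).target := by
  rw [extChartAt_target]
  simp only [piChartedSpace_chartAt, extChartAt_target]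
  simp [powModel, ModelWithCorners.pi, OpenPartialHomeomorph.pi]
  exact Set.mem_univ_pi

instance powModel_isManifold [IsManifold 𝓘(ℝ, E) ∞ G] :
    IsManifold (powModel E p) ∞ (Fin p → G) := by
  refine isManifold_of_contDiffOn _ _ _ ?_
  rintro _ _ ⟨e, he, rfl⟩ ⟨e', he', rfl⟩
  rw [contDiffOn_pi]
  intro i
  have h := (contDiffGroupoid ∞ 𝓘(ℝ, E)).compatible (he i trivial) (he' i trivial)
  rw [contDiffGroupoid, mem_groupoid_of_pregroupoid] at h
  have h' : ContDiffOn ℝ ∞ (fun y : E => e' i ((e i).symm y)) ((e i).symm.trans (e' i)).source :=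
    h.1.mono fun y hy => ⟨hy, ⟨y, rfl⟩⟩
  refine h'.comp (ContinuousLinearMap.proj (R := ℝ) (φ := fun _ : Fin p => E) i).contDiff.contDiffOn
    ?_
  rintro y ⟨hy, -⟩
  have hy' : y ∈ ((OpenPartialHomeomorph.pi e).symm.trans (OpenPartialHomeomorph.pi e')).source :=
      hy
  exact ⟨hy'.1 i trivial, hy'.2 i trivial⟩

theorem contMDiffAt_pow_iff {n : WithTop ℕ∞} {f : M → Fin p → G} {x : M} :
    ContMDiffAt I (powModel E p) n f x ↔ ∀ i, ContMDiffAt I 𝓘(ℝ, E) n (fun y => f y i) x := by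
  simp only [contMDiffAt_iff, continuousAt_pi, forall_and]
  rw [contDiffWithinAt_pi]
  rfl

theorem contMDiff_pow_iff {n : WithTop ℕ∞} {f : M → Fin p → G} :
    ContMDiff I (powModel E p) n f ↔ ∀ i, ContMDiff I 𝓘(ℝ, E) n (fun y => f y i) :=
  ⟨fun h i x => contMDiffAt_pow_iff.1 (h x) i, fun h x => contMDiffAt_pow_iff.2 fun i => h i x⟩

theorem hasMFDerivAt_pow_proj (i : Fin p) (g : Fin p → G) :
    HasMFDerivAt (powModel E p) 𝓘(ℝ, E) (fun x : Fin p → G => x i) g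
      (ContinuousLinearMap.proj (R := ℝ) (φ := fun _ : Fin p => E) i) := by
  refine ⟨(continuous_apply i).continuousAt, ?_⟩
  have h : HasFDerivWithinAt (fun y : Fin p → E => y i)
      (ContinuousLinearMap.proj (R := ℝ) (φ := fun _ : Fin p => E) i)
      (Set.range (powModel E p)) (extChartAt (powModel E p) g g) :=
    (ContinuousLinearMap.proj (R := ℝ) (φ := fun _ : Fin p => E) i).hasFDerivWithinAt
  refine h.congr_of_eventuallyEq ?_ ?_
  · filter_upwards [extChartAt_target_mem_nhdsWithin (I := powModel E p) g] with y hy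
    exact (extChartAt 𝓘(ℝ, E) (g i)).right_inv (mem_extChartAt_powModel_target.1 hy i)
  · simp only [writtenInExtChartAt, Function.comp, extChartAt_to_inv]
    rfl

theorem contMDiff_pow_proj {n : WithTop ℕ∞} (i : Fin p) [IsManifold 𝓘(ℝ, E) n G]
    [IsManifold (powModel E p) n (Fin p → G)] :
    ContMDiff (powModel E p) 𝓘(ℝ, E) n (fun x : Fin p → G => x i) :=
  contMDiff_pow_iff.1 contMDiff_id i

theorem tmap_pow_apply {f : M → Fin p → G} {x : M}
    (hf : MDifferentiableAt I (powModel E p) f x) (v : E₁) (i : Fin p) :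
    tmap I (powModel E p) f x v i = tmap I 𝓘(ℝ, E) (fun y => f y i) x v := by
  have := tmap_comp' (hasMFDerivAt_pow_proj (E := E) i (f x)).mdifferentiableAt hf
  rw [this, (hasMFDerivAt_pow_proj (E := E) i (f x)).tmap_eq]
  rfl

end Pow

/-! ### Calculus of differential forms -/

section AltCoeff

variable {E : Type*} [NormedAddCommGroup E] [NormedSpace ℝ E] [FiniteDimensional ℝ E]
  {F : Type*} [NormedAddCommGroup F] [NormedSpace ℝ F] [FiniteDimensional ℝ F]
  {X : Type*} [NormedAddCommGroup X] [NormedSpace ℝ X] {q : ℕ}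

variable (E F q) in
/-- An alternating map on a finite dimensional space depends linearly and continuously on finitely
many of its values. -/
theorem exists_alt_coeff : ∃ (ι : Type) (_ : Fintype ι) (e : ι → Fin q → E)
    (L : (ι → F) →L[ℝ] (E [⋀^Fin q]→L[ℝ] F)), ∀ a : E [⋀^Fin q]→L[ℝ] F,
      L (fun j => a (e j)) = a := by
  let b := Module.finBasis ℝ E
  let e : (Fin q → Fin (Module.finrank ℝ E)) → Fin q → E := fun s i => b (s i)
  let ev : (E [⋀^Fin q]→L[ℝ] F) →ₗ[ℝ] ((Fin q → Fin (Module.finrank ℝ E)) → F) :=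
    { toFun := fun a s => a (e s)
      map_add' := fun _ _ => rfl
      map_smul' := fun _ _ => rfl }
  have hinj : LinearMap.ker ev = ⊥ := by
    rw [LinearMap.ker_eq_bot']
    intro a ha
    have h : a.toMultilinearMap = 0 := Module.Basis.ext_multilinear (fun _ => b) fun s =>
      congrFun ha s
    ext v
    exact congrArg (fun m : MultilinearMap ℝ (fun _ : Fin q => E) F => m v) h
  obtain ⟨L, hL⟩ := ev.exists_leftInverse_of_injective hinj
  exact ⟨_, inferInstance, e, L.toContinuousLinearMap, fun a => LinearMap.congr_fun hL a⟩

theorem contDiffAt_alt_iff {n : WithTop ℕ∞} {f : X → E [⋀^Fin q]→L[ℝ] F} {x : X} :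
    ContDiffAt ℝ n f x ↔ ∀ v, ContDiffAt ℝ n (fun y => f y v) x := by
  refine ⟨fun h v => (ContinuousAlternatingMap.apply ℝ E F v).contDiff.contDiffAt.comp x h,
    fun h => ?_⟩
  obtain ⟨ι, _, e, L, hL⟩ := exists_alt_coeff E F q
  have : f = fun y => L fun j => f y (e j) := funext fun y => (hL _).symm
  rw [this]
  exact L.contDiff.contDiffAt.comp x (contDiffAt_pi.2 fun j => h (e j))

theorem ContDiffAt.alt_apply {n : WithTop ℕ∞} {f : X → E [⋀^Fin q]→L[ℝ] F} {w : X → Fin q → E}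
    {x : X} (hf : ContDiffAt ℝ n f x) (hw : ∀ i, ContDiffAt ℝ n (fun y => w y i) x) :
    ContDiffAt ℝ n (fun y => f y (w y)) x := by
  induction q with
  | zero =>
    have : (fun y => f y (w y)) = fun y => f y default := by
      funext y; congr 1; exact Subsingleton.elim _ _
    rw [this]
    exact contDiffAt_alt_iff.1 hf _
  | succ q ih =>
    have h1 : ContDiffAt ℝ n (fun y => (f y).curryLeft (w y 0)) x := by
      have hc : ContDiff ℝ n (fun a : E [⋀^Fin (q + 1)]→L[ℝ] F => a.curryLeft) := by
        apply IsBoundedLinearMap.contDiff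
        refine ⟨⟨fun _ _ => rfl, fun _ _ => rfl⟩, 1, one_pos, fun a => ?_⟩
        rw [one_mul]
        exact ((ContinuousAlternatingMap.curryLeftLI
          (𝕜 := ℝ) (E := E) (F := F) (n := q)).norm_map a).le
      exact ContDiffAt.clm_apply (hc.contDiffAt.comp x hf) (hw 0)
    have h2 := ih h1 (w := fun y => Fin.tail (w y)) fun i => hw i.succ
    refine h2.congr_of_eventuallyEq (.of_forall fun y => ?_)
    change f y (w y) = f y (Fin.cons (w y 0) (Fin.tail (w y)))
    rw [Fin.cons_self_tail]

theorem ContDiffAt.alt_comp {E₂ : Type*} [NormedAddCommGroup E₂] [NormedSpace ℝ E₂]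
    [FiniteDimensional ℝ E₂] {n : WithTop ℕ∞} {f : X → E [⋀^Fin q]→L[ℝ] F} {A : X → E₂ →L[ℝ] E}
    {x : X} (hf : ContDiffAt ℝ n f x) (hA : ContDiffAt ℝ n A x) :
    ContDiffAt ℝ n (fun y => (f y).compContinuousLinearMap (A y)) x :=
  contDiffAt_alt_iff.2 fun v => hf.alt_apply (w := fun y i => A y (v i)) fun _ =>
    hA.clm_apply contDiffAt_const

end AltCoeff

section FormCalculus

theorem two_le_infty : minSmoothness ℝ 2 ≤ ∞ := by
  rw [minSmoothness_of_isRCLikeNormedField]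
  exact WithTop.coe_le_coe.2 (le_top : (2 : ℕ∞) ≤ ⊤)

variable {E : Type*} [NormedAddCommGroup E] [NormedSpace ℝ E] [FiniteDimensional ℝ E]
  {H : Type*} [TopologicalSpace H] {I : ModelWithCorners ℝ E H} [I.Boundaryless]
  {M : Type*} [TopologicalSpace M] [ChartedSpace H M] [IsManifold I ∞ M]
  {E₂ : Type*} [NormedAddCommGroup E₂] [NormedSpace ℝ E₂] [FiniteDimensional ℝ E₂]
  {H₂ : Type*} [TopologicalSpace H₂] {J : ModelWithCorners ℝ E₂ H₂} [J.Boundaryless]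
  {N : Type*} [TopologicalSpace N] [ChartedSpace H₂ N] [IsManifold J ∞ N]
  {E₃ : Type*} [NormedAddCommGroup E₃] [NormedSpace ℝ E₃] [FiniteDimensional ℝ E₃]
  {H₃ : Type*} [TopologicalSpace H₃] {K : ModelWithCorners ℝ E₃ H₃} [K.Boundaryless]
  {P : Type*} [TopologicalSpace P] [ChartedSpace H₃ P] [IsManifold K ∞ P]
  {F : Type*} [NormedAddCommGroup F] [NormedSpace ℝ F] [FiniteDimensional ℝ F] {q : ℕ}

variable (I J) in
/-- The pullback of forms whose values are regarded as alternating maps on the model space. -/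
def pb (f : M → N) (η : N → E₂ [⋀^Fin q]→L[ℝ] F) : M → E [⋀^Fin q]→L[ℝ] F := fun x =>
  (η (f x)).compContinuousLinearMap (tmap I J f x)

variable (I) in
/-- The exterior derivative of forms whose values are regarded as alternating maps on the model
space. -/
def ed (η : M → E [⋀^Fin q]→L[ℝ] F) : M → E [⋀^Fin (q + 1)]→L[ℝ] F :=
  DForm.extD (I := I) (M := M) η

variable (I) in
/-- The form `η`, read in the preferred chart at `x₀`. -/
def chartForm (η : M → E [⋀^Fin q]→L[ℝ] F) (x₀ : M) : E → E [⋀^Fin q]→L[ℝ] F :=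
  pb 𝓘(ℝ, E) I (extChartAt I x₀).symm η

variable (I) in
/-- Smoothness of a form at a point, tested in the preferred chart there. -/
def SmoothFormAt (η : M → E [⋀^Fin q]→L[ℝ] F) (x : M) : Prop :=
  ContDiffAt ℝ ∞ (chartForm I η x) (extChartAt I x x)

theorem inChart_eq_chartForm (η : M → E [⋀^Fin q]→L[ℝ] F) (x₀ : M) :
    DForm.inChart (I := I) (M := M) η x₀ = chartForm I η x₀ := by
  funext y
  simp only [DForm.inChart, chartForm, pb, tmap, I.range_eq_univ, mfderivWithin_univ]
  rfl

theorem ed_apply (η : M → E [⋀^Fin q]→L[ℝ] F) (x : M) :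
    ed I η x = (extDeriv (chartForm I η x) (extChartAt I x x)).compContinuousLinearMap
      (tmap I 𝓘(ℝ, E) (extChartAt I x) x) := by
  have : ed I η x = (extDerivWithin (DForm.inChart (I := I) (M := M) η x) (Set.range I)
    (extChartAt I x x)).compContinuousLinearMap (tmap I 𝓘(ℝ, E) (extChartAt I x) x) := rfl
  rw [this, I.range_eq_univ, extDerivWithin_univ, inChart_eq_chartForm]

theorem pb_comp {g : N → P} {f : M → N} (hg : MDifferentiable J K g) (hf : MDifferentiable I J f)
    (η : P → E₃ [⋀^Fin q]→L[ℝ] F) : pb I J f (pb J K g η) = pb I K (g ∘ f) η := by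
  funext x
  simp only [pb, tmap_comp (hg _) (hf _)]
  rfl

theorem pb_id (η : M → E [⋀^Fin q]→L[ℝ] F) : pb I I id η = η := by
  funext x
  simp only [pb, tmap_id]
  rfl

theorem pb_eventuallyEq {u : E₂ → M} {y : E₂} (hu : ContMDiffAt 𝓘(ℝ, E₂) I ∞ u y)
    (η : M → E [⋀^Fin q]→L[ℝ] F) :
    pb 𝓘(ℝ, E₂) I u η =ᶠ[𝓝 y] fun z =>
      (chartForm I η (u y) (extChartAt I (u y) (u z))).compContinuousLinearMap
        (fderiv ℝ (fun z => extChartAt I (u y) (u z)) z) := by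
  have h1 : ∀ᶠ z in 𝓝 y, u z ∈ (extChartAt I (u y)).source :=
    hu.continuousAt.eventually_mem (extChartAt_source_mem_nhds (I := I) (u y))
  have h2 : ∀ᶠ z in 𝓝 y, ContMDiffAt 𝓘(ℝ, E₂) I 1 u z :=
    (contMDiffAt_iff_contMDiffAt_nhds (by simp)).1 (hu.of_le (by simp))
  filter_upwards [h1.eventually_nhds, h2] with z hz1 hz2
  have hz := hz1.self_of_nhds
  have hd : MDifferentiableAt 𝓘(ℝ, E₂) I u z := hz2.mdifferentiableAt (by simp)
  have hc : MDifferentiableAt I 𝓘(ℝ, E) (extChartAt I (u y)) (u z) :=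
    (contMDiffAt_extChartAt' (n := ∞) (by simpa using hz)).mdifferentiableAt (by simp)
  have hs : MDifferentiableAt 𝓘(ℝ, E) I (extChartAt I (u y)).symm (extChartAt I (u y) (u z)) := by
    have := (contMDiffOn_extChartAt_symm (I := I) (n := ∞) (u y)).contMDiffAt
      (extChartAt_target_mem_nhds' (I := I) ((extChartAt I (u y)).map_source hz))
    exact this.mdifferentiableAt (by simp)
  have h3 : tmap 𝓘(ℝ, E₂) I u z =
      (tmap 𝓘(ℝ, E) I (extChartAt I (u y)).symm (extChartAt I (u y) (u z))).comp
        (fderiv ℝ (fun z => extChartAt I (u y) (u z)) z) := by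
    rw [← tmap_eq_fderiv, ← tmap_comp' (f := fun z => extChartAt I (u y) (u z)) hs (hc.comp z hd)]
    refine tmap_congr ?_
    filter_upwards [hz1] with z' hz'
    exact ((extChartAt I (u y)).left_inv hz').symm
  simp only [pb, chartForm, h3]
  rw [(extChartAt I (u y)).left_inv hz]
  rfl

theorem contDiffAt_chart_comp {u : E₂ → M} {y : E₂} (hu : ContMDiffAt 𝓘(ℝ, E₂) I ∞ u y) :
    ContDiffAt ℝ ∞ (fun z => extChartAt I (u y) (u z)) y :=
  (contMDiffAt_iff_contDiffAt).1
    ((contMDiffAt_extChartAt' (n := ∞) (I := I) (mem_chart_source H (u y))).comp y hu)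

/-- Pulling back a smooth form to a vector space gives a smooth function. -/
theorem SmoothFormAt.contDiffAt_pb {u : E₂ → M} {y : E₂} {η : M → E [⋀^Fin q]→L[ℝ] F}
    (hη : SmoothFormAt I η (u y)) (hu : ContMDiffAt 𝓘(ℝ, E₂) I ∞ u y) :
    ContDiffAt ℝ ∞ (pb 𝓘(ℝ, E₂) I u η) y := by
  refine ContDiffAt.congr_of_eventuallyEq ?_ (pb_eventuallyEq hu η)
  have hc := contDiffAt_chart_comp hu
  exact (ContDiffAt.comp y (f := fun z => extChartAt I (u y) (u z)) hη hc).alt_comp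
    (hc.fderiv_right (m := ∞) (by simp))

/-- The exterior derivative is compatible with pullback to vector spaces. -/
theorem SmoothFormAt.extDeriv_pb {u : E₂ → M} {y : E₂} {η : M → E [⋀^Fin q]→L[ℝ] F}
    (hη : SmoothFormAt I η (u y)) (hu : ContMDiffAt 𝓘(ℝ, E₂) I ∞ u y) :
    extDeriv (pb 𝓘(ℝ, E₂) I u η) y = pb 𝓘(ℝ, E₂) I u (ed I η) y := by
  have hc := contDiffAt_chart_comp hu
  rw [(pb_eventuallyEq hu η).extDeriv_eq, extDeriv_pullback (r := ∞)
    (f := fun z => extChartAt I (u y) (u z))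
    (ContDiffAt.differentiableAt hη (by simp)) hc two_le_infty]
  simp only [pb, ed_apply]
  have hx : MDifferentiableAt I 𝓘(ℝ, E) (extChartAt I (u y)) (u y) :=
    (contMDiffAt_extChartAt (n := ∞)).mdifferentiableAt (by simp)
  rw [← tmap_eq_fderiv, tmap_comp' hx (hu.mdifferentiableAt (by simp))]
  rfl

theorem contMDiffAt_extChartAt_symm {x : M} {y : E} (hy : y ∈ (extChartAt I x).target) :
    ContMDiffAt 𝓘(ℝ, E) I ∞ (extChartAt I x).symm y :=
  (contMDiffOn_extChartAt_symm (I := I) (n := ∞) x).contMDiffAt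
    (extChartAt_target_mem_nhds' (I := I) hy)

theorem isSmooth_iff {η : M → E [⋀^Fin q]→L[ℝ] F} :
    DForm.IsSmooth (I := I) (M := M) η ↔ ∀ x, SmoothFormAt I η x := by
  constructor
  · intro h x
    have := (h x).contDiffAt (extChartAt_target_mem_nhds (I := I) x)
    rwa [inChart_eq_chartForm] at this
  · intro h x y hy
    rw [inChart_eq_chartForm]
    exact ((h _).contDiffAt_pb (contMDiffAt_extChartAt_symm hy)).contDiffWithinAt

theorem chartForm_pb_eventuallyEq {f : M → N} {x : M} (hf : ContMDiffAt I J ∞ f x)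
    (η : N → E₂ [⋀^Fin q]→L[ℝ] F) :
    chartForm I (pb I J f η) x =ᶠ[𝓝 (extChartAt I x x)]
      pb 𝓘(ℝ, E) J (fun y => f ((extChartAt I x).symm y)) η := by
  have h1 : ∀ᶠ z in 𝓝 x, ContMDiffAt I J 1 f z :=
    (contMDiffAt_iff_contMDiffAt_nhds (by simp)).1 (hf.of_le (by simp))
  have h2 := (continuousAt_extChartAt_symm (I := I) x).eventually (by simpa using h1)
  filter_upwards [h2, extChartAt_target_mem_nhds (I := I) x] with y hy hy'
  simp only [chartForm, pb]
  rw [tmap_comp' (hy.mdifferentiableAt (by simp))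
    ((contMDiffAt_extChartAt_symm hy').mdifferentiableAt (by simp))]
  rfl

theorem SmoothFormAt.pb {f : M → N} {x : M} {η : N → E₂ [⋀^Fin q]→L[ℝ] F}
    (hη : SmoothFormAt J η (f x)) (hf : ContMDiffAt I J ∞ f x) :
    SmoothFormAt I (pb I J f η) x := by
  refine ContDiffAt.congr_of_eventuallyEq ?_ (chartForm_pb_eventuallyEq hf η)
  refine contDiffAt_pb (by simpa using hη) ?_
  exact ContMDiffAt.comp_of_eq hf (contMDiffAt_extChartAt_symm (mem_extChartAt_target x)) (by simp)

/-- The exterior derivative commutes with pullbacks. -/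
theorem SmoothFormAt.ed_pb {f : M → N} {x : M} {η : N → E₂ [⋀^Fin q]→L[ℝ] F}
    (hη : SmoothFormAt J η (f x)) (hf : ContMDiffAt I J ∞ f x) :
    ed I (_root_.pb I J f η) x = _root_.pb I J f (ed J η) x := by
  have hu : ContMDiffAt 𝓘(ℝ, E) J ∞ (fun y => f ((extChartAt I x).symm y)) (extChartAt I x x) :=
    ContMDiffAt.comp_of_eq hf (contMDiffAt_extChartAt_symm (mem_extChartAt_target x)) (by simp)
  rw [ed_apply, (chartForm_pb_eventuallyEq hf η).extDeriv_eq,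
    extDeriv_pb (by simpa using hη) hu]
  simp only [_root_.pb, extChartAt_to_inv]
  have h1 : MDifferentiableAt I 𝓘(ℝ, E) (extChartAt I x) x :=
    (contMDiffAt_extChartAt (n := ∞)).mdifferentiableAt (by simp)
  have h2 := tmap_comp' (hu.mdifferentiableAt (by simp)) h1
  have h3 : tmap I J (fun z => f ((extChartAt I x).symm (extChartAt I x z))) x = tmap I J f x := by
    refine tmap_congr ?_
    filter_upwards [extChartAt_source_mem_nhds (I := I) x] with z hz
    rw [(extChartAt I x).left_inv hz]
  rw [h3] at h2
  rw [h2]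
  rfl

theorem chartForm_ed_eventuallyEq {η : M → E [⋀^Fin q]→L[ℝ] F} (hη : ∀ x, SmoothFormAt I η x)
    (x : M) : chartForm I (ed I η) x =ᶠ[𝓝 (extChartAt I x x)] extDeriv (chartForm I η x) := by
  filter_upwards [extChartAt_target_mem_nhds (I := I) x] with y hy
  exact ((hη _).extDeriv_pb (contMDiffAt_extChartAt_symm hy)).symm

theorem SmoothFormAt.ed {η : M → E [⋀^Fin q]→L[ℝ] F} (hη : ∀ x, SmoothFormAt I η x) (x : M) :
    SmoothFormAt I (ed I η) x := by
  refine ContDiffAt.congr_of_eventuallyEq ?_ (chartForm_ed_eventuallyEq hη x)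
  have h := (hη x).fderiv_right (m := ∞) (by simp)
  exact (ContinuousAlternatingMap.alternatizeUncurryFinCLM ℝ E F).contDiff.contDiffAt.comp _ h

theorem ed_ed {η : M → E [⋀^Fin q]→L[ℝ] F} (hη : ∀ x, SmoothFormAt I η x) :
    ed I (ed I η) = 0 := by
  funext x
  rw [ed_apply, (chartForm_ed_eventuallyEq hη x).extDeriv_eq,
    extDeriv_extDeriv_apply (r := ∞) (hη x) two_le_infty]
  rfl

end FormCalculus

/-! ### The exterior product -/

section WedgeAlgebra

/-- A sum over permutations of `x, w₀, w₁, …` can be organized by the position `j` of `x`. -/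
theorem sum_perm_cons {T A : Type*} [AddCommGroup A] {n : ℕ} (f : (Fin (n + 1) → T) → A) (x : T)
    (w : Fin n → T) :
    ∑ σ : Equiv.Perm (Fin (n + 1)), Equiv.Perm.sign σ • f (Fin.cons (α := fun _ => T) x w ∘ σ) =
      ∑ j : Fin (n + 1), (-1 : ℤ) ^ (j : ℕ) • ∑ τ : Equiv.Perm (Fin n),
        Equiv.Perm.sign τ • f (j.insertNth (α := fun _ => T) x (w ∘ τ)) := by
  let d : Equiv.Perm (Fin n) → Equiv.Perm (Fin (n + 1)) := fun τ =>
    Equiv.Perm.decomposeFin.symm (0, τ)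
  have hd0 : ∀ τ, d τ 0 = 0 := fun τ => by simp [d]
  have hds : ∀ τ i, d τ (Fin.succ i) = (τ i).succ := fun τ i => by simp [d]
  let g : Fin (n + 1) × Equiv.Perm (Fin n) → Equiv.Perm (Fin (n + 1)) := fun z =>
    d z.2 * z.1.cycleRange
  have hg0 : ∀ z, g z z.1 = 0 := fun z => by
    simp only [g, Equiv.Perm.mul_apply, Fin.cycleRange_self, hd0]
  have hinj : Function.Injective g := by
    rintro ⟨j, τ⟩ ⟨j', τ'⟩ h
    have h1 : j = j' := by
      apply (g (j', τ')).injective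
      rw [hg0 (j', τ'), ← h, hg0 (j, τ)]
    subst h1
    have h2 : d τ = d τ' := mul_right_cancel h
    have h3 := Equiv.Perm.decomposeFin.symm.injective h2
    rw [show τ = τ' from (Prod.ext_iff.1 h3).2]
  have hbij : Function.Bijective g := by
    rw [Fintype.bijective_iff_injective_and_card]
    refine ⟨hinj, ?_⟩
    simp [Fintype.card_perm, Nat.factorial_succ]
  have hcomp : ∀ z, Fin.cons (α := fun _ => T) x w ∘ g z =
      z.1.insertNth (α := fun _ => T) x (w ∘ z.2) := fun z => by
    rw [← Fin.cons_comp_cycleRange]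
    funext i
    simp only [Function.comp, g, Equiv.Perm.mul_apply]
    generalize z.1.cycleRange i = y
    refine Fin.cases ?_ (fun y => ?_) y
    · rw [hd0]; rfl
    · rw [hds]; rfl
  have hsign : ∀ z, Equiv.Perm.sign (g z) = (-1) ^ (z.1 : ℕ) * Equiv.Perm.sign z.2 := fun z => by
    simp [g, d, Equiv.Perm.sign_mul, Fin.sign_cycleRange, mul_comm]
  rw [← hbij.sum_comp (fun σ => Equiv.Perm.sign σ • f (Fin.cons (α := fun _ => T) x w ∘ σ)),
    Fintype.sum_prod_type]
  refine Finset.sum_congr rfl fun j _ => ?_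
  rw [Finset.smul_sum]
  refine Finset.sum_congr rfl fun τ _ => ?_
  rw [hcomp, hsign, mul_smul]
  simp [Units.smul_def]

variable {T : Type*} [NormedAddCommGroup T] [NormedSpace ℝ T]
  {T' : Type*} [NormedAddCommGroup T'] [NormedSpace ℝ T']
  {F₁ F₂ F₃ F₄ F₅ F₆ : Type*} [NormedAddCommGroup F₁] [NormedSpace ℝ F₁]
  [NormedAddCommGroup F₂] [NormedSpace ℝ F₂] [NormedAddCommGroup F₃] [NormedSpace ℝ F₃]
  [NormedAddCommGroup F₄] [NormedSpace ℝ F₄] [NormedAddCommGroup F₅] [NormedSpace ℝ F₅]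
  [NormedAddCommGroup F₆] [NormedSpace ℝ F₆]
  (B : F₁ →L[ℝ] F₂ →L[ℝ] F₃) {k l m q : ℕ}

/-- The exterior product as a sum over all permutations instead of shuffles. -/
theorem altWedge_eq_sum_perm (h : k + l = q) (a : T [⋀^Fin k]→L[ℝ] F₁) (b : T [⋀^Fin l]→L[ℝ] F₂)
    (v : Fin q → T) :
    (k.factorial * l.factorial : ℝ) • altWedge B h a b v =
      ∑ σ : Equiv.Perm (Fin q), Equiv.Perm.sign σ •
        B (a fun i => v (σ (Fin.cast h (Fin.castAdd l i))))
          (b fun i => v (σ (Fin.cast h (Fin.natAdd k i)))) := by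
  subst h
  have h1 := MultilinearMap.domCoprod_alternization_eq a.toAlternatingMap b.toAlternatingMap
  have h2 := congrArg (fun c => TensorProduct.lift (B.toLinearMap₁₂) (c (v ∘ finSumFinEquiv))) h1
  have h3 : altWedge B rfl a b v = TensorProduct.lift (B.toLinearMap₁₂)
    ((a.toAlternatingMap.domCoprod b.toAlternatingMap) (v ∘ finSumFinEquiv)) := rfl
  rw [h3]
  have h4 : ((k.factorial * l.factorial : ℝ)) • TensorProduct.lift (B.toLinearMap₁₂)
      ((a.toAlternatingMap.domCoprod b.toAlternatingMap) (v ∘ finSumFinEquiv)) =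
      (k.factorial * l.factorial) • TensorProduct.lift (B.toLinearMap₁₂)
      ((a.toAlternatingMap.domCoprod b.toAlternatingMap) (v ∘ finSumFinEquiv)) := by
    rw [← Nat.cast_smul_eq_nsmul ℝ]; push_cast; rfl
  rw [h4]
  simp only [Fintype.card_fin, AlternatingMap.smul_apply, map_nsmul] at h2
  rw [← h2, MultilinearMap.alternatization_apply, map_sum]
  refine Fintype.sum_equiv (Equiv.permCongr finSumFinEquiv) _ _ fun σ => ?_
  rw [Equiv.Perm.sign_permCongr]
  simp only [MultilinearMap.domDomCongr_apply,
    MultilinearMap.domCoprod_apply, Units.smul_def, map_zsmul]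
  congr 1
  simp only [TensorProduct.lift.tmul, Function.comp, Equiv.permCongr_apply, Fin.cast_eq_self]
  simp

theorem factorial_smul_cancel {x y : F₃} (h : (k.factorial * l.factorial : ℝ) • x =
    (k.factorial * l.factorial : ℝ) • y) : x = y := by
  refine smul_right_injective F₃ (r := (k.factorial * l.factorial : ℝ)) (by positivity) h

theorem altWedge_add_left (h : k + l = q) (a a' : T [⋀^Fin k]→L[ℝ] F₁)
    (b : T [⋀^Fin l]→L[ℝ] F₂) : altWedge B h (a + a') b = altWedge B h a b + altWedge B h a' b := by
  ext v
  apply factorial_smul_cancel (k := k) (l := l)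
  simp [altWedge_eq_sum_perm, smul_add, Finset.sum_add_distrib]

theorem altWedge_add_right (h : k + l = q) (a : T [⋀^Fin k]→L[ℝ] F₁)
    (b b' : T [⋀^Fin l]→L[ℝ] F₂) :
    altWedge B h a (b + b') = altWedge B h a b + altWedge B h a b' := by
  ext v
  apply factorial_smul_cancel (k := k) (l := l)
  simp [altWedge_eq_sum_perm, smul_add, Finset.sum_add_distrib]

theorem altWedge_smul_left (h : k + l = q) (c : ℝ) (a : T [⋀^Fin k]→L[ℝ] F₁)
    (b : T [⋀^Fin l]→L[ℝ] F₂) : altWedge B h (c • a) b = c • altWedge B h a b := by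
  ext v
  apply factorial_smul_cancel (k := k) (l := l)
  rw [ContinuousAlternatingMap.smul_apply, smul_comm _ c]
  simp [altWedge_eq_sum_perm, Finset.smul_sum, smul_comm _ c]

theorem altWedge_smul_right (h : k + l = q) (c : ℝ) (a : T [⋀^Fin k]→L[ℝ] F₁)
    (b : T [⋀^Fin l]→L[ℝ] F₂) : altWedge B h a (c • b) = c • altWedge B h a b := by
  ext v
  apply factorial_smul_cancel (k := k) (l := l)
  rw [ContinuousAlternatingMap.smul_apply, smul_comm _ c]
  simp [altWedge_eq_sum_perm, Finset.smul_sum, smul_comm _ c]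

/-- Exterior products are compatible with pullback along linear maps. -/
theorem altWedge_comp (h : k + l = q) (a : T [⋀^Fin k]→L[ℝ] F₁) (b : T [⋀^Fin l]→L[ℝ] F₂)
    (A : T' →L[ℝ] T) : altWedge B h (a.compContinuousLinearMap A) (b.compContinuousLinearMap A) =
      (altWedge B h a b).compContinuousLinearMap A := by
  ext v
  apply factorial_smul_cancel (k := k) (l := l)
  rw [altWedge_eq_sum_perm, ContinuousAlternatingMap.compContinuousLinearMap_apply,
    altWedge_eq_sum_perm]
  rfl

/-- Moving the coefficients of exterior products through compatible bilinear maps. -/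
theorem altWedge_coeff {B' : F₄ →L[ℝ] F₅ →L[ℝ] F₆} (h : k + l = q) {a : T [⋀^Fin k]→L[ℝ] F₁}
    {b : T [⋀^Fin l]→L[ℝ] F₂} {a' : T [⋀^Fin k]→L[ℝ] F₄} {b' : T [⋀^Fin l]→L[ℝ] F₅}
        (L : F₃ →L[ℝ] F₆)
    (H : ∀ u w, L (B (a u) (b w)) = B' (a' u) (b' w)) :
    L.compContinuousAlternatingMap (altWedge B h a b) = altWedge B' h a' b' := by
  ext v
  apply factorial_smul_cancel (k := k) (l := l)
  rw [ContinuousLinearMap.compContinuousAlternatingMap_coe, Function.comp, ← map_smul,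
    altWedge_eq_sum_perm, altWedge_eq_sum_perm, map_sum]
  refine Finset.sum_congr rfl fun σ _ => ?_
  rw [Units.smul_def, map_zsmul, H]
  rfl

theorem altWedge_mem {S : Submodule ℝ F₃} (h : k + l = q) {a : T [⋀^Fin k]→L[ℝ] F₁}
    {b : T [⋀^Fin l]→L[ℝ] F₂} (H : ∀ u w, B (a u) (b w) ∈ S) (v : Fin q → T) :
    altWedge B h a b v ∈ S := by
  have h1 : (k.factorial * l.factorial : ℝ) ≠ 0 := by positivity
  rw [← S.smul_mem_iff h1, altWedge_eq_sum_perm]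
  refine S.sum_mem fun σ _ => ?_
  rw [Units.smul_def]
  exact S.smul_of_tower_mem _ (H _ _)

theorem altWedge_const_left (h : 0 + l = l) (a : T [⋀^Fin 0]→L[ℝ] F₁)
    (b : T [⋀^Fin l]→L[ℝ] F₂) :
    altWedge B h a b = (B (a default)).compContinuousAlternatingMap b := by
  ext v
  apply factorial_smul_cancel (k := 0) (l := l)
  rw [altWedge_eq_sum_perm]
  have : ∀ σ : Equiv.Perm (Fin l), Equiv.Perm.sign σ •
      B (a fun i => v (σ (Fin.cast h (Fin.castAdd l i))))
        (b fun i => v (σ (Fin.cast h (Fin.natAdd 0 i)))) = B (a default) (b v) := fun σ => by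
    have h1 : (fun i => v (σ (Fin.cast h (Fin.castAdd l i)))) = default := Subsingleton.elim _ _
    have h2 : (fun i => v (σ (Fin.cast h (Fin.natAdd 0 i)))) = v ∘ σ := by
      funext i; simp only [Function.comp]; congr 2; ext; simp
    rw [h1, h2, show b (v ∘ σ) = Equiv.Perm.sign σ • b v from
      b.toAlternatingMap.map_perm v σ, Units.smul_def, Units.smul_def, map_zsmul, smul_smul]
    simp
  simp only [this]
  simp [Fintype.card_perm, ← Nat.cast_smul_eq_nsmul ℝ]

theorem altWedge_const_right (h : k + 0 = k) (a : T [⋀^Fin k]→L[ℝ] F₁)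
    (b : T [⋀^Fin 0]→L[ℝ] F₂) :
    altWedge B h a b = (B.flip (b default)).compContinuousAlternatingMap a := by
  ext v
  apply factorial_smul_cancel (k := k) (l := 0)
  rw [altWedge_eq_sum_perm]
  have : ∀ σ : Equiv.Perm (Fin k), Equiv.Perm.sign σ •
      B (a fun i => v (σ (Fin.cast h (Fin.castAdd 0 i))))
        (b fun i => v (σ (Fin.cast h (Fin.natAdd k i)))) = B (a v) (b default) := fun σ => by
    have h1 : (fun i => v (σ (Fin.cast h (Fin.natAdd k i)))) = default := Subsingleton.elim _ _
    have h2 : (fun i => v (σ (Fin.cast h (Fin.castAdd 0 i)))) = v ∘ σ := by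
      funext i; rfl
    rw [h1, h2, show a (v ∘ σ) = Equiv.Perm.sign σ • a v from
      a.toAlternatingMap.map_perm v σ, Units.smul_def, Units.smul_def, map_zsmul,
      _root_.smul_apply, smul_smul]
    simp
  simp only [this]
  simp [Fintype.card_perm, ← Nat.cast_smul_eq_nsmul ℝ]


theorem altWedge_summand_front {h : k + 1 + l = q + 1} (h' : k + l = q)
    (a : T [⋀^Fin (k + 1)]→L[ℝ] F₁) (b : T [⋀^Fin l]→L[ℝ] F₂) (x : T) (u : Fin q → T)
    (i : Fin (k + 1)) :
    B (a fun i' => (Fin.cast h (Fin.castAdd l i)).insertNth (α := fun _ => T) x u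
        (Fin.cast h (Fin.castAdd l i')))
      (b fun i' => (Fin.cast h (Fin.castAdd l i)).insertNth (α := fun _ => T) x u
        (Fin.cast h (Fin.natAdd (k + 1) i'))) =
    (-1 : ℤ) ^ (i : ℕ) • B (a.curryLeft x fun i' => u (Fin.cast h' (Fin.castAdd l i')))
      (b fun i' => u (Fin.cast h' (Fin.natAdd k i'))) := by
  have h1 : (fun i' => (Fin.cast h (Fin.castAdd l i)).insertNth (α := fun _ => T) x u
      (Fin.cast h (Fin.castAdd l i'))) =
      i.insertNth (α := fun _ => T) x fun i' => u (Fin.cast h' (Fin.castAdd l i')) := by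
    funext i'
    rcases Fin.eq_self_or_eq_succAbove i i' with rfl | ⟨j, rfl⟩
    · rw [Fin.insertNth_apply_same, Fin.insertNth_apply_same]
    · have : Fin.cast h (Fin.castAdd l (i.succAbove j)) =
          (Fin.cast h (Fin.castAdd l i)).succAbove (Fin.cast h' (Fin.castAdd l j)) := by
        ext
        simp only [Fin.succAbove, Fin.lt_def, Fin.val_cast, Fin.val_castAdd, Fin.val_castSucc]
        split_ifs <;> simp
      rw [this, Fin.insertNth_apply_succAbove, Fin.insertNth_apply_succAbove]
  have h2 : (fun i' => (Fin.cast h (Fin.castAdd l i)).insertNth (α := fun _ => T) x u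
      (Fin.cast h (Fin.natAdd (k + 1) i'))) = fun i' => u (Fin.cast h' (Fin.natAdd k i')) := by
    funext i'
    have : Fin.cast h (Fin.natAdd (k + 1) i') =
        (Fin.cast h (Fin.castAdd l i)).succAbove (Fin.cast h' (Fin.natAdd k i')) := by
      ext
      simp only [Fin.succAbove, Fin.lt_def, Fin.val_cast, Fin.val_castAdd, Fin.val_castSucc,
        Fin.val_natAdd]
      split_ifs
      · omega
      · simp; omega
    rw [this, Fin.insertNth_apply_succAbove]
  rw [h1, h2, a.map_insertNth]
  rw [map_zsmul, _root_.smul_apply]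
  rfl

theorem altWedge_summand_back {h : k + (l + 1) = q + 1} (h' : k + l = q)
    (a : T [⋀^Fin k]→L[ℝ] F₁) (b : T [⋀^Fin (l + 1)]→L[ℝ] F₂) (x : T) (u : Fin q → T)
    (i : Fin (l + 1)) :
    B (a fun i' => (Fin.cast h (Fin.natAdd k i)).insertNth (α := fun _ => T) x u
        (Fin.cast h (Fin.castAdd (l + 1) i')))
      (b fun i' => (Fin.cast h (Fin.natAdd k i)).insertNth (α := fun _ => T) x u
        (Fin.cast h (Fin.natAdd k i'))) =
    (-1 : ℤ) ^ (i : ℕ) • B (a fun i' => u (Fin.cast h' (Fin.castAdd l i')))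
      (b.curryLeft x fun i' => u (Fin.cast h' (Fin.natAdd k i'))) := by
  have h1 : (fun i' => (Fin.cast h (Fin.natAdd k i)).insertNth (α := fun _ => T) x u
      (Fin.cast h (Fin.natAdd k i'))) =
      i.insertNth (α := fun _ => T) x fun i' => u (Fin.cast h' (Fin.natAdd k i')) := by
    funext i'
    rcases Fin.eq_self_or_eq_succAbove i i' with rfl | ⟨j, rfl⟩
    · rw [Fin.insertNth_apply_same, Fin.insertNth_apply_same]
    · have : Fin.cast h (Fin.natAdd k (i.succAbove j)) =
          (Fin.cast h (Fin.natAdd k i)).succAbove (Fin.cast h' (Fin.natAdd k j)) := by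
        ext
        simp only [Fin.succAbove, Fin.lt_def, Fin.val_cast, Fin.val_natAdd, Fin.val_castSucc]
        split_ifs <;> simp <;> omega
      rw [this, Fin.insertNth_apply_succAbove, Fin.insertNth_apply_succAbove]
  have h2 : (fun i' => (Fin.cast h (Fin.natAdd k i)).insertNth (α := fun _ => T) x u
      (Fin.cast h (Fin.castAdd (l + 1) i'))) = fun i' => u (Fin.cast h' (Fin.castAdd l i')) := by
    funext i'
    have : Fin.cast h (Fin.castAdd (l + 1) i') =
        (Fin.cast h (Fin.natAdd k i)).succAbove (Fin.cast h' (Fin.castAdd l i')) := by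
      ext
      simp only [Fin.succAbove, Fin.lt_def, Fin.val_cast, Fin.val_castAdd, Fin.val_castSucc,
        Fin.val_natAdd]
      split_ifs
      · simp
      · omega
    rw [this, Fin.insertNth_apply_succAbove]
  rw [h1, h2, b.map_insertNth, map_zsmul]
  rfl

/-- The terms of the contraction of an exterior product in which the contracted vector is inserted
into one of the slots of the first factor. -/
theorem altWedge_front_slot {h : k + 1 + l = q + 1} (h' : k + l = q)
    (a : T [⋀^Fin (k + 1)]→L[ℝ] F₁) (b : T [⋀^Fin l]→L[ℝ] F₂) (x : T) (w : Fin q → T)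
    (i : Fin (k + 1)) :
    (-1 : ℤ) ^ (Fin.cast h (Fin.castAdd l i) : ℕ) • ∑ τ : Equiv.Perm (Fin q), Equiv.Perm.sign τ •
      B (a fun i' => (Fin.cast h (Fin.castAdd l i)).insertNth (α := fun _ => T) x (w ∘ τ)
          (Fin.cast h (Fin.castAdd l i')))
        (b fun i' => (Fin.cast h (Fin.castAdd l i)).insertNth (α := fun _ => T) x (w ∘ τ)
          (Fin.cast h (Fin.natAdd (k + 1) i'))) =
    (k.factorial * l.factorial : ℝ) • altWedge B h' (a.curryLeft x) b w := by
  rw [altWedge_eq_sum_perm, Finset.smul_sum]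
  refine Finset.sum_congr rfl fun τ _ => ?_
  rw [altWedge_summand_front B h', smul_comm, smul_smul, Fin.val_cast, Fin.val_castAdd, ← mul_pow]
  simp

theorem altWedge_back_slot {h : k + (l + 1) = q + 1} (h' : k + l = q)
    (a : T [⋀^Fin k]→L[ℝ] F₁) (b : T [⋀^Fin (l + 1)]→L[ℝ] F₂) (x : T) (w : Fin q → T)
    (i : Fin (l + 1)) :
    (-1 : ℤ) ^ (Fin.cast h (Fin.natAdd k i) : ℕ) • ∑ τ : Equiv.Perm (Fin q), Equiv.Perm.sign τ •
      B (a fun i' => (Fin.cast h (Fin.natAdd k i)).insertNth (α := fun _ => T) x (w ∘ τ)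
          (Fin.cast h (Fin.castAdd (l + 1) i')))
        (b fun i' => (Fin.cast h (Fin.natAdd k i)).insertNth (α := fun _ => T) x (w ∘ τ)
          (Fin.cast h (Fin.natAdd k i'))) =
    (k.factorial * l.factorial : ℝ) • (-1 : ℝ) ^ k • altWedge B h' a (b.curryLeft x) w := by
  rw [smul_comm, altWedge_eq_sum_perm, Finset.smul_sum, Finset.smul_sum]
  refine Finset.sum_congr rfl fun τ _ => ?_
  rw [altWedge_summand_back B h', smul_comm, smul_smul, Fin.val_cast, Fin.val_natAdd, pow_add,
    mul_assoc, ← mul_pow]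
  simp only [mul_neg, mul_one, neg_neg, one_pow]
  rw [← Int.cast_smul_eq_zsmul ℝ]
  push_cast
  exact smul_comm _ _ _

/-- The contraction of an exterior product, with the terms sorted by the slot of the contracted
vector. -/
theorem altWedge_cons_sum (h : k + l = q + 1) (a : T [⋀^Fin k]→L[ℝ] F₁) (b : T [⋀^Fin l]→L[ℝ] F₂)
    (x : T) (w : Fin q → T) :
    (k.factorial * l.factorial : ℝ) • (altWedge B h a b).curryLeft x w =
      (∑ i : Fin k, (-1 : ℤ) ^ (Fin.cast h (Fin.castAdd l i) : ℕ) •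
        ∑ τ : Equiv.Perm (Fin q), Equiv.Perm.sign τ •
          B (a fun i' => (Fin.cast h (Fin.castAdd l i)).insertNth (α := fun _ => T) x (w ∘ τ)
              (Fin.cast h (Fin.castAdd l i')))
            (b fun i' => (Fin.cast h (Fin.castAdd l i)).insertNth (α := fun _ => T) x (w ∘ τ)
              (Fin.cast h (Fin.natAdd k i')))) +
      ∑ i : Fin l, (-1 : ℤ) ^ (Fin.cast h (Fin.natAdd k i) : ℕ) •
        ∑ τ : Equiv.Perm (Fin q), Equiv.Perm.sign τ •
          B (a fun i' => (Fin.cast h (Fin.natAdd k i)).insertNth (α := fun _ => T) x (w ∘ τ)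
              (Fin.cast h (Fin.castAdd l i')))
            (b fun i' => (Fin.cast h (Fin.natAdd k i)).insertNth (α := fun _ => T) x (w ∘ τ)
              (Fin.cast h (Fin.natAdd k i'))) := by
  have h1 := altWedge_eq_sum_perm B h a b (Fin.cons (α := fun _ => T) x w)
  have h2 := sum_perm_cons (fun u : Fin (q + 1) → T =>
    B (a fun i => u (Fin.cast h (Fin.castAdd l i))) (b fun i => u (Fin.cast h (Fin.natAdd k i)))) x
        w
  refine (h1.trans h2).trans ?_
  rw [← (finCongr h).sum_comp, Fin.sum_univ_add]
  rfl

/-- Contraction of exterior products, for factors of positive degree. -/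
theorem altWedge_curryLeft (h : k + 1 + (l + 1) = q + 1) (h₁ : k + (l + 1) = q)
    (h₂ : k + 1 + l = q) (a : T [⋀^Fin (k + 1)]→L[ℝ] F₁) (b : T [⋀^Fin (l + 1)]→L[ℝ] F₂) (x : T) :
    (altWedge B h a b).curryLeft x = altWedge B h₁ (a.curryLeft x) b +
      (-1 : ℝ) ^ (k + 1) • altWedge B h₂ a (b.curryLeft x) := by
  ext w
  apply factorial_smul_cancel (k := k + 1) (l := l + 1)
  rw [altWedge_cons_sum, Finset.sum_congr rfl fun i _ => altWedge_front_slot B h₁ a b x w i,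
    Finset.sum_congr rfl fun i _ => altWedge_back_slot B h₂ a b x w i]
  simp only [Finset.sum_const, Finset.card_univ, Fintype.card_fin, ← Nat.cast_smul_eq_nsmul ℝ,
    smul_smul, Nat.factorial_succ, ContinuousAlternatingMap.add_apply,
    ContinuousAlternatingMap.smul_apply, smul_add]
  push_cast
  congr 2 <;> ring

theorem altWedge_curryLeft_zero_right (h : k + 1 + 0 = q + 1) (h₁ : k + 0 = q)
    (a : T [⋀^Fin (k + 1)]→L[ℝ] F₁) (b : T [⋀^Fin 0]→L[ℝ] F₂) (x : T) :
    (altWedge B h a b).curryLeft x = altWedge B h₁ (a.curryLeft x) b := by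
  ext w
  apply factorial_smul_cancel (k := k + 1) (l := 0)
  rw [altWedge_cons_sum, Finset.sum_congr rfl fun i _ => altWedge_front_slot B h₁ a b x w i]
  simp only [Finset.sum_const, Finset.card_univ, Fintype.card_fin, ← Nat.cast_smul_eq_nsmul ℝ,
    smul_smul, Nat.factorial_succ, Finset.univ_eq_empty, Finset.sum_empty, add_zero]
  push_cast
  congr 1; ring

theorem altWedge_curryLeft_zero_left (h : 0 + (l + 1) = q + 1) (h₁ : 0 + l = q)
    (a : T [⋀^Fin 0]→L[ℝ] F₁) (b : T [⋀^Fin (l + 1)]→L[ℝ] F₂) (x : T) :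
    (altWedge B h a b).curryLeft x = altWedge B h₁ a (b.curryLeft x) := by
  ext w
  apply factorial_smul_cancel (k := 0) (l := l + 1)
  rw [altWedge_cons_sum, Finset.sum_congr rfl fun i _ => altWedge_back_slot B h₁ a b x w i]
  simp only [Finset.sum_const, Finset.card_univ, Fintype.card_fin, ← Nat.cast_smul_eq_nsmul ℝ,
    smul_smul, Nat.factorial_succ, Finset.univ_eq_empty, Finset.sum_empty, zero_add, pow_zero]
  push_cast
  congr 1; ring

end WedgeAlgebra

section WedgeAlgebra

variable {T : Type*} [NormedAddCommGroup T] [NormedSpace ℝ T]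
  {F₁ F₂ F₃ : Type*} [NormedAddCommGroup F₁] [NormedSpace ℝ F₁]
  [NormedAddCommGroup F₂] [NormedSpace ℝ F₂] [NormedAddCommGroup F₃] [NormedSpace ℝ F₃]
  (B : F₁ →L[ℝ] F₂ →L[ℝ] F₃) {k l m kl lm q : ℕ}

theorem alt_ext_curryLeft {a b : T [⋀^Fin (k + 1)]→L[ℝ] F₁}
    (h : ∀ x, a.curryLeft x = b.curryLeft x) : a = b := by
  ext v
  have := congrArg (fun c => c (Fin.tail v)) (h (v 0))
  change a (Fin.cons (v 0) (Fin.tail v)) = b (Fin.cons (v 0) (Fin.tail v)) at this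
  rwa [Fin.cons_self_tail] at this

/-- Associativity of the exterior product, by induction on the degree: both sides have the same
contractions with vectors. -/
theorem altWedge_assoc {F₁₂ F₂₃ : Type*} [NormedAddCommGroup F₁₂] [NormedSpace ℝ F₁₂]
    [NormedAddCommGroup F₂₃] [NormedSpace ℝ F₂₃] {Z : Type*} [NormedAddCommGroup Z]
    [NormedSpace ℝ Z] {B₁₂ : F₁ →L[ℝ] F₂ →L[ℝ] F₁₂} {B' : F₁₂ →L[ℝ] F₃ →L[ℝ] Z}
    {B₂₃ : F₂ →L[ℝ] F₃ →L[ℝ] F₂₃} {B'' : F₁ →L[ℝ] F₂₃ →L[ℝ] Z}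
    (H : ∀ a b c, B' (B₁₂ a b) c = B'' a (B₂₃ b c)) (h₁ : k + l = kl) (h₂ : kl + m = q)
    (h₃ : l + m = lm) (h₄ : k + lm = q) (a : T [⋀^Fin k]→L[ℝ] F₁) (b : T [⋀^Fin l]→L[ℝ] F₂)
    (c : T [⋀^Fin m]→L[ℝ] F₃) :
    altWedge B' h₂ (altWedge B₁₂ h₁ a b) c = altWedge B'' h₄ a (altWedge B₂₃ h₃ b c) := by
  induction q generalizing k l m kl lm with
  | zero =>
    obtain rfl : k = 0 := by omega
    obtain rfl : l = 0 := by omega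
    obtain rfl : m = 0 := by omega
    obtain rfl : kl = 0 := by omega
    obtain rfl : lm = 0 := by omega
    ext v
    rw [altWedge_const_left, altWedge_const_left, altWedge_const_left, altWedge_const_left]
    simp only [ContinuousLinearMap.compContinuousAlternatingMap_coe, Function.comp, H]
  | succ q ih =>
    refine alt_ext_curryLeft fun x => ?_
    rcases k with _ | k <;> rcases l with _ | l <;> rcases m with _ | m
    · omega
    · obtain rfl : kl = 0 := by omega
      obtain rfl : lm = m + 1 := by omega
      rw [altWedge_curryLeft_zero_left _ _ (by omega), altWedge_curryLeft_zero_left _ _ (by omega),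
        altWedge_curryLeft_zero_left _ _ (by omega), ih]
    · obtain rfl : kl = l + 1 := by omega
      obtain rfl : lm = l + 1 := by omega
      rw [altWedge_curryLeft_zero_right _ _ (by omega),
        altWedge_curryLeft_zero_left _ _ (by omega),
        altWedge_curryLeft_zero_left _ _ (by omega),
        altWedge_curryLeft_zero_right _ _ (by omega), ih]
    · obtain rfl : kl = l + 1 := by omega
      obtain ⟨lm, rfl⟩ : ∃ n, lm = n + 1 := ⟨lm - 1, by omega⟩
      rw [altWedge_curryLeft _ _ (by omega) (by omega),
        altWedge_curryLeft_zero_left _ _ (by omega),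
        altWedge_curryLeft_zero_left _ _ (by omega),
        altWedge_curryLeft _ _ (by omega) (by omega), altWedge_add_right, altWedge_smul_right,
        ih (lm := lm) _ _ (by omega) (by omega), ih (lm := lm) _ _ (by omega) (by omega)]
    · obtain rfl : kl = k + 1 := by omega
      obtain rfl : lm = 0 := by omega
      rw [altWedge_curryLeft_zero_right _ _ (by omega),
        altWedge_curryLeft_zero_right _ _ (by omega),
        altWedge_curryLeft_zero_right _ _ (by omega), ih]
    · obtain rfl : kl = k + 1 := by omega
      obtain rfl : lm = m + 1 := by omega
      rw [altWedge_curryLeft _ _ (by omega) (by omega),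
        altWedge_curryLeft_zero_right _ _ (by omega),
        altWedge_curryLeft _ _ (by omega) (by omega),
        altWedge_curryLeft_zero_left _ _ (by omega),
        ih (lm := m + 1) _ _ (by omega) (by omega), ih (lm := m) _ _ (by omega) (by omega)]
    · obtain ⟨kl, rfl⟩ : ∃ n, kl = n + 1 := ⟨kl - 1, by omega⟩
      obtain rfl : lm = l + 1 := by omega
      rw [altWedge_curryLeft_zero_right _ _ (by omega),
        altWedge_curryLeft _ _ (by omega) (by omega),
        altWedge_curryLeft _ _ (by omega) (by omega),
        altWedge_curryLeft_zero_right _ _ (by omega), altWedge_add_left, altWedge_smul_left,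
        ih (lm := l + 1) _ _ (by omega) (by omega), ih (lm := l) _ _ (by omega) (by omega)]
    · obtain ⟨kl, rfl⟩ : ∃ n, kl = n + 1 := ⟨kl - 1, by omega⟩
      obtain ⟨lm, rfl⟩ : ∃ n, lm = n + 1 := ⟨lm - 1, by omega⟩
      rw [altWedge_curryLeft _ _ (by omega) (by omega),
        altWedge_curryLeft _ _ (by omega) (by omega),
        altWedge_curryLeft _ _ (by omega) (by omega),
        altWedge_curryLeft _ _ (by omega) (by omega), altWedge_add_left, altWedge_smul_left,
        altWedge_add_right, altWedge_smul_right,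
        ih (lm := lm + 1) _ _ (by omega) (by omega) (a.curryLeft x),
        ih (lm := lm) _ _ (by omega) (by omega) a (b.curryLeft x),
        ih (lm := lm) _ _ (by omega) (by omega) a b (c.curryLeft x),
        smul_add, smul_smul, ← pow_add, add_assoc]
      congr 4
      omega

/-- Exterior multiplication by `b` on the right, as a linear map. -/
def wedgeRight (h : k + l = q) (b : T [⋀^Fin l]→L[ℝ] F₂) :
    (T [⋀^Fin k]→L[ℝ] F₁) →ₗ[ℝ] (T [⋀^Fin q]→L[ℝ] F₃) where
  toFun a := altWedge B h a b
  map_add' a a' := altWedge_add_left B h a a' b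
  map_smul' c a := altWedge_smul_left B h c a b

/-- Exterior multiplication by `a` on the left, as a linear map. -/
def wedgeLeft (h : k + l = q) (a : T [⋀^Fin k]→L[ℝ] F₁) :
    (T [⋀^Fin l]→L[ℝ] F₂) →ₗ[ℝ] (T [⋀^Fin q]→L[ℝ] F₃) where
  toFun b := altWedge B h a b
  map_add' b b' := altWedge_add_right B h a b b'
  map_smul' c b := altWedge_smul_right B h c a b

variable [FiniteDimensional ℝ T]

/-- The antisymmetrization `(x₀, …, x_k) ↦ ∑ (-1) ^ i A x_i (x₀, …, omit x_i, …, x_k)` of a linear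
family of alternating maps; it turns the derivative of a form into its exterior derivative. -/
def altD (A : T →ₗ[ℝ] T [⋀^Fin k]→L[ℝ] F₁) : T [⋀^Fin (k + 1)]→L[ℝ] F₁ :=
  ContinuousAlternatingMap.alternatizeUncurryFin (LinearMap.toContinuousLinearMap A)

theorem altD_apply (A : T →ₗ[ℝ] T [⋀^Fin k]→L[ℝ] F₁) (v : Fin (k + 1) → T) :
    altD A v = ∑ i : Fin (k + 1), (-1 : ℤ) ^ (i : ℕ) • A (v i) (i.removeNth v) :=
  ContinuousAlternatingMap.alternatizeUncurryFin_apply _ _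

theorem altD_add (A A' : T →ₗ[ℝ] T [⋀^Fin k]→L[ℝ] F₁) : altD (A + A') = altD A + altD A' := by
  ext v
  simp [altD_apply, Finset.sum_add_distrib]

theorem altD_smul (c : ℝ) (A : T →ₗ[ℝ] T [⋀^Fin k]→L[ℝ] F₁) : altD (c • A) = c • altD A := by
  ext v
  simp only [altD_apply, ContinuousAlternatingMap.smul_apply, LinearMap.smul_apply,
    Finset.smul_sum, smul_comm _ c]

/-- Contraction with a vector, as a linear map. -/
def contr (x : T) : (T [⋀^Fin (k + 1)]→L[ℝ] F₁) →ₗ[ℝ] (T [⋀^Fin k]→L[ℝ] F₁) where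
  toFun a := a.curryLeft x
  map_add' _ _ := rfl
  map_smul' _ _ := rfl

theorem contr_apply (x : T) (a : T [⋀^Fin (k + 1)]→L[ℝ] F₁) : contr x a = a.curryLeft x := rfl

theorem altD_curryLeft_zero (A : T →ₗ[ℝ] T [⋀^Fin 0]→L[ℝ] F₁) (x : T) :
    (altD A).curryLeft x = A x := by
  ext w
  rw [ContinuousAlternatingMap.curryLeft_apply_apply, altD_apply]
  simp

theorem altD_curryLeft (A : T →ₗ[ℝ] T [⋀^Fin (k + 1)]→L[ℝ] F₁) (x : T) :
    (altD A).curryLeft x = A x - altD (contr x ∘ₗ A) := by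
  ext w
  rw [ContinuousAlternatingMap.curryLeft_apply_apply, altD_apply, Fin.sum_univ_succ,
    ContinuousAlternatingMap.sub_apply, altD_apply, sub_eq_add_neg, ← Finset.sum_neg_distrib]
  congr 1
  · simp
  · refine Finset.sum_congr rfl fun i _ => ?_
    have : i.succ.removeNth (Matrix.vecCons x w) = Matrix.vecCons x (i.removeNth w) := by
      funext j
      refine Fin.cases ?_ (fun j => ?_) j
      · simp [Fin.removeNth]
      · simp [Fin.removeNth]
    rw [this, Fin.val_succ, pow_succ]
    simp [contr_apply]

theorem wedgeRight_apply (h : k + l = q) (a : T [⋀^Fin k]→L[ℝ] F₁) (b : T [⋀^Fin l]→L[ℝ] F₂) :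
    wedgeRight B h b a = altWedge B h a b := rfl

theorem wedgeLeft_apply (h : k + l = q) (a : T [⋀^Fin k]→L[ℝ] F₁) (b : T [⋀^Fin l]→L[ℝ] F₂) :
    wedgeLeft B h a b = altWedge B h a b := rfl

/-- Exterior multiplication by a constant form on the right commutes with `altD`. -/
theorem altD_wedge_right (h : k + l = q) (h' : k + 1 + l = q + 1)
    (A : T →ₗ[ℝ] T [⋀^Fin k]→L[ℝ] F₁) (b : T [⋀^Fin l]→L[ℝ] F₂) :
    altD (wedgeRight B h b ∘ₗ A) = altWedge B h' (altD A) b := by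
  induction q generalizing k l with
  | zero =>
    obtain rfl : k = 0 := by omega
    obtain rfl : l = 0 := by omega
    refine alt_ext_curryLeft fun x => ?_
    rw [altD_curryLeft_zero, altWedge_curryLeft_zero_right _ _ (by omega), altD_curryLeft_zero]
    rfl
  | succ q ih =>
    refine alt_ext_curryLeft fun x => ?_
    rw [altD_curryLeft]
    rcases k with _ | k <;> rcases l with _ | l
    · omega
    · have hq₂ : 0 + l = q := by omega
      rw [altWedge_curryLeft (k := 0) (l := l) (q := q + 1) B h' (by omega) (by omega) (altD A) b x,
        altD_curryLeft_zero]
      have : contr x ∘ₗ wedgeRight B h b ∘ₗ A =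
          wedgeRight B hq₂ (b.curryLeft x) ∘ₗ A := by
        exact LinearMap.ext fun y => altWedge_curryLeft_zero_left B h hq₂ (A y) b x
      rw [this, ih hq₂ (by omega), sub_eq_add_neg]
      refine congrArg₂ (· + ·) rfl ?_
      rw [show (-1 : ℝ) ^ (0 + 1) = -1 by norm_num, neg_one_smul]
    · have hq₁ : k + 0 = q := by omega
      rw [altWedge_curryLeft_zero_right _ _ (by omega), altD_curryLeft]
      have : contr x ∘ₗ wedgeRight B h b ∘ₗ A =
          wedgeRight B hq₁ b ∘ₗ (contr x ∘ₗ A) := by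
        exact LinearMap.ext fun y => altWedge_curryLeft_zero_right B h hq₁ (A y) b x
      rw [this, ih (by omega) (by omega)]
      exact ((wedgeRight B h b).map_sub _ _).symm
    · have hq₁ : k + (l + 1) = q := by omega
      have hq₂ : k + 1 + l = q := by omega
      rw [altWedge_curryLeft _ _ (by omega) (by omega), altD_curryLeft]
      have : contr x ∘ₗ wedgeRight B h b ∘ₗ A =
          wedgeRight B hq₁ b ∘ₗ (contr x ∘ₗ A) +
            (-1 : ℝ) ^ (k + 1) • wedgeRight B hq₂ (b.curryLeft x) ∘ₗ A := by
        exact LinearMap.ext fun y => altWedge_curryLeft B h hq₁ hq₂ (A y) b x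
      rw [this, altD_add, altD_smul, ih (by omega) (by omega), ih (by omega) (by omega)]
      have h2 := (wedgeRight B h b).map_sub (A x) (altD (contr x ∘ₗ A))
      simp only [wedgeRight_apply] at h2
      rw [h2, pow_succ (-1 : ℝ) (k + 1), mul_neg_one, neg_smul]
      simp only [LinearMap.comp_apply, wedgeRight_apply]
      abel

/-- Exterior multiplication by a constant form of degree `k` on the left commutes with `altD` up
to the sign `(-1) ^ k`. -/
theorem altD_wedge_left (h : k + l = q) (h' : k + (l + 1) = q + 1)
    (A : T →ₗ[ℝ] T [⋀^Fin l]→L[ℝ] F₂) (a : T [⋀^Fin k]→L[ℝ] F₁) :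
    altD (wedgeLeft B h a ∘ₗ A) = (-1 : ℝ) ^ k • altWedge B h' a (altD A) := by
  induction q generalizing k l with
  | zero =>
    obtain rfl : k = 0 := by omega
    obtain rfl : l = 0 := by omega
    refine alt_ext_curryLeft fun x => ?_
    rw [altD_curryLeft_zero, pow_zero, one_smul, altWedge_curryLeft_zero_left _ _ (by omega),
      altD_curryLeft_zero]
    rfl
  | succ q ih =>
    refine alt_ext_curryLeft fun x => ?_
    rw [altD_curryLeft, ContinuousAlternatingMap.curryLeft_smul, _root_.smul_apply]
    rcases k with _ | k <;> rcases l with _ | l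
    · omega
    · have hq₂ : 0 + l = q := by omega
      rw [altWedge_curryLeft_zero_left (l := l + 1) (q := q + 1) B h' (by omega) a (altD A) x,
        altD_curryLeft]
      have : contr x ∘ₗ wedgeLeft B h a ∘ₗ A = wedgeLeft B hq₂ a ∘ₗ (contr x ∘ₗ A) := by
        exact LinearMap.ext fun y => altWedge_curryLeft_zero_left B h hq₂ a (A y) x
      rw [this, ih (by omega) (by omega), pow_zero, one_smul, one_smul]
      exact ((wedgeLeft B h a).map_sub _ _).symm
    · have hq₁ : k + 0 = q := by omega
      rw [altWedge_curryLeft _ _ (by omega) (by omega), altD_curryLeft_zero]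
      have : contr x ∘ₗ wedgeLeft B h a ∘ₗ A = wedgeLeft B hq₁ (a.curryLeft x) ∘ₗ A := by
        exact LinearMap.ext fun y => altWedge_curryLeft_zero_right B h hq₁ a (A y) x
      rw [this, ih (by omega) (by omega), smul_add, smul_smul, ← mul_pow, pow_succ]
      simp only [LinearMap.comp_apply, wedgeLeft_apply, mul_neg, mul_one, neg_neg, one_pow,
          one_smul,
        neg_smul]
      abel
    · have hq₁ : k + (l + 1) = q := by omega
      have hq₂ : k + 1 + l = q := by omega
      rw [altWedge_curryLeft _ _ (by omega) (by omega), altD_curryLeft]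
      have : contr x ∘ₗ wedgeLeft B h a ∘ₗ A = wedgeLeft B hq₁ (a.curryLeft x) ∘ₗ A +
            (-1 : ℝ) ^ (k + 1) • wedgeLeft B hq₂ a ∘ₗ (contr x ∘ₗ A) := by
        exact LinearMap.ext fun y => altWedge_curryLeft B h hq₁ hq₂ a (A y) x
      rw [this, altD_add, altD_smul, ih (by omega) (by omega), ih (by omega) (by omega)]
      have h2 := (wedgeLeft B h a).map_sub (A x) (altD (contr x ∘ₗ A))
      simp only [wedgeLeft_apply] at h2
      rw [h2, smul_add, smul_smul, smul_smul, ← mul_pow, pow_succ (-1 : ℝ) k]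
      simp only [LinearMap.comp_apply, wedgeLeft_apply, mul_neg, mul_one, neg_neg, one_pow,
          one_smul,
        neg_smul]
      abel

end WedgeAlgebra

/-! ### Products of differential forms -/

section FormWedge

variable {E : Type*} [NormedAddCommGroup E] [NormedSpace ℝ E] [FiniteDimensional ℝ E]
  {H : Type*} [TopologicalSpace H] {I : ModelWithCorners ℝ E H} [I.Boundaryless]
  {M : Type*} [TopologicalSpace M] [ChartedSpace H M] [IsManifold I ∞ M]
  {E₂ : Type*} [NormedAddCommGroup E₂] [NormedSpace ℝ E₂] [FiniteDimensional ℝ E₂]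
  {H₂ : Type*} [TopologicalSpace H₂] {J : ModelWithCorners ℝ E₂ H₂} [J.Boundaryless]
  {N : Type*} [TopologicalSpace N] [ChartedSpace H₂ N] [IsManifold J ∞ N]
  {F₁ F₂ F₃ : Type*} [NormedAddCommGroup F₁] [NormedSpace ℝ F₁] [FiniteDimensional ℝ F₁]
  [NormedAddCommGroup F₂] [NormedSpace ℝ F₂] [FiniteDimensional ℝ F₂]
  [NormedAddCommGroup F₃] [NormedSpace ℝ F₃] [FiniteDimensional ℝ F₃]
  {B : F₁ →L[ℝ] F₂ →L[ℝ] F₃} {k l q : ℕ}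
  {X : Type*} [NormedAddCommGroup X] [NormedSpace ℝ X]

instance finiteDimensional_alt : FiniteDimensional ℝ (E [⋀^Fin q]→L[ℝ] F₁) := by
  obtain ⟨ι, _, e, L, hL⟩ := exists_alt_coeff E F₁ q
  exact Module.Finite.of_surjective L.toLinearMap fun a => ⟨_, hL a⟩

variable (B) in
/-- The exterior product as a continuous bilinear map. -/
def wedgeCLM (h : k + l = q) :
    (E [⋀^Fin k]→L[ℝ] F₁) →L[ℝ] (E [⋀^Fin l]→L[ℝ] F₂) →L[ℝ] (E [⋀^Fin q]→L[ℝ] F₃) :=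
  (LinearMap.mk₂ ℝ (altWedge B h) (altWedge_add_left B h) (altWedge_smul_left B h)
    (altWedge_add_right B h) (altWedge_smul_right B h)).toContinuousBilinearMap

theorem ContDiffAt.alt_wedge {n : WithTop ℕ∞} (h : k + l = q) {a : X → E [⋀^Fin k]→L[ℝ] F₁}
    {b : X → E [⋀^Fin l]→L[ℝ] F₂} {x : X} (ha : ContDiffAt ℝ n a x) (hb : ContDiffAt ℝ n b x) :
    ContDiffAt ℝ n (fun y => altWedge B h (a y) (b y)) x := by
  refine contDiffAt_alt_iff.2 fun v => ?_
  have h1 : (k.factorial * l.factorial : ℝ) ≠ 0 := by positivity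
  have h2 : (fun y => altWedge B h (a y) (b y) v) = fun y => (k.factorial * l.factorial : ℝ)⁻¹ •
      ∑ σ : Equiv.Perm (Fin q), Equiv.Perm.sign σ •
        B (a y fun i => v (σ (Fin.cast h (Fin.castAdd l i))))
          (b y fun i => v (σ (Fin.cast h (Fin.natAdd k i)))) := by
    funext y
    rw [← altWedge_eq_sum_perm, inv_smul_smul₀ h1]
  rw [h2]
  refine contDiffAt_const.smul (ContDiffAt.sum fun σ _ => ?_)
  have h3 : ContDiffAt ℝ n (fun y => B (a y fun i => v (σ (Fin.cast h (Fin.castAdd l i))))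
      (b y fun i => v (σ (Fin.cast h (Fin.natAdd k i))))) x :=
    ((B.contDiff.contDiffAt.comp x (contDiffAt_alt_iff.1 ha _)).clm_apply
      (contDiffAt_alt_iff.1 hb _))
  rcases Int.units_eq_one_or (Equiv.Perm.sign σ) with hσ | hσ
  · simpa [hσ] using h3
  · simpa [hσ] using h3.neg

theorem extDeriv_eq_altD (a : E → E [⋀^Fin k]→L[ℝ] F₁) (x : E) :
    extDeriv a x = altD (fderiv ℝ a x).toLinearMap := by
  ext v
  rw [altD_apply, extDeriv, ContinuousAlternatingMap.alternatizeUncurryFin_apply]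
  rfl

theorem extDeriv_altWedge (h : k + l = q) (h₁ : k + 1 + l = q + 1) (h₂ : k + (l + 1) = q + 1)
    {a : E → E [⋀^Fin k]→L[ℝ] F₁} {b : E → E [⋀^Fin l]→L[ℝ] F₂} {x : E}
    (ha : DifferentiableAt ℝ a x) (hb : DifferentiableAt ℝ b x) :
    extDeriv (fun y => altWedge B h (a y) (b y)) x =
      altWedge B h₁ (extDeriv a x) (b x) + (-1 : ℝ) ^ k • altWedge B h₂ (a x) (extDeriv b x) := by
  have h3 := (wedgeCLM (E := E) B h).hasFDerivAt_of_bilinear ha.hasFDerivAt hb.hasFDerivAt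
  rw [extDeriv_eq_altD, extDeriv_eq_altD, extDeriv_eq_altD, ← altD_wedge_right B h,
    ← altD_wedge_left B h, ← altD_add]
  congr 1
  ext1 e
  have h4 := congrArg (fun D => D e) h3.fderiv
  refine Eq.trans h4 ?_
  exact add_comm _ _

variable (B) in
/-- The exterior product of forms. -/
def wd (h : k + l = q) (a : M → E [⋀^Fin k]→L[ℝ] F₁) (b : M → E [⋀^Fin l]→L[ℝ] F₂) :
    M → E [⋀^Fin q]→L[ℝ] F₃ := fun x => altWedge B h (a x) (b x)

theorem pb_wd (h : k + l = q) (f : M → N) (a : N → E₂ [⋀^Fin k]→L[ℝ] F₁)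
    (b : N → E₂ [⋀^Fin l]→L[ℝ] F₂) :
    pb I J f (wd B h a b) = wd B h (pb I J f a) (pb I J f b) :=
  funext fun x => (altWedge_comp B h (a (f x)) (b (f x)) (tmap I J f x)).symm

theorem SmoothFormAt.wd (h : k + l = q) {a : M → E [⋀^Fin k]→L[ℝ] F₁}
    {b : M → E [⋀^Fin l]→L[ℝ] F₂} {x : M} (ha : SmoothFormAt I a x) (hb : SmoothFormAt I b x) :
    SmoothFormAt I (wd B h a b) x := by
  unfold SmoothFormAt chartForm at *
  rw [pb_wd]
  exact ha.alt_wedge h hb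

theorem chartForm_comp_tmap (c : M → E [⋀^Fin q]→L[ℝ] F₁) (x : M) :
    (chartForm I c x (extChartAt I x x)).compContinuousLinearMap
      (tmap I 𝓘(ℝ, E) (extChartAt I x) x) = c x := by
  have h1 : MDifferentiableAt I 𝓘(ℝ, E) (extChartAt I x) x :=
    (contMDiffAt_extChartAt (n := ∞)).mdifferentiableAt (by simp)
  have h2 : MDifferentiableAt 𝓘(ℝ, E) I (extChartAt I x).symm (extChartAt I x x) :=
    (contMDiffAt_extChartAt_symm (mem_extChartAt_target x)).mdifferentiableAt (by simp)
  have h3 : tmap I I (fun z => (extChartAt I x).symm (extChartAt I x z)) x =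
      ContinuousLinearMap.id ℝ E := by
    rw [← tmap_id (I := I) x]
    refine tmap_congr ?_
    filter_upwards [extChartAt_source_mem_nhds (I := I) x] with z hz
    exact (extChartAt I x).left_inv hz
  rw [tmap_comp' h2 h1] at h3
  simp only [chartForm, pb, extChartAt_to_inv]
  ext v
  have h4 : ∀ e : E, tmap 𝓘(ℝ, E) I (extChartAt I x).symm (extChartAt I x x)
      (tmap I 𝓘(ℝ, E) (extChartAt I x) x e) = e := fun e => congrArg (fun D => D e) h3
  simp only [ContinuousAlternatingMap.compContinuousLinearMap_apply, Function.comp_def, h4]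

/-- The Leibniz rule for the exterior derivative. -/
theorem ed_wd (h : k + l = q) (h₁ : k + 1 + l = q + 1) (h₂ : k + (l + 1) = q + 1)
    {a : M → E [⋀^Fin k]→L[ℝ] F₁} {b : M → E [⋀^Fin l]→L[ℝ] F₂} {x : M}
    (ha : SmoothFormAt I a x) (hb : SmoothFormAt I b x) :
    ed I (wd B h a b) x =
      wd B h₁ (ed I a) b x + (-1 : ℝ) ^ k • wd B h₂ a (ed I b) x := by
  have h3 := extDeriv_altWedge (B := B) h h₁ h₂ (ContDiffAt.differentiableAt ha (by simp))
    (ContDiffAt.differentiableAt hb (by simp))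
  have h4 : chartForm I (wd B h a b) x =
      fun y => altWedge B h (chartForm I a x y) (chartForm I b x y) := pb_wd h _ a b
  rw [ed_apply, h4, h3]
  have h5 := altWedge_comp B h₁ (extDeriv (chartForm I a x) (extChartAt I x x))
    (chartForm I b x (extChartAt I x x)) (tmap I 𝓘(ℝ, E) (extChartAt I x) x)
  have h6 := altWedge_comp B h₂ (chartForm I a x (extChartAt I x x))
    (extDeriv (chartForm I b x) (extChartAt I x x)) (tmap I 𝓘(ℝ, E) (extChartAt I x) x)
  rw [chartForm_comp_tmap, ← ed_apply] at h5 h6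
  simp only [wd]
  rw [h5, h6]
  rfl

/-- The action of a linear map on the coefficients of a form. -/
def mc (A : F₁ →L[ℝ] F₂) (a : M → E [⋀^Fin k]→L[ℝ] F₁) : M → E [⋀^Fin k]→L[ℝ] F₂ := fun x =>
  A.compContinuousAlternatingMap (a x)

theorem contDiffAt_comp_alt {n : WithTop ℕ∞} {A : X → F₁ →L[ℝ] F₂} {a : X → E [⋀^Fin k]→L[ℝ] F₁}
    {x : X} (hA : ContDiffAt ℝ n A x) (ha : ContDiffAt ℝ n a x) :
    ContDiffAt ℝ n (fun y => (A y).compContinuousAlternatingMap (a y)) x :=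
  contDiffAt_alt_iff.2 fun v => hA.clm_apply (contDiffAt_alt_iff.1 ha v)

theorem SmoothFormAt.mc {a : M → E [⋀^Fin k]→L[ℝ] F₁} {x : M} (ha : SmoothFormAt I a x)
    (A : F₁ →L[ℝ] F₂) : SmoothFormAt I (mc A a) x :=
  contDiffAt_comp_alt contDiffAt_const ha

theorem ed_mc {a : M → E [⋀^Fin k]→L[ℝ] F₁} {x : M} (ha : SmoothFormAt I a x) (A : F₁ →L[ℝ] F₂) :
    ed I (mc A a) x = mc A (ed I a) x := by
  have hd : DifferentiableAt ℝ (chartForm I a x) (extChartAt I x x) :=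
    ContDiffAt.differentiableAt ha (by simp)
  have hd' : DifferentiableAt ℝ (chartForm I (mc A a) x) (extChartAt I x x) :=
    ContDiffAt.differentiableAt (ha.mc A) (by simp)
  ext v
  change ed I (mc A a) x v = A (ed I a x v)
  rw [ed_apply, ed_apply]
  simp only [ContinuousAlternatingMap.compContinuousLinearMap_apply]
  rw [extDeriv_apply hd, extDeriv_apply hd', map_sum]
  refine Finset.sum_congr rfl fun i _ => ?_
  rw [map_zsmul]
  congr 1
  have h1 : DifferentiableAt ℝ (fun y => chartForm I a x y (i.removeNth fun j =>
      tmap I 𝓘(ℝ, E) (extChartAt I x) x (v j))) (extChartAt I x x) :=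
    ((contDiffAt_alt_iff.1 ha) _).differentiableAt (by simp)
  exact congrArg (fun D : E →L[ℝ] F₂ => D (tmap I 𝓘(ℝ, E) (extChartAt I x) x (v i)))
    (A.hasFDerivAt.comp _ h1.hasFDerivAt).fderiv

theorem SmoothFormAt.add {a b : M → E [⋀^Fin k]→L[ℝ] F₁} {x : M} (ha : SmoothFormAt I a x)
    (hb : SmoothFormAt I b x) : SmoothFormAt I (a + b) x :=
  ContDiffAt.add ha hb

theorem SmoothFormAt.smul {a : M → E [⋀^Fin k]→L[ℝ] F₁} {x : M} (ha : SmoothFormAt I a x)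
    (c : ℝ) : SmoothFormAt I (c • a) x :=
  ContDiffAt.const_smul c ha

theorem SmoothFormAt.zero (x : M) : SmoothFormAt I (0 : M → E [⋀^Fin k]→L[ℝ] F₁) x :=
  contDiffAt_const (c := 0)

theorem SmoothFormAt.sum {ι : Type*} {s : Finset ι} {a : ι → M → E [⋀^Fin k]→L[ℝ] F₁} {x : M}
    (ha : ∀ i ∈ s, SmoothFormAt I (a i) x) : SmoothFormAt I (∑ i ∈ s, a i) x := by
  classical
  induction s using Finset.induction_on with
  | empty => exact SmoothFormAt.zero x
  | insert i s hi ih =>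
    rw [Finset.sum_insert hi]
    exact (ha i (Finset.mem_insert_self _ _)).add
      (ih fun j hj => ha j (Finset.mem_insert_of_mem hj))

theorem ed_add {a b : M → E [⋀^Fin k]→L[ℝ] F₁} {x : M} (ha : SmoothFormAt I a x)
    (hb : SmoothFormAt I b x) : ed I (a + b) x = ed I a x + ed I b x := by
  rw [ed_apply, ed_apply, ed_apply]
  have h := extDeriv_add (ContDiffAt.differentiableAt ha (by simp))
    (ContDiffAt.differentiableAt hb (by simp))
  exact congrArg (fun c => c.compContinuousLinearMap (tmap I 𝓘(ℝ, E) (extChartAt I x) x)) h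

theorem ed_smul (a : M → E [⋀^Fin k]→L[ℝ] F₁) (x : M) (c : ℝ) :
    ed I (c • a) x = c • ed I a x := by
  rw [ed_apply, ed_apply]
  have h : extDeriv (chartForm I (c • a) x) (extChartAt I x x) =
      c • extDeriv (chartForm I a x) (extChartAt I x x) := extDeriv_smul c (chartForm I a x)
  rw [h]
  rfl

theorem ed_zero : ed I (0 : M → E [⋀^Fin k]→L[ℝ] F₁) = 0 := by
  funext x
  have := ed_smul (I := I) (0 : M → E [⋀^Fin k]→L[ℝ] F₁) x 0
  simpa using this

theorem ed_sum {ι : Type*} {s : Finset ι} {a : ι → M → E [⋀^Fin k]→L[ℝ] F₁} {x : M}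
    (ha : ∀ i ∈ s, SmoothFormAt I (a i) x) : ed I (∑ i ∈ s, a i) x = ∑ i ∈ s, ed I (a i) x := by
  classical
  induction s using Finset.induction_on with
  | empty => exact congrFun (ed_zero (I := I) (M := M) (F₁ := F₁) (k := k)) x
  | insert i s hi ih =>
    have h1 : ∀ j ∈ s, SmoothFormAt I (a j) x := fun j hj => ha j (Finset.mem_insert_of_mem hj)
    have h2 : SmoothFormAt I (∑ j ∈ s, a j) x := SmoothFormAt.sum h1
    rw [Finset.sum_insert hi, Finset.sum_insert hi, ← ih h1]
    exact ed_add (ha i (Finset.mem_insert_self _ _)) h2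

end FormWedge

/-! ### The Maurer-Cartan form and the adjoint action -/

section Charts

variable {E : Type*} [NormedAddCommGroup E] [NormedSpace ℝ E]
  {H : Type*} [TopologicalSpace H] {I : ModelWithCorners ℝ E H} [I.Boundaryless]
  {M : Type*} [TopologicalSpace M] [ChartedSpace H M]
  {E₂ : Type*} [NormedAddCommGroup E₂] [NormedSpace ℝ E₂]
  {H₂ : Type*} [TopologicalSpace H₂] {J : ModelWithCorners ℝ E₂ H₂} [J.Boundaryless]
  {N : Type*} [TopologicalSpace N] [ChartedSpace H₂ N]

theorem tmap_eq_fderiv_charts {f : M → N} {x : M} (hf : MDifferentiableAt I J f x) :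
    tmap I J f x = fderiv ℝ (fun y => extChartAt J (f x) (f ((extChartAt I x).symm y)))
      (extChartAt I x x) := by
  have h := hf.mfderiv
  rw [I.range_eq_univ, fderivWithin_univ] at h
  exact h

theorem tmap_vec {u : E → N} {y : E} (hu : MDifferentiableAt 𝓘(ℝ, E) J u y) :
    tmap 𝓘(ℝ, E) J u y = fderiv ℝ (fun z => extChartAt J (u y) (u z)) y := by
  have := tmap_eq_fderiv_charts hu
  simp only [extChartAt_model_space_eq_id] at this
  exact this

theorem tmap_extChartAt_self [IsManifold I ∞ M] (x : M) :
    tmap I 𝓘(ℝ, E) (extChartAt I x) x = ContinuousLinearMap.id ℝ E := by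
  have h1 : MDifferentiableAt I 𝓘(ℝ, E) (extChartAt I x) x :=
    (contMDiffAt_extChartAt (n := ∞)).mdifferentiableAt (by simp)
  rw [tmap_eq_fderiv_charts h1]
  have : (fun y => extChartAt 𝓘(ℝ, E) (extChartAt I x x)
      (extChartAt I x ((extChartAt I x).symm y))) =ᶠ[𝓝 (extChartAt I x x)] id := by
    filter_upwards [extChartAt_target_mem_nhds (I := I) x] with y hy
    rw [(extChartAt I x).right_inv hy, extChartAt_model_space_eq_id]
    rfl
  rw [this.fderiv_eq, fderiv_id]

theorem tmap_extChartAt_symm_self [IsManifold I ∞ M] (x : M) :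
    tmap 𝓘(ℝ, E) I (extChartAt I x).symm (extChartAt I x x) = ContinuousLinearMap.id ℝ E := by
  have h1 : MDifferentiableAt 𝓘(ℝ, E) I (extChartAt I x).symm (extChartAt I x x) :=
    ((contMDiffOn_extChartAt_symm (I := I) (n := ∞) x).contMDiffAt
      (extChartAt_target_mem_nhds' (I := I) (mem_extChartAt_target x))).mdifferentiableAt (by simp)
  rw [tmap_vec h1]
  have : (fun z => extChartAt I ((extChartAt I x).symm (extChartAt I x x))
      ((extChartAt I x).symm z)) =ᶠ[𝓝 (extChartAt I x x)] id := by
    rw [extChartAt_to_inv]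
    filter_upwards [extChartAt_target_mem_nhds (I := I) x] with y hy
    exact (extChartAt I x).right_inv hy
  rw [this.fderiv_eq, fderiv_id]

end Charts

section LieGroups

variable {E : Type v} [NormedAddCommGroup E] [NormedSpace ℝ E] [FiniteDimensional ℝ E]
  {G : Type w} [TopologicalSpace G] [ChartedSpace E G] [Group G] [LieGroup 𝓘(ℝ, E) ∞ G]

variable (E) in
/-- Left translation as used for the Maurer-Cartan form is smooth. -/
theorem contMDiff_left (a : G) : ContMDiff 𝓘(ℝ, E) 𝓘(ℝ, E) ∞ (fun h : G => a * h) :=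
  contMDiff_mul_left

variable (E) in
theorem mdiff_left (a h : G) : MDifferentiableAt 𝓘(ℝ, E) 𝓘(ℝ, E) (fun h : G => a * h) h :=
  (contMDiff_left E a).mdifferentiableAt (by simp)

variable (E) in
/-- The Maurer-Cartan form, as a linear map of the model space. -/
def mcf (g : G) : E →L[ℝ] E := tmap 𝓘(ℝ, E) 𝓘(ℝ, E) (fun h : G => g⁻¹ * h) g

variable (E) in
/-- The adjoint action. -/
def Ad (g : G) : E →L[ℝ] E := tmap 𝓘(ℝ, E) 𝓘(ℝ, E) (fun h : G => g * h * g⁻¹) 1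

variable (E) in
theorem contMDiff_two_sided (a b : G) :
    ContMDiff 𝓘(ℝ, E) 𝓘(ℝ, E) ∞ (fun h : G => a * h * b) :=
  (contMDiff_mul_right (I := 𝓘(ℝ, E)) (n := ∞) (a := b)).comp (contMDiff_left E a)

variable (E) in
theorem mdiff_two_sided (a b h : G) :
    MDifferentiableAt 𝓘(ℝ, E) 𝓘(ℝ, E) (fun h : G => a * h * b) h :=
  (contMDiff_two_sided E a b).mdifferentiableAt (by simp)

theorem mcf_one : mcf E (1 : G) = ContinuousLinearMap.id ℝ E := by
  have : (fun h : G => 1⁻¹ * h) = id := by funext h; simp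
  rw [mcf, this, tmap_id]

theorem Ad_one : Ad E (1 : G) = ContinuousLinearMap.id ℝ E := by
  have : (fun h : G => 1 * h * 1⁻¹) = id := by funext h; simp
  rw [Ad, this, tmap_id]

/-- For maps `f` into `G`, the value of the Maurer-Cartan form on the velocity of `f` at `x` is the
velocity of `f x⁻¹ * f`. -/
theorem mcf_comp_tmap {E₂ : Type*} [NormedAddCommGroup E₂] [NormedSpace ℝ E₂]
    {H₂ : Type*} [TopologicalSpace H₂] {J : ModelWithCorners ℝ E₂ H₂}
    {N : Type*} [TopologicalSpace N] [ChartedSpace H₂ N] {f : N → G} {x : N}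
    (hf : MDifferentiableAt J 𝓘(ℝ, E) f x) :
    (mcf E (f x)).comp (tmap J 𝓘(ℝ, E) f x) =
      tmap J 𝓘(ℝ, E) (fun y => (f x)⁻¹ * f y) x :=
  (tmap_comp' (mdiff_left E _ _) hf).symm

theorem mcf_two_sided (a b h : G) :
    (mcf E (a * h * b⁻¹)).comp (tmap 𝓘(ℝ, E) 𝓘(ℝ, E) (fun h : G => a * h * b⁻¹) h) =
      (Ad E b).comp (mcf E h) := by
  rw [mcf_comp_tmap (f := fun h : G => a * h * b⁻¹) (mdiff_two_sided E _ _ _)]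
  have : (fun y : G => (a * h * b⁻¹)⁻¹ * (a * y * b⁻¹)) =
      fun y => (fun z => b * z * b⁻¹) ((fun y => h⁻¹ * y) y) := by
    funext y; simp only; group
  rw [this, tmap_comp' (mdiff_two_sided E _ _ _) (mdiff_left E _ _), inv_mul_cancel]
  rfl

theorem mcf_left (a h : G) :
    (mcf E (a * h)).comp (tmap 𝓘(ℝ, E) 𝓘(ℝ, E) (fun h : G => a * h) h) = mcf E h := by
  rw [mcf_comp_tmap (f := fun h : G => a * h) (mdiff_left E _ _)]
  have : (fun y : G => (a * h)⁻¹ * (a * y)) = fun y => h⁻¹ * y := by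
    funext y; group
  rw [this]
  rfl

theorem Ad_mul (a b : G) : Ad E (a * b) = (Ad E a).comp (Ad E b) := by
  have : (fun h : G => a * b * h * (a * b)⁻¹) =
      fun y => (fun z => a * z * a⁻¹) ((fun y => b * y * b⁻¹) y) := by
    funext y; simp only; group
  rw [Ad, this, tmap_comp' (mdiff_two_sided E _ _ _) (mdiff_two_sided E _ _ _)]
  simp only [mul_one, mul_inv_cancel]
  rfl

/-- The Maurer-Cartan form of a product of maps into the group. -/
theorem mcf_mul_tmap {E₂ : Type*} [NormedAddCommGroup E₂] [NormedSpace ℝ E₂]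
    {H₂ : Type*} [TopologicalSpace H₂] {J : ModelWithCorners ℝ E₂ H₂}
    {N : Type*} [TopologicalSpace N] [ChartedSpace H₂ N] {f₁ f₂ : N → G} {x : N}
    (hf₁ : MDifferentiableAt J 𝓘(ℝ, E) f₁ x) (hf₂ : MDifferentiableAt J 𝓘(ℝ, E) f₂ x) :
    (mcf E (f₁ x * f₂ x)).comp (tmap J 𝓘(ℝ, E) (fun y => f₁ y * f₂ y) x) =
      (Ad E (f₂ x)⁻¹).comp ((mcf E (f₁ x)).comp (tmap J 𝓘(ℝ, E) f₁ x)) +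
        (mcf E (f₂ x)).comp (tmap J 𝓘(ℝ, E) f₂ x) := by
  have hp : MDifferentiableAt (𝓘(ℝ, E).prod 𝓘(ℝ, E)) 𝓘(ℝ, E) (fun z : G × G => z.1 * z.2)
      (f₁ x, f₂ x) := (contMDiff_mul 𝓘(ℝ, E) ∞).mdifferentiableAt (by simp)
  have h1 : tmap J 𝓘(ℝ, E) (fun y => f₁ y * f₂ y) x =
      (tmap 𝓘(ℝ, E) 𝓘(ℝ, E) (fun z : G => z * f₂ x) (f₁ x)).comp (tmap J 𝓘(ℝ, E) f₁ x) +
      (tmap 𝓘(ℝ, E) 𝓘(ℝ, E) (fun z : G => f₁ x * z) (f₂ x)).comp (tmap J 𝓘(ℝ, E) f₂ x) := by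
    have h2 := tmap_comp' (f := fun y => (f₁ y, f₂ y)) hp (hf₁.prodMk hf₂)
    rw [h2]
    ext v
    have h3 := mfderiv_prod_eq_add_apply hp (v := (tmap J (𝓘(ℝ, E).prod 𝓘(ℝ, E))
      (fun y => (f₁ y, f₂ y)) x v))
    refine h3.trans ?_
    have h4 := congrArg (fun D => D v) (mfderiv_prodMk hf₁ hf₂)
    change tmap J (𝓘(ℝ, E).prod 𝓘(ℝ, E)) (fun y => (f₁ y, f₂ y)) x v =
      (tmap J 𝓘(ℝ, E) f₁ x v, tmap J 𝓘(ℝ, E) f₂ x v) at h4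
    rw [h4]
    rfl
  rw [h1, ContinuousLinearMap.comp_add]
  congr 1
  · have := mcf_two_sided (E := E) (G := G) 1 (f₂ x)⁻¹ (f₁ x)
    simp only [one_mul, inv_inv] at this
    rw [← ContinuousLinearMap.comp_assoc, this]
    rfl
  · rw [← ContinuousLinearMap.comp_assoc, mcf_left]

end LieGroups

section LieGroups

variable {E : Type v} [NormedAddCommGroup E] [NormedSpace ℝ E] [FiniteDimensional ℝ E]
  {G : Type w} [TopologicalSpace G] [ChartedSpace E G] [Group G] [LieGroup 𝓘(ℝ, E) ∞ G]

variable (E) in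
/-- The inverse of the chart at `x`, as a parametrization of a neighborhood of `x`. -/
abbrev par (x : G) (y : E) : G := (extChartAt 𝓘(ℝ, E) x).symm y

variable (E) in
/-- The chart at `x`. -/
abbrev cha (x g : G) : E := extChartAt 𝓘(ℝ, E) x g

theorem par_cha (x : G) : par E x (cha E x x) = x := extChartAt_to_inv x

theorem contMDiffAt_par (x : G) : ContMDiffAt 𝓘(ℝ, E) 𝓘(ℝ, E) ∞ (par E x) (cha E x x) :=
  contMDiffAt_extChartAt_symm (mem_extChartAt_target x)

theorem eventually_contMDiffAt_par (x : G) :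
    ∀ᶠ y in 𝓝 (cha E x x), ContMDiffAt 𝓘(ℝ, E) 𝓘(ℝ, E) ∞ (par E x) y := by
  filter_upwards [extChartAt_target_mem_nhds (I := 𝓘(ℝ, E)) x] with y hy
  exact contMDiffAt_extChartAt_symm hy

/-- Smooth maps from a vector space are smooth in charts. -/
theorem ContMDiffAt.contDiffAt_cha {X : Type*} [NormedAddCommGroup X] [NormedSpace ℝ X]
    {u : X → G} {z : X} {x : G} (hu : ContMDiffAt 𝓘(ℝ, X) 𝓘(ℝ, E) ∞ u z) (hx : u z = x) :
    ContDiffAt ℝ ∞ (fun z => cha E x (u z)) z := by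
  subst hx
  exact (contMDiffAt_iff_contDiffAt).1
    ((contMDiffAt_extChartAt' (n := ∞) (I := 𝓘(ℝ, E)) (mem_chart_source E (u z))).comp z hu)

theorem contMDiffAt_par_fst (x : G) (b : E) : ContMDiffAt 𝓘(ℝ, E × E) 𝓘(ℝ, E) ∞
    (fun z : E × E => par E x z.1) (cha E x x, b) :=
  ContMDiffAt.comp_of_eq (contMDiffAt_par x) (contMDiffAt_iff_contDiffAt.2 contDiffAt_fst) rfl

theorem contMDiffAt_par_snd (x : G) (b : E) : ContMDiffAt 𝓘(ℝ, E × E) 𝓘(ℝ, E) ∞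
    (fun z : E × E => par E x z.2) (b, cha E x x) :=
  ContMDiffAt.comp_of_eq (contMDiffAt_par x) (contMDiffAt_iff_contDiffAt.2 contDiffAt_snd) rfl

/-- The Maurer-Cartan form is smooth. -/
theorem contDiffAt_mcf (x : G) : ContDiffAt ℝ ∞
    (fun y => (mcf E (par E x y)).comp (tmap 𝓘(ℝ, E) 𝓘(ℝ, E) (par E x) y)) (cha E x x) := by
  have h1 : ContDiffAt ℝ ∞ (fun z : E × E => cha E (1 : G) ((par E x z.1)⁻¹ * par E x z.2))
      (cha E x x, cha E x x) := by
    refine ContMDiffAt.contDiffAt_cha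
      (u := fun z : E × E => (par E x z.1)⁻¹ * par E x z.2) ?_ (by simp)
    exact (contMDiffAt_par_fst x _).inv.mul (contMDiffAt_par_snd x _)
  have h2 := ContDiffAt.fderiv (f := fun y y' => cha E (1 : G) ((par E x y)⁻¹ * par E x y'))
    (g := fun y => y) (x₀ := cha E x x) (m := ∞) h1 contDiffAt_id (by simp)
  refine h2.congr_of_eventuallyEq ?_
  filter_upwards [eventually_contMDiffAt_par x] with y hy
  have hy' := hy.mdifferentiableAt (by simp)
  have hc : MDifferentiableAt 𝓘(ℝ, E) 𝓘(ℝ, E) (fun y' => (par E x y)⁻¹ * par E x y') y :=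
    (mdiff_left E _ _).comp y hy'
  rw [mcf_comp_tmap hy', tmap_vec hc, inv_mul_cancel]

variable (E G) in
/-- The chart coordinate of the identity. -/
abbrev cen : E := cha E (1 : G) (1 : G)

theorem par_cen : par E (1 : G) (cen E G) = 1 := par_cha 1

theorem cha_par_eventually : ∀ᶠ a in 𝓝 (cen E G), cha E (1 : G) (par E (1 : G) a) = a := by
  filter_upwards [extChartAt_target_mem_nhds (I := 𝓘(ℝ, E)) (1 : G)] with y hy
  exact (extChartAt 𝓘(ℝ, E) (1 : G)).right_inv hy

variable (E G) in
/-- The multiplication of `G` in the chart at the identity. -/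
def mulChart (z : E × E) : E := cha E (1 : G) (par E (1 : G) z.1 * par E (1 : G) z.2)

variable (E G) in
/-- Conjugation in the chart at the identity. -/
def conjChart (z : E × E) : E :=
  cha E (1 : G) (par E (1 : G) z.1 * par E (1 : G) z.2 * (par E (1 : G) z.1)⁻¹)

theorem contDiffAt_mulChart : ContDiffAt ℝ ∞ (mulChart E G) (cen E G, cen E G) :=
  ContMDiffAt.contDiffAt_cha (u := fun z : E × E => par E (1 : G) z.1 * par E (1 : G) z.2)
    ((contMDiffAt_par_fst 1 _).mul (contMDiffAt_par_snd 1 _)) (by simp)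

theorem contMDiffAt_conj : ContMDiffAt 𝓘(ℝ, E × E) 𝓘(ℝ, E) ∞
    (fun z : E × E => par E (1 : G) z.1 * par E (1 : G) z.2 * (par E (1 : G) z.1)⁻¹)
    (cen E G, cen E G) :=
  ((contMDiffAt_par_fst 1 _).mul (contMDiffAt_par_snd 1 _)).mul (contMDiffAt_par_fst 1 _).inv

theorem contDiffAt_conjChart : ContDiffAt ℝ ∞ (conjChart E G) (cen E G, cen E G) :=
  ContMDiffAt.contDiffAt_cha contMDiffAt_conj (by simp)

theorem Ad_eq_fderiv (g : G) :
    Ad E g = fderiv ℝ (fun b => cha E (1 : G) (g * par E (1 : G) b * g⁻¹)) (cen E G) := by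
  have h := tmap_eq_fderiv_charts (mdiff_two_sided E g g⁻¹ (1 : G))
  simp only [mul_one, mul_inv_cancel] at h
  exact h

theorem contDiffAt_Ad_par :
    ContDiffAt ℝ ∞ (fun a => Ad E (par E (1 : G) a)) (cen E G) := by
  have h2 := ContDiffAt.fderiv (f := fun a b => conjChart E G (a, b))
    (g := fun _ => cen E G) (x₀ := cen E G) (m := ∞) (n := ∞)
    contDiffAt_conjChart contDiffAt_const (by simp)
  refine h2.congr_of_eventuallyEq (.of_forall fun a => ?_)
  exact Ad_eq_fderiv _

theorem eventually_differentiableAt_mulChart :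
    ∀ᶠ z in 𝓝 (cen E G, cen E G), DifferentiableAt ℝ (mulChart E G) z := by
  have := (contDiffAt_mulChart (E := E) (G := G)).of_le (m := 1) (by simp)
  filter_upwards [this.eventually (by simp)] with z hz
  exact hz.differentiableAt (by simp)

/-- The derivative at the identity of the relation `(a * b * a⁻¹) * a = a * b`, in the variable
`b`. -/
theorem mulChart_Ad (w : E) : ∀ᶠ a in 𝓝 (cen E G),
    fderiv ℝ (mulChart E G) (cen E G, a) (Ad E (par E (1 : G) a) w, 0) =
      fderiv ℝ (mulChart E G) (a, cen E G) (0, w) := by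
  have h1 : ∀ᶠ z in 𝓝 (cen E G, cen E G), mulChart E G (conjChart E G z, z.1) =
      mulChart E G z := by
    have h := (contMDiffAt_conj (E := E) (G := G)).continuousAt.eventually_mem
      (s := (extChartAt 𝓘(ℝ, E) (1 : G)).source) (by
        simpa using extChartAt_source_mem_nhds (I := 𝓘(ℝ, E)) (1 : G))
    filter_upwards [h] with z hz
    have h2 : par E (1 : G) (conjChart E G z) = _ := (extChartAt 𝓘(ℝ, E) (1 : G)).left_inv hz
    simp only [mulChart, h2, inv_mul_cancel_right]
  have hc : ∀ᶠ z in 𝓝 (cen E G, cen E G), DifferentiableAt ℝ (conjChart E G) z := by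
    have := (contDiffAt_conjChart (E := E) (G := G)).of_le (m := 1) (by simp)
    filter_upwards [this.eventually (by simp)] with z hz
    exact hz.differentiableAt (by simp)
  have hm1 : ∀ᶠ a in 𝓝 (cen E G), DifferentiableAt ℝ (mulChart E G) (cen E G, a) :=
    (Continuous.prodMk_right (cen E G)).continuousAt.eventually
      eventually_differentiableAt_mulChart
  have hm2 : ∀ᶠ a in 𝓝 (cen E G), DifferentiableAt ℝ (mulChart E G) (a, cen E G) :=
    (Continuous.prodMk_left (cen E G)).continuousAt.eventually
      eventually_differentiableAt_mulChart
  have hc2 : ∀ᶠ a in 𝓝 (cen E G), DifferentiableAt ℝ (conjChart E G) (a, cen E G) :=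
    (Continuous.prodMk_left (cen E G)).continuousAt.eventually hc
  filter_upwards [h1.curry_nhds, hm1, hm2, hc2] with a ha hma hmb hca
  have hi : HasFDerivAt (fun b : E => (a, b)) (ContinuousLinearMap.inr ℝ E E) (cen E G) :=
    hasFDerivAt_prodMk_right a _
  have hcc : conjChart E G (a, cen E G) = cen E G := by simp [conjChart]
  have hA : Ad E (par E (1 : G) a) =
      (fderiv ℝ (conjChart E G) (a, cen E G)).comp (ContinuousLinearMap.inr ℝ E E) := by
    rw [Ad_eq_fderiv]
    exact (hca.hasFDerivAt.comp _ hi).fderiv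
  have hL : HasFDerivAt (fun b => mulChart E G (conjChart E G (a, b), a))
      ((fderiv ℝ (mulChart E G) (cen E G, a)).comp ((Ad E (par E (1 : G) a)).prod 0))
      (cen E G) := by
    have h3 : HasFDerivAt (fun b => (conjChart E G (a, b), a))
        ((Ad E (par E (1 : G) a)).prod (0 : E →L[ℝ] E)) (cen E G) := by
      rw [hA]
      exact (hca.hasFDerivAt.comp _ hi).prodMk (hasFDerivAt_const a _)
    have h5 : HasFDerivAt (mulChart E G) (fderiv ℝ (mulChart E G) (cen E G, a))
        (conjChart E G (a, cen E G), a) := by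
      rw [hcc]
      exact hma.hasFDerivAt
    exact HasFDerivAt.comp (g := mulChart E G) (f := fun b => (conjChart E G (a, b), a))
      (cen E G) h5 h3
  have hR := (hmb.hasFDerivAt.comp _ hi)
  have h4 := (hL.congr_of_eventuallyEq (f₁ := fun b => mulChart E G (a, b))
    (by filter_upwards [ha] with b hb; exact hb.symm)).unique hR
  exact congrArg (fun D : E →L[ℝ] E => D w) h4

theorem fderiv_mulChart_inl (z : E) :
    fderiv ℝ (mulChart E G) (cen E G, cen E G) (z, 0) = z := by
  have h1 := (contDiffAt_mulChart (E := E) (G := G)).differentiableAt (by simp)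
  have h2 := HasFDerivAt.comp (g := mulChart E G) (f := fun b => (b, cen E G)) (cen E G)
    h1.hasFDerivAt (hasFDerivAt_prodMk_left (𝕜 := ℝ) (cen E G) (cen E G))
  have h3 : (fun b => mulChart E G (b, cen E G)) =ᶠ[𝓝 (cen E G)] id := by
    filter_upwards [cha_par_eventually (E := E) (G := G)] with a ha
    simp only [mulChart, par_cen, mul_one, id, ha]
  have h4 := ((hasFDerivAt_id (𝕜 := ℝ) (cen E G)).congr_of_eventuallyEq h3).unique h2
  exact (congrArg (fun D : E →L[ℝ] E => D z) h4).symm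

/-- The derivative of the adjoint action at the identity, in the chart. -/
theorem fderiv_Ad_par (v w : E) :
    fderiv ℝ (fun a => Ad E (par E (1 : G) a)) (cen E G) v w =
      fderiv ℝ (fderiv ℝ (mulChart E G)) (cen E G, cen E G) (v, 0) (0, w) -
        fderiv ℝ (fderiv ℝ (mulChart E G)) (cen E G, cen E G) (w, 0) (0, v) := by
  have hD : DifferentiableAt ℝ (fderiv ℝ (mulChart E G)) (cen E G, cen E G) :=
    ((contDiffAt_mulChart (E := E) (G := G)).fderiv_right (m := ∞) (by simp)).differentiableAt
      (by simp)
  have hA : HasFDerivAt (fun a => Ad E (par E (1 : G) a)) _ (cen E G) :=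
    (contDiffAt_Ad_par.differentiableAt (by simp)).hasFDerivAt
  have hAw := hA.clm_apply (hasFDerivAt_const w (cen E G))
  have h1 := (HasFDerivAt.comp (g := fderiv ℝ (mulChart E G)) (f := fun b => (cen E G, b))
    (cen E G) hD.hasFDerivAt (hasFDerivAt_prodMk_right (𝕜 := ℝ) (cen E G) (cen E G))).clm_apply
      (hAw.prodMk (hasFDerivAt_const (0 : E) (cen E G)))
  have h2 := (HasFDerivAt.comp (g := fderiv ℝ (mulChart E G)) (f := fun b => (b, cen E G))
    (cen E G) hD.hasFDerivAt (hasFDerivAt_prodMk_left (𝕜 := ℝ) (cen E G) (cen E G))).clm_apply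
      (hasFDerivAt_const ((0 : E), w) (cen E G))
  have h3 := (h1.congr_of_eventuallyEq (f₁ := fun a =>
    fderiv ℝ (mulChart E G) (a, cen E G) (0, w)) (by
      filter_upwards [mulChart_Ad (E := E) (G := G) w] with a ha
      exact ha.symm)).unique h2
  have h4 := congrArg (fun D : E →L[ℝ] E => D v) h3
  have hs : IsSymmSndFDerivAt ℝ (mulChart E G) (cen E G, cen E G) :=
    (contDiffAt_mulChart (E := E) (G := G)).isSymmSndFDerivAt two_le_infty
  have h5 := hs.eq (0, v) (w, 0)
  simp [Ad_one, fderiv_mulChart_inl, h5] at h4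
  rw [← h4]
  abel

end LieGroups

/-! ### The adjoint action and the bracket -/

section LieGroups

variable {E : Type v} [NormedAddCommGroup E] [NormedSpace ℝ E] [FiniteDimensional ℝ E]
  {G : Type w} [TopologicalSpace G] [ChartedSpace E G] [Group G] [LieGroup 𝓘(ℝ, E) ∞ G]
  {U : Type*} [NormedAddCommGroup U] [NormedSpace ℝ U]

/-- The left invariant vector field with value `v` at the identity, in the chart. -/
theorem mpullbackWithin_mulInvariantVectorField (v : E) :
    ∀ᶠ y in 𝓝 (cen E G), VectorField.mpullbackWithin 𝓘(ℝ, E) 𝓘(ℝ, E) (par E (1 : G))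
      (mulInvariantVectorField (I := 𝓘(ℝ, E)) (G := G) v) Set.univ y =
        fderiv ℝ (mulChart E G) (y, cen E G) (0, v) := by
  have hm : ∀ᶠ a in 𝓝 (cen E G), DifferentiableAt ℝ (mulChart E G) (a, cen E G) :=
    (Continuous.prodMk_left (cen E G)).continuousAt.eventually
      eventually_differentiableAt_mulChart
  filter_upwards [eventually_contMDiffAt_par (E := E) (1 : G), hm,
    (extChartAt_target_mem_nhds (I := 𝓘(ℝ, E)) (1 : G)),
    (cha_par_eventually (E := E) (G := G)).eventually_nhds] with y hy hmy hyt hyy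
  have hy1 := hy.mdifferentiableAt (by simp)
  have hs : par E (1 : G) y ∈ (extChartAt 𝓘(ℝ, E) (1 : G)).source :=
    (extChartAt 𝓘(ℝ, E) (1 : G)).map_target hyt
  have hch : MDifferentiableAt 𝓘(ℝ, E) 𝓘(ℝ, E) (cha E (1 : G)) (par E (1 : G) y) :=
    (contMDiffAt_extChartAt' (n := ∞) (by simpa using hs)).mdifferentiableAt (by simp)
  have h1 : (tmap 𝓘(ℝ, E) 𝓘(ℝ, E) (par E (1 : G)) y).inverse =
      tmap 𝓘(ℝ, E) 𝓘(ℝ, E) (cha E (1 : G)) (par E (1 : G) y) := by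
    refine ContinuousLinearMap.inverse_eq ?_ ?_
    · have e := tmap_comp' (I := 𝓘(ℝ, E)) (J := 𝓘(ℝ, E)) (K := 𝓘(ℝ, E)) (g := par E (1 : G))
        (f := cha E (1 : G)) (x := par E (1 : G) y) (by rw [hyy.self_of_nhds]; exact hy1) hch
      rw [hyy.self_of_nhds] at e
      rw [← e, ← tmap_id (I := 𝓘(ℝ, E)) (par E (1 : G) y)]
      refine tmap_congr ?_
      filter_upwards [(isOpen_extChartAt_source (I := 𝓘(ℝ, E)) (1 : G)).mem_nhds hs] with z hz
      exact (extChartAt 𝓘(ℝ, E) (1 : G)).left_inv hz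
    · rw [← tmap_comp' hch hy1, ← tmap_id (I := 𝓘(ℝ, E)) y]
      exact tmap_congr hyy
  have h2 : VectorField.mpullbackWithin 𝓘(ℝ, E) 𝓘(ℝ, E) (par E (1 : G))
      (mulInvariantVectorField (I := 𝓘(ℝ, E)) (G := G) v) Set.univ y =
      (tmap 𝓘(ℝ, E) 𝓘(ℝ, E) (par E (1 : G)) y).inverse
        (tmap 𝓘(ℝ, E) 𝓘(ℝ, E) (fun h : G => par E (1 : G) y * h) 1 v) := by
    rw [VectorField.mpullbackWithin_apply, mfderivWithin_univ]
    rfl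
  rw [h2, h1]
  have h3 : HasFDerivAt (fun b => mulChart E G (y, b)) _ (cen E G) :=
    HasFDerivAt.comp (g := mulChart E G) (f := fun b => (y, b))
      (cen E G) hmy.hasFDerivAt (hasFDerivAt_prodMk_right (𝕜 := ℝ) y (cen E G))
  have h4 : MDifferentiableAt 𝓘(ℝ, E) 𝓘(ℝ, E) (cha E (1 : G)) (par E (1 : G) y * 1) := by
    rwa [mul_one]
  have h5 := tmap_comp' (f := fun h : G => par E (1 : G) y * h) h4 (mdiff_left E _ 1)
  have h7 : MDifferentiableAt 𝓘(ℝ, E) 𝓘(ℝ, E)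
      (fun h : G => cha E (1 : G) (par E (1 : G) y * h)) 1 := h4.comp (1 : G) (mdiff_left E _ 1)
  rw [mul_one, tmap_eq_fderiv_charts h7] at h5
  simp only [extChartAt_model_space_eq_id] at h5
  have h6 := h3.fderiv.symm.trans h5
  exact (congrArg (fun D : E →L[ℝ] E => D v) h6).symm

/-- The bracket of left invariant vector fields, in the chart. -/
theorem bracket_eq_chart (v w : LieAlg (E := E) G) : (⁅v, w⁆ : LieAlg (E := E) G) =
    (fderiv ℝ (fderiv ℝ (mulChart E G)) (cen E G, cen E G) (v, 0) (0, w) -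
      fderiv ℝ (fderiv ℝ (mulChart E G)) (cen E G, cen E G) (w, 0) (0, v) : E) := by
  have hD : DifferentiableAt ℝ (fderiv ℝ (mulChart E G)) (cen E G, cen E G) :=
    ((contDiffAt_mulChart (E := E) (G := G)).fderiv_right (m := ∞) (by simp)).differentiableAt
      (by simp)
  have hV : ∀ v : E, HasFDerivAt (fun y => fderiv ℝ (mulChart E G) (y, cen E G) (0, v))
      (((fderiv ℝ (fderiv ℝ (mulChart E G)) (cen E G, cen E G)).comp
        (ContinuousLinearMap.inl ℝ E E)).flip (0, v)) (cen E G) := fun v => by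
    have h2 := (HasFDerivAt.comp (g := fderiv ℝ (mulChart E G)) (f := fun b => (b, cen E G))
      (cen E G) hD.hasFDerivAt (hasFDerivAt_prodMk_left (𝕜 := ℝ) (cen E G) (cen E G))).clm_apply
        (hasFDerivAt_const ((0 : E), v) (cen E G))
    refine h2.congr_fderiv ?_
    ext z
    simp
  have hM : ∀ z : E, fderiv ℝ (mulChart E G) (cen E G, cen E G) (0, z) = z := fun z => by
    have h1 := (contDiffAt_mulChart (E := E) (G := G)).differentiableAt (by simp)
    have h2 := HasFDerivAt.comp (g := mulChart E G) (f := fun b => (cen E G, b)) (cen E G)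
      h1.hasFDerivAt (hasFDerivAt_prodMk_right (𝕜 := ℝ) (cen E G) (cen E G))
    have h3 : (fun b => mulChart E G (cen E G, b)) =ᶠ[𝓝 (cen E G)] id := by
      filter_upwards [cha_par_eventually (E := E) (G := G)] with a ha
      simp only [mulChart, par_cen, one_mul, id, ha]
    have h4 := ((hasFDerivAt_id (𝕜 := ℝ) (cen E G)).congr_of_eventuallyEq h3).unique h2
    exact (congrArg (fun D : E →L[ℝ] E => D z) h4).symm
  rw [GroupLieAlgebra.bracket_def, VectorField.mlieBracket, VectorField.mlieBracketWithin_apply]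
  have hinv : (tmap 𝓘(ℝ, E) 𝓘(ℝ, E) (cha E (1 : G)) 1).inverse = ContinuousLinearMap.id ℝ E := by
    rw [tmap_extChartAt_self, ContinuousLinearMap.inverse_id]
  have h1 : ∀ z : E, (mfderiv 𝓘(ℝ, E) 𝓘(ℝ, E) (extChartAt 𝓘(ℝ, E) (1 : G)) 1).inverse z = z :=
    fun z => congrArg (fun D : E →L[ℝ] E => D z) hinv
  rw [h1]
  simp only [Set.preimage_univ, Set.univ_inter, modelWithCornersSelf_coe, Set.range_id]
  have e1 := mpullbackWithin_mulInvariantVectorField (E := E) (G := G) v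
  have e2 := mpullbackWithin_mulInvariantVectorField (E := E) (G := G) w
  have key : ∀ V W : E → E,
      V =ᶠ[𝓝 (cen E G)] (fun y => fderiv ℝ (mulChart E G) (y, cen E G) (0, v)) →
      W =ᶠ[𝓝 (cen E G)] (fun y => fderiv ℝ (mulChart E G) (y, cen E G) (0, w)) →
      VectorField.lieBracketWithin ℝ V W Set.univ (cen E G) =
        fderiv ℝ (fderiv ℝ (mulChart E G)) (cen E G, cen E G) (v, 0) (0, w) -
          fderiv ℝ (fderiv ℝ (mulChart E G)) (cen E G, cen E G) (w, 0) (0, v) := by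
    intro V W e1 e2
    rw [VectorField.lieBracketWithin_univ, Filter.EventuallyEq.lieBracket_vectorField_eq e1 e2,
      VectorField.lieBracket, (hV v).fderiv, (hV w).fderiv, hM v, hM w]
    rfl
  exact key _ _ e1 e2

variable (E G) in
theorem contMDiffAt_Ad_one : ContMDiffAt 𝓘(ℝ, E) 𝓘(ℝ, E →L[ℝ] E) ∞ (Ad E (G := G)) 1 := by
  have h1 : ContMDiffAt 𝓘(ℝ, E) 𝓘(ℝ, E →L[ℝ] E) ∞
      (fun g : G => Ad E (par E (1 : G) (cha E (1 : G) g))) 1 :=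
    ContMDiffAt.comp (1 : G) (I' := 𝓘(ℝ, E)) (g := fun a => Ad E (par E (1 : G) a))
      (contMDiffAt_iff_contDiffAt.2 contDiffAt_Ad_par) (contMDiffAt_extChartAt (n := ∞))
  refine h1.congr_of_eventuallyEq ?_
  filter_upwards [extChartAt_source_mem_nhds (I := 𝓘(ℝ, E)) (1 : G)] with z hz
  have h2 : par E (1 : G) (cha E (1 : G) z) = z := (extChartAt 𝓘(ℝ, E) (1 : G)).left_inv hz
  rw [h2]

/-- The derivative of the adjoint action at the identity is the bracket. -/
theorem tmap_Ad (v w : LieAlg (E := E) G) :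
    tmap 𝓘(ℝ, E) 𝓘(ℝ, E →L[ℝ] E) (Ad E (G := G)) 1 v w = ⁅v, w⁆ := by
  rw [bracket_eq_chart]
  refine Eq.trans ?_ (fderiv_Ad_par (E := E) (G := G) v w)
  rw [tmap_eq_fderiv_charts ((contMDiffAt_Ad_one E G).mdifferentiableAt (by simp))]
  rfl

theorem eq_of_tmap_eq_zero [ConnectedSpace G] {f : G → U}
    (hd : ∀ x, MDifferentiableAt 𝓘(ℝ, E) 𝓘(ℝ, U) f x)
    (h0 : ∀ x, tmap 𝓘(ℝ, E) 𝓘(ℝ, U) f x = 0) (x y : G) : f x = f y := by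
  have hl : IsLocallyConstant f := by
    rw [IsLocallyConstant.iff_eventually_eq]
    intro x
    obtain ⟨r, hr, hb⟩ := Metric.mem_nhds_iff.1
      (extChartAt_target_mem_nhds (I := 𝓘(ℝ, E)) x)
    have hdd : ∀ z ∈ Metric.ball (cha E x x) r,
        MDifferentiableAt 𝓘(ℝ, E) 𝓘(ℝ, U) (fun y => f (par E x y)) z := fun z hz =>
      (hd _).comp z ((contMDiffAt_extChartAt_symm (hb hz)).mdifferentiableAt (by simp))
    have hconst : ∀ z ∈ Metric.ball (cha E x x) r, f (par E x z) = f (par E x (cha E x x)) :=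
      fun z hz => Metric.isOpen_ball.is_const_of_fderiv_eq_zero (𝕜 := ℝ)
        (f := fun y => f (par E x y))
        (convex_ball _ _).isPreconnected
        (fun z hz => (hdd z hz).differentiableAt.differentiableWithinAt)
        (fun z hz => by
          have h1 := tmap_comp' (hd _)
            ((contMDiffAt_extChartAt_symm (hb hz)).mdifferentiableAt (by simp))
          rw [h0, ContinuousLinearMap.zero_comp, tmap_eq_fderiv] at h1
          exact h1) hz (Metric.mem_ball_self hr)
    have hc : ∀ᶠ y in 𝓝 x, cha E x y ∈ Metric.ball (cha E x x) r :=
      (continuousAt_extChartAt x).eventually_mem (Metric.ball_mem_nhds _ hr)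
    filter_upwards [hc, extChartAt_source_mem_nhds (I := 𝓘(ℝ, E)) x] with y hy hys
    have := hconst _ hy
    rwa [show par E x (cha E x y) = y from (extChartAt 𝓘(ℝ, E) x).left_inv hys, par_cha] at this
  exact hl.apply_eq_of_preconnectedSpace x y

/-- A family of functions on a connected Lie group which is permuted, up to linear maps, by left
translations, consists of constant functions if the derivatives at the identity vanish. -/
theorem eq_of_equivariant [ConnectedSpace G] {ι : Type*} {f : ι → G → U}
    (hd : ∀ i, MDifferentiableAt 𝓘(ℝ, E) 𝓘(ℝ, U) (f i) 1)
    (h0 : ∀ i, tmap 𝓘(ℝ, E) 𝓘(ℝ, U) (f i) 1 = 0)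
    (he : ∀ i a, ∃ (j : ι) (T : U →L[ℝ] U), ∀ h, f i (a * h) = T (f j h)) (i : ι) (g : G) :
    f i g = f i 1 := by
  have key : ∀ x, HasMFDerivAt 𝓘(ℝ, E) 𝓘(ℝ, U) (f i) x (0 : E →L[ℝ] U) := fun x => by
    obtain ⟨j, T, hT⟩ := he i x
    have h1 : f i = fun h => T (f j (x⁻¹ * h)) := by
      funext h
      rw [← hT, mul_inv_cancel_left]
    have h2 : MDifferentiableAt 𝓘(ℝ, E) 𝓘(ℝ, U) (f j) (x⁻¹ * x) := by
      rw [inv_mul_cancel]; exact hd j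
    have h3 : MDifferentiableAt 𝓘(ℝ, U) 𝓘(ℝ, U) T (f j (x⁻¹ * x)) :=
      T.differentiableAt.mdifferentiableAt
    have h4 : MDifferentiableAt 𝓘(ℝ, E) 𝓘(ℝ, U) (fun h : G => f j (x⁻¹ * h)) x :=
      h2.comp x (mdiff_left E _ x)
    have h5 : tmap 𝓘(ℝ, E) 𝓘(ℝ, U) (fun h : G => f j (x⁻¹ * h)) x = 0 := by
      rw [tmap_comp' h2 (mdiff_left E _ x), inv_mul_cancel, h0, ContinuousLinearMap.zero_comp]
    have h6 : MDifferentiableAt 𝓘(ℝ, E) 𝓘(ℝ, U) (f i) x := by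
      rw [h1]; exact h3.comp x h4
    have h7 : tmap 𝓘(ℝ, E) 𝓘(ℝ, U) (f i) x = 0 := by
      rw [h1, tmap_comp' (f := fun h : G => f j (x⁻¹ * h)) h3 h4, h5, ContinuousLinearMap.comp_zero]
    rw [← h7]
    exact h6.hasMFDerivAt
  exact eq_of_tmap_eq_zero (fun x => (key x).mdifferentiableAt) (fun x => (key x).tmap_eq) _ _

variable (E G) in
theorem tmap_inv_one : tmap 𝓘(ℝ, E) 𝓘(ℝ, E) (fun g : G => g⁻¹) 1 = -ContinuousLinearMap.id ℝ E := by
  have hi : MDifferentiableAt 𝓘(ℝ, E) 𝓘(ℝ, E) (fun g : G => g⁻¹) 1 :=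
    (contMDiff_inv 𝓘(ℝ, E) ∞).mdifferentiableAt (by simp)
  have h := mcf_mul_tmap (E := E) (f₁ := fun g : G => g) (f₂ := fun g : G => g⁻¹)
    mdifferentiableAt_id hi
  simp only [mul_inv_cancel, inv_one, mcf_one, Ad_one, tmap_const] at h
  have h' := tmap_id (I := 𝓘(ℝ, E)) (1 : G)
  change tmap 𝓘(ℝ, E) 𝓘(ℝ, E) (fun g : G => g) 1 = _ at h'
  rw [h'] at h
  simp only [ContinuousLinearMap.comp_zero, ContinuousLinearMap.id_comp] at h
  exact (neg_eq_of_add_eq_zero_right h.symm).symm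

end LieGroups

/-! ### Equivariance of the operators of a representation -/

section ProductRule

variable {E : Type*} [NormedAddCommGroup E] [NormedSpace ℝ E]
  {H : Type*} [TopologicalSpace H] {I : ModelWithCorners ℝ E H} [I.Boundaryless]
  {M : Type*} [TopologicalSpace M] [ChartedSpace H M]
  {F₁ F₂ F₃ : Type*} [NormedAddCommGroup F₁] [NormedSpace ℝ F₁]
  [NormedAddCommGroup F₂] [NormedSpace ℝ F₂] [NormedAddCommGroup F₃] [NormedSpace ℝ F₃]

theorem tmap_to_vec {f : M → F₁} {x : M} (hf : MDifferentiableAt I 𝓘(ℝ, F₁) f x) :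
    HasFDerivAt (fun y => f ((extChartAt I x).symm y)) (tmap I 𝓘(ℝ, F₁) f x)
      (extChartAt I x x) := by
  have h1 := tmap_eq_fderiv_charts hf
  simp only [extChartAt_model_space_eq_id] at h1
  have h2 := hf.differentiableWithinAt_writtenInExtChartAt
  rw [I.range_eq_univ, differentiableWithinAt_univ] at h2
  have h3 : DifferentiableAt ℝ (fun y => f ((extChartAt I x).symm y)) (extChartAt I x x) := by
    simp only [writtenInExtChartAt, extChartAt_model_space_eq_id] at h2
    exact h2
  rw [h1]
  exact h3.hasFDerivAt

theorem mdifferentiableAt_bilin (B : F₁ →L[ℝ] F₂ →L[ℝ] F₃) {f₁ : M → F₁} {f₂ : M → F₂} {x : M}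
    (h₁ : MDifferentiableAt I 𝓘(ℝ, F₁) f₁ x) (h₂ : MDifferentiableAt I 𝓘(ℝ, F₂) f₂ x) :
    MDifferentiableAt I 𝓘(ℝ, F₃) (fun y => B (f₁ y) (f₂ y)) x :=
  (B.isBoundedBilinearMap.differentiableAt (f₁ x, f₂ x)).mdifferentiableAt.comp x
    (h₁.prodMk_space h₂)

/-- The product rule, for functions on a manifold. -/
theorem tmap_bilin (B : F₁ →L[ℝ] F₂ →L[ℝ] F₃) {f₁ : M → F₁} {f₂ : M → F₂} {x : M}
    (h₁ : MDifferentiableAt I 𝓘(ℝ, F₁) f₁ x) (h₂ : MDifferentiableAt I 𝓘(ℝ, F₂) f₂ x) (v : E) :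
    tmap I 𝓘(ℝ, F₃) (fun y => B (f₁ y) (f₂ y)) x v =
      B (tmap I 𝓘(ℝ, F₁) f₁ x v) (f₂ x) + B (f₁ x) (tmap I 𝓘(ℝ, F₂) f₂ x v) := by
  have h3 := (tmap_to_vec (mdifferentiableAt_bilin B h₁ h₂)).unique
    (B.hasFDerivAt_of_bilinear (tmap_to_vec h₁) (tmap_to_vec h₂))
  rw [h3]
  simp only [extChartAt_to_inv, add_apply, ContinuousLinearMap.precompR_apply,
    ContinuousLinearMap.precompL_apply]
  exact add_comm _ _

end ProductRule

namespace TRep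

variable {E : Type v} [NormedAddCommGroup E] [NormedSpace ℝ E] [FiniteDimensional ℝ E]
  {G : Type w} [TopologicalSpace G] [ChartedSpace E G] [Group G] [LieGroup 𝓘(ℝ, E) ∞ G]
  (V W : TRep.{u} (E := E) G)

/-- The contractions, as a linear map on the model space. -/
def iE : E →L[ℝ] V.V →L[ℝ] V.V := V.i

/-- The Lie derivatives, as a linear map on the model space. -/
def LE : E →L[ℝ] V.V →L[ℝ] V.V := V.L

theorem iE_anticomm (x y : E) : V.iE x ∘L V.iE y = -(V.iE y ∘L V.iE x) :=
  eq_neg_of_add_eq_zero_left (V.i_i x y)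

theorem mdiff_rho (g : G) : MDifferentiableAt 𝓘(ℝ, E) 𝓘(ℝ, V.V →L[ℝ] V.V) V.ρ g :=
  (V.ρ_smooth g).mdifferentiableAt (by simp)

theorem tmap_rho_one (x : E) : tmap 𝓘(ℝ, E) 𝓘(ℝ, V.V →L[ℝ] V.V) V.ρ (1 : G) x = V.LE x :=
  V.ρ_deriv x

theorem rho_mul (g h : G) : V.ρ (g * h) = V.ρ g ∘L V.ρ h := map_mul V.ρ g h

theorem rho_one : V.ρ 1 = ContinuousLinearMap.id ℝ V.V := map_one V.ρ

theorem rho_inv_comp (g : G) : V.ρ g⁻¹ ∘L V.ρ g = ContinuousLinearMap.id ℝ V.V := by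
  rw [← rho_mul, inv_mul_cancel, rho_one]

theorem rho_comp_inv (g : G) : V.ρ g ∘L V.ρ g⁻¹ = ContinuousLinearMap.id ℝ V.V := by
  rw [← rho_mul, mul_inv_cancel, rho_one]

theorem mdiff_inv_one : MDifferentiableAt 𝓘(ℝ, E) 𝓘(ℝ, E) (fun g : G => g⁻¹) 1 :=
  (contMDiff_inv 𝓘(ℝ, E) ∞).mdifferentiableAt (by simp)

theorem mdiff_rho_inv_one : MDifferentiableAt 𝓘(ℝ, E) 𝓘(ℝ, V.V →L[ℝ] V.V)
    (fun g => V.ρ g⁻¹) (1 : G) :=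
  MDifferentiableAt.comp (1 : G) (g := V.ρ) (V.mdiff_rho _) mdiff_inv_one

theorem tmap_rho_inv_one (x : E) :
    tmap 𝓘(ℝ, E) 𝓘(ℝ, V.V →L[ℝ] V.V) (fun g => V.ρ g⁻¹) (1 : G) x = -V.LE x := by
  rw [tmap_comp' (g := V.ρ) (V.mdiff_rho _) mdiff_inv_one, tmap_inv_one, inv_one]
  change tmap 𝓘(ℝ, E) 𝓘(ℝ, V.V →L[ℝ] V.V) V.ρ (1 : G) (-x) = _
  rw [map_neg, tmap_rho_one]

variable {V W}

/-- A linear map `A` which commutes with the Lie derivatives is equivariant, since the function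
`g ↦ ρ g ∘ A ∘ ρ g⁻¹` is constant. -/
theorem rho_comp_eq [ConnectedSpace G] {A : V.V →L[ℝ] W.V}
    (hA : ∀ x, W.LE x ∘L A = A ∘L V.LE x) (g : G) : W.ρ g ∘L A = A ∘L V.ρ g := by
  have h1 : MDifferentiableAt 𝓘(ℝ, E) 𝓘(ℝ, V.V →L[ℝ] W.V)
      (fun g => ContinuousLinearMap.compL ℝ V.V W.V W.V (W.ρ g) A) (1 : G) :=
    mdifferentiableAt_bilin _ (W.mdiff_rho 1) mdifferentiableAt_const
  have h := eq_of_equivariant (ι := Unit) (f := fun _ g =>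
      ContinuousLinearMap.compL ℝ V.V V.V W.V (ContinuousLinearMap.compL ℝ V.V W.V W.V (W.ρ g) A)
        (V.ρ g⁻¹))
    (fun _ => mdifferentiableAt_bilin _ h1 V.mdiff_rho_inv_one)
    (fun _ => by
      ext1 x
      rw [tmap_bilin _ h1 V.mdiff_rho_inv_one,
        tmap_bilin _ (W.mdiff_rho 1) mdifferentiableAt_const, tmap_const, tmap_rho_one,
        tmap_rho_inv_one]
      simp only [ContinuousLinearMap.compL_apply, inv_one, rho_one, hA]
      ext v
      simp)
    (fun _ a => ⟨(), ContinuousLinearMap.compL ℝ V.V W.V W.V (W.ρ a) ∘L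
        (ContinuousLinearMap.compL ℝ V.V V.V W.V).flip (V.ρ a⁻¹), fun h => by
      simp only [ContinuousLinearMap.compL_apply, rho_mul, mul_inv_rev]
      rfl⟩) () g
  simp only [ContinuousLinearMap.compL_apply, inv_one, rho_one] at h
  have h' := congrArg (fun B => B ∘L V.ρ g) h
  simpa [ContinuousLinearMap.comp_assoc, rho_inv_comp] using h'

theorem rho_delta [ConnectedSpace G] (V : TRep.{u} (E := E) G) (g : G) :
    V.ρ g ∘L V.δ = V.δ ∘L V.ρ g :=
  rho_comp_eq (E := E) (V := V) (W := V) (A := V.δ) (fun x : E => sub_eq_zero.1 (V.L_δ x)) g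

/-- The contractions are equivariant, since the functions `g ↦ ρ g ∘ i (Ad g⁻¹ w) ∘ ρ g⁻¹` are
constant: left translations permute them, and their derivatives at the identity vanish by the
relation `[L y, i w] = i [y, w]`. -/
theorem rho_i [ConnectedSpace G] (V : TRep.{u} (E := E) G) (g : G) (x : E) :
    V.ρ g ∘L V.iE x = V.iE (Ad E g x) ∘L V.ρ g := by
  have hAd : MDifferentiableAt 𝓘(ℝ, E) 𝓘(ℝ, E →L[ℝ] E) (fun g : G => Ad E g⁻¹) (1 : G) :=
    MDifferentiableAt.comp (1 : G) (g := Ad E (G := G))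
      (by rw [inv_one]; exact (contMDiffAt_Ad_one E G).mdifferentiableAt (by simp)) mdiff_inv_one
  have tAd : ∀ y w : E, tmap 𝓘(ℝ, E) 𝓘(ℝ, E →L[ℝ] E) (fun g : G => Ad E g⁻¹) (1 : G) y w =
      -(@Bracket.bracket (LieAlg (E := E) G) (LieAlg (E := E) G) _ y w) := fun y w => by
    rw [tmap_comp' (g := Ad E (G := G))
      (by rw [inv_one]; exact (contMDiffAt_Ad_one E G).mdifferentiableAt (by simp)) mdiff_inv_one,
      tmap_inv_one, inv_one]
    change tmap 𝓘(ℝ, E) 𝓘(ℝ, E →L[ℝ] E) (Ad E (G := G)) 1 (-y) w = _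
    rw [map_neg]
    exact congrArg Neg.neg (tmap_Ad (G := G) y w)
  let B : E → (E →L[ℝ] E) →L[ℝ] V.V →L[ℝ] V.V := fun w =>
    V.iE ∘L (ContinuousLinearMap.apply ℝ E w)
  have hB : ∀ w, MDifferentiableAt 𝓘(ℝ, E) 𝓘(ℝ, V.V →L[ℝ] V.V)
      (fun g : G => V.iE (Ad E g⁻¹ w)) 1 := fun w =>
    (B w).differentiableAt.mdifferentiableAt.comp (1 : G) hAd
  have tB : ∀ w y, tmap 𝓘(ℝ, E) 𝓘(ℝ, V.V →L[ℝ] V.V)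
      (fun g : G => V.iE (Ad E g⁻¹ w)) 1 y = -(V.LE y ∘L V.iE w - V.iE w ∘L V.LE y) :=
    fun w y => by
      have h1 := tmap_comp' (g := B w) (f := fun g : G => Ad E g⁻¹) (x := 1)
        (B w).differentiableAt.mdifferentiableAt hAd
      rw [tmap_eq_fderiv, (B w).fderiv] at h1
      have h2 := congrArg (fun D : E →L[ℝ] V.V →L[ℝ] V.V => D y) h1
      refine h2.trans ?_
      change V.iE (tmap 𝓘(ℝ, E) 𝓘(ℝ, E →L[ℝ] E) (fun g : G => Ad E g⁻¹) (1 : G) y w) = _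
      rw [tAd]
      refine (map_neg V.i _).trans (congrArg Neg.neg ?_)
      exact (V.L_i y w).symm
  have h1 : ∀ w, MDifferentiableAt 𝓘(ℝ, E) 𝓘(ℝ, V.V →L[ℝ] V.V)
      (fun g => ContinuousLinearMap.compL ℝ V.V V.V V.V (V.ρ g) (V.iE (Ad E g⁻¹ w))) (1 : G) :=
    fun w => mdifferentiableAt_bilin _ (V.mdiff_rho 1) (hB w)
  have h := eq_of_equivariant (f := fun w g =>
      ContinuousLinearMap.compL ℝ V.V V.V V.V
        (ContinuousLinearMap.compL ℝ V.V V.V V.V (V.ρ g) (V.iE (Ad E g⁻¹ w))) (V.ρ g⁻¹))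
    (fun w => mdifferentiableAt_bilin _ (h1 w) V.mdiff_rho_inv_one)
    (fun w => by
      ext1 y
      rw [tmap_bilin _ (h1 w) V.mdiff_rho_inv_one,
        tmap_bilin _ (V.mdiff_rho 1) (hB w), tB, tmap_rho_one, tmap_rho_inv_one]
      simp only [ContinuousLinearMap.compL_apply, inv_one, rho_one, Ad_one]
      ext v
      simp)
    (fun w a => ⟨Ad E a⁻¹ w, ContinuousLinearMap.compL ℝ V.V V.V V.V (V.ρ a) ∘L
        (ContinuousLinearMap.compL ℝ V.V V.V V.V).flip (V.ρ a⁻¹), fun h => by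
      simp only [ContinuousLinearMap.compL_apply, rho_mul, mul_inv_rev, Ad_mul]
      rfl⟩) (Ad E g x) g
  simp only [ContinuousLinearMap.compL_apply, inv_one, rho_one, Ad_one] at h
  have h2 : Ad E g⁻¹ (Ad E g x) = x := by
    rw [← ContinuousLinearMap.comp_apply, ← Ad_mul, inv_mul_cancel, Ad_one]
    rfl
  rw [h2] at h
  have h' := congrArg (fun B => B ∘L V.ρ g) h
  simpa [ContinuousLinearMap.comp_assoc, rho_inv_comp] using h'

/-- The projections to the homogeneous components. -/
theorem exists_proj (V : TRep.{u} (E := E) G) (n : ℤ) : ∃ π : V.V →L[ℝ] V.V,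
    (∀ v ∈ V.gr n, π v = v) ∧ (∀ m ≠ n, ∀ v ∈ V.gr m, π v = 0) ∧ ∀ v, π v ∈ V.gr n := by
  classical
  let e := LinearEquiv.ofBijective (DirectSum.coeLinearMap V.gr) V.gr_isInternal
  have he : ∀ m (v : V.gr m), e.symm (v : V.V) = DirectSum.lof ℝ ℤ (fun n => V.gr n) m v :=
    fun m v => by
      rw [LinearEquiv.symm_apply_eq]
      exact (DirectSum.coeLinearMap_lof V.gr m v).symm
  refine ⟨LinearMap.toContinuousLinearMap ((V.gr n).subtype ∘ₗ DirectSum.component ℝ ℤ _ n ∘ₗ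
    e.symm.toLinearMap), fun v hv => ?_, fun m hm v hv => ?_, fun v => ?_⟩
  · have := he n ⟨v, hv⟩
    simp [this, DirectSum.component.lof_self]
  · have := he m ⟨v, hv⟩
    simp [this, DirectSum.component.of, hm]
  · exact Subtype.mem _

theorem gr_ext {F : Type*} [NormedAddCommGroup F] [NormedSpace ℝ F] {A B : V.V →L[ℝ] F}
    (h : ∀ n, ∀ v ∈ V.gr n, A v = B v) : A = B := by
  ext v
  have hv : v ∈ ⨆ n, V.gr n := by
    rw [V.gr_isInternal.submodule_iSup_eq_top]; trivial
  induction hv using Submodule.iSup_induction' with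
  | mem n v hv => exact h n v hv
  | zero => simp
  | add v w _ _ h1 h2 => rw [map_add, map_add, h1, h2]

theorem rho_mem [ConnectedSpace G] (V : TRep.{u} (E := E) G) (g : G) (n : ℤ) {v : V.V}
    (hv : v ∈ V.gr n) : V.ρ g v ∈ V.gr n := by
  obtain ⟨π, h1, h2, h3⟩ := V.exists_proj n
  have h : V.ρ g ∘L π = π ∘L V.ρ g := by
    refine rho_comp_eq (fun x => gr_ext fun m u hu => ?_) g
    change V.L x (π u) = π (V.L x u)
    rcases eq_or_ne m n with rfl | hm
    · rw [h1 u hu, h1 _ (V.L_mem x _ u hu)]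
    · rw [h2 m hm u hu, h2 m hm _ (V.L_mem x _ u hu), map_zero]
  have h4 := congrArg (fun A : V.V →L[ℝ] V.V => A v) h
  change V.ρ g (π v) = π (V.ρ g v) at h4
  rw [h1 v hv] at h4
  rw [h4]
  exact h3 _

end TRep

/-! ### Contractions with sums of vectors -/

namespace TRep

variable {E : Type v} [NormedAddCommGroup E] [NormedSpace ℝ E] [FiniteDimensional ℝ E]
  {G : Type w} [TopologicalSpace G] [ChartedSpace E G] [Group G] [LieGroup 𝓘(ℝ, E) ∞ G]
  (V : TRep.{u} (E := E) G)

/-- The contractions `(x₁, …, x_k) ↦ i x₁ ∘ ⋯ ∘ i x_k`, on the model space. -/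
def iFwd (k : ℕ) : E [⋀^Fin k]→L[ℝ] (V.V →L[ℝ] V.V) := V.iAlt k

/-- The contractions `(x₁, …, x_k) ↦ i x_k ∘ ⋯ ∘ i x₁`, on the model space. -/
def iRev (k : ℕ) : E [⋀^Fin k]→L[ℝ] (V.V →L[ℝ] V.V) := (-1 : ℝ) ^ (k * (k - 1) / 2) • V.iFwd k

theorem iFwd_apply (k : ℕ) (w : Fin k → E) : V.iFwd k w = (List.ofFn fun j => V.iE (w j)).prod :=
  ContinuousMultilinearMap.mkPiAlgebraFin_apply (R := ℝ) (A := V.V →L[ℝ] V.V) _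

theorem iFwd_cons (k : ℕ) (x : E) (w : Fin k → E) :
    V.iFwd (k + 1) (Fin.cons x w) = V.iE x ∘L V.iFwd k w := by
  rw [iFwd_apply, iFwd_apply, List.ofFn_succ, List.prod_cons]
  rfl

theorem iE_iFwd (k : ℕ) (x : E) (w : Fin k → E) :
    V.iE x ∘L V.iFwd k w = (-1 : ℝ) ^ k • (V.iFwd k w ∘L V.iE x) := by
  induction k with
  | zero => simp [iFwd_apply]; rfl
  | succ k ih =>
    rw [← Fin.cons_self_tail w, iFwd_cons, ← ContinuousLinearMap.comp_assoc, iE_anticomm,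
      ContinuousLinearMap.neg_comp, ContinuousLinearMap.comp_assoc, ih, pow_succ,
      ContinuousLinearMap.comp_smul, ContinuousLinearMap.comp_assoc]
    simp

theorem iRev_cons (k : ℕ) (x : E) (w : Fin k → E) :
    V.iRev (k + 1) (Fin.cons x w) = V.iRev k w ∘L V.iE x := by
  have h1 : (k + 1) * (k + 1 - 1) / 2 = k * (k - 1) / 2 + k := Nat.triangle_succ k
  simp only [iRev, ContinuousAlternatingMap.smul_apply]
  rw [h1, iFwd_cons, iE_iFwd, smul_smul, pow_add, mul_assoc, ← pow_add, Even.neg_one_pow ⟨k, rfl⟩,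
    mul_one, ContinuousLinearMap.smul_comp]

theorem iRev_zero (w : Fin 0 → E) : V.iRev 0 w = ContinuousLinearMap.id ℝ V.V := by
  simp [iRev, iFwd_apply]
  rfl

theorem iRev_cases {P : (k : ℕ) → (V.V →L[ℝ] V.V) → (Fin k → E) → Prop}
    (h0 : ∀ w, P 0 (ContinuousLinearMap.id ℝ V.V) w)
    (hs : ∀ k x w, P k (V.iRev k w) w → P (k + 1) (V.iRev k w ∘L V.iE x) (Fin.cons x w))
    (k : ℕ) (w : Fin k → E) : P k (V.iRev k w) w := by
  induction k with
  | zero => rw [iRev_zero]; exact h0 w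
  | succ k ih =>
    have := hs k (w 0) (Fin.tail w) (ih _)
    rwa [← iRev_cons, Fin.cons_self_tail] at this

theorem iE_iRev (k : ℕ) (x : E) (w : Fin k → E) :
    V.iE x ∘L V.iRev k w = (-1 : ℝ) ^ k • (V.iRev k w ∘L V.iE x) := by
  simp only [iRev, ContinuousAlternatingMap.smul_apply, ContinuousLinearMap.comp_smul, iE_iFwd,
    ContinuousLinearMap.smul_comp]
  rw [smul_comm]

theorem rho_iRev [ConnectedSpace G] (g : G) (k : ℕ) (w : Fin k → E) :
    V.ρ g ∘L V.iRev k w = V.iRev k (fun j => Ad E g (w j)) ∘L V.ρ g := by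
  refine V.iRev_cases (P := fun k A w => V.ρ g ∘L A = V.iRev k (fun j => Ad E g (w j)) ∘L V.ρ g)
    (fun w => by rw [iRev_zero]; rfl) (fun k x w ih => ?_) k w
  have h1 : (fun j => Ad E g (Fin.cons (α := fun _ => E) x w j)) =
      Fin.cons (Ad E g x) fun j => Ad E g (w j) := by
    funext j
    refine Fin.cases ?_ (fun j => ?_) j <;> rfl
  rw [h1, iRev_cons, ← ContinuousLinearMap.comp_assoc, ih, ContinuousLinearMap.comp_assoc, rho_i,
    ContinuousLinearMap.comp_assoc]

theorem iRev_mem (k : ℕ) (w : Fin k → E) : V.iRev k w ∈ HomDeg V V (-k) := by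
  refine V.iRev_cases (P := fun k A _ => A ∈ HomDeg V V (-k)) (fun w n v hv => by simpa using hv)
    (fun k x w ih n v hv => ?_) k w
  have h1 := ih (n - 1) (V.iE x v) (V.i_mem x n v hv)
  have h2 : n - 1 + (-(k : ℤ)) = n + -((k + 1 : ℕ) : ℤ) := by push_cast; ring
  rw [h2] at h1
  exact h1

/-- The terms of the product formula for the contractions. -/
def iRevTerm {T : Type*} [NormedAddCommGroup T] [NormedSpace ℝ T] (A C : T →L[ℝ] E) (a b k : ℕ) :
    T [⋀^Fin k]→L[ℝ] (V.V →L[ℝ] V.V) :=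
  if h : a + b = k then (-1 : ℝ) ^ (a * b) • altWedge (ContinuousLinearMap.compL ℝ V.V V.V V.V) h
    ((V.iRev a).compContinuousLinearMap A) ((V.iRev b).compContinuousLinearMap C) else 0

section

variable {T : Type*} [NormedAddCommGroup T] [NormedSpace ℝ T]

theorem iRev_comp_curryLeft (A : T →L[ℝ] E) (k : ℕ) (x : T) :
    ((V.iRev (k + 1)).compContinuousLinearMap A).curryLeft x =
      ((ContinuousLinearMap.compL ℝ V.V V.V V.V).flip (V.iE (A x))).compContinuousAlternatingMap
        ((V.iRev k).compContinuousLinearMap A) := by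
  ext1 w
  refine Eq.trans ?_ (V.iRev_cons k (A x) (A ∘ w))
  refine congrArg (V.iRev (k + 1)) ?_
  funext j
  refine Fin.cases ?_ (fun j => ?_) j <;> rfl

theorem altWedge_iRev_right (A C : T →L[ℝ] E) {a b k : ℕ} (h : a + b = k) (x : E) :
    altWedge (ContinuousLinearMap.compL ℝ V.V V.V V.V) h
      (((ContinuousLinearMap.compL ℝ V.V V.V V.V).flip (V.iE x)).compContinuousAlternatingMap
        ((V.iRev a).compContinuousLinearMap A)) ((V.iRev b).compContinuousLinearMap C) =
    (-1 : ℝ) ^ b • ((ContinuousLinearMap.compL ℝ V.V V.V V.V).flip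
      (V.iE x)).compContinuousAlternatingMap
      (altWedge (ContinuousLinearMap.compL ℝ V.V V.V V.V) h
        ((V.iRev a).compContinuousLinearMap A) ((V.iRev b).compContinuousLinearMap C)) := by
  symm
  refine altWedge_coeff (ContinuousLinearMap.compL ℝ V.V V.V V.V) h
    ((-1 : ℝ) ^ b • (ContinuousLinearMap.compL ℝ V.V V.V V.V).flip (V.iE x)) fun u w => ?_
  change (-1 : ℝ) ^ b • ((V.iRev a (A ∘ u) ∘L V.iRev b (C ∘ w)) ∘L V.iE x) =
    (V.iRev a (A ∘ u) ∘L V.iE x) ∘L V.iRev b (C ∘ w)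
  rw [ContinuousLinearMap.comp_assoc (V.iRev a (A ∘ u)) (V.iE x), iE_iRev,
    ContinuousLinearMap.comp_smul, ContinuousLinearMap.comp_assoc]

theorem altWedge_iRev_left (A C : T →L[ℝ] E) {a b k : ℕ} (h : a + b = k) (x : E) :
    altWedge (ContinuousLinearMap.compL ℝ V.V V.V V.V) h ((V.iRev a).compContinuousLinearMap A)
      (((ContinuousLinearMap.compL ℝ V.V V.V V.V).flip (V.iE x)).compContinuousAlternatingMap
        ((V.iRev b).compContinuousLinearMap C)) =
    ((ContinuousLinearMap.compL ℝ V.V V.V V.V).flip (V.iE x)).compContinuousAlternatingMap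
      (altWedge (ContinuousLinearMap.compL ℝ V.V V.V V.V) h
        ((V.iRev a).compContinuousLinearMap A) ((V.iRev b).compContinuousLinearMap C)) := by
  symm
  exact altWedge_coeff (ContinuousLinearMap.compL ℝ V.V V.V V.V) h _ fun u w => rfl

/-- The contraction of the first factor of `iRevTerm`. -/
def iRevTermFst (A C : T →L[ℝ] E) (k : ℕ) (x : T) :
    ℕ → ℕ → T [⋀^Fin k]→L[ℝ] (V.V →L[ℝ] V.V)
  | 0, _ => 0
  | a + 1, b => ((ContinuousLinearMap.compL ℝ V.V V.V V.V).flip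
      (V.iE (A x))).compContinuousAlternatingMap (V.iRevTerm A C a b k)

/-- The contraction of the second factor of `iRevTerm`. -/
def iRevTermSnd (A C : T →L[ℝ] E) (k : ℕ) (x : T) :
    ℕ → ℕ → T [⋀^Fin k]→L[ℝ] (V.V →L[ℝ] V.V)
  | _, 0 => 0
  | a, b + 1 => ((ContinuousLinearMap.compL ℝ V.V V.V V.V).flip
      (V.iE (C x))).compContinuousAlternatingMap (V.iRevTerm A C a b k)

theorem iRevTerm_curryLeft (A C : T →L[ℝ] E) (a b k : ℕ) (h : a + b = k + 1) (x : T) :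
    (V.iRevTerm A C a b (k + 1)).curryLeft x =
      V.iRevTermFst A C k x a b + V.iRevTermSnd A C k x a b := by
  rw [iRevTerm, dif_pos h]
  have hs : ∀ (c : ℝ) (a : T [⋀^Fin (k + 1)]→L[ℝ] (V.V →L[ℝ] V.V)),
    (c • a).curryLeft x = c • a.curryLeft x := fun _ _ => rfl
  have hc : ∀ (c : ℝ) (L : (V.V →L[ℝ] V.V) →L[ℝ] (V.V →L[ℝ] V.V))
    (a : T [⋀^Fin k]→L[ℝ] (V.V →L[ℝ] V.V)), L.compContinuousAlternatingMap (c • a) =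
      c • L.compContinuousAlternatingMap a := fun c L a => by
    ext1 v
    exact map_smul L c (a v)
  rw [hs]
  rcases a with _ | a <;> rcases b with _ | b
  · omega
  · rw [altWedge_curryLeft_zero_left _ _ (by omega), iRev_comp_curryLeft, altWedge_iRev_left]
    rw [iRevTermFst, iRevTermSnd, iRevTerm, dif_pos (show 0 + b = k by omega), hc,
      zero_mul, zero_mul]
    exact (zero_add _).symm
  · rw [altWedge_curryLeft_zero_right _ _ (by omega), iRev_comp_curryLeft, altWedge_iRev_right]
    rw [iRevTermFst, iRevTermSnd, iRevTerm, dif_pos (show a + 0 = k by omega), hc,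
      mul_zero, mul_zero, pow_zero]
    simp only [one_smul]
    exact (add_zero _).symm
  · rw [altWedge_curryLeft _ _ (show a + (b + 1) = k by omega) (show a + 1 + b = k by omega),
      iRev_comp_curryLeft, altWedge_iRev_right, iRev_comp_curryLeft, altWedge_iRev_left]
    simp only [iRevTermFst, iRevTermSnd, iRevTerm, dif_pos (show a + (b + 1) = k by omega),
      dif_pos (show a + 1 + b = k by omega), hc, smul_add, smul_smul]
    congr 2
    · rw [← pow_add, show (a + 1) * (b + 1) + (b + 1) = a * (b + 1) + 2 * (b + 1) by ring, pow_add,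
        (even_two_mul _).neg_one_pow, mul_one]
    · rw [← pow_add, show (a + 1) * (b + 1) + (a + 1) = (a + 1) * b + 2 * (a + 1) by ring, pow_add,
        (even_two_mul _).neg_one_pow, mul_one]

/-- The contractions with sums of vectors, by induction on the degree: both sides have the same
contractions with vectors. -/
theorem iRev_comp_add (A C : T →L[ℝ] E) (k : ℕ) :
    (V.iRev k).compContinuousLinearMap (A + C) =
      ∑ t ∈ Finset.HasAntidiagonal.antidiagonal k, V.iRevTerm A C t.1 t.2 k := by
  induction k with
  | zero =>
    ext1 w
    simp [iRevTerm, altWedge_const_left, iRev_zero]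
  | succ k ih =>
    refine alt_ext_curryLeft fun x => ?_
    have hs : (∑ t ∈ Finset.HasAntidiagonal.antidiagonal (k + 1),
        V.iRevTerm A C t.1 t.2 (k + 1)).curryLeft x =
        ∑ t ∈ Finset.HasAntidiagonal.antidiagonal (k + 1),
          (V.iRevTerm A C t.1 t.2 (k + 1)).curryLeft x :=
      map_sum (contr (k := k) (F₁ := V.V →L[ℝ] V.V) x) _ _
    rw [hs, Finset.sum_congr rfl fun t ht => V.iRevTerm_curryLeft A C t.1 t.2 k
      (Finset.HasAntidiagonal.mem_antidiagonal.1 ht) x, Finset.sum_add_distrib,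
      Finset.Nat.sum_antidiagonal_succ, Finset.Nat.sum_antidiagonal_succ']
    simp only [iRevTermFst, iRevTermSnd, zero_add]
    have hL : ∀ L : (V.V →L[ℝ] V.V) →L[ℝ] (V.V →L[ℝ] V.V),
        ∑ t ∈ Finset.HasAntidiagonal.antidiagonal k,
          L.compContinuousAlternatingMap (V.iRevTerm A C t.1 t.2 k) =
        L.compContinuousAlternatingMap ((V.iRev k).compContinuousLinearMap (A + C)) := fun L => by
      rw [ih]
      ext1 w
      simp
    rw [hL, hL, iRev_comp_curryLeft]
    ext1 w
    simp

end

end TRep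

/-! ### Cartan's formula -/

section Cartan

variable {E : Type*} [NormedAddCommGroup E] [NormedSpace ℝ E] [FiniteDimensional ℝ E]
  {H : Type*} [TopologicalSpace H] {I : ModelWithCorners ℝ E H} [I.Boundaryless]
  {M : Type*} [TopologicalSpace M] [ChartedSpace H M] [IsManifold I ∞ M]
  {F : Type*} [NormedAddCommGroup F] [NormedSpace ℝ F] [FiniteDimensional ℝ F] {q : ℕ}

variable (I) in
/-- A family of maps `f t` in the chart at `x`, as a map on a vector space. -/
def famChart (f : ℝ → M → M) (x : M) (z : ℝ × E) : M := f z.1 ((extChartAt I x).symm z.2)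

/-- The vectors `v` on the factor `E` of `ℝ × E`, preceded by the unit vector of `ℝ`. -/
def cylVec (v : Fin q → E) : Fin (q + 1) → ℝ × E :=
  Fin.cons (α := fun _ => ℝ × E) (1, 0) fun i => ((0 : ℝ), v i)

variable {f : ℝ → M → M} {x : M}

theorem famChart_pb (hu : ContMDiffAt 𝓘(ℝ, ℝ × E) I ∞ (famChart I f x) (0, extChartAt I x x))
    (η : M → E [⋀^Fin q]→L[ℝ] F) : ∀ᶠ t in 𝓝 (0 : ℝ),
      (pb 𝓘(ℝ, ℝ × E) I (famChart I f x) η (t, extChartAt I x x)).compContinuousLinearMap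
        (ContinuousLinearMap.inr ℝ ℝ E) = pb I I (f t) η x := by
  have h1 : ∀ᶠ z in 𝓝 ((0 : ℝ), extChartAt I x x),
      ContMDiffAt 𝓘(ℝ, ℝ × E) I 1 (famChart I f x) z :=
    (contMDiffAt_iff_contMDiffAt_nhds (by simp)).1 (hu.of_le (by simp))
  have h2 : ∀ᶠ t in 𝓝 (0 : ℝ), ContMDiffAt 𝓘(ℝ, ℝ × E) I 1 (famChart I f x)
      (t, extChartAt I x x) :=
    (Continuous.prodMk_left (extChartAt I x x)).continuousAt.eventually h1
  filter_upwards [h2] with t ht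
  have hd := ht.mdifferentiableAt (by simp)
  have hi : HasFDerivAt (fun b : E => (t, b)) (ContinuousLinearMap.inr ℝ ℝ E)
      (extChartAt I x x) := hasFDerivAt_prodMk_right t _
  have h3 := tmap_comp' (f := fun b : E => (t, b)) hd hi.differentiableAt.mdifferentiableAt
  rw [tmap_eq_fderiv, hi.fderiv] at h3
  have hc : MDifferentiableAt I 𝓘(ℝ, E) (extChartAt I x) x :=
    (contMDiffAt_extChartAt (n := ∞)).mdifferentiableAt (by simp)
  have h4 : MDifferentiableAt 𝓘(ℝ, E) I (fun b => famChart I f x (t, b)) (extChartAt I x x) :=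
    hd.comp _ hi.differentiableAt.mdifferentiableAt
  have h5 := tmap_comp' h4 hc
  rw [tmap_extChartAt_self, ContinuousLinearMap.comp_id, h3] at h5
  have h6 : tmap I I (f t) x = _ := (tmap_congr (by
    filter_upwards [extChartAt_source_mem_nhds (I := I) x] with z hz
    simp only [famChart, (extChartAt I x).left_inv hz])).trans h5
  simp only [pb, h6]
  simp only [famChart, extChartAt_to_inv]
  rfl

/-- The derivative of a family of pullbacks, in terms of the exterior derivative of the pullback
of the form to the product with the line. -/
theorem hasDerivAt_pb_aux
    (hu : ContMDiffAt 𝓘(ℝ, ℝ × E) I ∞ (famChart I f x) (0, extChartAt I x x))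
    (h0 : ∀ z, f 0 z = z) {η : M → E [⋀^Fin q]→L[ℝ] F} (hη : ∀ x, SmoothFormAt I η x) :
    ∃ D : E [⋀^Fin q]→L[ℝ] F, HasDerivAt (fun t => pb I I (f t) η x) D 0 ∧
      ∀ v, D v = ed I η x (Fin.cons (tmap 𝓘(ℝ, ℝ) I (fun t => f t x) 0 1) v) +
        ∑ j : Fin q, (-1 : ℤ) ^ (j : ℕ) • fderiv ℝ (fun y =>
          pb 𝓘(ℝ, ℝ × E) I (famChart I f x) η (0, y)
            (j.succ.removeNth (α := fun _ => ℝ × E) (cylVec v))) (extChartAt I x x) (v j) := by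
  have hs : ContDiffAt ℝ ∞ (pb 𝓘(ℝ, ℝ × E) I (famChart I f x) η) (0, extChartAt I x x) :=
    (hη _).contDiffAt_pb hu
  have hd := hs.differentiableAt (by simp)
  have hl : HasFDerivAt (fun t : ℝ => (t, extChartAt I x x)) (ContinuousLinearMap.inl ℝ ℝ E) 0 :=
    hasFDerivAt_prodMk_left 0 _
  have hr : HasFDerivAt (fun y : E => ((0 : ℝ), y)) (ContinuousLinearMap.inr ℝ ℝ E)
      (extChartAt I x x) := hasFDerivAt_prodMk_right 0 _
  have hdv : ∀ w, DifferentiableAt ℝ (fun z => pb 𝓘(ℝ, ℝ × E) I (famChart I f x) η z w)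
      (0, extChartAt I x x) := fun w =>
    (contDiffAt_alt_iff.1 hs w).differentiableAt (by simp)
  let c : ℝ → E [⋀^Fin q]→L[ℝ] F := fun t =>
    (pb 𝓘(ℝ, ℝ × E) I (famChart I f x) η (t, extChartAt I x x)).compContinuousLinearMap
      (ContinuousLinearMap.inr ℝ ℝ E)
  have hcd : DifferentiableAt ℝ c 0 := by
    have h1 : ContDiffAt ℝ ∞ c 0 :=
      ContDiffAt.alt_comp (ContDiffAt.comp (0 : ℝ) (g := pb 𝓘(ℝ, ℝ × E) I (famChart I f x) η)
        (f := fun t : ℝ => (t, extChartAt I x x)) hs (contDiffAt_id.prodMk contDiffAt_const))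
        contDiffAt_const
    exact h1.differentiableAt (by simp)
  refine ⟨deriv c 0, hcd.hasDerivAt.congr_of_eventuallyEq (by
    filter_upwards [famChart_pb hu η] with t ht using ht.symm), fun v => ?_⟩
  have hx : famChart I f x (0, extChartAt I x x) = x := by simp [famChart, h0]
  have hfx : MDifferentiableAt 𝓘(ℝ, ℝ × E) I (famChart I f x) (0, extChartAt I x x) :=
    hu.mdifferentiableAt (by simp)
  have e1 : deriv c 0 v = fderiv ℝ (fun z => pb 𝓘(ℝ, ℝ × E) I (famChart I f x) η z
      (fun i => ((0 : ℝ), v i))) (0, extChartAt I x x) (1, 0) := by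
    have h1 : HasDerivAt (fun t => c t v) (deriv c 0 v) 0 :=
      ((ContinuousAlternatingMap.apply ℝ E F v).hasFDerivAt.comp_hasDerivAt (0 : ℝ)
        hcd.hasDerivAt)
    have h2 := ((hdv (fun i => ((0 : ℝ), v i))).hasFDerivAt.comp (0 : ℝ) hl).hasDerivAt
    refine h1.unique (h2.congr_deriv ?_)
    simp
  have e2 : ed I η x (Fin.cons (tmap 𝓘(ℝ, ℝ) I (fun t => f t x) 0 1) v) =
      extDeriv (pb 𝓘(ℝ, ℝ × E) I (famChart I f x) η) (0, extChartAt I x x)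
        (cylVec v) := by
    rw [(hη _).extDeriv_pb hu]
    simp only [pb, ContinuousAlternatingMap.compContinuousLinearMap_apply]
    rw [hx]
    congr 1
    have t1 : tmap 𝓘(ℝ, ℝ) I (fun t => f t x) 0 =
        (tmap 𝓘(ℝ, ℝ × E) I (famChart I f x) (0, extChartAt I x x)).comp
          (ContinuousLinearMap.inl ℝ ℝ E) := by
      have h1 := tmap_comp' (f := fun t : ℝ => (t, extChartAt I x x)) hfx
        hl.differentiableAt.mdifferentiableAt
      rw [tmap_eq_fderiv, hl.fderiv] at h1
      simpa only [famChart, extChartAt_to_inv] using h1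
    have t2 : (tmap 𝓘(ℝ, ℝ × E) I (famChart I f x) (0, extChartAt I x x)).comp
          (ContinuousLinearMap.inr ℝ ℝ E) = ContinuousLinearMap.id ℝ E := by
      have h1 := tmap_comp' (f := fun y : E => ((0 : ℝ), y)) hfx
        hr.differentiableAt.mdifferentiableAt
      rw [tmap_eq_fderiv, hr.fderiv] at h1
      rw [← h1, ← tmap_extChartAt_symm_self (I := I) x]
      simp only [famChart, h0]
    funext i
    refine Fin.cases ?_ (fun i => ?_) i
    · exact congrArg (fun D : ℝ →L[ℝ] E => D 1) t1
    · exact (congrArg (fun D : E →L[ℝ] E => D (v i)) t2).symm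
  -- The derivative with respect to time is the summand of index zero of the exterior derivative on
  -- `ℝ × E`.
  rw [e1, e2, extDeriv_apply hd, Fin.sum_univ_succ]
  have e3 : ∀ j : Fin q, fderiv ℝ (fun z => pb 𝓘(ℝ, ℝ × E) I (famChart I f x) η z
      (j.succ.removeNth (α := fun _ => ℝ × E) (cylVec v))) (0, extChartAt I x x)
        ((0 : ℝ), v j) =
      fderiv ℝ (fun y => pb 𝓘(ℝ, ℝ × E) I (famChart I f x) η (0, y)
      (j.succ.removeNth (α := fun _ => ℝ × E) (cylVec v))) (extChartAt I x x) (v j) :=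
    fun j => (congrArg (fun D : E →L[ℝ] F => D (v j)) ((hdv _).hasFDerivAt.comp _ hr).fderiv).symm
  rw [add_assoc]
  have e4 : ∑ j : Fin q, (-1 : ℤ) ^ (j.succ : ℕ) • fderiv ℝ (fun z =>
      pb 𝓘(ℝ, ℝ × E) I (famChart I f x) η z
        (j.succ.removeNth (α := fun _ => ℝ × E) (cylVec v))) (0, extChartAt I x x)
        (cylVec v j.succ) =
      -∑ j : Fin q, (-1 : ℤ) ^ (j : ℕ) • fderiv ℝ (fun y =>
          pb 𝓘(ℝ, ℝ × E) I (famChart I f x) η (0, y)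
              (j.succ.removeNth (α := fun _ => ℝ × E) (cylVec v))) (extChartAt I x x) (v j) := by
    rw [← Finset.sum_neg_distrib]
    refine Finset.sum_congr rfl fun j _ => ?_
    rw [show cylVec v j.succ = ((0 : ℝ), v j) from rfl, e3, Fin.val_succ, pow_succ]
    simp
  rw [e4, neg_add_cancel, add_zero]
  simp [cylVec]

/-- The contraction with the velocity of a family of maps, in terms of the pullback of the form to
the product with the line. -/
theorem chartForm_velocity_eventuallyEq
    (hu : ContMDiffAt 𝓘(ℝ, ℝ × E) I ∞ (famChart I f x) (0, extChartAt I x x))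
    (h0 : ∀ z, f 0 z = z) (η : M → E [⋀^Fin (q + 1)]→L[ℝ] F) (w : Fin q → E) :
    (fun y => chartForm I (fun z => (η z).curryLeft
      (tmap 𝓘(ℝ, ℝ) I (fun t => f t z) 0 1)) x y w) =ᶠ[𝓝 (extChartAt I x x)] fun y =>
        pb 𝓘(ℝ, ℝ × E) I (famChart I f x) η (0, y) (cylVec w) := by
  have h1 : ∀ᶠ z in 𝓝 ((0 : ℝ), extChartAt I x x),
      ContMDiffAt 𝓘(ℝ, ℝ × E) I 1 (famChart I f x) z :=
    (contMDiffAt_iff_contMDiffAt_nhds (by simp)).1 (hu.of_le (by simp))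
  have h2 : ∀ᶠ y in 𝓝 (extChartAt I x x), ContMDiffAt 𝓘(ℝ, ℝ × E) I 1 (famChart I f x) (0, y) :=
    (Continuous.prodMk_right (0 : ℝ)).continuousAt.eventually h1
  filter_upwards [h2] with y hy
  have hfx := hy.mdifferentiableAt (by simp)
  have hl : HasFDerivAt (fun t : ℝ => (t, y)) (ContinuousLinearMap.inl ℝ ℝ E) 0 :=
    hasFDerivAt_prodMk_left 0 _
  have hr : HasFDerivAt (fun y : E => ((0 : ℝ), y)) (ContinuousLinearMap.inr ℝ ℝ E) y :=
    hasFDerivAt_prodMk_right 0 _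
  have t1 : tmap 𝓘(ℝ, ℝ) I (fun t => f t ((extChartAt I x).symm y)) 0 =
      (tmap 𝓘(ℝ, ℝ × E) I (famChart I f x) (0, y)).comp (ContinuousLinearMap.inl ℝ ℝ E) := by
    have h1 := tmap_comp' (f := fun t : ℝ => (t, y)) hfx
      hl.differentiableAt.mdifferentiableAt
    rw [tmap_eq_fderiv, hl.fderiv] at h1
    exact h1
  have t2 : (tmap 𝓘(ℝ, ℝ × E) I (famChart I f x) (0, y)).comp
        (ContinuousLinearMap.inr ℝ ℝ E) = tmap 𝓘(ℝ, E) I (extChartAt I x).symm y := by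
    have h1 := tmap_comp' (f := fun y : E => ((0 : ℝ), y)) hfx
      hr.differentiableAt.mdifferentiableAt
    rw [tmap_eq_fderiv, hr.fderiv] at h1
    rw [← h1]
    simp only [famChart, h0]
  have t3 : famChart I f x (0, y) = (extChartAt I x).symm y := h0 _
  simp only [chartForm, pb, ContinuousAlternatingMap.compContinuousLinearMap_apply]
  rw [t3, t1, ← t2]
  change η _ (Fin.cons _ _) = _
  congr 1
  funext i
  refine Fin.cases ?_ (fun i => ?_) i <;> rfl

/-- Contraction with the velocity of a family of maps preserves smoothness. -/
theorem SmoothFormAt.velocity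
    (hu : ContMDiffAt 𝓘(ℝ, ℝ × E) I ∞ (famChart I f x) (0, extChartAt I x x))
    (h0 : ∀ z, f 0 z = z) {η : M → E [⋀^Fin (q + 1)]→L[ℝ] F} (hη : ∀ x, SmoothFormAt I η x) :
    SmoothFormAt I (fun z => (η z).curryLeft (tmap 𝓘(ℝ, ℝ) I (fun t => f t z) 0 1)) x := by
  refine contDiffAt_alt_iff.2 fun w => ContDiffAt.congr_of_eventuallyEq ?_
    (chartForm_velocity_eventuallyEq hu h0 η w)
  exact contDiffAt_alt_iff.1 (ContDiffAt.comp (extChartAt I x x)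
    (g := _root_.pb 𝓘(ℝ, ℝ × E) I (famChart I f x) η) (f := fun y : E => ((0 : ℝ), y))
    ((hη _).contDiffAt_pb hu) (contDiffAt_const.prodMk contDiffAt_id)) (cylVec w)

/-- Cartan's formula for the derivative of a family of pullbacks, in degree zero. -/
theorem hasDerivAt_pb_zero
    (hu : ContMDiffAt 𝓘(ℝ, ℝ × E) I ∞ (famChart I f x) (0, extChartAt I x x))
    (h0 : ∀ z, f 0 z = z) {η : M → E [⋀^Fin 0]→L[ℝ] F} (hη : ∀ x, SmoothFormAt I η x) :
    HasDerivAt (fun t => pb I I (f t) η x)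
      ((ed I η x).curryLeft (tmap 𝓘(ℝ, ℝ) I (fun t => f t x) 0 1)) 0 := by
  obtain ⟨D, hD, hD'⟩ := hasDerivAt_pb_aux hu h0 hη
  convert hD using 1
  ext v
  rw [hD']
  simp only [Finset.univ_eq_empty, Finset.sum_empty, add_zero]
  rfl

/-- Cartan's formula for the derivative of a family of pullbacks, in positive degrees. -/
theorem hasDerivAt_pb_succ
    (hu : ContMDiffAt 𝓘(ℝ, ℝ × E) I ∞ (famChart I f x) (0, extChartAt I x x))
    (h0 : ∀ z, f 0 z = z) {η : M → E [⋀^Fin (q + 1)]→L[ℝ] F} (hη : ∀ x, SmoothFormAt I η x) :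
    HasDerivAt (fun t => pb I I (f t) η x)
      ((ed I η x).curryLeft (tmap 𝓘(ℝ, ℝ) I (fun t => f t x) 0 1) +
        ed I (fun z => (η z).curryLeft (tmap 𝓘(ℝ, ℝ) I (fun t => f t z) 0 1)) x) 0 := by
  obtain ⟨D, hD, hD'⟩ := hasDerivAt_pb_aux hu h0 hη
  convert hD using 1
  ext v
  rw [hD', ContinuousAlternatingMap.add_apply]
  congr 1
  rw [ed_apply, tmap_extChartAt_self]
  change extDeriv _ _ v = _
  rw [extDeriv_apply (ContDiffAt.differentiableAt (SmoothFormAt.velocity hu h0 hη) (by simp))]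
  refine Finset.sum_congr rfl fun j _ => ?_
  rw [(chartForm_velocity_eventuallyEq hu h0 η _).fderiv_eq]
  have h4 : j.succ.removeNth (α := fun _ => ℝ × E) (cylVec v) = cylVec (j.removeNth v) := by
    funext i
    refine Fin.cases ?_ (fun i => ?_) i
    · simp [Fin.removeNth, cylVec]
    · simp [Fin.removeNth, cylVec]
  rw [h4]

end Cartan

/-! ### The representation form -/

theorem HasDerivAt.alt_apply {E F : Type*} [NormedAddCommGroup E] [NormedSpace ℝ E]
    [NormedAddCommGroup F] [NormedSpace ℝ F] {k : ℕ} {c : ℝ → E [⋀^Fin k]→L[ℝ] F}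
    {D : E [⋀^Fin k]→L[ℝ] F} {t : ℝ} (h : HasDerivAt c D t) (w : Fin k → E) :
    HasDerivAt (fun t => c t w) (D w) t := by
  have h1 := (ContinuousAlternatingMap.apply ℝ E F w).hasFDerivAt.comp_hasDerivAt t h
  exact h1

namespace TRep

variable {E : Type v} [NormedAddCommGroup E] [NormedSpace ℝ E] [FiniteDimensional ℝ E]
  {G : Type w} [TopologicalSpace G] [ChartedSpace E G] [Group G] [LieGroup 𝓘(ℝ, E) ∞ G]
  (V : TRep.{u} (E := E) G)

/-- The representation form, whose values are regarded as alternating maps on the model space. -/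
def phi (k : ℕ) : G → E [⋀^Fin k]→L[ℝ] (V.V →L[ℝ] V.V) := V.Φ k

theorem phi_apply (k : ℕ) (g : G) (w : Fin k → E) :
    V.phi k g w = V.ρ g ∘L V.iRev k (fun j => mcf E g (w j)) := by
  change (-1 : ℝ) ^ (k * (k - 1) / 2) • (V.ρ g ∘L V.iFwd k fun j => mcf E g (w j)) = _
  rw [iRev, ContinuousAlternatingMap.smul_apply, ContinuousLinearMap.comp_smul]

theorem phi_curryLeft (k : ℕ) (g : G) (v : E) : (V.phi (k + 1) g).curryLeft v =
    ((ContinuousLinearMap.compL ℝ V.V V.V V.V).flip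
      (V.iE (mcf E g v))).compContinuousAlternatingMap (V.phi k g) := by
  ext1 w
  change V.phi (k + 1) g (Fin.cons v w) = V.phi k g w ∘L V.iE (mcf E g v)
  have h1 : (fun j => mcf E g (Fin.cons (α := fun _ => E) v w j)) =
      Fin.cons (mcf E g v) fun j => mcf E g (w j) := by
    funext j
    refine Fin.cases ?_ (fun j => ?_) j <;> rfl
  rw [phi_apply, phi_apply, h1, iRev_cons, ContinuousLinearMap.comp_assoc]

theorem phi_zero (g : G) (w : Fin 0 → E) : V.phi 0 g w = V.ρ g := by
  rw [phi_apply, iRev_zero, ContinuousLinearMap.comp_id]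

theorem phi_mem [ConnectedSpace G] (k : ℕ) (g : G) (w : Fin k → E) :
    V.phi k g w ∈ HomDeg V V (-k) := fun n v hv => by
  rw [phi_apply]
  exact V.rho_mem g _ (V.iRev_mem k _ n v hv)

theorem phi_smooth (k : ℕ) (x : G) : SmoothFormAt 𝓘(ℝ, E) (V.phi k) x := by
  have h1 : ContDiffAt ℝ ∞ (fun y => (V.iRev k).compContinuousLinearMap
      ((mcf E (par E x y)).comp (tmap 𝓘(ℝ, E) 𝓘(ℝ, E) (par E x) y))) (cha E x x) :=
    ContDiffAt.alt_comp contDiffAt_const (contDiffAt_mcf x)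
  have h2 : ContDiffAt ℝ ∞ (fun y => V.ρ (par E x y)) (cha E x x) :=
    contMDiffAt_iff_contDiffAt.1
      (ContMDiffAt.comp (g := V.ρ) (I' := 𝓘(ℝ, E)) _ (V.ρ_smooth _) (contMDiffAt_par x))
  have h3 := contDiffAt_comp_alt
    ((ContinuousLinearMap.compL ℝ V.V V.V V.V).contDiff.contDiffAt.comp _ h2) h1
  refine h3.congr_of_eventuallyEq (.of_forall fun y => ?_)
  ext1 w
  exact V.phi_apply k _ _

/-- The equivariance of the representation form with respect to left and right translations. -/
theorem pb_phi_two_sided [ConnectedSpace G] (k : ℕ) (a b : G) :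
    pb 𝓘(ℝ, E) 𝓘(ℝ, E) (fun h : G => a * h * b⁻¹) (V.phi k) =
      mc (ContinuousLinearMap.compL ℝ V.V V.V V.V (V.ρ a) ∘L
        (ContinuousLinearMap.compL ℝ V.V V.V V.V).flip (V.ρ b⁻¹)) (V.phi k) := by
  funext h
  ext1 w
  change V.phi k (a * h * b⁻¹) (fun j => tmap 𝓘(ℝ, E) 𝓘(ℝ, E) (fun h : G => a * h * b⁻¹) h (w j)) =
    V.ρ a ∘L (V.phi k h w ∘L V.ρ b⁻¹)
  rw [phi_apply, phi_apply]
  have h1 : ∀ x, mcf E (a * h * b⁻¹) (tmap 𝓘(ℝ, E) 𝓘(ℝ, E) (fun h : G => a * h * b⁻¹) h x) =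
      Ad E b (mcf E h x) := fun x => congrArg (fun D : E →L[ℝ] E => D x) (mcf_two_sided a b h)
  simp only [h1, rho_mul]
  have h2 := V.rho_iRev b k (fun j => mcf E h (w j))
  have h3 : V.ρ b⁻¹ ∘L V.iRev k (fun j => Ad E b (mcf E h (w j))) =
      V.iRev k (fun j => mcf E h (w j)) ∘L V.ρ b⁻¹ := by
    have := congrArg (fun A => V.ρ b⁻¹ ∘L A ∘L V.ρ b⁻¹) h2
    simp only [ContinuousLinearMap.comp_assoc, rho_comp_inv] at this
    rw [← ContinuousLinearMap.comp_assoc, rho_inv_comp] at this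
    exact this.symm
  simp only [ContinuousLinearMap.comp_assoc, h3]

section

variable {E₂ : Type*} [NormedAddCommGroup E₂] [NormedSpace ℝ E₂]
  {H₂ : Type*} [TopologicalSpace H₂] {J : ModelWithCorners ℝ E₂ H₂}
  {N : Type*} [TopologicalSpace N] [ChartedSpace H₂ N]

variable (J) in
/-- The terms of the formula for the pullback of the representation form along a product. -/
def phiTerm (f₁ f₂ : N → G) (a b k : ℕ) : N → E₂ [⋀^Fin k]→L[ℝ] (V.V →L[ℝ] V.V) :=
  if h : a + b = k then (-1 : ℝ) ^ (a * b) • wd (ContinuousLinearMap.compL ℝ V.V V.V V.V) h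
    (pb J 𝓘(ℝ, E) f₁ (V.phi a)) (pb J 𝓘(ℝ, E) f₂ (V.phi b)) else 0

/-- The multiplicativity of the representation form: its pullback along a product is the exterior
product of the pullbacks, with a sign. -/
theorem pb_phi_mul [ConnectedSpace G] {f₁ f₂ : N → G}
    (h₁ : MDifferentiable J 𝓘(ℝ, E) f₁) (h₂ : MDifferentiable J 𝓘(ℝ, E) f₂) (k : ℕ) :
    pb J 𝓘(ℝ, E) (fun y => f₁ y * f₂ y) (V.phi k) =
      ∑ t ∈ Finset.HasAntidiagonal.antidiagonal k, V.phiTerm J f₁ f₂ t.1 t.2 k := by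
  funext x
  have hp : ∀ (f : N → G) (l : ℕ), pb J 𝓘(ℝ, E) f (V.phi l) x =
      (ContinuousLinearMap.compL ℝ V.V V.V V.V (V.ρ (f x))).compContinuousAlternatingMap
        ((V.iRev l).compContinuousLinearMap
          ((mcf E (f x)).comp (tmap J 𝓘(ℝ, E) f x))) := fun f l => by
    ext1 w
    exact V.phi_apply l _ _
  have h3 : (∑ t ∈ Finset.HasAntidiagonal.antidiagonal k, V.phiTerm J f₁ f₂ t.1 t.2 k) x =
      ∑ t ∈ Finset.HasAntidiagonal.antidiagonal k, V.phiTerm J f₁ f₂ t.1 t.2 k x :=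
    Finset.sum_apply _ _ _
  rw [h3, hp, mcf_mul_tmap (h₁ x) (h₂ x), iRev_comp_add]
  ext1 w
  simp only [ContinuousLinearMap.compContinuousAlternatingMap_coe, Function.comp_apply,
    ContinuousAlternatingMap.sum_apply, map_sum]
  refine Finset.sum_congr rfl fun t ht => ?_
  have ht' := Finset.HasAntidiagonal.mem_antidiagonal.1 ht
  rw [iRevTerm, phiTerm, dif_pos ht', dif_pos ht']
  change _ = (-1 : ℝ) ^ (t.1 * t.2) • altWedge (ContinuousLinearMap.compL ℝ V.V V.V V.V) ht'
    (pb J 𝓘(ℝ, E) f₁ (V.phi t.1) x) (pb J 𝓘(ℝ, E) f₂ (V.phi t.2) x) w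
  rw [ContinuousAlternatingMap.smul_apply, map_smul]
  congr 1
  rw [hp, hp]
  refine congrArg (fun c : E₂ [⋀^Fin k]→L[ℝ] (V.V →L[ℝ] V.V) => c w)
    (altWedge_coeff (ContinuousLinearMap.compL ℝ V.V V.V V.V) ht'
    (ContinuousLinearMap.compL ℝ V.V V.V V.V (V.ρ (f₁ x * f₂ x))) fun y z => ?_)
  set A₁ := (mcf E (f₁ x)).comp (tmap J 𝓘(ℝ, E) f₁ x)
  set A₂ := (mcf E (f₂ x)).comp (tmap J 𝓘(ℝ, E) f₂ x)
  change V.ρ (f₁ x * f₂ x) ∘L (V.iRev t.1 (fun j => Ad E (f₂ x)⁻¹ (A₁ (y j))) ∘L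
    V.iRev t.2 (A₂ ∘ z)) = (V.ρ (f₁ x) ∘L V.iRev t.1 (A₁ ∘ y)) ∘L V.ρ (f₂ x) ∘L
      V.iRev t.2 (A₂ ∘ z)
  -- Moving `ρ (f₂ x)` past the contractions of the first factor cancels the adjoint action.
  have h4 : ∀ e, Ad E (f₂ x) (Ad E (f₂ x)⁻¹ e) = e := fun e => by
    rw [← ContinuousLinearMap.comp_apply, ← Ad_mul, mul_inv_cancel, Ad_one]
    rfl
  have h5 := V.rho_iRev (f₂ x) t.1 (fun j => Ad E (f₂ x)⁻¹ (A₁ (y j)))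
  simp only [h4] at h5
  rw [rho_mul, ContinuousLinearMap.comp_assoc, ← ContinuousLinearMap.comp_assoc (V.ρ (f₂ x)), h5]
  rfl

end

variable (G) in
/-- A curve through the identity with velocity `x`. -/
def curve (x : E) (t : ℝ) : G := par E (1 : G) (cen E G + t • x)

theorem curve_zero (x : E) : curve G x 0 = 1 := by simp [curve]

theorem contMDiffAt_curve (x : E) {X : Type*} [NormedAddCommGroup X] [NormedSpace ℝ X] (z : X)
    {u : X → ℝ} (hu : ContDiffAt ℝ ∞ u z) (h0 : u z = 0) :
    ContMDiffAt 𝓘(ℝ, X) 𝓘(ℝ, E) ∞ (fun y => curve G x (u y)) z :=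
  ContMDiffAt.comp_of_eq (contMDiffAt_par (1 : G))
    (contMDiffAt_iff_contDiffAt.2 (contDiffAt_const.add (hu.smul contDiffAt_const)))
    (by simp [h0])

theorem tmap_curve (x : E) : tmap 𝓘(ℝ, ℝ) 𝓘(ℝ, E) (curve G x) 0 1 = x := by
  have h1 : HasFDerivAt (fun t : ℝ => cen E G + t • x)
      ((ContinuousLinearMap.id ℝ ℝ).smulRight x) 0 :=
    ((ContinuousLinearMap.id ℝ ℝ).smulRight x).hasFDerivAt.const_add _
  have h2 : MDifferentiableAt 𝓘(ℝ, E) 𝓘(ℝ, E) (par E (1 : G)) (cen E G + (0 : ℝ) • x) := by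
    rw [zero_smul, add_zero]
    exact (contMDiffAt_par (1 : G)).mdifferentiableAt (by simp)
  have h3 := tmap_comp' (f := fun t : ℝ => cen E G + t • x) h2
    h1.differentiableAt.mdifferentiableAt
  rw [tmap_eq_fderiv, h1.fderiv, zero_smul, add_zero, tmap_extChartAt_symm_self] at h3
  have h4 := congrArg (fun D : ℝ →L[ℝ] E => D 1) h3
  refine h4.trans ?_
  simp

theorem mdiff_curve (x : E) : MDifferentiableAt 𝓘(ℝ, ℝ) 𝓘(ℝ, E) (curve G x) 0 :=
  (contMDiffAt_curve x (0 : ℝ) contDiffAt_id rfl).mdifferentiableAt (by simp)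

/-- The derivative of the representation along a curve through the identity. -/
theorem hasDerivAt_rho {c : ℝ → G} (hc : MDifferentiableAt 𝓘(ℝ, ℝ) 𝓘(ℝ, E) c 0) (h0 : c 0 = 1) :
    HasDerivAt (fun t => V.ρ (c t)) (V.LE (tmap 𝓘(ℝ, ℝ) 𝓘(ℝ, E) c 0 1)) 0 := by
  have h1 := tmap_comp' (V.mdiff_rho _) hc
  have h2 : DifferentiableAt ℝ (fun t => V.ρ (c t)) 0 :=
    (MDifferentiableAt.comp (0 : ℝ) (V.mdiff_rho _) hc).differentiableAt
  rw [tmap_eq_fderiv, h0] at h1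
  have h3 := h2.hasFDerivAt.hasDerivAt
  rw [h1] at h3
  exact h3.congr_deriv (V.tmap_rho_one _)

theorem hasDerivAt_rho_inv {c : ℝ → G} (hc : MDifferentiableAt 𝓘(ℝ, ℝ) 𝓘(ℝ, E) c 0)
    (h0 : c 0 = 1) :
    HasDerivAt (fun t => V.ρ (c t)⁻¹) (-V.LE (tmap 𝓘(ℝ, ℝ) 𝓘(ℝ, E) c 0 1)) 0 := by
  have hr : MDifferentiableAt 𝓘(ℝ, E) 𝓘(ℝ, V.V →L[ℝ] V.V) (fun g => V.ρ g⁻¹) (c 0) := by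
    rw [h0]
    exact V.mdiff_rho_inv_one
  have h1 := tmap_comp' hr hc
  have h2 : DifferentiableAt ℝ (fun t => V.ρ (c t)⁻¹) 0 :=
    (MDifferentiableAt.comp (0 : ℝ) hr hc).differentiableAt
  rw [tmap_eq_fderiv, h0] at h1
  have h3 := h2.hasFDerivAt.hasDerivAt
  rw [h1] at h3
  exact h3.congr_deriv (V.tmap_rho_inv_one _)

theorem hasDerivAt_rho_curve (x : E) : HasDerivAt (fun t => V.ρ (curve G x t)) (V.LE x) 0 :=
  (V.hasDerivAt_rho (mdiff_curve x) (curve_zero x)).congr_deriv (congrArg V.LE (tmap_curve x))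

theorem tmap_left_mcf (g : G) (v : E) :
    tmap 𝓘(ℝ, E) 𝓘(ℝ, E) (fun h : G => g * h) 1 (mcf E g v) = v := by
  have h := tmap_comp' (g := fun h : G => g * h) (f := fun h : G => g⁻¹ * h) (x := g)
    (mdiff_left E _ _) (mdiff_left E _ _)
  simp only [mul_inv_cancel_left, inv_mul_cancel] at h
  have h1 := congrArg (fun D : E →L[ℝ] E => D v) h
  have h2 := tmap_id (I := 𝓘(ℝ, E)) g
  change tmap 𝓘(ℝ, E) 𝓘(ℝ, E) (fun g : G => g) g = _ at h2
  rw [h2] at h1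
  exact h1.symm

theorem mcf_tmap_left (g : G) (x : E) :
    mcf E g (tmap 𝓘(ℝ, E) 𝓘(ℝ, E) (fun h : G => g * h) 1 x) = x := by
  have h := mcf_left (E := E) g 1
  rw [mul_one, mcf_one] at h
  exact congrArg (fun D : E →L[ℝ] E => D x) h

/-- The exterior derivative of the representation form, by induction on the degree, using Cartan's
formula for left invariant vector fields. -/
theorem ed_phi [ConnectedSpace G] (k : ℕ) : ed 𝓘(ℝ, E) (V.phi k) =
    (-1 : ℝ) ^ k • mc (ContinuousLinearMap.compL ℝ V.V V.V V.V V.δ) (V.phi (k + 1)) +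
      mc ((ContinuousLinearMap.compL ℝ V.V V.V V.V).flip V.δ) (V.phi (k + 1)) := by
  have hX : ∀ (x : E) (h : G), tmap 𝓘(ℝ, ℝ) 𝓘(ℝ, E) (fun t => h * curve G x t) 0 1 =
      tmap 𝓘(ℝ, E) 𝓘(ℝ, E) (fun h' : G => h * h') 1 x := fun x h => by
    have h1 := tmap_comp' (f := curve G x) (g := fun h' : G => h * h') (x := (0 : ℝ))
      (mdiff_left E _ _) (mdiff_curve x)
    rw [h1, curve_zero]
    exact congrArg (tmap 𝓘(ℝ, E) 𝓘(ℝ, E) (fun h' : G => h * h') 1) (tmap_curve x)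
  have hu : ∀ (x : E) (g : G), ContMDiffAt 𝓘(ℝ, ℝ × E) 𝓘(ℝ, E) ∞
      (famChart 𝓘(ℝ, E) (fun t h => h * curve G x t) g) (0, extChartAt 𝓘(ℝ, E) g g) :=
    fun x g => ContMDiffAt.mul
      (ContMDiffAt.comp_of_eq (contMDiffAt_par g) (contMDiffAt_iff_contDiffAt.2 contDiffAt_snd) rfl)
      (contMDiffAt_curve x _ contDiffAt_fst rfl)
  have h0 : ∀ (x : E) (z : G), (fun t h => h * curve G x t) (0 : ℝ) z = z := fun x z => by
    simp [curve_zero]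
  have hd : ∀ (k : ℕ) (x : E) (g : G) (w : Fin k → E), HasDerivAt (fun t =>
      pb 𝓘(ℝ, E) 𝓘(ℝ, E) (fun h => h * curve G x t) (V.phi k) g w) (V.phi k g w ∘L V.LE x) 0 := by
    intro k x g w
    have h1 : ∀ t, pb 𝓘(ℝ, E) 𝓘(ℝ, E) (fun h => h * curve G x t) (V.phi k) g w =
        V.phi k g w ∘L V.ρ (curve G x t) := fun t => by
      have h2 := V.pb_phi_two_sided k 1 (curve G x t)⁻¹
      simp only [one_mul, inv_inv] at h2
      rw [h2]
      change V.ρ 1 ∘L (V.phi k g w ∘L V.ρ (curve G x t)) = _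
      rw [rho_one, ContinuousLinearMap.id_comp]
    simp only [h1]
    exact (ContinuousLinearMap.compL ℝ V.V V.V V.V (V.phi k g w)).hasFDerivAt.comp_hasDerivAt
      (0 : ℝ) (V.hasDerivAt_rho_curve x)
  have hL : ∀ x, V.LE x = V.iE x ∘L V.δ + V.δ ∘L V.iE x := fun x => (V.i_δ x).symm
  have hev : ∀ {k : ℕ} {g : G} {D : E [⋀^Fin k]→L[ℝ] (V.V →L[ℝ] V.V)} {f : ℝ → G → G}
      (w : Fin k → E), HasDerivAt (fun t => pb 𝓘(ℝ, E) 𝓘(ℝ, E) (f t) (V.phi k) g) D 0 →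
      HasDerivAt (fun t => pb 𝓘(ℝ, E) 𝓘(ℝ, E) (f t) (V.phi k) g w) (D w) 0 := fun w h =>
    h.alt_apply w
  -- Along a left invariant vector field the form changes by composition with `L x` (`hd`), and its
  -- contraction is a form of degree one less, composed with `i x`. Hence Cartan's formula
  -- determines the exterior derivatives inductively.
  induction k with
  | zero =>
    funext g
    refine alt_ext_curryLeft fun v => ?_
    ext1 w
    have h1 := hev w (hasDerivAt_pb_zero (hu (mcf E g v) g) (h0 _) (V.phi_smooth 0))
    rw [hX, tmap_left_mcf] at h1
    rw [h1.unique (hd 0 (mcf E g v) g w), hL]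
    have h2 : V.phi 1 g (Fin.cons v w) = V.phi 0 g w ∘L V.iE (mcf E g v) :=
      congrArg (fun c => c w) (V.phi_curryLeft 0 g v)
    change _ = (-1 : ℝ) ^ 0 • (V.δ ∘L V.phi 1 g (Fin.cons v w)) + V.phi 1 g (Fin.cons v w) ∘L V.δ
    rw [h2, phi_zero, pow_zero, one_smul, ContinuousLinearMap.comp_add,
      ← ContinuousLinearMap.comp_assoc, ← ContinuousLinearMap.comp_assoc,
      ← ContinuousLinearMap.comp_assoc, rho_delta]
    abel
  | succ k ih =>
    funext g
    refine alt_ext_curryLeft fun v => ?_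
    ext1 w
    have hc : ∀ z : G, (V.phi (k + 1) z).curryLeft
        (tmap 𝓘(ℝ, ℝ) 𝓘(ℝ, E) (fun t => z * curve G (mcf E g v) t) 0 1) =
        mc ((ContinuousLinearMap.compL ℝ V.V V.V V.V).flip (V.iE (mcf E g v))) (V.phi k) z :=
      fun z => by rw [hX, phi_curryLeft, mcf_tmap_left]; rfl
    have h1 := hev w (hasDerivAt_pb_succ (hu (mcf E g v) g) (h0 _) (V.phi_smooth (k + 1)))
    simp only [hc] at h1
    rw [hX, tmap_left_mcf] at h1
    have h2 := h1.unique (hd (k + 1) (mcf E g v) g w)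
    have h3 : ed 𝓘(ℝ, E) (fun z : G => mc ((ContinuousLinearMap.compL ℝ V.V V.V V.V).flip
        (V.iE (mcf E g v))) (V.phi k) z) g w =
        ((-1 : ℝ) ^ k • (V.δ ∘L V.phi (k + 1) g w) + V.phi (k + 1) g w ∘L V.δ) ∘L
          V.iE (mcf E g v) := by
      have h4 := ed_mc (V.phi_smooth k g)
        ((ContinuousLinearMap.compL ℝ V.V V.V V.V).flip (V.iE (mcf E g v)))
      rw [ih] at h4
      exact congrArg (fun c => c w) h4
    rw [ContinuousAlternatingMap.add_apply, h3, hL] at h2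
    have h5 : V.phi (k + 2) g (Fin.cons v w) = V.phi (k + 1) g w ∘L V.iE (mcf E g v) :=
      congrArg (fun c => c w) (V.phi_curryLeft (k + 1) g v)
    change _ = (-1 : ℝ) ^ (k + 1) • (V.δ ∘L V.phi (k + 2) g (Fin.cons v w)) +
      V.phi (k + 2) g (Fin.cons v w) ∘L V.δ
    rw [h5, eq_sub_of_add_eq h2, pow_succ]
    simp only [ContinuousLinearMap.comp_add, ContinuousLinearMap.add_comp,
      ContinuousLinearMap.smul_comp, ContinuousLinearMap.comp_assoc, mul_neg, mul_one, neg_smul]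
    abel

end TRep

/-! ### Signs -/

section Signs

/-- The sign `(-1) ^ m`, as a real number. -/
def sgn (m : ℤ) : ℝ := ((m.negOnePow : ℤ) : ℝ)

theorem negOnePow_smul {F : Type*} [AddCommGroup F] [Module ℝ F] (m : ℤ) (x : F) :
    m.negOnePow • x = sgn m • x := by
  rw [Units.smul_def, sgn, Int.cast_smul_eq_zsmul]

theorem sgn_add (m n : ℤ) : sgn (m + n) = sgn m * sgn n := by
  simp [sgn, Int.negOnePow_add]

theorem sgn_mul_self (m : ℤ) : sgn m * sgn m = 1 := by
  rw [← sgn_add]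
  simp [sgn, Int.negOnePow_even _ ⟨m, rfl⟩]

theorem sgn_natCast (n : ℕ) : sgn n = (-1) ^ n := by
  rcases Nat.even_or_odd n with h | h
  · simp [sgn, Int.negOnePow_even _ (Int.even_coe_nat n |>.2 h), h.neg_one_pow]
  · have h' : Odd (n : ℤ) := by exact_mod_cast h
    simp [sgn, Int.negOnePow_odd _ h', h.neg_one_pow]

theorem sgn_one : sgn 1 = -1 := by simp [sgn]

theorem sgn_zero : sgn 0 = 1 := by simp [sgn]

theorem sgn_congr {m n : ℤ} (h : Even (m + n)) : sgn m = sgn n := by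
  have h1 : sgn (m + n) = 1 := by simp [sgn, Int.negOnePow_even _ h]
  rw [sgn_add] at h1
  calc sgn m = sgn m * (sgn n * sgn n) := by rw [sgn_mul_self, mul_one]
    _ = sgn n := by rw [← mul_assoc, h1, one_mul]

theorem sgn_add_one (m : ℤ) : sgn (m + 1) = -sgn m := by rw [sgn_add, sgn_one, mul_neg_one]

end Signs

/-! ### The algebra of cochains -/

section PowForms

variable {E : Type v} [NormedAddCommGroup E] [NormedSpace ℝ E] [FiniteDimensional ℝ E]
  {G : Type w} [TopologicalSpace G] [ChartedSpace E G] [Group G] [LieGroup 𝓘(ℝ, E) ∞ G]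
  {p p₁ p₂ : ℕ}

variable (E) in
theorem contMDiff_front (h : p₁ + p₂ = p) :
    ContMDiff (powModel E p) (powModel E p₁) ∞ (front (G := G) h) :=
  contMDiff_pow_iff.2 fun _ => contMDiff_pow_proj _

variable (E) in
theorem contMDiff_back (h : p₁ + p₂ = p) :
    ContMDiff (powModel E p) (powModel E p₂) ∞ (back (G := G) h) :=
  contMDiff_pow_iff.2 fun _ => contMDiff_pow_proj _

variable (E) in
theorem contMDiff_face (a : Fin (p + 2)) :
    ContMDiff (powModel E (p + 1)) (powModel E p) ∞ (face (G := G) a) :=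
  contMDiff_pow_iff.2 fun j => by
    by_cases h1 : (j : ℕ) + 1 < a
    · simpa only [face, if_pos h1] using contMDiff_pow_proj (E := E) (G := G) j.castSucc
    · by_cases h2 : (j : ℕ) + 1 = a
      · simp only [face, if_neg h1, if_pos h2]
        exact (contMDiff_pow_proj (E := E) (G := G) j.castSucc).mul
          (contMDiff_pow_proj (E := E) (G := G) j.succ)
      · simpa only [face, if_neg h1, if_neg h2] using contMDiff_pow_proj (E := E) (G := G) j.succ

variable (E) in
theorem contMDiff_zeta (a : Fin (p + 1) → G) :
    ContMDiff (powModel E p) (powModel E p) ∞ (zeta a) :=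
  contMDiff_pow_iff.2 fun _ => (contMDiff_const.mul (contMDiff_pow_proj _)).mul contMDiff_const

theorem ContMDiff.mdiff {E₁ E₂ H₁ H₂ M N : Type*} [NormedAddCommGroup E₁] [NormedSpace ℝ E₁]
    [NormedAddCommGroup E₂] [NormedSpace ℝ E₂] [TopologicalSpace H₁] [TopologicalSpace H₂]
    {I : ModelWithCorners ℝ E₁ H₁} {J : ModelWithCorners ℝ E₂ H₂} [TopologicalSpace M]
    [ChartedSpace H₁ M] [TopologicalSpace N] [ChartedSpace H₂ N] {f : M → N}
    (h : ContMDiff I J ∞ f) : MDifferentiable I J f := h.mdifferentiable (by simp)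

end PowForms

section Cochains

variable {E : Type v} [NormedAddCommGroup E] [NormedSpace ℝ E] [FiniteDimensional ℝ E]
  {G : Type w} [TopologicalSpace G] [ChartedSpace E G] [Group G] [LieGroup 𝓘(ℝ, E) ∞ G]

variable (E G) in
/-- Forms on `BG_p`, whose values are regarded as alternating maps on the model space. -/
abbrev PForm (p q : ℕ) (F : Type*) [NormedAddCommGroup F] [NormedSpace ℝ F] : Type _ :=
  (Fin p → G) → (Fin p → E) [⋀^Fin q]→L[ℝ] F

/-- Cochains, consisting of forms whose values are regarded as alternating maps on the model
spaces. -/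
abbrev PCochain (V W : TRep.{u} (E := E) G) : Type _ := (p q : ℕ) → PForm E G p q (V.V →L[ℝ] W.V)

variable {V W X Y : TRep.{u} (E := E) G}

-- Shortcuts which keep instance searches short.
instance TRep.mulAction (V : TRep.{u} (E := E) G) : MulAction ℝ V.V := inferInstance

instance TRep.homTopologicalSpace : TopologicalSpace (V.V →L[ℝ] W.V) := inferInstance

instance TRep.homAddCommMonoid : AddCommMonoid (V.V →L[ℝ] W.V) := inferInstance

instance TRep.homAddCommGroup : AddCommGroup (V.V →L[ℝ] W.V) := inferInstance

instance TRep.homNormedSpace : NormedSpace ℝ (V.V →L[ℝ] W.V) := inferInstance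

instance TRep.homModule : Module ℝ (V.V →L[ℝ] W.V) := inferInstance

instance TRep.homContinuousAdd : ContinuousAdd (V.V →L[ℝ] W.V) := inferInstance

instance TRep.homIsTopologicalAddGroup : IsTopologicalAddGroup (V.V →L[ℝ] W.V) := inferInstance

instance TRep.homContinuousConstSMul : ContinuousConstSMul ℝ (V.V →L[ℝ] W.V) := inferInstance

instance TRep.homFiniteDimensional : FiniteDimensional ℝ (V.V →L[ℝ] W.V) := inferInstance

instance TRep.altAdd {p q : ℕ} : Add ((Fin p → E) [⋀^Fin q]→L[ℝ] (V.V →L[ℝ] W.V)) := inferInstance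

instance TRep.altZero {p q : ℕ} : Zero ((Fin p → E) [⋀^Fin q]→L[ℝ] (V.V →L[ℝ] W.V)) :=
  inferInstance

instance TRep.altSMul {p q : ℕ} : SMul ℝ ((Fin p → E) [⋀^Fin q]→L[ℝ] (V.V →L[ℝ] W.V)) :=
  inferInstance

instance TRep.altAddZeroClass {p q : ℕ} : AddZeroClass ((Fin p → E) [⋀^Fin q]→L[ℝ] (V.V →L[ℝ] W.V)) :=
  inferInstance

instance TRep.altAddMonoid {p q : ℕ} : AddMonoid ((Fin p → E) [⋀^Fin q]→L[ℝ] (V.V →L[ℝ] W.V)) :=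
  inferInstance

instance TRep.altAddCommMonoid {p q : ℕ} : AddCommMonoid ((Fin p → E) [⋀^Fin q]→L[ℝ] (V.V →L[ℝ] W.V)) :=
  inferInstance

instance TRep.altAddCommGroup {p q : ℕ} : AddCommGroup ((Fin p → E) [⋀^Fin q]→L[ℝ] (V.V →L[ℝ] W.V)) :=
  inferInstance

instance TRep.altSMulZeroClass {p q : ℕ} : SMulZeroClass ℝ ((Fin p → E) [⋀^Fin q]→L[ℝ] (V.V →L[ℝ] W.V)) :=
  inferInstance

instance TRep.altDistribSMul {p q : ℕ} : DistribSMul ℝ ((Fin p → E) [⋀^Fin q]→L[ℝ] (V.V →L[ℝ] W.V)) :=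
  inferInstance

instance TRep.altMulAction {p q : ℕ} : MulAction ℝ ((Fin p → E) [⋀^Fin q]→L[ℝ] (V.V →L[ℝ] W.V)) :=
  inferInstance

instance TRep.altModule {p q : ℕ} : Module ℝ ((Fin p → E) [⋀^Fin q]→L[ℝ] (V.V →L[ℝ] W.V)) :=
  inferInstance

instance PForm.formAdd {p q : ℕ} : Add (PForm E G p q (V.V →L[ℝ] W.V)) := inferInstance

instance PForm.formZero {p q : ℕ} : Zero (PForm E G p q (V.V →L[ℝ] W.V)) := inferInstance

instance PForm.formSMul {p q : ℕ} : SMul ℝ (PForm E G p q (V.V →L[ℝ] W.V)) := inferInstance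

instance PForm.formAddZeroClass {p q : ℕ} : AddZeroClass (PForm E G p q (V.V →L[ℝ] W.V)) :=
  inferInstance

instance PForm.formAddMonoid {p q : ℕ} : AddMonoid (PForm E G p q (V.V →L[ℝ] W.V)) :=
  inferInstance

instance PForm.formAddCommMonoid {p q : ℕ} : AddCommMonoid (PForm E G p q (V.V →L[ℝ] W.V)) :=
  inferInstance

instance PForm.formAddCommGroup {p q : ℕ} : AddCommGroup (PForm E G p q (V.V →L[ℝ] W.V)) :=
  inferInstance

instance PForm.formSMulZeroClass {p q : ℕ} : SMulZeroClass ℝ (PForm E G p q (V.V →L[ℝ] W.V)) :=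
  inferInstance

instance PForm.formDistribSMul {p q : ℕ} : DistribSMul ℝ (PForm E G p q (V.V →L[ℝ] W.V)) :=
  inferInstance

instance PForm.formMulAction {p q : ℕ} : MulAction ℝ (PForm E G p q (V.V →L[ℝ] W.V)) :=
  inferInstance

instance PForm.formModule {p q : ℕ} : Module ℝ (PForm E G p q (V.V →L[ℝ] W.V)) := inferInstance

instance PCochain.cochainAdd : Add (PCochain V W) := inferInstance

instance PCochain.cochainZero : Zero (PCochain V W) := inferInstance

instance PCochain.cochainSMul : SMul ℝ (PCochain V W) := inferInstance

instance PCochain.cochainAddZeroClass : AddZeroClass (PCochain V W) := inferInstance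

instance PCochain.cochainAddCommMonoid : AddCommMonoid (PCochain V W) := inferInstance

instance PCochain.cochainAddCommGroup : AddCommGroup (PCochain V W) := inferInstance

instance PCochain.cochainSMulZeroClass : SMulZeroClass ℝ (PCochain V W) := inferInstance

instance PCochain.cochainDistribSMul : DistribSMul ℝ (PCochain V W) := inferInstance

instance PCochain.cochainMulAction : MulAction ℝ (PCochain V W) := inferInstance

instance PCochain.cochainModule : Module ℝ (PCochain V W) := inferInstance

/-- The exterior product of forms on `BG_p₁` and `BG_p₂`, as a form on `BG_p`. -/
def blk {p₁ p₂ p q₁ q₂ q : ℕ} (hp : p₁ + p₂ = p) (hq : q₁ + q₂ = q)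
    (α : PForm E G p₁ q₁ (W.V →L[ℝ] X.V)) (β : PForm E G p₂ q₂ (V.V →L[ℝ] W.V)) :
    PForm E G p q (V.V →L[ℝ] X.V) :=
  wd (ContinuousLinearMap.compL ℝ V.V W.V X.V) hq
    (pb (powModel E p) (powModel E p₁) (front hp) α)
    (pb (powModel E p) (powModel E p₂) (back hp) β)

namespace PCochain

/-- The vertical differential. -/
def dB (η : PCochain V W) : PCochain V W := fun p q =>
  match q with
  | 0 => 0
  | q + 1 => (-1 : ℝ) ^ p • ed (powModel E p) (η p q)

/-- The alternating sum of the pullbacks along all face maps. -/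
def allD (η : PCochain V W) : PCochain V W := fun p q =>
  match p with
  | 0 => 0
  | p + 1 => ∑ a : Fin (p + 2), (-1 : ℝ) ^ (a : ℕ) •
      pb (powModel E (p + 1)) (powModel E p) (face a) (η p q)

/-- The alternating sum of the pullbacks of a form along the face maps different from the first and
the last one. -/
def intFace {p q : ℕ} {F : Type*} [NormedAddCommGroup F] [NormedSpace ℝ F] (α : PForm E G p q F) :
    PForm E G (p + 1) q F :=
  ∑ a : Fin p, (-1 : ℝ) ^ ((a : ℕ) + 1) •
    pb (powModel E (p + 1)) (powModel E p) (face a.succ.castSucc) α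

/-- The alternating sum of the pullbacks along the face maps different from the first and the last
one. -/
def intD (η : PCochain V W) : PCochain V W := fun p q =>
  match p with
  | 0 => 0
  | _ + 1 => intFace (η _ q)

/-- The differential induced by those of `V` and `W` on forms with coefficients of degree `r`, up
to a sign. -/
def coeffD (r : ℤ) {p q : ℕ} (α : PForm E G p q (V.V →L[ℝ] W.V)) : PForm E G p q (V.V →L[ℝ] W.V) :=
  mc (ContinuousLinearMap.compL ℝ V.V W.V W.V W.δ) α -
    sgn r • mc ((ContinuousLinearMap.compL ℝ V.V V.V W.V).flip V.δ) α

/-- The differential induced by those of `V` and `W`, on cochains of total degree `m`. -/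
def dl (m : ℤ) (η : PCochain V W) : PCochain V W := fun p q =>
  (-1 : ℝ) ^ (p + q) • coeffD (m - p - q) (η p q)

/-- The sign of the product of forms of degrees `q₁` and `q₂` on `BG_p₁` and `BG_p₂`, where the
first factor has total degree `m`. -/
def cupSign (m : ℤ) (p₁ q₁ p₂ q₂ : ℕ) : ℝ := sgn ((m - p₁ - q₁) * (p₂ + q₂) + q₁ * p₂)

/-- The product of a cochain of total degree `m` and a cochain. -/
def cp (m : ℤ) (ψ : PCochain W X) (φ : PCochain V W) : PCochain V X := fun p q =>
  ∑ s : {s // s ∈ Finset.HasAntidiagonal.antidiagonal p},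
    ∑ t : {t // t ∈ Finset.HasAntidiagonal.antidiagonal q},
    cupSign m s.1.1 t.1.1 s.1.2 t.1.2 •
      blk (Finset.HasAntidiagonal.mem_antidiagonal.1 s.2)
        (Finset.HasAntidiagonal.mem_antidiagonal.1 t.2) (ψ s.1.1 t.1.1) (φ s.1.2 t.1.2)

/-- The cochain with the single component `α`. -/
def sg (p q : ℕ) (α : PForm E G p q (V.V →L[ℝ] W.V)) : PCochain V W :=
  Pi.single p (Pi.single q α)

theorem sg_same (p q : ℕ) (α : PForm E G p q (V.V →L[ℝ] W.V)) : sg p q α p q = α := by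
  simp [sg]

theorem sg_ne {p q p' q' : ℕ} (α : PForm E G p q (V.V →L[ℝ] W.V)) (h : p' ≠ p ∨ q' ≠ q) :
    sg p q α p' q' = 0 := by
  by_cases hp : p' = p
  · subst hp
    have hq : q' ≠ q := h.resolve_left fun h => h rfl
    simp [sg, hq]
  · simp [sg, hp]

theorem sg_add (p q : ℕ) (α β : PForm E G p q (V.V →L[ℝ] W.V)) :
    sg p q (α + β) = sg p q α + sg p q β := by
  simp [sg, Pi.single_add]

theorem sg_smul (p q : ℕ) (c : ℝ) (α : PForm E G p q (V.V →L[ℝ] W.V)) :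
    sg p q (c • α) = c • sg p q α := by
  rw [sg, sg, ← Pi.single_smul, ← Pi.single_smul]

theorem sg_zero (p q : ℕ) : sg p q (0 : PForm E G p q (V.V →L[ℝ] W.V)) = 0 := by
  simp [sg]

/-- A cochain agrees with the cochain with a single component `α` if its component is `α` and the
others vanish. -/
theorem eq_sg {p q : ℕ} {α : PForm E G p q (V.V →L[ℝ] W.V)} {η : PCochain V W} (h : η p q = α)
    (h' : ∀ p' q', p' ≠ p ∨ q' ≠ q → η p' q' = 0) : η = sg p q α := by
  funext p' q'
  by_cases hpq : p' = p ∧ q' = q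
  · obtain ⟨rfl, rfl⟩ := hpq
    rw [sg_same, h]
  · rw [not_and_or] at hpq
    rw [h' _ _ hpq, sg_ne _ hpq]

theorem pb_zero {E₁ E₂ H₁ H₂ M N F : Type*} [NormedAddCommGroup E₁] [NormedSpace ℝ E₁]
    [NormedAddCommGroup E₂] [NormedSpace ℝ E₂] [TopologicalSpace H₁] [TopologicalSpace H₂]
    {I : ModelWithCorners ℝ E₁ H₁} {J : ModelWithCorners ℝ E₂ H₂} [TopologicalSpace M]
    [ChartedSpace H₁ M] [TopologicalSpace N] [ChartedSpace H₂ N] [NormedAddCommGroup F]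
    [NormedSpace ℝ F] {q : ℕ} (f : M → N) : pb I J f (0 : N → E₂ [⋀^Fin q]→L[ℝ] F) = 0 := rfl

section blk

variable {p₁ p₂ p q₁ q₂ q : ℕ} (hp : p₁ + p₂ = p) (hq : q₁ + q₂ = q)

theorem blk_add_left (α α' : PForm E G p₁ q₁ (W.V →L[ℝ] X.V))
    (β : PForm E G p₂ q₂ (V.V →L[ℝ] W.V)) :
    blk hp hq (α + α') β = blk hp hq α β + blk hp hq α' β :=
  funext fun x => altWedge_add_left (ContinuousLinearMap.compL ℝ V.V W.V X.V) hq
    (pb (powModel E p) (powModel E p₁) (front hp) α x)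
    (pb (powModel E p) (powModel E p₁) (front hp) α' x)
    (pb (powModel E p) (powModel E p₂) (back hp) β x)

theorem blk_add_right (α : PForm E G p₁ q₁ (W.V →L[ℝ] X.V))
    (β β' : PForm E G p₂ q₂ (V.V →L[ℝ] W.V)) :
    blk hp hq α (β + β') = blk hp hq α β + blk hp hq α β' :=
  funext fun x => altWedge_add_right (ContinuousLinearMap.compL ℝ V.V W.V X.V) hq
    (pb (powModel E p) (powModel E p₁) (front hp) α x)
    (pb (powModel E p) (powModel E p₂) (back hp) β x)
    (pb (powModel E p) (powModel E p₂) (back hp) β' x)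

theorem blk_smul_left (c : ℝ) (α : PForm E G p₁ q₁ (W.V →L[ℝ] X.V))
    (β : PForm E G p₂ q₂ (V.V →L[ℝ] W.V)) : blk hp hq (c • α) β = c • blk hp hq α β :=
  funext fun x => altWedge_smul_left (ContinuousLinearMap.compL ℝ V.V W.V X.V) hq c
    (pb (powModel E p) (powModel E p₁) (front hp) α x)
    (pb (powModel E p) (powModel E p₂) (back hp) β x)

theorem blk_smul_right (c : ℝ) (α : PForm E G p₁ q₁ (W.V →L[ℝ] X.V))
    (β : PForm E G p₂ q₂ (V.V →L[ℝ] W.V)) : blk hp hq α (c • β) = c • blk hp hq α β :=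
  funext fun x => altWedge_smul_right (ContinuousLinearMap.compL ℝ V.V W.V X.V) hq c
    (pb (powModel E p) (powModel E p₁) (front hp) α x)
    (pb (powModel E p) (powModel E p₂) (back hp) β x)

theorem blk_zero_left (β : PForm E G p₂ q₂ (V.V →L[ℝ] W.V)) :
    blk hp hq (0 : PForm E G p₁ q₁ (W.V →L[ℝ] X.V)) β = 0 := by
  simpa using blk_smul_left hp hq 0 (0 : PForm E G p₁ q₁ (W.V →L[ℝ] X.V)) β

theorem blk_zero_right (α : PForm E G p₁ q₁ (W.V →L[ℝ] X.V)) :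
    blk hp hq α (0 : PForm E G p₂ q₂ (V.V →L[ℝ] W.V)) = 0 := by
  simpa using blk_smul_right hp hq 0 α (0 : PForm E G p₂ q₂ (V.V →L[ℝ] W.V))

theorem blk_sum_left {ι : Type*} (s : Finset ι) (α : ι → PForm E G p₁ q₁ (W.V →L[ℝ] X.V))
    (β : PForm E G p₂ q₂ (V.V →L[ℝ] W.V)) :
    blk hp hq (∑ i ∈ s, α i) β = ∑ i ∈ s, blk hp hq (α i) β :=
  map_sum (AddMonoidHom.mk' (fun α => blk hp hq α β) fun α α' => blk_add_left hp hq α α' β) _ _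

theorem blk_sum_right {ι : Type*} (s : Finset ι) (α : PForm E G p₁ q₁ (W.V →L[ℝ] X.V))
    (β : ι → PForm E G p₂ q₂ (V.V →L[ℝ] W.V)) :
    blk hp hq α (∑ i ∈ s, β i) = ∑ i ∈ s, blk hp hq α (β i) :=
  map_sum (AddMonoidHom.mk' (fun β => blk hp hq α β) fun β β' => blk_add_right hp hq α β β') _ _

end blk

theorem cp_add_left (m : ℤ) (ψ ψ' : PCochain W X) (φ : PCochain V W) :
    cp m (ψ + ψ') φ = cp m ψ φ + cp m ψ' φ := by
  funext p q
  simp only [cp, Pi.add_apply, blk_add_left, smul_add, Finset.sum_add_distrib]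

theorem cp_add_right (m : ℤ) (ψ : PCochain W X) (φ φ' : PCochain V W) :
    cp m ψ (φ + φ') = cp m ψ φ + cp m ψ φ' := by
  funext p q
  simp only [cp, Pi.add_apply, blk_add_right, smul_add, Finset.sum_add_distrib]

theorem cp_smul_left (m : ℤ) (c : ℝ) (ψ : PCochain W X) (φ : PCochain V W) :
    cp m (c • ψ) φ = c • cp m ψ φ := by
  funext p q
  simp only [cp, Pi.smul_apply, blk_smul_left, Finset.smul_sum, smul_comm _ c]

theorem cp_smul_right (m : ℤ) (c : ℝ) (ψ : PCochain W X) (φ : PCochain V W) :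
    cp m ψ (c • φ) = c • cp m ψ φ := by
  funext p q
  simp only [cp, Pi.smul_apply, blk_smul_right, Finset.smul_sum, smul_comm _ c]

theorem cp_sg (m : ℤ) {p₁ p₂ p q₁ q₂ q : ℕ} (hp : p₁ + p₂ = p) (hq : q₁ + q₂ = q)
    (α : PForm E G p₁ q₁ (W.V →L[ℝ] X.V)) (β : PForm E G p₂ q₂ (V.V →L[ℝ] W.V)) :
    cp m (sg p₁ q₁ α) (sg p₂ q₂ β) = sg p q (cupSign m p₁ q₁ p₂ q₂ • blk hp hq α β) := by
  have key : ∀ (p' q' : ℕ) (s : ℕ × ℕ) (t : ℕ × ℕ) (hs : s.1 + s.2 = p') (ht : t.1 + t.2 = q'),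
      ¬ (s = (p₁, p₂) ∧ t = (q₁, q₂)) →
      blk hs ht (sg p₁ q₁ α s.1 t.1) (sg p₂ q₂ β s.2 t.2) = 0 := by
    rintro p' q' ⟨s₁, s₂⟩ ⟨t₁, t₂⟩ hs ht h
    by_cases h1 : s₁ = p₁ ∧ t₁ = q₁
    · by_cases h2 : s₂ = p₂ ∧ t₂ = q₂
      · exact absurd ⟨by rw [h1.1, h2.1], by rw [h1.2, h2.2]⟩ h
      · rw [sg_ne β (not_and_or.1 h2), blk_zero_right]
    · rw [sg_ne α (not_and_or.1 h1), blk_zero_left]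
  refine eq_sg ?_ fun p' q' h => ?_
  · unfold cp
    rw [Finset.sum_eq_single ⟨(p₁, p₂), Finset.HasAntidiagonal.mem_antidiagonal.2 hp⟩,
      Finset.sum_eq_single ⟨(q₁, q₂), Finset.HasAntidiagonal.mem_antidiagonal.2 hq⟩]
    · simp only [sg_same]
    · intro t _ ht
      rw [key _ _ (p₁, p₂) t.1 _ _ fun h => ht (Subtype.ext h.2), smul_zero]
    · simp
    · intro s _ hs
      refine Finset.sum_eq_zero fun t _ => ?_
      rw [key _ _ s.1 t.1 _ _ fun h => hs (Subtype.ext h.1), smul_zero]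
    · simp
  · unfold cp
    refine Finset.sum_eq_zero fun s _ => Finset.sum_eq_zero fun t _ => ?_
    have hs := Finset.HasAntidiagonal.mem_antidiagonal.1 s.2
    have ht := Finset.HasAntidiagonal.mem_antidiagonal.1 t.2
    rw [key _ _ s.1 t.1 _ _, smul_zero]
    rintro ⟨h1, h2⟩
    rw [h1] at hs
    rw [h2] at ht
    rcases h with h | h
    · exact h (by rw [← hs, ← hp])
    · exact h (by rw [← ht, ← hq])

theorem intFace_add {p q : ℕ} {F : Type*} [NormedAddCommGroup F] [NormedSpace ℝ F]
    (α β : PForm E G p q F) : intFace (α + β) = intFace α + intFace β := by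
  have h : ∀ a : Fin p, pb (powModel E (p + 1)) (powModel E p) (face a.succ.castSucc) (α + β) =
    pb (powModel E (p + 1)) (powModel E p) (face a.succ.castSucc) α +
      pb (powModel E (p + 1)) (powModel E p) (face a.succ.castSucc) β := fun _ => rfl
  simp only [intFace, h, smul_add, Finset.sum_add_distrib]

theorem intFace_smul {p q : ℕ} {F : Type*} [NormedAddCommGroup F] [NormedSpace ℝ F]
    (c : ℝ) (α : PForm E G p q F) : intFace (c • α) = c • intFace α := by
  have h : ∀ a : Fin p, pb (powModel E (p + 1)) (powModel E p) (face a.succ.castSucc) (c • α) =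
    c • pb (powModel E (p + 1)) (powModel E p) (face a.succ.castSucc) α := fun _ => rfl
  simp only [intFace, h, Finset.smul_sum, smul_comm _ c]

theorem intFace_zero {p q : ℕ} {F : Type*} [NormedAddCommGroup F] [NormedSpace ℝ F] :
    intFace (0 : PForm E G p q F) = 0 := by
  simpa using intFace_smul 0 (0 : PForm E G p q F)

theorem coeffD_add (r : ℤ) {p q : ℕ} (α β : PForm E G p q (V.V →L[ℝ] W.V)) :
    coeffD r (α + β) = coeffD r α + coeffD r β := by
  have h : ∀ A : (V.V →L[ℝ] W.V) →L[ℝ] (V.V →L[ℝ] W.V), mc A (α + β) = mc A α + mc A β :=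
      fun A => by
    funext x
    ext1 v
    exact map_add A _ _
  simp only [coeffD, h, smul_add]
  abel

theorem coeffD_smul (r : ℤ) {p q : ℕ} (c : ℝ) (α : PForm E G p q (V.V →L[ℝ] W.V)) :
    coeffD r (c • α) = c • coeffD r α := by
  have h : ∀ A : (V.V →L[ℝ] W.V) →L[ℝ] (V.V →L[ℝ] W.V), mc A (c • α) = c • mc A α := fun A => by
    funext x
    ext1 v
    exact map_smul A _ _
  simp only [coeffD, h, smul_sub, smul_comm _ c]

theorem coeffD_zero (r : ℤ) {p q : ℕ} :
    coeffD r (0 : PForm E G p q (V.V →L[ℝ] W.V)) = 0 := by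
  simpa using coeffD_smul r 0 (0 : PForm E G p q (V.V →L[ℝ] W.V))

theorem intD_add (η η' : PCochain V W) : intD (η + η') = intD η + intD η' := by
  funext p q
  cases p with
  | zero => exact (add_zero _).symm
  | succ p => exact intFace_add _ _

theorem intD_smul (c : ℝ) (η : PCochain V W) : intD (c • η) = c • intD η := by
  funext p q
  cases p with
  | zero => exact (smul_zero c).symm
  | succ p => exact intFace_smul _ _

theorem dl_add (m : ℤ) (η η' : PCochain V W) : dl m (η + η') = dl m η + dl m η' := by
  funext p q
  simp only [dl, Pi.add_apply, coeffD_add, smul_add]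

theorem dl_smul (m : ℤ) (c : ℝ) (η : PCochain V W) : dl m (c • η) = c • dl m η := by
  funext p q
  simp only [dl, Pi.smul_apply, coeffD_smul, smul_comm _ c]

/-- Smoothness of all components of a cochain. -/
def Sm (η : PCochain V W) : Prop := ∀ p q x, SmoothFormAt (powModel E p) (η p q) x

theorem dB_add {η η' : PCochain V W} (h : Sm η) (h' : Sm η') : dB (η + η') = dB η + dB η' := by
  funext p q
  cases q with
  | zero => exact (add_zero _).symm
  | succ q =>
    have : ed (powModel E p) (η p q + η' p q) = ed (powModel E p) (η p q) +
        ed (powModel E p) (η' p q) := funext fun x => ed_add (h p q x) (h' p q x)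
    exact (congrArg ((-1 : ℝ) ^ p • ·) this).trans (smul_add _ _ _)

theorem dB_smul (c : ℝ) (η : PCochain V W) : dB (c • η) = c • dB η := by
  funext p q
  cases q with
  | zero => exact (smul_zero c).symm
  | succ q =>
    have : ed (powModel E p) (c • η p q) = c • ed (powModel E p) (η p q) :=
      funext fun x => ed_smul _ x c
    exact (congrArg ((-1 : ℝ) ^ p • ·) this).trans (smul_comm _ _ _)

theorem dB_sg (p q : ℕ) (α : PForm E G p q (V.V →L[ℝ] W.V)) :
    dB (sg p q α) = sg p (q + 1) ((-1 : ℝ) ^ p • ed (powModel E p) α) := by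
  refine eq_sg ?_ fun p' q' h => ?_
  · simp only [dB, sg_same]
  · cases q' with
    | zero => rfl
    | succ q' =>
      have : p' ≠ p ∨ q' ≠ q := h.imp_right fun h h' => h (by rw [h'])
      simp only [dB, sg_ne α this, ed_zero, smul_zero]

theorem intD_sg (p q : ℕ) (α : PForm E G p q (V.V →L[ℝ] W.V)) :
    intD (sg p q α) = sg (p + 1) q (intFace α) := by
  refine eq_sg ?_ fun p' q' h => ?_
  · simp only [intD, sg_same]
  · cases p' with
    | zero => rfl
    | succ p' =>
      have : p' ≠ p ∨ q' ≠ q := h.imp_left fun h h' => h (by rw [h'])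
      simp only [intD, sg_ne α this, intFace_zero]

theorem dl_sg (m : ℤ) (p q : ℕ) (α : PForm E G p q (V.V →L[ℝ] W.V)) :
    dl m (sg p q α) = sg p q ((-1 : ℝ) ^ (p + q) • coeffD (m - p - q) α) := by
  refine eq_sg ?_ fun p' q' h => ?_
  · simp only [dl, sg_same]
  · simp only [dl, sg_ne α h, coeffD_zero, smul_zero]

/-! #### Smoothness -/

theorem Sm.add {η η' : PCochain V W} (h : Sm η) (h' : Sm η') : Sm (η + η') :=
  fun p q x => (h p q x).add (h' p q x)

theorem Sm.smul {η : PCochain V W} (h : Sm η) (c : ℝ) : Sm (c • η) :=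
  fun p q x => (h p q x).smul c

theorem Sm.zero : Sm (0 : PCochain V W) := fun _ _ x => SmoothFormAt.zero x

theorem Sm.neg {η : PCochain V W} (h : Sm η) : Sm (-η) := by
  have e : (-1 : ℝ) • η = -η := by
    funext p q x
    ext1 v
    simp
  exact e ▸ h.smul (-1)

theorem Sm.sub {η η' : PCochain V W} (h : Sm η) (h' : Sm η') : Sm (η - η') := by
  rw [sub_eq_add_neg]
  exact h.add h'.neg

theorem Sm.sg {p q : ℕ} {α : PForm E G p q (V.V →L[ℝ] W.V)}
    (h : ∀ x, SmoothFormAt (powModel E p) α x) : Sm (sg p q α) := fun p' q' x => by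
  by_cases hpq : p' = p ∧ q' = q
  · obtain ⟨rfl, rfl⟩ := hpq
    rw [sg_same]
    exact h x
  · rw [sg_ne α (not_and_or.1 hpq)]
    exact SmoothFormAt.zero x

theorem Sm.dB {η : PCochain V W} (h : Sm η) : Sm (dB η) := fun p q x => by
  cases q with
  | zero => exact SmoothFormAt.zero x
  | succ q => exact (SmoothFormAt.ed (h p q) x).smul _

theorem smooth_intFace {p q : ℕ} {F : Type*} [NormedAddCommGroup F] [NormedSpace ℝ F]
    [FiniteDimensional ℝ F] {α : PForm E G p q F}
    (h : ∀ x, SmoothFormAt (powModel E p) α x) (x : Fin (p + 1) → G) :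
    SmoothFormAt (powModel E (p + 1)) (intFace α) x :=
  SmoothFormAt.sum fun _ _ => SmoothFormAt.smul ((h _).pb (contMDiff_face E _ x)) _

theorem Sm.intD {η : PCochain V W} (h : Sm η) : Sm (intD η) := fun p q x => by
  cases p with
  | zero => exact SmoothFormAt.zero x
  | succ p => exact smooth_intFace (h p q) x

theorem smooth_coeffD (r : ℤ) {p q : ℕ} {α : PForm E G p q (V.V →L[ℝ] W.V)} {x : Fin p → G}
    (h : SmoothFormAt (powModel E p) α x) : SmoothFormAt (powModel E p) (coeffD r α) x := by
  rw [coeffD, sub_eq_add_neg, ← neg_smul]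
  exact (h.mc _).add ((h.mc _).smul _)

theorem Sm.dl {η : PCochain V W} (h : Sm η) (m : ℤ) : Sm (dl m η) :=
  fun p q x => (smooth_coeffD _ (h p q x)).smul _

theorem smooth_blk {p₁ p₂ p q₁ q₂ q : ℕ} (hp : p₁ + p₂ = p) (hq : q₁ + q₂ = q)
    {α : PForm E G p₁ q₁ (W.V →L[ℝ] X.V)} {β : PForm E G p₂ q₂ (V.V →L[ℝ] W.V)}
    (hα : ∀ x, SmoothFormAt (powModel E p₁) α x) (hβ : ∀ x, SmoothFormAt (powModel E p₂) β x)
    (x : Fin p → G) : SmoothFormAt (powModel E p) (blk hp hq α β) x :=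
  SmoothFormAt.wd hq ((hα _).pb (contMDiff_front E hp x)) ((hβ _).pb (contMDiff_back E hp x))

theorem Sm.cp {ψ : PCochain W X} {φ : PCochain V W} (h : Sm ψ) (h' : Sm φ) (m : ℤ) :
    Sm (cp m ψ φ) := fun _ _ x =>
  SmoothFormAt.sum fun s _ => SmoothFormAt.sum fun t _ =>
    SmoothFormAt.smul (smooth_blk (Finset.HasAntidiagonal.mem_antidiagonal.1 s.2)
      (Finset.HasAntidiagonal.mem_antidiagonal.1 t.2) (h _ _) (h' _ _) x) _

/-! #### Reduction to cochains with a single component -/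

/-- Two cochains agree in the bidegrees up to `(p, q)`. -/
def Agree (p q : ℕ) (η η' : PCochain V W) : Prop := ∀ i ≤ p, ∀ j ≤ q, η i j = η' i j

theorem Agree.refl (p q : ℕ) (η : PCochain V W) : Agree p q η η := fun _ _ _ _ => rfl

theorem Agree.add {p q : ℕ} {η η' ξ ξ' : PCochain V W} (h : Agree p q η η') (h' : Agree p q ξ ξ') :
    Agree p q (η + ξ) (η' + ξ') := fun i hi j hj => by
  simp only [Pi.add_apply, h i hi j hj, h' i hi j hj]

theorem Agree.smul {p q : ℕ} {η η' : PCochain V W} (h : Agree p q η η') (c : ℝ) :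
    Agree p q (c • η) (c • η') := fun i hi j hj => by
  simp only [Pi.smul_apply, h i hi j hj]

theorem Agree.dB {p q : ℕ} {η η' : PCochain V W} (h : Agree p q η η') :
    Agree p q (dB η) (dB η') := fun i hi j hj => by
  cases j with
  | zero => rfl
  | succ j => simp only [PCochain.dB, h i hi j (by omega)]

theorem Agree.intD {p q : ℕ} {η η' : PCochain V W} (h : Agree p q η η') :
    Agree p q (intD η) (intD η') := fun i hi j hj => by
  cases i with
  | zero => rfl
  | succ i => simp only [PCochain.intD, h i (by omega) j hj]

theorem Agree.dl {p q : ℕ} {η η' : PCochain V W} (h : Agree p q η η') (m : ℤ) :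
    Agree p q (dl m η) (dl m η') := fun i hi j hj => by
  simp only [PCochain.dl, h i hi j hj]

theorem Agree.cp {p q : ℕ} {ψ ψ' : PCochain W X} {φ φ' : PCochain V W} (h : Agree p q ψ ψ')
    (h' : Agree p q φ φ') (m : ℤ) : Agree p q (cp m ψ φ) (cp m ψ' φ') := fun i hi j hj => by
  unfold PCochain.cp
  refine Finset.sum_congr rfl fun s _ => Finset.sum_congr rfl fun t _ => ?_
  have hs := Finset.HasAntidiagonal.mem_antidiagonal.1 s.2
  have ht := Finset.HasAntidiagonal.mem_antidiagonal.1 t.2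
  rw [h s.1.1 (by omega) t.1.1 (by omega), h' s.1.2 (by omega) t.1.2 (by omega)]

theorem Sm.finsetSum {ι : Type*} {s : Finset ι} {η : ι → PCochain V W} (h : ∀ i ∈ s, Sm (η i)) :
    Sm (∑ i ∈ s, η i) := by
  classical
  induction s using Finset.induction_on with
  | empty => exact Sm.zero
  | insert i s hi ih =>
    rw [Finset.sum_insert hi]
    exact (h i (Finset.mem_insert_self _ _)).add (ih fun j hj => h j (Finset.mem_insert_of_mem hj))

/-- To prove a local property of smooth cochains it suffices to consider cochains with a single
component. -/
theorem sm_induction {P : PCochain V W → Prop} (p q : ℕ)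
    (hadd : ∀ η η', Sm η → Sm η' → P η → P η' → P (η + η'))
    (hsg : ∀ i j (α : PForm E G i j (V.V →L[ℝ] W.V)),
      (∀ x, SmoothFormAt (powModel E i) α x) → P (sg i j α))
    (hloc : ∀ η η', Agree p q η η' → Sm η → Sm η' → P η → P η') {η : PCochain V W} (hη : Sm η) :
    P η := by
  classical
  have hsum : ∀ s : Finset (ℕ × ℕ), P (∑ i ∈ s, sg i.1 i.2 (η i.1 i.2)) ∧
      Sm (∑ i ∈ s, sg i.1 i.2 (η i.1 i.2)) := fun s => by
    refine ⟨?_, Sm.finsetSum fun i _ => Sm.sg (hη _ _)⟩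
    induction s using Finset.induction_on with
    | empty =>
      rw [Finset.sum_empty, ← sg_zero 0 0]
      exact hsg _ _ _ fun x => SmoothFormAt.zero x
    | insert i s hi ih =>
      rw [Finset.sum_insert hi]
      exact hadd _ _ (Sm.sg (hη _ _)) (Sm.finsetSum fun i _ => Sm.sg (hη _ _))
        (hsg _ _ _ (hη _ _)) ih
  have h1 := hsum (Finset.range (p + 1) ×ˢ Finset.range (q + 1))
  refine hloc _ η (fun i hi j hj => ?_) h1.2 hη h1.1
  have h2 : (∑ a ∈ Finset.range (p + 1) ×ˢ Finset.range (q + 1), sg a.1 a.2 (η a.1 a.2)) i j =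
      ∑ a ∈ Finset.range (p + 1) ×ˢ Finset.range (q + 1), sg a.1 a.2 (η a.1 a.2) i j := by
    simp only [Finset.sum_apply]
  rw [h2, Finset.sum_eq_single (i, j)]
  · exact sg_same _ _ _
  · rintro ⟨a, b⟩ _ hab
    refine sg_ne _ ?_
    by_contra h
    push Not at h
    exact hab (by rw [h.1, h.2])
  · intro h
    refine absurd ?_ h
    simp only [Finset.mem_product, Finset.mem_range]
    omega

end PCochain

end Cochains

section Identities

variable {E : Type v} [NormedAddCommGroup E] [NormedSpace ℝ E] [FiniteDimensional ℝ E]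
  {G : Type w} [TopologicalSpace G] [ChartedSpace E G] [Group G] [LieGroup 𝓘(ℝ, E) ∞ G]

/-! ### Faces -/

section Faces

variable {p : ℕ}

theorem face_face {a : Fin (p + 2)} {b : Fin (p + 3)} {a' : Fin (p + 3)} {b' : Fin (p + 2)}
    (h : (a : ℕ) < b) (ha : (a' : ℕ) = a) (hb : (b' : ℕ) + 1 = b) :
    (face a ∘ face b : (Fin (p + 2) → G) → Fin p → G) = face b' ∘ face a' := by
  funext g j
  simp only [Function.comp, face, Fin.val_castSucc, Fin.val_succ, ha, ← hb]
  rw [← hb] at h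
  rcases lt_trichotomy ((j : ℕ) + 1) a with h1 | h1 | h1 <;>
  rcases lt_trichotomy ((j : ℕ) + 1) b' with h2 | h2 | h2 <;>
  first
  | omega
  | simp (disch := omega) only [if_pos, if_neg, mul_assoc, Fin.succ_castSucc]

theorem front_face_left {p₁ p₂ : ℕ} (hp : p₁ + p₂ = p) (hp' : p₁ + 1 + p₂ = p + 1) {a : Fin (p + 2)}
    {a' : Fin (p₁ + 2)} (ha : (a' : ℕ) = a) :
    (front hp ∘ face a : (Fin (p + 1) → G) → _) = face a' ∘ front hp' := by
  funext g j
  have := j.2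
  simp only [Function.comp, face, front, Fin.val_cast, Fin.val_castAdd, ha]
  split_ifs <;> rfl

theorem back_face_left {p₁ p₂ : ℕ} (hp : p₁ + p₂ = p) (hp' : p₁ + 1 + p₂ = p + 1) {a : Fin (p + 2)}
    (h : (a : ℕ) ≤ p₁) : (back hp ∘ face a : (Fin (p + 1) → G) → _) = back hp' := by
  funext g j
  simp only [Function.comp, face, back, Fin.val_cast, Fin.val_natAdd]
  rw [if_neg (by omega), if_neg (by omega)]
  congr 1
  ext
  simp only [Fin.val_cast, Fin.val_natAdd, Fin.val_succ]
  omega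

theorem front_face_right {p₁ p₂ : ℕ} (hp : p₁ + p₂ = p) (hp' : p₁ + (p₂ + 1) = p + 1)
    {a : Fin (p + 2)} (h : p₁ < (a : ℕ)) :
    (front hp ∘ face a : (Fin (p + 1) → G) → _) = front hp' := by
  funext g j
  have := j.2
  simp only [Function.comp, face, front, Fin.val_cast, Fin.val_castAdd]
  rw [if_pos (by omega)]
  rfl

theorem back_face_right {p₁ p₂ : ℕ} (hp : p₁ + p₂ = p) (hp' : p₁ + (p₂ + 1) = p + 1)
    {a : Fin (p + 2)} {a' : Fin (p₂ + 2)} (ha : (a : ℕ) = p₁ + a') :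
    (back hp ∘ face a : (Fin (p + 1) → G) → _) = face a' ∘ back hp' := by
  funext g j
  have e : (Fin.cast hp (Fin.natAdd p₁ j)).succ = Fin.cast hp' (Fin.natAdd p₁ j.succ) := by
    ext
    simp only [Fin.val_cast, Fin.val_natAdd, Fin.val_succ]
    omega
  simp only [Function.comp, face, back, Fin.val_cast, Fin.val_natAdd, e]
  by_cases h1 : (j : ℕ) + 1 < a'
  · rw [if_pos h1, if_pos (by omega)]
    rfl
  · by_cases h2 : (j : ℕ) + 1 = a'
    · rw [if_neg h1, if_neg (by omega), if_pos h2, if_pos (by omega)]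
      rfl
    · rw [if_neg h1, if_neg (by omega), if_neg h2, if_neg (by omega)]

theorem face_zero_eq (h : 1 + p = p + 1) : (face 0 : (Fin (p + 1) → G) → _) = back h := by
  funext g j
  have h0 : ¬ (j : ℕ) + 1 < (0 : Fin (p + 2)) := by simp
  have h1 : ¬ (j : ℕ) + 1 = (0 : Fin (p + 2)) := by simp
  rw [face, back, if_neg h0, if_neg h1]
  congr 1
  ext
  simp only [Fin.val_cast, Fin.val_natAdd, Fin.val_succ]
  omega

theorem face_last_eq (h : p + 1 = p + 1) :
    (face (Fin.last (p + 1)) : (Fin (p + 1) → G) → _) = front h := by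
  funext g j
  have := j.2
  simp only [face, front, Fin.val_last]
  rw [if_pos (by omega)]
  rfl

end Faces

variable {V W X Y : TRep.{u} (E := E) G}

/-! ### Products, faces and differentials of forms -/

namespace PCochain

section FormIdentities

variable {p q : ℕ}

theorem pb_face_comp {F : Type*} [NormedAddCommGroup F] [NormedSpace ℝ F]
    [FiniteDimensional ℝ F] (a : Fin (p + 2))
    (b : Fin (p + 3)) (α : PForm E G p q F) :
    pb (powModel E (p + 2)) (powModel E (p + 1)) (face b)
      (pb (powModel E (p + 1)) (powModel E p) (face a) α) =
    pb (powModel E (p + 2)) (powModel E p) (face a ∘ face b) α :=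
  pb_comp (contMDiff_face E a).mdiff (contMDiff_face E b).mdiff α

theorem pb_face_smul {F : Type*} [NormedAddCommGroup F] [NormedSpace ℝ F] (a : Fin (p + 2))
    (c : ℝ) (α : PForm E G p q F) :
    pb (powModel E (p + 1)) (powModel E p) (face a) (c • α) =
      c • pb (powModel E (p + 1)) (powModel E p) (face a) α := rfl

theorem pb_face_sum {F : Type*} [NormedAddCommGroup F] [NormedSpace ℝ F] {ι : Type*} (s : Finset ι)
    (a : Fin (p + 2)) (α : ι → PForm E G p q F) :
    pb (powModel E (p + 1)) (powModel E p) (face a) (∑ i ∈ s, α i) =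
      ∑ i ∈ s, pb (powModel E (p + 1)) (powModel E p) (face a) (α i) :=
  map_sum (AddMonoidHom.mk' (fun α : PForm E G p q F =>
    pb (powModel E (p + 1)) (powModel E p) (face a) α) fun _ _ => rfl) _ _

theorem intFace_intFace {F : Type*} [NormedAddCommGroup F] [NormedSpace ℝ F]
    [FiniteDimensional ℝ F]
    (α : PForm E G p q F) : intFace (intFace α) = 0 := by
  classical
  simp only [intFace, pb_face_sum, pb_face_smul, pb_face_comp, Finset.smul_sum, smul_smul]
  rw [← Finset.sum_product']
  let σ : Fin (p + 1) × Fin p → Fin (p + 1) × Fin p := fun x =>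
    if h : (x.2 : ℕ) < x.1 then (x.2.castSucc, ⟨x.1 - 1, by omega⟩)
    else (x.2.succ, ⟨x.1, by omega⟩)
  refine Finset.sum_involution (fun x _ => σ x) ?_ ?_ (fun _ _ => Finset.mem_univ _) ?_
  · rintro ⟨b, a⟩ _
    have hs : ∀ n : ℕ, ((-1 : ℝ) ^ (n + 1) = -(-1) ^ n) := fun n => by rw [pow_succ]; ring
    by_cases h : (a : ℕ) < b
    · have e : (face a.succ.castSucc ∘ face b.succ.castSucc : (Fin (p + 2) → G) → Fin p → G) = _ :=
        face_face (a' := a.succ.castSucc.castSucc) (b' := ⟨b, by omega⟩)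
        (by simpa using h) (by simp) (by simp)
      simp only [σ, dif_pos h, e]
      have e1 : (⟨b, by omega⟩ : Fin (p + 2)) =
          (⟨(b : ℕ) - 1, by omega⟩ : Fin p).succ.castSucc := by
        ext
        simp only [Fin.val_castSucc, Fin.val_succ]
        omega
      have e2 : a.succ.castSucc.castSucc = a.castSucc.succ.castSucc := rfl
      rw [e1, e2, ← add_smul]
      have e3 : (-1 : ℝ) ^ ((b : ℕ) + 1) * (-1) ^ ((a : ℕ) + 1) +
          (-1) ^ ((a.castSucc : ℕ) + 1) * (-1) ^ ((b : ℕ) - 1 + 1) = 0 := by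
        rw [Nat.sub_add_cancel (by omega), Fin.val_castSucc, pow_succ]
        ring
      simp only [e3, zero_smul]
    · have e : (face (⟨b, by omega⟩ : Fin p).succ.castSucc ∘ face a.succ.succ.castSucc :
          (Fin (p + 2) → G) → Fin p → G) = _ :=
        face_face (a' := b.succ.castSucc) (b' := a.succ.castSucc)
        (by simp only [Fin.val_castSucc, Fin.val_succ]; omega) (by simp) (by simp)
      simp only [σ, dif_neg h, e]
      rw [← add_smul]
      have e3 : (-1 : ℝ) ^ ((b : ℕ) + 1) * (-1) ^ ((a : ℕ) + 1) +
          (-1) ^ ((a.succ : ℕ) + 1) * (-1) ^ ((b : ℕ) + 1) = 0 := by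
        rw [Fin.val_succ, pow_succ _ ((a : ℕ) + 1)]
        ring
      simp only [e3, zero_smul]
  · rintro ⟨b, a⟩ _ _ h
    by_cases h' : (a : ℕ) < b
    · have := congrArg (fun x => (x.1 : ℕ)) h
      simp only [σ, dif_pos h', Fin.val_castSucc] at this
      omega
    · have := congrArg (fun x => (x.1 : ℕ)) h
      simp only [σ, dif_neg h', Fin.val_succ] at this
      omega
  · rintro ⟨b, a⟩ _
    by_cases h' : (a : ℕ) < b
    · have h'' : ¬ (b : ℕ) - 1 < a := by omega
      simp only [σ, dif_pos h', Fin.val_castSucc, dif_neg h'']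
      ext <;> simp
      omega
    · have h'' : (b : ℕ) < a + 1 := by omega
      simp only [σ, dif_neg h', Fin.val_succ, dif_pos h'']
      ext <;> simp

theorem ed_intFace {α : PForm E G p q (V.V →L[ℝ] W.V)} (hα : ∀ x, SmoothFormAt (powModel E p) α x) :
    ed (powModel E (p + 1)) (intFace α) = intFace (ed (powModel E p) α) := by
  funext x
  simp only [intFace]
  rw [ed_sum (I := powModel E (p + 1)) (x := x) (a := fun a : Fin p => (-1 : ℝ) ^ ((a : ℕ) + 1) •
    pb (powModel E (p + 1)) (powModel E p) (face a.succ.castSucc) α)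
    fun a _ => ((hα _).pb (contMDiff_face E _ x)).smul _]
  have h : ∀ a : Fin p, ed (powModel E (p + 1)) ((-1 : ℝ) ^ ((a : ℕ) + 1) •
      pb (powModel E (p + 1)) (powModel E p) (face a.succ.castSucc) α) x =
      ((-1 : ℝ) ^ ((a : ℕ) + 1) • pb (powModel E (p + 1)) (powModel E p) (face a.succ.castSucc)
        (ed (powModel E p) α)) x := fun a => by
    rw [ed_smul, SmoothFormAt.ed_pb (hα _) (contMDiff_face E _ x)]
    rfl
  simp only [h, Finset.sum_apply]

theorem mc_smul {F F' : Type*} [NormedAddCommGroup F] [NormedSpace ℝ F] [NormedAddCommGroup F']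
    [NormedSpace ℝ F'] (A : F →L[ℝ] F') (c : ℝ) (α : PForm E G p q F) :
    mc A (c • α) = c • mc A α := by
  funext x
  ext1 v
  exact map_smul A _ _

theorem mc_sum {F F' : Type*} [NormedAddCommGroup F] [NormedSpace ℝ F] [NormedAddCommGroup F']
    [NormedSpace ℝ F'] (A : F →L[ℝ] F') {ι : Type*} (s : Finset ι) (α : ι → PForm E G p q F) :
    mc A (∑ i ∈ s, α i) = ∑ i ∈ s, mc A (α i) :=
  map_sum (AddMonoidHom.mk' (fun α : PForm E G p q F => mc A α) fun α β => by
    funext x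
    ext1 v
    exact map_add A _ _) _ _

theorem mc_intFace {F F' : Type*} [NormedAddCommGroup F] [NormedSpace ℝ F] [NormedAddCommGroup F']
    [NormedSpace ℝ F'] (A : F →L[ℝ] F') (α : PForm E G p q F) :
    mc A (intFace α) = intFace (mc A α) := by
  simp only [intFace, mc_sum, mc_smul]
  rfl

theorem intFace_sub {F : Type*} [NormedAddCommGroup F] [NormedSpace ℝ F] (α β : PForm E G p q F) :
    intFace (α - β) = intFace α - intFace β :=
  map_sub (AddMonoidHom.mk' (fun α : PForm E G p q F => intFace α) intFace_add) _ _

theorem coeffD_intFace (r : ℤ) (α : PForm E G p q (V.V →L[ℝ] W.V)) :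
    coeffD r (intFace α) = intFace (coeffD r α) := by
  simp only [coeffD, intFace_sub, intFace_smul, mc_intFace]

theorem ed_coeffD (r : ℤ) {α : PForm E G p q (V.V →L[ℝ] W.V)}
    (hα : ∀ x, SmoothFormAt (powModel E p) α x) :
    ed (powModel E p) (coeffD r α) = coeffD r (ed (powModel E p) α) := by
  funext x
  have e : ∀ β : PForm E G p q (V.V →L[ℝ] W.V), coeffD r β =
      mc (ContinuousLinearMap.compL ℝ V.V W.V W.V W.δ) β +
    (-sgn r) • mc ((ContinuousLinearMap.compL ℝ V.V V.V W.V).flip V.δ) β := fun β => by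
    rw [coeffD, sub_eq_add_neg, neg_smul]
  have e' : ∀ β : PForm E G p (q + 1) (V.V →L[ℝ] W.V), coeffD r β =
      mc (ContinuousLinearMap.compL ℝ V.V W.V W.V W.δ) β +
    (-sgn r) • mc ((ContinuousLinearMap.compL ℝ V.V V.V W.V).flip V.δ) β := fun β => by
    rw [coeffD, sub_eq_add_neg, neg_smul]
  rw [e, e', ed_add ((hα x).mc _) (((hα x).mc _).smul _), ed_smul, ed_mc (hα x), ed_mc (hα x)]
  rfl

theorem coeffD_coeffD (r : ℤ) (α : PForm E G p q (V.V →L[ℝ] W.V)) :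
    coeffD (r + 1) (coeffD r α) = 0 := by
  funext x
  ext v w
  have h1 : ∀ y, W.δ (W.δ y) = 0 := fun y => congrArg (fun A : W.V →L[ℝ] W.V => A y) W.δ_δ
  have h2 : ∀ y, V.δ (V.δ y) = 0 := fun y => congrArg (fun A : V.V →L[ℝ] V.V => A y) V.δ_δ
  simp [coeffD, mc, h1, h2, sgn_add_one]

end FormIdentities

section Blk

variable {p₁ p₂ p q₁ q₂ q : ℕ} (hp : p₁ + p₂ = p) (hq : q₁ + q₂ = q)
  {α : PForm E G p₁ q₁ (W.V →L[ℝ] X.V)} {β : PForm E G p₂ q₂ (V.V →L[ℝ] W.V)}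

/-- The Leibniz rule for the exterior derivative. -/
theorem ed_blk (h₁ : q₁ + 1 + q₂ = q + 1) (h₂ : q₁ + (q₂ + 1) = q + 1)
    (hα : ∀ x, SmoothFormAt (powModel E p₁) α x) (hβ : ∀ x, SmoothFormAt (powModel E p₂) β x) :
    ed (powModel E p) (blk hp hq α β) =
      blk hp h₁ (ed (powModel E p₁) α) β + (-1 : ℝ) ^ q₁ • blk hp h₂ α (ed (powModel E p₂) β) := by
  funext x
  have h := ed_wd (B := ContinuousLinearMap.compL ℝ V.V W.V X.V) hq h₁ h₂
    ((hα _).pb (contMDiff_front E hp x)) ((hβ _).pb (contMDiff_back E hp x))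
  have e1 : pb (powModel E p) (powModel E p₁) (front hp) (ed (powModel E p₁) α) =
      ed (powModel E p) (pb (powModel E p) (powModel E p₁) (front hp) α) :=
    funext fun y => (SmoothFormAt.ed_pb (hα _) (contMDiff_front E hp y)).symm
  have e2 : pb (powModel E p) (powModel E p₂) (back hp) (ed (powModel E p₂) β) =
      ed (powModel E p) (pb (powModel E p) (powModel E p₂) (back hp) β) :=
    funext fun y => (SmoothFormAt.ed_pb (hβ _) (contMDiff_back E hp y)).symm
  simp only [blk, e1, e2]
  exact h

theorem pb_blk {p' : ℕ} {f : (Fin p' → G) → Fin p → G}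
    (hf : ContMDiff (powModel E p') (powModel E p) ∞ f)
    (α : PForm E G p₁ q₁ (W.V →L[ℝ] X.V)) (β : PForm E G p₂ q₂ (V.V →L[ℝ] W.V)) :
    pb (powModel E p') (powModel E p) f (blk hp hq α β) =
      wd (ContinuousLinearMap.compL ℝ V.V W.V X.V) hq
        (pb (powModel E p') (powModel E p₁) (front hp ∘ f) α)
        (pb (powModel E p') (powModel E p₂) (back hp ∘ f) β) := by
  rw [blk, pb_wd, pb_comp (contMDiff_front E hp).mdiff hf.mdiff,
    pb_comp (contMDiff_back E hp).mdiff hf.mdiff]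

theorem pb_face_blk_left (hp' : p₁ + 1 + p₂ = p + 1) {a : Fin (p + 2)} {a' : Fin (p₁ + 2)}
    (ha : (a' : ℕ) = a) (h : (a : ℕ) ≤ p₁) (α : PForm E G p₁ q₁ (W.V →L[ℝ] X.V))
    (β : PForm E G p₂ q₂ (V.V →L[ℝ] W.V)) :
    pb (powModel E (p + 1)) (powModel E p) (face a) (blk hp hq α β) =
      blk hp' hq (pb (powModel E (p₁ + 1)) (powModel E p₁) (face a') α) β := by
  rw [pb_blk hp hq (contMDiff_face E a), front_face_left hp hp' ha, back_face_left hp hp' h, blk,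
    pb_comp (contMDiff_face E a').mdiff (contMDiff_front E hp').mdiff]

theorem pb_face_blk_right (hp' : p₁ + (p₂ + 1) = p + 1) {a : Fin (p + 2)} {a' : Fin (p₂ + 2)}
    (ha : (a : ℕ) = p₁ + a') (h : p₁ < (a : ℕ)) (α : PForm E G p₁ q₁ (W.V →L[ℝ] X.V))
    (β : PForm E G p₂ q₂ (V.V →L[ℝ] W.V)) :
    pb (powModel E (p + 1)) (powModel E p) (face a) (blk hp hq α β) =
      blk hp' hq α (pb (powModel E (p₂ + 1)) (powModel E p₂) (face a') β) := by
  rw [pb_blk hp hq (contMDiff_face E a), front_face_right hp hp' h, back_face_right hp hp' ha, blk,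
    pb_comp (contMDiff_face E a').mdiff (contMDiff_back E hp').mdiff]

/-- The Leibniz rule for the faces different from the first and the last one: each such face of a
product acts on one of the factors. -/
theorem intFace_blk (h₁ : p₁ + 1 + p₂ = p + 1) (h₂ : p₁ + (p₂ + 1) = p + 1)
    (α : PForm E G p₁ q₁ (W.V →L[ℝ] X.V)) (β : PForm E G p₂ q₂ (V.V →L[ℝ] W.V)) :
    intFace (blk hp hq α β) =
      blk h₁ hq (intFace α) β + (-1 : ℝ) ^ p₁ • blk h₂ hq α (intFace β) := by
  subst hp
  rw [intFace, Fin.sum_univ_add, intFace, intFace, blk_sum_left, blk_sum_right, Finset.smul_sum]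
  congr 1
  · refine Finset.sum_congr rfl fun a _ => ?_
    rw [blk_smul_left, ← pb_face_blk_left rfl hq h₁ (a := (Fin.castAdd p₂ a).succ.castSucc)
      (a' := a.succ.castSucc) (by simp) (by simp)]
    rfl
  · refine Finset.sum_congr rfl fun a _ => ?_
    rw [blk_smul_right, ← pb_face_blk_right rfl hq h₂ (a := (Fin.natAdd p₁ a).succ.castSucc)
      (a' := a.succ.castSucc) (by simp [add_assoc]) (by simp), smul_smul, ← pow_add]
    simp [add_assoc]

theorem mc_post_blk (α : PForm E G p₁ q₁ (W.V →L[ℝ] X.V)) (β : PForm E G p₂ q₂ (V.V →L[ℝ] W.V))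
    (A : X.V →L[ℝ] Y.V) :
    mc (ContinuousLinearMap.compL ℝ V.V X.V Y.V A) (blk hp hq α β) =
      blk hp hq (mc (ContinuousLinearMap.compL ℝ W.V X.V Y.V A) α) β :=
  funext fun x => altWedge_coeff (ContinuousLinearMap.compL ℝ V.V W.V X.V)
    (B' := ContinuousLinearMap.compL ℝ V.V W.V Y.V) hq
    (a' := pb (powModel E p) (powModel E p₁) (front hp)
      (mc (ContinuousLinearMap.compL ℝ W.V X.V Y.V A) α) x)
    (b' := pb (powModel E p) (powModel E p₂) (back hp) β x) _ fun _ _ => rfl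

theorem mc_pre_blk (α : PForm E G p₁ q₁ (W.V →L[ℝ] X.V)) (β : PForm E G p₂ q₂ (V.V →L[ℝ] W.V))
    (A : Y.V →L[ℝ] V.V) :
    mc ((ContinuousLinearMap.compL ℝ Y.V V.V X.V).flip A) (blk hp hq α β) =
      blk hp hq α (mc ((ContinuousLinearMap.compL ℝ Y.V V.V W.V).flip A) β) :=
  funext fun x => altWedge_coeff (ContinuousLinearMap.compL ℝ V.V W.V X.V)
    (B' := ContinuousLinearMap.compL ℝ Y.V W.V X.V) hq
    (a' := pb (powModel E p) (powModel E p₁) (front hp) α x)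
    (b' := pb (powModel E p) (powModel E p₂) (back hp)
      (mc ((ContinuousLinearMap.compL ℝ Y.V V.V W.V).flip A) β) x) _ fun _ _ => rfl

theorem blk_mc_mid (α : PForm E G p₁ q₁ (X.V →L[ℝ] Y.V)) (β : PForm E G p₂ q₂ (V.V →L[ℝ] W.V))
    (A : W.V →L[ℝ] X.V) :
    blk hp hq (mc ((ContinuousLinearMap.compL ℝ W.V X.V Y.V).flip A) α) β =
      blk hp hq α (mc (ContinuousLinearMap.compL ℝ V.V W.V X.V A) β) := by
  funext x
  have h := altWedge_coeff (ContinuousLinearMap.compL ℝ V.V W.V Y.V)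
    (B' := ContinuousLinearMap.compL ℝ V.V X.V Y.V) hq
    (a := pb (powModel E p) (powModel E p₁) (front hp)
      (mc ((ContinuousLinearMap.compL ℝ W.V X.V Y.V).flip A) α) x)
    (b := pb (powModel E p) (powModel E p₂) (back hp) β x)
    (a' := pb (powModel E p) (powModel E p₁) (front hp) α x)
    (b' := pb (powModel E p) (powModel E p₂) (back hp)
      (mc (ContinuousLinearMap.compL ℝ V.V W.V X.V A) β) x) (ContinuousLinearMap.id ℝ _)
      fun _ _ => rfl
  exact h

theorem blk_sub_left (α α' : PForm E G p₁ q₁ (W.V →L[ℝ] X.V))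
    (β : PForm E G p₂ q₂ (V.V →L[ℝ] W.V)) :
    blk hp hq (α - α') β = blk hp hq α β - blk hp hq α' β :=
  map_sub (AddMonoidHom.mk' (fun α => blk hp hq α β) fun α α' => blk_add_left hp hq α α' β) _ _

theorem blk_sub_right (α : PForm E G p₁ q₁ (W.V →L[ℝ] X.V))
    (β β' : PForm E G p₂ q₂ (V.V →L[ℝ] W.V)) :
    blk hp hq α (β - β') = blk hp hq α β - blk hp hq α β' :=
  map_sub (AddMonoidHom.mk' (fun β => blk hp hq α β) fun β β' => blk_add_right hp hq α β β') _ _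

/-- The Leibniz rule for the differential of the coefficients. -/
theorem coeffD_blk (r₁ r₂ : ℤ) (α : PForm E G p₁ q₁ (W.V →L[ℝ] X.V))
    (β : PForm E G p₂ q₂ (V.V →L[ℝ] W.V)) :
    coeffD (r₁ + r₂) (blk hp hq α β) =
      blk hp hq (coeffD r₁ α) β + sgn r₁ • blk hp hq α (coeffD r₂ β) := by
  simp only [coeffD, blk_sub_left, blk_sub_right, blk_smul_left, blk_smul_right, mc_post_blk,
    mc_pre_blk, blk_mc_mid, smul_sub, smul_smul, ← sgn_add]
  abel

theorem blk_assoc {p₃ q₃ p₁₂ q₁₂ p₂₃ q₂₃ : ℕ} (hp₁₂ : p₁ + p₂ = p₁₂) (hq₁₂ : q₁ + q₂ = q₁₂)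
    (hp₂₃ : p₂ + p₃ = p₂₃) (hq₂₃ : q₂ + q₃ = q₂₃) (h₁ : p₁₂ + p₃ = p) (h₂ : q₁₂ + q₃ = q)
    (h₃ : p₁ + p₂₃ = p) (h₄ : q₁ + q₂₃ = q) (α : PForm E G p₁ q₁ (X.V →L[ℝ] Y.V))
    (β : PForm E G p₂ q₂ (W.V →L[ℝ] X.V)) (γ : PForm E G p₃ q₃ (V.V →L[ℝ] W.V)) :
    blk h₁ h₂ (blk hp₁₂ hq₁₂ α β) γ = blk h₃ h₄ α (blk hp₂₃ hq₂₃ β γ) := by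
  have e1 : (front hp₁₂ ∘ front h₁ : (Fin p → G) → _) = front h₃ := rfl
  have e2 : (back hp₁₂ ∘ front h₁ : (Fin p → G) → _) = front hp₂₃ ∘ back h₃ := rfl
  have e3 : (back h₁ : (Fin p → G) → _) = back hp₂₃ ∘ back h₃ := by
    funext g j
    simp only [back, Function.comp]
    congr 1
    ext
    simp only [Fin.val_cast, Fin.val_natAdd]
    omega
  have h5 := pb_blk hp₁₂ hq₁₂ (contMDiff_front E h₁) α β
  have h6 := pb_blk hp₂₃ hq₂₃ (contMDiff_back E h₃) β γ
  rw [blk, h5, e1, e2, e3]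
  conv_rhs => rw [blk, h6]
  exact funext fun x => altWedge_assoc (fun _ _ _ => rfl) _ _ _ _ _ _ _

theorem blk_const_left (h : 0 + q = q) (c : W.V →L[ℝ] X.V) (β : PForm E G p₂ q (V.V →L[ℝ] W.V)) :
    blk hp h (fun _ => ContinuousAlternatingMap.constOfIsEmpty ℝ (Fin p₁ → E) (Fin 0) c) β =
      mc (ContinuousLinearMap.compL ℝ V.V W.V X.V c)
        (pb (powModel E p) (powModel E p₂) (back hp) β) :=
  funext fun _ => altWedge_const_left (ContinuousLinearMap.compL ℝ V.V W.V X.V) h _ _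

theorem blk_const_right (h : q + 0 = q) (α : PForm E G p₁ q (W.V →L[ℝ] X.V)) (c : V.V →L[ℝ] W.V) :
    blk hp h α (fun _ => ContinuousAlternatingMap.constOfIsEmpty ℝ (Fin p₂ → E) (Fin 0) c) =
      mc ((ContinuousLinearMap.compL ℝ V.V W.V X.V).flip c)
        (pb (powModel E p) (powModel E p₁) (front hp) α) :=
  funext fun _ => altWedge_const_right (ContinuousLinearMap.compL ℝ V.V W.V X.V) h _ _

end Blk

end PCochain

end Identities

section Total

variable {E : Type v} [NormedAddCommGroup E] [NormedSpace ℝ E] [FiniteDimensional ℝ E]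
  {G : Type w} [TopologicalSpace G] [ChartedSpace E G] [Group G] [LieGroup 𝓘(ℝ, E) ∞ G]

variable {V W X Y : TRep.{u} (E := E) G}

namespace PCochain

theorem ed_smul' {p q : ℕ} {F : Type*} [NormedAddCommGroup F] [NormedSpace ℝ F]
    [FiniteDimensional ℝ F] (c : ℝ) (α : PForm E G p q F) :
    ed (powModel E p) (c • α) = c • ed (powModel E p) α :=
  funext fun x => ed_smul α x c

/-! ### The differential of the untwisted cochains -/

theorem dB_dB {η : PCochain V W} (h : Sm η) : dB (dB η) = 0 := by
  funext p q
  match q with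
  | 0 => rfl
  | 1 =>
    change (-1 : ℝ) ^ p • ed (powModel E p) (0 : PForm E G p 0 (V.V →L[ℝ] W.V)) = 0
    rw [ed_zero, smul_zero]
  | q + 2 =>
    change (-1 : ℝ) ^ p • ed (powModel E p) ((-1 : ℝ) ^ p • ed (powModel E p) (η p q)) = 0
    rw [ed_smul', ed_ed (h p q), smul_zero, smul_zero]

theorem intD_intD (η : PCochain V W) : intD (intD η) = 0 := by
  funext p q
  match p with
  | 0 => rfl
  | 1 => exact intFace_zero
  | p + 2 => exact intFace_intFace _

theorem dl_dl (m : ℤ) (η : PCochain V W) : dl (m + 1) (dl m η) = 0 := by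
  funext p q
  simp only [dl, coeffD_smul]
  rw [show m + 1 - p - q = m - p - q + 1 by ring, coeffD_coeffD, smul_zero, smul_zero]
  rfl

theorem dB_intD {η : PCochain V W} (h : Sm η) : dB (intD η) + intD (dB η) = 0 := by
  funext p q
  match p, q with
  | 0, 0 => exact add_zero _
  | 0, q + 1 =>
    change (-1 : ℝ) ^ 0 • ed (powModel E 0) (0 : PForm E G 0 q (V.V →L[ℝ] W.V)) + 0 = 0
    rw [ed_zero, smul_zero, add_zero]
  | p + 1, 0 =>
    change 0 + intFace (0 : PForm E G p 0 (V.V →L[ℝ] W.V)) = 0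
    rw [intFace_zero, add_zero]
  | p + 1, q + 1 =>
    change (-1 : ℝ) ^ (p + 1) • ed (powModel E (p + 1)) (intFace (η p q)) +
      intFace ((-1 : ℝ) ^ p • ed (powModel E p) (η p q)) = 0
    rw [ed_intFace (h p q), intFace_smul, ← add_smul, pow_succ, mul_neg_one, neg_add_cancel,
      zero_smul]

theorem dB_dl (m : ℤ) {η : PCochain V W} (h : Sm η) : dB (dl m η) + dl (m + 1) (dB η) = 0 := by
  funext p q
  match q with
  | 0 =>
    change 0 + (-1 : ℝ) ^ (p + 0) • coeffD _ (0 : PForm E G p 0 (V.V →L[ℝ] W.V)) = 0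
    rw [coeffD_zero, smul_zero, add_zero]
  | q + 1 =>
    change (-1 : ℝ) ^ p • ed (powModel E p) ((-1 : ℝ) ^ (p + q) • coeffD (m - p - q) (η p q)) +
      (-1 : ℝ) ^ (p + (q + 1)) • coeffD (m + 1 - p - (q + 1 : ℕ))
        ((-1 : ℝ) ^ p • ed (powModel E p) (η p q)) = 0
    rw [ed_smul', ed_coeffD _ (h p q), coeffD_smul,
      show m + 1 - p - (q + 1 : ℕ) = m - p - q by push_cast; ring, smul_smul, smul_smul, ← add_smul,
      show (-1 : ℝ) ^ p * (-1) ^ (p + q) + (-1) ^ (p + (q + 1)) * (-1) ^ p = 0 by ring, zero_smul]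

theorem intD_dl (m : ℤ) (η : PCochain V W) : intD (dl m η) + dl (m + 1) (intD η) = 0 := by
  funext p q
  match p with
  | 0 =>
    change 0 + (-1 : ℝ) ^ (0 + q) • coeffD _ (0 : PForm E G 0 q (V.V →L[ℝ] W.V)) = 0
    rw [coeffD_zero, smul_zero, add_zero]
  | p + 1 =>
    change intFace ((-1 : ℝ) ^ (p + q) • coeffD (m - p - q) (η p q)) +
      (-1 : ℝ) ^ (p + 1 + q) • coeffD (m + 1 - (p + 1 : ℕ) - q) (intFace (η p q)) = 0
    rw [coeffD_intFace, intFace_smul,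
      show m + 1 - (p + 1 : ℕ) - q = m - p - q by push_cast; ring, ← add_smul,
      show (-1 : ℝ) ^ (p + q) + (-1) ^ (p + 1 + q) = 0 by ring, zero_smul]

/-- The differential on the cochains of total degree `m`, before the twist by the representation
forms. -/
def D1 (m : ℤ) (η : PCochain V W) : PCochain V W := dB η + intD η + dl m η

theorem D1_add (m : ℤ) {η η' : PCochain V W} (h : Sm η) (h' : Sm η') :
    D1 m (η + η') = D1 m η + D1 m η' := by
  simp only [D1, dB_add h h', intD_add, dl_add]
  abel

theorem D1_smul (m : ℤ) (c : ℝ) (η : PCochain V W) : D1 m (c • η) = c • D1 m η := by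
  simp only [D1, dB_smul, intD_smul, dl_smul, smul_add]

theorem Sm.D1 {η : PCochain V W} (h : Sm η) (m : ℤ) : Sm (D1 m η) := (h.dB.add h.intD).add (h.dl m)

theorem Agree.D1 {p q : ℕ} {η η' : PCochain V W} (h : Agree p q η η') (m : ℤ) :
    Agree p q (D1 m η) (D1 m η') := (h.dB.add h.intD).add (h.dl m)

theorem D1_D1 (m : ℤ) {η : PCochain V W} (h : Sm η) : D1 (m + 1) (D1 m η) = 0 := by
  have h1 := dB_intD h
  have h2 := dB_dl m h
  have h3 := intD_dl m η
  have h4 := dB_dB h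
  have h5 := intD_intD η
  have h6 := dl_dl m η
  simp only [D1, dB_add (h.dB.add h.intD) (h.dl m), dB_add h.dB h.intD, intD_add, dl_add]
  rw [← add_zero (0 : PCochain V W), ← h1]
  nth_rw 2 [← add_zero (dB (intD η) + intD (dB η))]
  rw [h4, h5, h6]
  calc _ = (dB (intD η) + intD (dB η)) + (dB (dl m η) + dl (m + 1) (dB η)) +
      (intD (dl m η) + dl (m + 1) (intD η)) := by abel
    _ = _ := by rw [h1, h2, h3]; simp

/-! ### The Leibniz rule, associativity and units -/

section Single

variable {p₁ q₁ p₂ q₂ : ℕ}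

theorem cp_sg' (m : ℤ) (α : PForm E G p₁ q₁ (W.V →L[ℝ] X.V)) (β : PForm E G p₂ q₂ (V.V →L[ℝ] W.V)) :
    cp m (sg p₁ q₁ α) (sg p₂ q₂ β) =
      sg (p₁ + p₂) (q₁ + q₂) (cupSign m p₁ q₁ p₂ q₂ • blk rfl rfl α β) := cp_sg m rfl rfl α β

theorem dB_cp_sg (m : ℤ) {α : PForm E G p₁ q₁ (W.V →L[ℝ] X.V)} {β : PForm E G p₂ q₂ (V.V →L[ℝ] W.V)}
    (hα : ∀ x, SmoothFormAt (powModel E p₁) α x) (hβ : ∀ x, SmoothFormAt (powModel E p₂) β x) :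
    dB (cp m (sg p₁ q₁ α) (sg p₂ q₂ β)) =
      cp (m + 1) (dB (sg p₁ q₁ α)) (sg p₂ q₂ β) +
        sgn m • cp m (sg p₁ q₁ α) (dB (sg p₂ q₂ β)) := by
  rw [cp_sg', dB_sg, dB_sg, dB_sg, cp_sg (m + 1) (q := q₁ + q₂ + 1) rfl (by omega),
    cp_sg m (q := q₁ + q₂ + 1) rfl (by omega), ← sg_smul, ← sg_add]
  congr 1
  rw [ed_smul', ed_blk rfl rfl (by omega) (by omega) hα hβ, blk_smul_left, blk_smul_right]
  simp only [smul_add, smul_smul]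
  have e1 : (-1 : ℝ) ^ (p₁ + p₂) * cupSign m p₁ q₁ p₂ q₂ =
      cupSign (m + 1) p₁ (q₁ + 1) p₂ q₂ * (-1) ^ p₁ := by
    simp only [cupSign, ← sgn_natCast, ← sgn_add]
    refine sgn_congr ?_
    push_cast
    simp only [Int.even_add, Int.even_sub, Int.even_mul, Int.not_even_one]
    grind
  have e2 : (-1 : ℝ) ^ (p₁ + p₂) * (cupSign m p₁ q₁ p₂ q₂ * (-1) ^ q₁) =
      sgn m * (cupSign m p₁ q₁ p₂ (q₂ + 1) * (-1) ^ p₂) := by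
    simp only [cupSign, ← sgn_natCast, ← sgn_add]
    refine sgn_congr ?_
    push_cast
    simp only [Int.even_add, Int.even_sub, Int.even_mul, Int.not_even_one]
    grind
  rw [e1, ← e2]

theorem intD_cp_sg (m : ℤ) (α : PForm E G p₁ q₁ (W.V →L[ℝ] X.V))
    (β : PForm E G p₂ q₂ (V.V →L[ℝ] W.V)) :
    intD (cp m (sg p₁ q₁ α) (sg p₂ q₂ β)) =
      cp (m + 1) (intD (sg p₁ q₁ α)) (sg p₂ q₂ β) +
        sgn m • cp m (sg p₁ q₁ α) (intD (sg p₂ q₂ β)) := by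
  rw [cp_sg', intD_sg, intD_sg, intD_sg, cp_sg (m + 1) (p := p₁ + p₂ + 1) (by omega) rfl,
    cp_sg m (p := p₁ + p₂ + 1) (by omega) rfl, ← sg_smul, ← sg_add]
  congr 1
  rw [intFace_smul, intFace_blk rfl rfl (by omega) (by omega)]
  simp only [smul_add, smul_smul]
  have e1 : cupSign m p₁ q₁ p₂ q₂ = cupSign (m + 1) (p₁ + 1) q₁ p₂ q₂ := by
    simp only [cupSign]
    refine congrArg sgn ?_
    push_cast
    ring
  have e2 : cupSign m p₁ q₁ p₂ q₂ * (-1) ^ p₁ = sgn m * cupSign m p₁ q₁ (p₂ + 1) q₂ := by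
    simp only [cupSign, ← sgn_natCast, ← sgn_add]
    refine sgn_congr ?_
    push_cast
    simp only [Int.even_add, Int.even_sub, Int.even_mul, Int.not_even_one]
    grind
  rw [← e1, ← e2]

theorem dl_cp_sg (m n : ℤ) (α : PForm E G p₁ q₁ (W.V →L[ℝ] X.V))
    (β : PForm E G p₂ q₂ (V.V →L[ℝ] W.V)) :
    dl (m + n) (cp m (sg p₁ q₁ α) (sg p₂ q₂ β)) =
      cp (m + 1) (dl m (sg p₁ q₁ α)) (sg p₂ q₂ β) +
        sgn m • cp m (sg p₁ q₁ α) (dl n (sg p₂ q₂ β)) := by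
  rw [cp_sg', dl_sg, dl_sg, dl_sg, cp_sg', cp_sg', ← sg_smul, ← sg_add]
  congr 1
  rw [coeffD_smul, show m + n - (p₁ + p₂ : ℕ) - (q₁ + q₂ : ℕ) =
    (m - p₁ - q₁) + (n - p₂ - q₂) by push_cast; ring, coeffD_blk, blk_smul_left, blk_smul_right]
  simp only [smul_add, smul_smul]
  have e1 : (-1 : ℝ) ^ (p₁ + p₂ + (q₁ + q₂)) * cupSign m p₁ q₁ p₂ q₂ =
      cupSign (m + 1) p₁ q₁ p₂ q₂ * (-1) ^ (p₁ + q₁) := by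
    simp only [cupSign, ← sgn_natCast, ← sgn_add]
    refine sgn_congr ?_
    push_cast
    simp only [Int.even_add, Int.even_sub, Int.even_mul, Int.not_even_one]
    grind
  have e2 : (-1 : ℝ) ^ (p₁ + p₂ + (q₁ + q₂)) * cupSign m p₁ q₁ p₂ q₂ * sgn (m - p₁ - q₁) =
      sgn m * (cupSign m p₁ q₁ p₂ q₂ * (-1) ^ (p₂ + q₂)) := by
    simp only [cupSign, ← sgn_natCast, ← sgn_add]
    refine sgn_congr ?_
    push_cast
    simp only [Int.even_add, Int.even_sub, Int.even_mul]
    grind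
  rw [e1, ← e2, ← e1]
  simp only [mul_assoc]

theorem D1_cp_sg (m n : ℤ) {α : PForm E G p₁ q₁ (W.V →L[ℝ] X.V)}
    {β : PForm E G p₂ q₂ (V.V →L[ℝ] W.V)}
    (hα : ∀ x, SmoothFormAt (powModel E p₁) α x) (hβ : ∀ x, SmoothFormAt (powModel E p₂) β x) :
    D1 (m + n) (cp m (sg p₁ q₁ α) (sg p₂ q₂ β)) =
      cp (m + 1) (D1 m (sg p₁ q₁ α)) (sg p₂ q₂ β) +
        sgn m • cp m (sg p₁ q₁ α) (D1 n (sg p₂ q₂ β)) := by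
  simp only [D1, dB_cp_sg m hα hβ, intD_cp_sg, dl_cp_sg, cp_add_left, cp_add_right, smul_add]
  abel

theorem cp_assoc_sg (l m : ℤ) {p₃ q₃ : ℕ} (α : PForm E G p₁ q₁ (X.V →L[ℝ] Y.V))
    (β : PForm E G p₂ q₂ (W.V →L[ℝ] X.V)) (γ : PForm E G p₃ q₃ (V.V →L[ℝ] W.V)) :
    cp (l + m) (cp l (sg p₁ q₁ α) (sg p₂ q₂ β)) (sg p₃ q₃ γ) =
      cp l (sg p₁ q₁ α) (cp m (sg p₂ q₂ β) (sg p₃ q₃ γ)) := by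
  rw [cp_sg' l, cp_sg', cp_sg' m, cp_sg l (p := p₁ + p₂ + p₃) (q := q₁ + q₂ + q₃)
    (by omega) (by omega)]
  congr 1
  rw [blk_smul_left, blk_smul_right, blk_assoc (p₂₃ := p₂ + p₃) (q₂₃ := q₂ + q₃) rfl rfl rfl rfl
    rfl rfl (by omega) (by omega), smul_smul, smul_smul]
  congr 1
  simp only [cupSign, ← sgn_add]
  refine sgn_congr ?_
  push_cast
  simp only [Int.even_add, Int.even_sub, Int.even_mul]
  grind

end Single

/-- The Leibniz rule. -/
theorem D1_cp (m n : ℤ) {ψ : PCochain W X} {φ : PCochain V W} (hψ : Sm ψ) (hφ : Sm φ) :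
    D1 (m + n) (cp m ψ φ) = cp (m + 1) (D1 m ψ) φ + sgn m • cp m ψ (D1 n φ) := by
  funext p q
  refine sm_induction (P := fun ψ => ∀ φ : PCochain V W, Sm φ → (D1 (m + n) (cp m ψ φ)) p q =
    (cp (m + 1) (D1 m ψ) φ + sgn m • cp m ψ (D1 n φ)) p q) p q ?_ ?_ ?_ hψ φ hφ
  · intro η η' h h' ih ih' φ hφ
    rw [cp_add_left, D1_add _ (h.cp hφ m) (h'.cp hφ m), Pi.add_apply, Pi.add_apply, ih φ hφ,
      ih' φ hφ, D1_add m h h', cp_add_left, cp_add_left, smul_add]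
    simp only [Pi.add_apply]
    abel
  · intro i j α hα φ hφ
    refine sm_induction (P := fun φ => (D1 (m + n) (cp m (sg i j α) φ)) p q =
      (cp (m + 1) (D1 m (sg i j α)) φ + sgn m • cp m (sg i j α) (D1 n φ)) p q) p q ?_ ?_ ?_ hφ
    · intro η η' h h' ih ih'
      rw [cp_add_right, D1_add _ ((Sm.sg hα).cp h m) ((Sm.sg hα).cp h' m), Pi.add_apply,
        Pi.add_apply, ih, ih', D1_add n h h', cp_add_right, cp_add_right, smul_add]
      simp only [Pi.add_apply]
      abel
    · intro k l β hβ
      rw [D1_cp_sg m n hα hβ]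
    · intro η η' ha _ _ ih
      have hr := Agree.refl p q (sg i j α)
      rw [← (hr.cp ha m).D1 (m + n) p le_rfl q le_rfl, ih]
      exact (((hr.D1 m).cp ha (m + 1)).add ((hr.cp (ha.D1 n) m).smul _)) p le_rfl q le_rfl
  · intro η η' ha _ _ ih φ hφ
    have hr := Agree.refl p q φ
    rw [← (ha.cp hr m).D1 (m + n) p le_rfl q le_rfl, ih φ hφ]
    exact (((ha.D1 m).cp hr (m + 1)).add ((ha.cp (hr.D1 n) m).smul _)) p le_rfl q le_rfl

/-- The product is associative. -/
theorem cp_assoc {l m lm : ℤ} (hlm : l + m = lm) {a : PCochain X Y} {b : PCochain W X}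
    {c : PCochain V W} (ha : Sm a) (hb : Sm b) (hc : Sm c) :
    cp lm (cp l a b) c = cp l a (cp m b c) := by
  subst hlm
  funext p q
  revert b c
  refine sm_induction (P := fun a => ∀ {b : PCochain W X} {c : PCochain V W}, Sm b → Sm c →
    (cp (l + m) (cp l a b) c) p q = (cp l a (cp m b c)) p q) p q ?_ ?_ ?_ ha
  · intro η η' h h' ih ih' b c hb hc
    simp only [cp_add_left, Pi.add_apply, ih hb hc, ih' hb hc]
  · intro i j α hα b c hb hc
    revert c
    refine sm_induction (P := fun b => ∀ {c : PCochain V W}, Sm c →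
      (cp (l + m) (cp l (sg i j α) b) c) p q = (cp l (sg i j α) (cp m b c)) p q) p q ?_ ?_ ?_ hb
    · intro η η' h h' ih ih' c hc
      simp only [cp_add_left, cp_add_right, Pi.add_apply, ih hc, ih' hc]
    · intro i' j' β hβ c hc
      refine sm_induction (P := fun c => (cp (l + m) (cp l (sg i j α) (sg i' j' β)) c) p q =
        (cp l (sg i j α) (cp m (sg i' j' β) c)) p q) p q ?_ ?_ ?_ hc
      · intro η η' h h' ih ih'
        simp only [cp_add_right, Pi.add_apply, ih, ih']
      · intro i'' j'' γ _
        rw [cp_assoc_sg]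
      · intro η η' h _ _ ih
        rw [← (Agree.refl p q _).cp h (l + m) p le_rfl q le_rfl, ih]
        exact (Agree.refl p q _).cp ((Agree.refl p q _).cp h m) l p le_rfl q le_rfl
    · intro η η' h _ _ ih c hc
      rw [← ((Agree.refl p q _).cp h l).cp (Agree.refl p q c) (l + m) p le_rfl q le_rfl, ih hc]
      exact (Agree.refl p q _).cp (h.cp (Agree.refl p q c) m) l p le_rfl q le_rfl
  · intro η η' h _ _ ih b c hb hc
    rw [← (h.cp (Agree.refl p q b) l).cp (Agree.refl p q c) (l + m) p le_rfl q le_rfl, ih hb hc]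
    exact h.cp (Agree.refl p q (cp m b c)) l p le_rfl q le_rfl

variable (E G) in
/-- A constant function on `BG_p`, as a form of degree zero. -/
def cst (p : ℕ) {F : Type*} [NormedAddCommGroup F] [NormedSpace ℝ F] (c : F) : PForm E G p 0 F :=
  fun _ => ContinuousAlternatingMap.constOfIsEmpty ℝ (Fin p → E) (Fin 0) c

theorem smooth_cst (p : ℕ) {F : Type*} [NormedAddCommGroup F] [NormedSpace ℝ F]
    [FiniteDimensional ℝ F] (c : F) (x : Fin p → G) :
    SmoothFormAt (powModel E p) (cst E G p c) x := by
  have : chartForm (powModel E p) (cst E G p c) x =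
      fun _ => ContinuousAlternatingMap.constOfIsEmpty ℝ (Fin p → E) (Fin 0) c := by
    funext y
    ext v
    rfl
  rw [SmoothFormAt, this]
  exact contDiffAt_const

theorem ed_cst (p : ℕ) {F : Type*} [NormedAddCommGroup F] [NormedSpace ℝ F]
    [FiniteDimensional ℝ F] (c : F) : ed (powModel E p) (cst E G p c) = 0 := by
  funext x
  have : chartForm (powModel E p) (cst E G p c) x =
      fun _ => ContinuousAlternatingMap.constOfIsEmpty ℝ (Fin p → E) (Fin 0) c := by
    funext y
    ext v
    rfl
  rw [ed_apply, this, extDeriv, fderiv_fun_const]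
  have h := map_zero (ContinuousAlternatingMap.alternatizeUncurryFinCLM ℝ (Fin p → E) F (n := 0))
  exact (congrArg (fun c : (Fin p → E) [⋀^Fin 1]→L[ℝ] F => c.compContinuousLinearMap
    (tmap (powModel E p) 𝓘(ℝ, Fin p → E) (extChartAt (powModel E p) x) x)) h).trans rfl

theorem blk_id_left {p₂ p q : ℕ} (p₁ : ℕ) (hp : p₁ + p₂ = p) (h : 0 + q = q)
    (β : PForm E G p₂ q (V.V →L[ℝ] W.V)) :
    blk hp h (cst E G p₁ (ContinuousLinearMap.id ℝ W.V)) β =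
      pb (powModel E p) (powModel E p₂) (back hp) β := by
  exact (blk_const_left hp h _ β).trans rfl

theorem blk_id_right {p₁ p q : ℕ} (p₂ : ℕ) (hp : p₁ + p₂ = p) (h : q + 0 = q)
    (α : PForm E G p₁ q (V.V →L[ℝ] W.V)) :
    blk hp h α (cst E G p₂ (ContinuousLinearMap.id ℝ V.V)) =
      pb (powModel E p) (powModel E p₁) (front hp) α := by
  exact (blk_const_right hp h α _).trans rfl

variable (V) in
/-- The constant function `id` on `BG_p`, as a cochain. -/
def unit (p : ℕ) : PCochain V V := sg p 0 (cst E G p (ContinuousLinearMap.id ℝ V.V))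

theorem Sm.unit (p : ℕ) : Sm (unit V p) := Sm.sg (smooth_cst p _)

theorem unit_cp {φ : PCochain V W} (hφ : Sm φ) : cp 0 (unit W 0) φ = φ := by
  funext p q
  refine sm_induction (P := fun φ => cp 0 (unit W 0) φ p q = φ p q) p q ?_ ?_ ?_ hφ
  · intro η η' _ _ h h'
    rw [cp_add_right, Pi.add_apply, Pi.add_apply, h, h']
    rfl
  · intro i j α _
    have e : cp 0 (unit W 0) (sg i j α) = sg i j α := by
      rw [unit, cp_sg 0 (zero_add i) (zero_add j), blk_id_left, cupSign]
      have : (back (zero_add i) : (Fin i → G) → _) = id := by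
        funext g k
        simp only [back, id]
        congr 1
        ext
        simp
      rw [this, pb_id]
      simp [sgn_zero]
    rw [e]
  · intro η η' h _ _ ih
    rw [← (Agree.refl p q _).cp h 0 p le_rfl q le_rfl, ih, h p le_rfl q le_rfl]

theorem cp_unit (m : ℤ) {φ : PCochain V W} (hφ : Sm φ) : cp m φ (unit V 0) = φ := by
  funext p q
  refine sm_induction (P := fun φ => cp m φ (unit V 0) p q = φ p q) p q ?_ ?_ ?_ hφ
  · intro η η' _ _ h h'
    rw [cp_add_left, Pi.add_apply, Pi.add_apply, h, h']
    rfl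
  · intro i j α _
    have e : cp m (sg i j α) (unit V 0) = sg i j α := by
      rw [unit, cp_sg m (add_zero i) (add_zero j), blk_id_right, cupSign]
      have : (front (add_zero i) : (Fin i → G) → _) = id := rfl
      rw [this, pb_id]
      simp [sgn_zero]
    rw [e]
  · intro η η' h _ _ ih
    rw [← h.cp (Agree.refl p q _) m p le_rfl q le_rfl, ih, h p le_rfl q le_rfl]

theorem D1_unit : D1 0 (unit V 0) = 0 := by
  have h1 : coeffD 0 (cst E G 0 (ContinuousLinearMap.id ℝ V.V)) = 0 := by
    funext x
    ext v w
    simp [coeffD, mc, cst, sgn_zero]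
  have h2 : intFace (cst E G 0 (ContinuousLinearMap.id ℝ V.V)) = 0 := by simp [intFace]
  rw [D1, unit, dB_sg, intD_sg, dl_sg, ed_cst, h2]
  simp only [Nat.cast_zero, sub_zero, h1, smul_zero, sg_zero, add_zero]

end PCochain

end Total

section Twisted

variable {E : Type v} [NormedAddCommGroup E] [NormedSpace ℝ E] [FiniteDimensional ℝ E]
  {G : Type w} [TopologicalSpace G] [ChartedSpace E G] [Group G] [LieGroup 𝓘(ℝ, E) ∞ G]

variable {V W X Y : TRep.{u} (E := E) G}

namespace PCochain

/-! ### The twist by the representation forms -/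

variable (V) in
/-- The representation form of `V`, as a cochain with components on `BG_1`. -/
def Phi : PCochain V V := fun p q =>
  match p with
  | 1 => pb (powModel E 1) 𝓘(ℝ, E) (fun g => g 0) (V.phi q)
  | _ => 0

theorem Phi_ne {p : ℕ} (h : p ≠ 1) (q : ℕ) : Phi V p q = 0 := by
  match p with
  | 0 => rfl
  | 1 => exact absurd rfl h
  | p + 2 => rfl

theorem Phi_one (q : ℕ) :
    Phi V 1 q = pb (powModel E 1) 𝓘(ℝ, E) (fun g => g 0) (V.phi q) := rfl

theorem Sm.Phi : Sm (Phi V) := fun p q x => by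
  by_cases h : p = 1
  · subst h
    exact (V.phi_smooth q _).pb (contMDiff_pow_proj (E := E) (G := G) 0 x)
  · rw [Phi_ne h]
    exact SmoothFormAt.zero x

theorem cp_Phi_left (m : ℤ) (φ : PCochain V W) (p q : ℕ) : cp m (Phi W) φ (p + 1) q =
    ∑ t : {t // t ∈ Finset.HasAntidiagonal.antidiagonal q}, cupSign m 1 t.1.1 p t.1.2 •
      blk (add_comm 1 p) (Finset.HasAntidiagonal.mem_antidiagonal.1 t.2) (Phi W 1 t.1.1)
        (φ p t.1.2) := by
  unfold cp
  rw [Finset.sum_eq_single ⟨(1, p), Finset.HasAntidiagonal.mem_antidiagonal.2 (add_comm 1 p)⟩]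
  · rintro ⟨⟨a, b⟩, hs⟩ _ h
    have hs' := Finset.HasAntidiagonal.mem_antidiagonal.1 hs
    have ha : a ≠ 1 := by
      rintro rfl
      exact h (Subtype.ext (Prod.ext rfl (by simp only at hs' ⊢; omega)))
    refine Finset.sum_eq_zero fun t _ => ?_
    rw [Phi_ne ha, blk_zero_left, smul_zero]
  · intro h
    exact absurd (Finset.mem_univ _) h

theorem cp_Phi_left_zero (m : ℤ) (φ : PCochain V W) (q : ℕ) : cp m (Phi W) φ 0 q = 0 := by
  unfold cp
  refine Finset.sum_eq_zero fun s _ => Finset.sum_eq_zero fun t _ => ?_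
  have hs' := Finset.HasAntidiagonal.mem_antidiagonal.1 s.2
  rw [Phi_ne (by omega), blk_zero_left, smul_zero]

theorem cp_Phi_right (m : ℤ) (φ : PCochain V W) (p q : ℕ) : cp m φ (Phi V) (p + 1) q =
    ∑ t : {t // t ∈ Finset.HasAntidiagonal.antidiagonal q}, cupSign m p t.1.1 1 t.1.2 •
      blk rfl (Finset.HasAntidiagonal.mem_antidiagonal.1 t.2) (φ p t.1.1)
        (Phi V 1 t.1.2) := by
  unfold cp
  rw [Finset.sum_eq_single ⟨(p, 1), Finset.HasAntidiagonal.mem_antidiagonal.2 rfl⟩]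
  · rintro ⟨⟨a, b⟩, hs⟩ _ h
    have hs' := Finset.HasAntidiagonal.mem_antidiagonal.1 hs
    have ha : b ≠ 1 := by
      rintro rfl
      exact h (Subtype.ext (Prod.ext (by simp only at hs' ⊢; omega) rfl))
    refine Finset.sum_eq_zero fun t _ => ?_
    rw [Phi_ne ha, blk_zero_right, smul_zero]
  · intro h
    exact absurd (Finset.mem_univ _) h

theorem cp_Phi_right_zero (m : ℤ) (φ : PCochain V W) (q : ℕ) : cp m φ (Phi V) 0 q = 0 := by
  unfold cp
  refine Finset.sum_eq_zero fun s _ => Finset.sum_eq_zero fun t _ => ?_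
  have hs' := Finset.HasAntidiagonal.mem_antidiagonal.1 s.2
  rw [Phi_ne (by omega), blk_zero_right, smul_zero]

theorem cupSign_one (a b : ℕ) : cupSign 1 1 a 1 b = (-1) ^ (a * b) := by
  simp only [cupSign, ← sgn_natCast]
  refine sgn_congr ?_
  push_cast
  simp only [Int.even_add, Int.even_sub, Int.even_mul, Int.not_even_one]
  grind

/-- The multiplicativity of the representation form. -/
theorem intFace_Phi [ConnectedSpace G] (q : ℕ) :
    intFace (Phi V 1 q) + cp 1 (Phi V) (Phi V) 2 q = 0 := by
  have h0 : (fun g : Fin 1 → G => g 0) ∘ face (1 : Fin 3) = fun g : Fin 2 → G => g 0 * g 1 := rfl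
  have h1 : intFace (Phi V 1 q) =
      -pb (powModel E 2) 𝓘(ℝ, E) (fun g : Fin 2 → G => g 0 * g 1) (V.phi q) := by
    rw [intFace, Fin.sum_univ_one, Phi_one,
      pb_comp (contMDiff_pow_proj (E := E) (G := G) (0 : Fin 1)).mdiff (contMDiff_face E _).mdiff]
    have h2 : ((0 : Fin 1).succ.castSucc : Fin 3) = 1 := rfl
    rw [h2, h0]
    simp
  rw [h1, cp_Phi_left, V.pb_phi_mul (contMDiff_pow_proj (E := E) (G := G) (0 : Fin 2)).mdiff
    (contMDiff_pow_proj (E := E) (G := G) (1 : Fin 2)).mdiff, neg_add_eq_zero,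
    ← Finset.sum_coe_sort (Finset.HasAntidiagonal.antidiagonal q)]
  refine Finset.sum_congr rfl fun t _ => ?_
  have ht := Finset.HasAntidiagonal.mem_antidiagonal.1 t.2
  rw [TRep.phiTerm, dif_pos ht, blk, Phi_one, Phi_one,
    pb_comp (contMDiff_pow_proj (E := E) (G := G) (0 : Fin 1)).mdiff (contMDiff_front E _).mdiff,
    pb_comp (contMDiff_pow_proj (E := E) (G := G) (0 : Fin 1)).mdiff (contMDiff_back E _).mdiff]
  rw [← cupSign_one]
  rfl

/-- The representation form is closed, for the differentials of forms and of coefficients. -/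
theorem dB_Phi_one [ConnectedSpace G] (q : ℕ) : dB (Phi V) 1 q + dl 1 (Phi V) 1 q = 0 := by
  have hp : ∀ k, pb (powModel E 1) 𝓘(ℝ, E) (fun g : Fin 1 → G => g 0) (V.phi k) = Phi V 1 k :=
    fun _ => rfl
  match q with
  | 0 =>
    change 0 + (-1 : ℝ) ^ (1 + 0) • coeffD (1 - (1 : ℕ) - (0 : ℕ)) (Phi V 1 0) = 0
    have : coeffD (1 - (1 : ℕ) - (0 : ℕ)) (Phi V 1 0) = 0 := by
      funext g
      ext w y
      have h := V.rho_delta (g 0)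
      have h2 : ∀ w' : Fin 0 → E, V.phi 0 (g 0) w' = V.ρ (g 0) := V.phi_zero (g 0)
      have h3 : Phi V 1 0 g w = V.ρ (g 0) := h2 _
      have h4 := congrArg (fun A : V.V →L[ℝ] V.V => A y) h
      simp only [ContinuousLinearMap.comp_apply] at h4
      simp [coeffD, mc, h3, sgn_zero, h4]
    rw [this, smul_zero, add_zero]
  | q + 1 =>
    change (-1 : ℝ) ^ 1 • ed (powModel E 1) (Phi V 1 q) +
      (-1 : ℝ) ^ (1 + (q + 1)) • coeffD (1 - (1 : ℕ) - (q + 1 : ℕ)) (Phi V 1 (q + 1)) = 0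
    have h1 : ed (powModel E 1) (Phi V 1 q) =
        (-1 : ℝ) ^ q • mc (ContinuousLinearMap.compL ℝ V.V V.V V.V V.δ) (Phi V 1 (q + 1)) +
        mc ((ContinuousLinearMap.compL ℝ V.V V.V V.V).flip V.δ) (Phi V 1 (q + 1)) := by
      have h2 : ed (powModel E 1) (Phi V 1 q) =
          pb (powModel E 1) 𝓘(ℝ, E) (fun g : Fin 1 → G => g 0) (ed 𝓘(ℝ, E) (V.phi q)) :=
        funext fun x => SmoothFormAt.ed_pb (V.phi_smooth q _)
          (contMDiff_pow_proj (E := E) (G := G) 0 x)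
      rw [h2, V.ed_phi]
      rfl
    have h3 : sgn (1 - (1 : ℕ) - (q + 1 : ℕ)) = (-1 : ℝ) ^ (q + 1) := by
      rw [← sgn_natCast]
      exact sgn_congr ⟨0, by push_cast; ring⟩
    have h4 : (-1 : ℝ) ^ (1 + (q + 1)) = (-1) ^ q := by ring
    have h5 : (-1 : ℝ) ^ q * (-1) ^ (q + 1) = -1 := by
      rw [← pow_add, show q + (q + 1) = 2 * q + 1 by ring, pow_succ, pow_mul]
      simp
    rw [h1, coeffD, h3, h4, smul_sub, smul_smul, h5, pow_one, smul_add, smul_smul, neg_one_mul,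
      neg_smul, neg_smul, one_smul]
    abel

/-- The Maurer-Cartan equation for the representation form. In the differential only the faces
different from the first and the last one are used, whence `Φ` replaces `Φ - id`. -/
theorem D1_Phi [ConnectedSpace G] : D1 1 (Phi V) + cp 1 (Phi V) (Phi V) = 0 := by
  have hdB : ∀ p q, p ≠ 1 → dB (Phi V) p q = 0 := fun p q h => by
    cases q with
    | zero => rfl
    | succ q =>
      change (-1 : ℝ) ^ p • ed (powModel E p) (Phi V p q) = 0
      rw [Phi_ne h, ed_zero, smul_zero]
  have hdl : ∀ p q, p ≠ 1 → dl 1 (Phi V) p q = 0 := fun p q h => by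
    change _ • coeffD _ (Phi V p q) = 0
    rw [Phi_ne h, coeffD_zero, smul_zero]
  funext p q
  change dB (Phi V) p q + intD (Phi V) p q + dl 1 (Phi V) p q + cp 1 (Phi V) (Phi V) p q = 0
  match p with
  | 0 =>
    rw [hdB _ _ (by omega), hdl _ _ (by omega), cp_Phi_left_zero]
    simp [intD]
  | 1 =>
    have h1 : intD (Phi V) 1 q = 0 := intFace_zero
    have h2 : cp 1 (Phi V) (Phi V) 1 q = 0 := by
      rw [cp_Phi_left]
      refine Finset.sum_eq_zero fun t _ => ?_
      rw [Phi_ne (p := 0) (by omega), blk_zero_right, smul_zero]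
    rw [h1, h2, add_zero, add_zero, dB_Phi_one]
  | 2 =>
    rw [hdB _ _ (by omega), hdl _ _ (by omega), zero_add, add_zero]
    exact intFace_Phi q
  | p + 3 =>
    have h1 : intD (Phi V) (p + 3) q = 0 := by
      change intFace (Phi V (p + 2) q) = 0
      rw [Phi_ne (by omega), intFace_zero]
    have h2 : cp 1 (Phi V) (Phi V) (p + 3) q = 0 := by
      rw [cp_Phi_left]
      refine Finset.sum_eq_zero fun t _ => ?_
      rw [Phi_ne (p := p + 2) (by omega), blk_zero_right, smul_zero]
    rw [hdB _ _ (by omega), hdl _ _ (by omega), h1, h2]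
    simp

/-- The twisted differential on the cochains of total degree `m`. -/
def tD (m : ℤ) (φ : PCochain V W) : PCochain V W :=
  D1 m φ + cp 1 (Phi W) φ - sgn m • cp m φ (Phi V)

theorem Sm.tD {φ : PCochain V W} (h : Sm φ) (m : ℤ) : Sm (tD m φ) :=
  ((h.D1 m).add (Sm.Phi.cp h 1)).sub ((h.cp Sm.Phi m).smul _)

theorem tD_add (m : ℤ) {φ φ' : PCochain V W} (h : Sm φ) (h' : Sm φ') :
    tD m (φ + φ') = tD m φ + tD m φ' := by
  simp only [tD, D1_add m h h', cp_add_left, cp_add_right, smul_add]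
  abel

theorem tD_smul (m : ℤ) (c : ℝ) (φ : PCochain V W) : tD m (c • φ) = c • tD m φ := by
  simp only [tD, D1_smul, cp_smul_left, cp_smul_right, smul_add, smul_sub, smul_comm _ c]

theorem cp_sub_left (m : ℤ) (ψ ψ' : PCochain W X) (φ : PCochain V W) :
    cp m (ψ - ψ') φ = cp m ψ φ - cp m ψ' φ :=
  map_sub (AddMonoidHom.mk' (fun ψ => cp m ψ φ) fun ψ ψ' => cp_add_left m ψ ψ' φ) _ _

theorem cp_sub_right (m : ℤ) (ψ : PCochain W X) (φ φ' : PCochain V W) :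
    cp m ψ (φ - φ') = cp m ψ φ - cp m ψ φ' :=
  map_sub (AddMonoidHom.mk' (fun φ => cp m ψ φ) fun φ φ' => cp_add_right m ψ φ φ') _ _

/-- The general `neg_one_smul`, for the instances found on cochains. -/
theorem neg_one_smul' (η : PCochain V W) : (-1 : ℝ) • η = -η := by
  funext p q x
  ext1 v
  simp

/-- The general `neg_smul`, for the instances found on cochains. -/
theorem neg_smul' (c : ℝ) (η : PCochain V W) : (-c) • η = -(c • η) := by
  funext p q x
  ext1 v
  simp

theorem D1_sub (m : ℤ) {η η' : PCochain V W} (h : Sm η) (h' : Sm η') :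
    D1 m (η - η') = D1 m η - D1 m η' := by
  rw [sub_eq_add_neg, ← neg_one_smul', D1_add m h (h'.smul _), D1_smul, neg_one_smul',
    ← sub_eq_add_neg]

/-- The twisted differential is a derivation. -/
theorem tD_cp (m n : ℤ) {ψ : PCochain W X} {φ : PCochain V W} (hψ : Sm ψ) (hφ : Sm φ) :
    tD (m + n) (cp m ψ φ) = cp (m + 1) (tD m ψ) φ + sgn m • cp m ψ (tD n φ) := by
  have h1 := cp_assoc (add_comm 1 m) Sm.Phi hψ hφ
  have h2 := cp_assoc (rfl : m + 1 = m + 1) hψ Sm.Phi hφ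
  have h3 := cp_assoc (rfl : m + n = m + n) hψ hφ Sm.Phi
  simp only [tD, D1_cp m n hψ hφ, cp_sub_left, cp_add_left, cp_smul_left, cp_sub_right,
    cp_add_right, cp_smul_right, h1, h2, h3, smul_add, smul_sub, smul_smul, sgn_add]
  abel

theorem tD_unit : tD 0 (unit V 0) = 0 := by
  rw [tD, D1_unit, cp_unit 1 Sm.Phi, unit_cp Sm.Phi, sgn_zero, one_smul, zero_add, sub_self]

/-- The twisted differential squares to zero, by the Maurer-Cartan equation for `Φ`. -/
theorem tD_tD [ConnectedSpace G] (m : ℤ) {φ : PCochain V W} (h : Sm φ) :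
    tD (m + 1) (tD m φ) = 0 := by
  have hP : ∀ U : TRep.{u} (E := E) G, D1 1 (Phi U) = -cp 1 (Phi U) (Phi U) := fun U =>
    eq_neg_of_add_eq_zero_left D1_Phi
  have hW : Sm (cp 1 (Phi W) φ) := Sm.Phi.cp h 1
  have hV : Sm (cp m φ (Phi V)) := h.cp Sm.Phi m
  have hn : ∀ ψ : PCochain W W, cp 2 (-ψ) φ = -cp 2 ψ φ := fun ψ => by
    rw [← neg_one_smul', cp_smul_left, neg_one_smul']
  have hn' : ∀ ψ : PCochain V V, cp m φ (-ψ) = -cp m φ ψ := fun ψ => by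
    rw [← neg_one_smul', cp_smul_right, neg_one_smul']
  have h1 : D1 (m + 1) (cp 1 (Phi W) φ) =
      -cp 1 (Phi W) (cp 1 (Phi W) φ) - cp 1 (Phi W) (D1 m φ) := by
    rw [add_comm m 1, D1_cp 1 m Sm.Phi h, hP, show (1 : ℤ) + 1 = 2 from rfl, hn,
      cp_assoc (show (1 : ℤ) + 1 = 2 from rfl) Sm.Phi Sm.Phi h, sgn_one, neg_one_smul',
      ← sub_eq_add_neg]
  have h2 : D1 (m + 1) (cp m φ (Phi V)) =
      cp (m + 1) (D1 m φ) (Phi V) - sgn m • cp m φ (cp 1 (Phi V) (Phi V)) := by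
    rw [D1_cp m 1 h Sm.Phi, hP, hn', smul_neg, ← sub_eq_add_neg]
  have h3 := cp_assoc (rfl : m + 1 = m + 1) h (Sm.Phi (V := V)) (Sm.Phi (V := V))
  have h4 := cp_assoc (add_comm 1 m) (Sm.Phi (V := W)) h (Sm.Phi (V := V))
  rw [tD, tD, D1_sub _ ((h.D1 m).add hW) (hV.smul _), D1_add _ (h.D1 m) hW, D1_smul, D1_D1 m h, h1,
    h2]
  simp only [cp_sub_left, cp_add_left, cp_smul_left, cp_sub_right, cp_add_right, cp_smul_right,
    sgn_add_one, neg_smul, smul_sub, smul_add, h3, h4, smul_smul, neg_mul, sgn_mul_self, one_smul]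
  abel

end PCochain

end Twisted

section Categories

variable {E : Type v} [NormedAddCommGroup E] [NormedSpace ℝ E] [FiniteDimensional ℝ E]
  {G : Type w} [TopologicalSpace G] [ChartedSpace E G] [Group G] [LieGroup 𝓘(ℝ, E) ∞ G]

variable {V W X Y : TRep.{u} (E := E) G}

namespace PCochain

/-! ### Comparison of the two descriptions of cochains -/

theorem cup_eq (m : ℤ) (ψ : PCochain W X) (φ : PCochain V W) :
    (Cochain.cup m ψ φ : Cochain V X) = cp m ψ φ := by
  funext p q
  refine Finset.sum_congr rfl fun s _ => Finset.sum_congr rfl fun t _ => ?_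
  exact negOnePow_smul _ (blk (Finset.HasAntidiagonal.mem_antidiagonal.1 s.2)
    (Finset.HasAntidiagonal.mem_antidiagonal.1 t.2) (ψ s.1.1 t.1.1) (φ s.1.2 t.1.2))

theorem dBar_eq (φ : PCochain V W) : (Cochain.dBar φ : Cochain V W) = dB φ := by
  funext p q
  cases q <;> rfl

theorem partialD_eq (φ : PCochain V W) : (Cochain.partialD φ : Cochain V W) = allD φ := by
  funext p q
  cases p <;> rfl

theorem deltaBar_eq (m : ℤ) (φ : PCochain V W) :
    (Cochain.deltaBar m φ : Cochain V W) = dl m φ := by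
  funext p q
  refine congrArg (fun α : PForm E G p q (V.V →L[ℝ] W.V) => (-1 : ℝ) ^ (p + q) •
    (mc (ContinuousLinearMap.compL ℝ V.V W.V W.V W.δ) (φ p q) - α)) ?_
  exact negOnePow_smul _ (mc ((ContinuousLinearMap.compL ℝ V.V V.V W.V).flip V.δ) (φ p q))

theorem one_eq : (Cochain.one V : Cochain V V) = unit V 0 := by
  refine eq_sg (η := Cochain.one V) rfl fun p q h => ?_
  match p, q with
  | 0, 0 => simp at h
  | 0, q + 1 => rfl
  | p + 1, q => rfl

theorem theta_eq : (Cochain.theta V : Cochain V V) = (Phi V - unit V 1 : PCochain V V) := by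
  funext p q
  change _ = Phi V p q - unit V 1 p q
  match p, q with
  | 0, q =>
    rw [unit, sg_ne _ (by simp), Phi_ne (by omega)]
    simp [Cochain.theta]
    rfl
  | 1, 0 =>
    rw [unit, sg_same]
    rfl
  | 1, q + 1 =>
    rw [unit, sg_ne _ (by simp), sub_zero]
    rfl
  | p + 2, q =>
    rw [unit, sg_ne _ (by simp), Phi_ne (by omega)]
    simp [Cochain.theta]
    rfl

/-- The first and last faces are products with the constant function `id` on `BG_1`. -/
theorem allD_eq (m : ℤ) {φ : PCochain V W} (hφ : Sm φ) :
    allD φ = intD φ + cp 1 (unit W 1) φ - sgn m • cp m φ (unit V 1) := by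
  funext p q
  have hadd : ∀ η η' : PCochain V W, allD (η + η') = allD η + allD η' := fun η η' => by
    funext p q
    cases p with
    | zero => exact (add_zero _).symm
    | succ p =>
      have h : ∀ a : Fin (p + 2), pb (powModel E (p + 1)) (powModel E p) (face a)
        (η p q + η' p q) = pb (powModel E (p + 1)) (powModel E p) (face a) (η p q) +
          pb (powModel E (p + 1)) (powModel E p) (face a) (η' p q) := fun _ => rfl
      simp only [allD, Pi.add_apply, h, smul_add, Finset.sum_add_distrib]
  refine sm_induction (P := fun φ => allD φ p q =
    (intD φ + cp 1 (unit W 1) φ - sgn m • cp m φ (unit V 1)) p q) p q ?_ ?_ ?_ hφ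
  · intro η η' _ _ h h'
    rw [hadd, Pi.add_apply, Pi.add_apply, h, h', intD_add, cp_add_right, cp_add_left, smul_add]
    simp only [Pi.add_apply, Pi.sub_apply]
    abel
  · intro i j α _
    have h1 : allD (sg i j α) = sg (i + 1) j (∑ a : Fin (i + 2), (-1 : ℝ) ^ (a : ℕ) •
        pb (powModel E (i + 1)) (powModel E i) (face a) α) := by
      refine eq_sg ?_ fun p' q' h => ?_
      · simp only [allD, sg_same]
      · cases p' with
        | zero => rfl
        | succ p' =>
          have : p' ≠ i ∨ q' ≠ j := h.imp_left fun h h' => h (by rw [h'])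
          simp only [allD, sg_ne α this, pb_zero, smul_zero, Finset.sum_const_zero]
    have h2 : cp 1 (unit W 1) (sg i j α) =
        sg (i + 1) j (pb (powModel E (i + 1)) (powModel E i) (face 0) α) := by
      rw [unit, cp_sg 1 (add_comm 1 i) (zero_add j), blk_id_left, ← face_zero_eq, cupSign]
      simp [sgn_zero]
    have h3 : sgn m • cp m (sg i j α) (unit V 1) = sg (i + 1) j ((-1 : ℝ) ^ i •
        pb (powModel E (i + 1)) (powModel E i) (face (Fin.last (i + 1))) α) := by
      have h4 : sgn m * cupSign m i j 1 0 = (-1) ^ i := by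
        rw [cupSign, ← sgn_add, ← sgn_natCast]
        refine sgn_congr ⟨m, ?_⟩
        push_cast
        ring
      rw [unit, cp_sg m (rfl : i + 1 = i + 1) (add_zero j), blk_id_right, ← face_last_eq, ← sg_smul,
        smul_smul, h4]
    have h5 : (∑ a : Fin (i + 2), (-1 : ℝ) ^ (a : ℕ) •
        pb (powModel E (i + 1)) (powModel E i) (face a) α) =
        (intFace α + pb (powModel E (i + 1)) (powModel E i) (face 0) α) +
          (-1 : ℝ) • ((-1 : ℝ) ^ i •
            pb (powModel E (i + 1)) (powModel E i) (face (Fin.last (i + 1))) α) := by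
      rw [Fin.sum_univ_castSucc, Fin.sum_univ_succ, intFace, smul_smul, ← pow_succ']
      simp only [Fin.castSucc_zero, Fin.val_zero, pow_zero, one_smul, Fin.val_castSucc,
        Fin.val_succ, Fin.val_last]
      abel
    rw [h1, h2, h3, intD_sg, h5, sg_add, sg_add, sg_smul, neg_one_smul', sub_eq_add_neg]
  · intro η η' h hη hη' ih
    have hl : allD η p q = allD η' p q := by
      cases p with
      | zero => rfl
      | succ p => simp only [allD, h p (by omega) q le_rfl]
    rw [← hl, ih, sub_eq_add_neg, ← neg_smul', sub_eq_add_neg, ← neg_smul']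
    exact ((h.intD.add ((Agree.refl p q _).cp h 1)).add
      ((h.cp (Agree.refl p q _) m).smul _)) p le_rfl q le_rfl

/-- The contributions of `-id` to the twist are the missing first and last faces. -/
theorem twistedD_eq (m : ℤ) {φ : PCochain V W} (hφ : Sm φ) :
    (Cochain.twistedD m φ : Cochain V W) = tD m φ := by
  have e1 : (Cochain.cup 1 (Cochain.theta W) φ : Cochain V W) = cp 1 (Phi W - unit W 1) φ :=
    (congrArg (fun θ : Cochain W W => Cochain.cup 1 θ φ) theta_eq).trans
      (cup_eq 1 (Phi W - unit W 1) φ)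
  have e2 : (m.negOnePow • Cochain.cup m φ (Cochain.theta V) : Cochain V W) =
      (sgn m • cp m φ (Phi V - unit V 1) : PCochain V W) :=
    (negOnePow_smul m (Cochain.cup m φ (Cochain.theta V))).trans
      (congrArg (fun η : Cochain V W => sgn m • η)
        ((congrArg (fun θ : Cochain V V => Cochain.cup m φ θ) theta_eq).trans
          (cup_eq m φ (Phi V - unit V 1))))
  have h1 : (Cochain.twistedD m φ : Cochain V W) =
      (dB φ + allD φ + dl m φ + cp 1 (Phi W - unit W 1) φ -
        sgn m • cp m φ (Phi V - unit V 1) : PCochain V W) :=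
    congrArg₂ (fun a b : Cochain V W => a - b) (congrArg₂ (fun a b : Cochain V W => a + b)
      (congrArg₂ (fun a b : Cochain V W => a + b) (congrArg₂ (fun a b : Cochain V W => a + b)
        (dBar_eq φ) (partialD_eq φ)) (deltaBar_eq m φ)) e1) e2
  rw [h1, allD_eq m hφ, cp_sub_left, cp_sub_right, tD, D1, smul_sub]
  abel

/-! ### Degrees -/

/-- The coefficients of all components of a cochain of total degree `m` have the complementary
degree. -/
def Dg (m : ℤ) (η : PCochain V W) : Prop :=
  ∀ (p q : ℕ) (g : Fin p → G) (v : Fin q → Fin p → E), η p q g v ∈ TRep.HomDeg V W (m - p - q)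

theorem comp_mem_homDeg {r s t : ℤ} (h : r + s = t) {f : W.V →L[ℝ] X.V} {g : V.V →L[ℝ] W.V}
    (hf : f ∈ TRep.HomDeg W X r) (hg : g ∈ TRep.HomDeg V W s) :
    f ∘L g ∈ TRep.HomDeg V X t := fun n v hv => by
  have := hf _ _ (hg n v hv)
  rwa [add_assoc, add_comm s r, h] at this

theorem delta_mem : V.δ ∈ TRep.HomDeg V V 1 := fun n v hv => V.δ_mem n v hv

theorem rho_mem_homDeg [ConnectedSpace G] (g : G) : V.ρ g ∈ TRep.HomDeg V V 0 := fun n v hv => by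
  rw [add_zero]
  exact V.rho_mem g n hv

/-- A submodule of a finite dimensional space is the kernel of a continuous linear map. -/
theorem exists_clm_ker {F : Type*} [NormedAddCommGroup F] [NormedSpace ℝ F] [FiniteDimensional ℝ F]
    (S : Submodule ℝ F) : ∃ A : F →L[ℝ] F, ∀ v, A v = 0 ↔ v ∈ S := by
  obtain ⟨f, hf⟩ := S.subtype.exists_leftInverse_of_injective (by simp)
  refine ⟨LinearMap.toContinuousLinearMap (LinearMap.id - S.subtype ∘ₗ f), fun v => ?_⟩
  have h : LinearMap.toContinuousLinearMap (LinearMap.id - S.subtype ∘ₗ f) v = v - f v := rfl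
  rw [h, sub_eq_zero]
  constructor
  · intro h
    rw [h]
    exact (f v).2
  · intro h
    exact (congrArg Subtype.val (LinearMap.congr_fun hf ⟨v, h⟩)).symm

theorem ed_mem {p q : ℕ} {F : Type*} [NormedAddCommGroup F] [NormedSpace ℝ F]
    [FiniteDimensional ℝ F] {S : Submodule ℝ F} {α : PForm E G p q F}
    (hα : ∀ x, SmoothFormAt (powModel E p) α x) (h : ∀ g v, α g v ∈ S) (g : Fin p → G)
    (v : Fin (q + 1) → Fin p → E) : ed (powModel E p) α g v ∈ S := by
  obtain ⟨A, hA⟩ := exists_clm_ker S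
  rw [← hA]
  have h1 : mc A α = 0 := by
    funext g
    ext1 v
    exact (hA _).2 (h g v)
  have h2 := ed_mc (hα g) A
  rw [h1, ed_zero] at h2
  exact (congrArg (fun c : (Fin p → E) [⋀^Fin (q + 1)]→L[ℝ] F => c v) h2).symm

theorem Dg.add {m : ℤ} {η η' : PCochain V W} (h : Dg m η) (h' : Dg m η') : Dg m (η + η') :=
  fun p q g v => Submodule.add_mem _ (h p q g v) (h' p q g v)

theorem Dg.smul {m : ℤ} {η : PCochain V W} (h : Dg m η) (c : ℝ) : Dg m (c • η) :=
  fun p q g v => Submodule.smul_mem _ c (h p q g v)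

theorem Dg.sub {m : ℤ} {η η' : PCochain V W} (h : Dg m η) (h' : Dg m η') : Dg m (η - η') :=
  fun p q g v => Submodule.sub_mem _ (h p q g v) (h' p q g v)

theorem Dg.dB {m : ℤ} {η : PCochain V W} (h : Dg m η) (hη : Sm η) : Dg (m + 1) (dB η) :=
  fun p q g v => by
    cases q with
    | zero => exact Submodule.zero_mem _
    | succ q =>
      rw [show m + 1 - p - (q + 1 : ℕ) = m - p - q by push_cast; ring]
      exact Submodule.smul_mem _ _ (ed_mem (hη p q) (h p q) g v)

theorem intFace_mem {p q : ℕ} {F : Type*} [NormedAddCommGroup F] [NormedSpace ℝ F]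
    {S : Submodule ℝ F} {α : PForm E G p q F} (h : ∀ g v, α g v ∈ S) (g : Fin (p + 1) → G)
    (v : Fin q → Fin (p + 1) → E) : intFace α g v ∈ S := by
  have : intFace α g v = ∑ a : Fin p, (-1 : ℝ) ^ ((a : ℕ) + 1) •
      pb (powModel E (p + 1)) (powModel E p) (face a.succ.castSucc) α g v := by
    simp [intFace]
  rw [this]
  exact Submodule.sum_mem _ fun a _ => Submodule.smul_mem _ _ (h _ _)

theorem Dg.intD {m : ℤ} {η : PCochain V W} (h : Dg m η) : Dg (m + 1) (intD η) :=
  fun p q g v => by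
    cases p with
    | zero => exact Submodule.zero_mem _
    | succ p =>
      rw [show m + 1 - (p + 1 : ℕ) - q = m - p - q by push_cast; ring]
      exact intFace_mem (h p q) g v

theorem Dg.dl {m : ℤ} {η : PCochain V W} (h : Dg m η) : Dg (m + 1) (dl m η) :=
  fun p q g v => by
    refine Submodule.smul_mem _ _ (Submodule.sub_mem _ ?_ (Submodule.smul_mem _ _ ?_))
    · exact comp_mem_homDeg (by ring) delta_mem (h p q g v)
    · exact comp_mem_homDeg (by ring) (h p q g v) delta_mem

theorem Dg.cp {m n : ℤ} {ψ : PCochain W X} {φ : PCochain V W} (h : Dg m ψ) (h' : Dg n φ) :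
    Dg (m + n) (cp m ψ φ) := fun p q g v => by
  have h1 : PCochain.cp m ψ φ p q g v = ∑ s : {s // s ∈ Finset.HasAntidiagonal.antidiagonal p},
    ∑ t : {t // t ∈ Finset.HasAntidiagonal.antidiagonal q},
      cupSign m s.1.1 t.1.1 s.1.2 t.1.2 •
        blk (Finset.HasAntidiagonal.mem_antidiagonal.1 s.2)
          (Finset.HasAntidiagonal.mem_antidiagonal.1 t.2) (ψ s.1.1 t.1.1) (φ s.1.2 t.1.2) g v := by
    simp [PCochain.cp]
  rw [h1]
  refine Submodule.sum_mem _ fun s _ => Submodule.sum_mem _ fun t _ => Submodule.smul_mem _ _ ?_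
  have hs := Finset.HasAntidiagonal.mem_antidiagonal.1 s.2
  have ht := Finset.HasAntidiagonal.mem_antidiagonal.1 t.2
  refine altWedge_mem _ ht (fun a b => comp_mem_homDeg ?_ (h s.1.1 t.1.1 _ _) (h' s.1.2 t.1.2 _ _))
    v
  have hs' : (s.1.1 : ℤ) + s.1.2 = p := by exact_mod_cast hs
  have ht' : (t.1.1 : ℤ) + t.1.2 = q := by exact_mod_cast ht
  linear_combination -hs' - ht'

theorem Dg.unit : Dg 0 (unit V 0) := fun p q g v => by
  by_cases h : p = 0 ∧ q = 0
  · obtain ⟨rfl, rfl⟩ := h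
    rw [PCochain.unit, sg_same]
    intro n y hy
    simpa [cst] using hy
  · rw [PCochain.unit, sg_ne _ (not_and_or.1 h)]
    exact Submodule.zero_mem _

theorem Dg.Phi [ConnectedSpace G] : Dg 1 (Phi V) := fun p q g v => by
  by_cases h : p = 1
  · subst h
    rw [show (1 : ℤ) - (1 : ℕ) - q = -q by push_cast; ring]
    exact V.phi_mem q _ _
  · rw [Phi_ne h]
    exact Submodule.zero_mem _

theorem Dg.tD [ConnectedSpace G] {m : ℤ} {η : PCochain V W} (h : Dg m η) (hη : Sm η) :
    Dg (m + 1) (tD m η) := by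
  refine Dg.sub (Dg.add (Dg.add (Dg.add (h.dB hη) h.intD) h.dl) ?_) (Dg.smul (Dg.cp h Dg.Phi) _)
  rw [add_comm m 1]
  exact Dg.cp Dg.Phi h

theorem mem_BSSHom_iff {m : ℤ} {η : PCochain V W} :
    (η : Cochain V W) ∈ BSSHom V W m ↔ Sm η ∧ Dg m η := by
  constructor
  · intro h
    exact ⟨fun p q => isSmooth_iff.1 (h p q).1, fun p q => (h p q).2⟩
  · intro h p q
    exact ⟨isSmooth_iff.2 (h.1 p q), h.2 p q⟩

/-! ### Invariance -/

/-- The change of coefficients by the representations. -/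
def tw (a b : G) {p q : ℕ} (α : PForm E G p q (V.V →L[ℝ] W.V)) : PForm E G p q (V.V →L[ℝ] W.V) :=
  mc ((ContinuousLinearMap.compL ℝ V.V V.V W.V).flip (V.ρ b⁻¹))
    (mc (ContinuousLinearMap.compL ℝ V.V W.V W.V (W.ρ a)) α)

/-- Invariance of a cochain. -/
def Inv (η : PCochain V W) : Prop := ∀ (p q : ℕ) (a : Fin (p + 1) → G),
  pb (powModel E p) (powModel E p) (zeta a) (η p q) = tw (a 0) (a (Fin.last p)) (η p q)

theorem mc_add {F F' : Type*} [NormedAddCommGroup F] [NormedSpace ℝ F] [NormedAddCommGroup F']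
    [NormedSpace ℝ F'] {p q : ℕ} (A : F →L[ℝ] F') (α β : PForm E G p q F) :
    mc A (α + β) = mc A α + mc A β := by
  funext x
  ext1 v
  exact map_add A _ _

theorem tw_smul (a b : G) {p q : ℕ} (c : ℝ) (α : PForm E G p q (V.V →L[ℝ] W.V)) :
    tw a b (c • α) = c • tw a b α := by
  simp only [tw, mc_smul]

theorem tw_add (a b : G) {p q : ℕ} (α β : PForm E G p q (V.V →L[ℝ] W.V)) :
    tw a b (α + β) = tw a b α + tw a b β := by
  simp only [tw, mc_add]

theorem tw_zero (a b : G) {p q : ℕ} : tw a b (0 : PForm E G p q (V.V →L[ℝ] W.V)) = 0 := by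
  have := tw_smul a b 0 (0 : PForm E G p q (V.V →L[ℝ] W.V))
  rwa [zero_smul, zero_smul] at this

theorem tw_sum (a b : G) {p q : ℕ} {ι : Type*} (s : Finset ι)
    (α : ι → PForm E G p q (V.V →L[ℝ] W.V)) : tw a b (∑ i ∈ s, α i) = ∑ i ∈ s, tw a b (α i) :=
  map_sum (AddMonoidHom.mk' (fun α : PForm E G p q (V.V →L[ℝ] W.V) => tw a b α) (tw_add a b)) _ _

theorem tw_sub (a b : G) {p q : ℕ} (α β : PForm E G p q (V.V →L[ℝ] W.V)) :
    tw a b (α - β) = tw a b α - tw a b β :=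
  map_sub (AddMonoidHom.mk' (fun α : PForm E G p q (V.V →L[ℝ] W.V) => tw a b α) (tw_add a b)) _ _

theorem pb_tw (a b : G) {p p' q : ℕ} (f : (Fin p' → G) → Fin p → G)
    (α : PForm E G p q (V.V →L[ℝ] W.V)) :
    pb (powModel E p') (powModel E p) f (tw a b α) =
      tw a b (pb (powModel E p') (powModel E p) f α) := rfl

theorem pb_sum {p p' q : ℕ} {F : Type*} [NormedAddCommGroup F] [NormedSpace ℝ F] {ι : Type*}
    (s : Finset ι) (f : (Fin p' → G) → Fin p → G) (α : ι → PForm E G p q F) :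
    pb (powModel E p') (powModel E p) f (∑ i ∈ s, α i) =
      ∑ i ∈ s, pb (powModel E p') (powModel E p) f (α i) :=
  map_sum (AddMonoidHom.mk' (fun α : PForm E G p q F =>
    pb (powModel E p') (powModel E p) f α) fun _ _ => rfl) _ _

theorem Inv.add {η η' : PCochain V W} (h : Inv η) (h' : Inv η') : Inv (η + η') := fun p q a => by
  change pb _ _ _ (η p q) + pb _ _ _ (η' p q) = tw _ _ (η p q + η' p q)
  rw [h, h', tw_add]

theorem Inv.smul {η : PCochain V W} (h : Inv η) (c : ℝ) : Inv (c • η) := fun p q a => by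
  change c • pb _ _ _ (η p q) = tw _ _ (c • η p q)
  rw [h, tw_smul]

theorem Inv.sub {η η' : PCochain V W} (h : Inv η) (h' : Inv η') : Inv (η - η') := fun p q a => by
  change pb _ _ _ (η p q) - pb _ _ _ (η' p q) = tw _ _ (η p q - η' p q)
  rw [h, h', tw_sub]

theorem ed_tw (a b : G) {p q : ℕ} {α : PForm E G p q (V.V →L[ℝ] W.V)}
    (hα : ∀ x, SmoothFormAt (powModel E p) α x) :
    ed (powModel E p) (tw a b α) = tw a b (ed (powModel E p) α) := by
  funext x
  have h1 : ed (powModel E p) (mc (ContinuousLinearMap.compL ℝ V.V W.V W.V (W.ρ a)) α) =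
      mc (ContinuousLinearMap.compL ℝ V.V W.V W.V (W.ρ a)) (ed (powModel E p) α) :=
    funext fun x => ed_mc (hα x) _
  rw [tw, ed_mc ((hα x).mc _)]
  change _ = (mc _ (mc _ (ed (powModel E p) α))) x
  rw [← h1]

theorem ed_pb_zeta {p q : ℕ} {F : Type*} [NormedAddCommGroup F] [NormedSpace ℝ F]
    [FiniteDimensional ℝ F] (a : Fin (p + 1) → G) {α : PForm E G p q F}
    (hα : ∀ x, SmoothFormAt (powModel E p) α x) :
    ed (powModel E p) (pb (powModel E p) (powModel E p) (zeta a) α) =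
      pb (powModel E p) (powModel E p) (zeta a) (ed (powModel E p) α) :=
  funext fun x => SmoothFormAt.ed_pb (hα _) (contMDiff_zeta E a x)

theorem Inv.dB {η : PCochain V W} (h : Inv η) (hη : Sm η) : Inv (dB η) := fun p q a => by
  cases q with
  | zero =>
    change 0 = tw _ _ 0
    exact (tw_zero _ _).symm
  | succ q =>
    change (-1 : ℝ) ^ p • pb (powModel E p) (powModel E p) (zeta a) (ed (powModel E p) (η p q)) =
      tw (a 0) (a (Fin.last p)) ((-1 : ℝ) ^ p • ed (powModel E p) (η p q))
    rw [← ed_pb_zeta a (hη p q), h, ed_tw _ _ (hη p q), tw_smul]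

/-- The change of coefficients commutes with the differential of the coefficients. -/
theorem coeffD_tw [ConnectedSpace G] (r : ℤ) (a b : G) {p q : ℕ}
    (α : PForm E G p q (V.V →L[ℝ] W.V)) :
    coeffD r (tw a b α) = tw a b (coeffD r α) := by
  funext x
  ext v y
  have h1 : ∀ g y, W.ρ g (W.δ y) = W.δ (W.ρ g y) := fun g y =>
    congrArg (fun A : W.V →L[ℝ] W.V => A y) (W.rho_delta g)
  have h2 : ∀ g y, V.ρ g (V.δ y) = V.δ (V.ρ g y) := fun g y =>
    congrArg (fun A : V.V →L[ℝ] V.V => A y) (V.rho_delta g)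
  simp [coeffD, tw, mc, h1, h2]

theorem Inv.dl [ConnectedSpace G] {η : PCochain V W} (h : Inv η) (m : ℤ) : Inv (dl m η) :=
  fun p q a => by
    change (-1 : ℝ) ^ (p + q) • coeffD (m - p - q)
      (pb (powModel E p) (powModel E p) (zeta a) (η p q)) =
      tw (a 0) (a (Fin.last p)) ((-1 : ℝ) ^ (p + q) • coeffD (m - p - q) (η p q))
    rw [h, coeffD_tw, tw_smul]

theorem face_zeta {p : ℕ} (i : Fin (p + 2)) (a : Fin (p + 2) → G) :
    face i ∘ zeta a = zeta (a ∘ i.succAbove) ∘ face i := by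
  funext g j
  simp only [Function.comp, face, zeta]
  by_cases h1 : (j : ℕ) + 1 < i
  · rw [if_pos h1, if_pos h1, Fin.succAbove_of_castSucc_lt, Fin.succAbove_of_castSucc_lt]
    · rfl
    · rw [Fin.lt_def]; simpa using h1
    · rw [Fin.lt_def]; simp; omega
  · by_cases h2 : (j : ℕ) + 1 = i
    · rw [if_neg h1, if_pos h2, if_neg h1, if_pos h2, Fin.succAbove_of_castSucc_lt,
        Fin.succAbove_of_le_castSucc]
      · simp only [Fin.succ_castSucc]
        group
      · rw [Fin.le_def]; simp; omega
      · rw [Fin.lt_def]; simp; omega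
    · rw [if_neg h1, if_neg h2, if_neg h1, if_neg h2, Fin.succAbove_of_le_castSucc,
        Fin.succAbove_of_le_castSucc]
      · rfl
      · rw [Fin.le_def]; simp; omega
      · rw [Fin.le_def]; simp; omega

theorem Inv.intD {η : PCochain V W} (h : Inv η) : Inv (intD η) := fun p q a => by
  cases p with
  | zero =>
    change 0 = tw _ _ 0
    exact (tw_zero _ _).symm
  | succ p =>
    change pb _ _ _ (intFace (η p q)) = tw _ _ (intFace (η p q))
    rw [intFace, pb_sum, tw_sum]
    refine Finset.sum_congr rfl fun i _ => ?_
    have h1 : pb (powModel E (p + 1)) (powModel E (p + 1)) (zeta a)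
        (pb (powModel E (p + 1)) (powModel E p) (face i.succ.castSucc) (η p q)) =
        tw (a 0) (a (Fin.last (p + 1)))
          (pb (powModel E (p + 1)) (powModel E p) (face i.succ.castSucc) (η p q)) := by
      rw [pb_comp (contMDiff_face E _).mdiff (contMDiff_zeta E a).mdiff, face_zeta,
        ← pb_comp (contMDiff_zeta E _).mdiff (contMDiff_face E _).mdiff, h, pb_tw]
      have e1 : (a ∘ i.succ.castSucc.succAbove) 0 = a 0 := by
        rw [Function.comp, Fin.succAbove_of_castSucc_lt _ _ (by rw [Fin.lt_def]; simp)]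
        rfl
      have e2 : (a ∘ i.succ.castSucc.succAbove) (Fin.last p) = a (Fin.last (p + 1)) := by
        rw [Function.comp, Fin.succAbove_of_le_castSucc _ _ (by rw [Fin.le_def]; simp)]
        rfl
      rw [e1, e2]
    rw [tw_smul, ← h1]
    rfl

theorem front_zeta {p₁ p₂ p : ℕ} (hp : p₁ + p₂ = p) (a : Fin (p + 1) → G) :
    front hp ∘ zeta a = zeta (fun i : Fin (p₁ + 1) => a ⟨i, by omega⟩) ∘ front hp := rfl

theorem back_zeta {p₁ p₂ p : ℕ} (hp : p₁ + p₂ = p) (a : Fin (p + 1) → G) :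
    back hp ∘ zeta a = zeta (fun i : Fin (p₂ + 1) => a ⟨p₁ + i, by omega⟩) ∘ back hp := rfl

/-- The changes of coefficients by the middle element `b` cancel in a product. -/
theorem blk_tw {p₁ p₂ p q₁ q₂ q : ℕ} (hp : p₁ + p₂ = p) (hq : q₁ + q₂ = q) (a b c : G)
    (α : PForm E G p₁ q₁ (W.V →L[ℝ] X.V)) (β : PForm E G p₂ q₂ (V.V →L[ℝ] W.V)) :
    blk hp hq (tw a b α) (tw b c β) = tw a c (blk hp hq α β) := by
  have h1 : mc (ContinuousLinearMap.compL ℝ V.V W.V W.V (W.ρ b⁻¹))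
      (mc ((ContinuousLinearMap.compL ℝ V.V V.V W.V).flip (V.ρ c⁻¹))
        (mc (ContinuousLinearMap.compL ℝ V.V W.V W.V (W.ρ b)) β)) =
      mc ((ContinuousLinearMap.compL ℝ V.V V.V W.V).flip (V.ρ c⁻¹)) β := by
    funext x
    ext v y
    have h2 : ∀ y, W.ρ b⁻¹ (W.ρ b y) = y := fun y =>
      congrArg (fun A : W.V →L[ℝ] W.V => A y) (W.rho_inv_comp b)
    simp [mc, h2]
  rw [tw, tw, blk_mc_mid, h1, ← mc_pre_blk, ← mc_post_blk]
  rfl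

theorem Inv.blk {p₁ p₂ p q₁ q₂ q : ℕ} (hp : p₁ + p₂ = p) (hq : q₁ + q₂ = q) {ψ : PCochain W X}
    {φ : PCochain V W} (h : Inv ψ) (h' : Inv φ) (a : Fin (p + 1) → G) :
    pb (powModel E p) (powModel E p) (zeta a) (blk hp hq (ψ p₁ q₁) (φ p₂ q₂)) =
      tw (a 0) (a (Fin.last p)) (_root_.blk hp hq (ψ p₁ q₁) (φ p₂ q₂)) := by
  rw [pb_blk hp hq (contMDiff_zeta E a), front_zeta, back_zeta,
    ← pb_comp (contMDiff_zeta E _).mdiff (contMDiff_front E hp).mdiff,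
    ← pb_comp (contMDiff_zeta E _).mdiff (contMDiff_back E hp).mdiff, h, h']
  have e : (⟨p₁ + (Fin.last p₂ : ℕ), by simp [hp]⟩ : Fin (p + 1)) = Fin.last p :=
    Fin.ext (by simp [hp])
  have h3 := blk_tw hp hq (a ⟨0, by omega⟩) (a ⟨p₁, by omega⟩) (a (Fin.last p)) (ψ p₁ q₁) (φ p₂ q₂)
  rw [← e] at h3 ⊢
  exact h3

theorem Inv.cp {ψ : PCochain W X} {φ : PCochain V W} (h : Inv ψ) (h' : Inv φ) (m : ℤ) :
    Inv (cp m ψ φ) := fun p q a => by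
  rw [PCochain.cp, pb_sum, tw_sum]
  refine Finset.sum_congr rfl fun s _ => ?_
  rw [pb_sum, tw_sum]
  refine Finset.sum_congr rfl fun t _ => ?_
  rw [tw_smul, ← Inv.blk _ _ h h']
  rfl

theorem Inv.unit : Inv (unit V 0) := fun p q a => by
  by_cases h : p = 0 ∧ q = 0
  · obtain ⟨rfl, rfl⟩ := h
    rw [PCochain.unit, sg_same]
    funext x
    ext v y
    have h2 : ∀ b y, V.ρ b (V.ρ b⁻¹ y) = y := fun b y =>
      congrArg (fun A : V.V →L[ℝ] V.V => A y) (V.rho_comp_inv b)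
    simp [cst, pb, tw, mc, h2]
  · rw [PCochain.unit, sg_ne _ (not_and_or.1 h)]
    change 0 = tw _ _ 0
    exact (tw_zero _ _).symm

theorem Inv.Phi [ConnectedSpace G] : Inv (Phi V) := fun p q a => by
  by_cases h : p = 1
  · subst h
    have h1 := V.pb_phi_two_sided q (a 0) (a 1)
    have h2 : (fun g : Fin 1 → G => g 0) ∘ zeta a =
      (fun h : G => a 0 * h * (a 1)⁻¹) ∘ fun g : Fin 1 → G => g 0 := rfl
    rw [Phi_one, pb_comp (contMDiff_pow_proj (E := E) (G := G) (0 : Fin 1)).mdiff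
      (contMDiff_zeta E a).mdiff, h2, ← pb_comp (mdiff_two_sided E (a 0) (a 1)⁻¹)
      (contMDiff_pow_proj (E := E) (G := G) (0 : Fin 1)).mdiff, h1]
    rfl
  · rw [Phi_ne h]
    change 0 = tw _ _ 0
    exact (tw_zero _ _).symm

theorem Inv.tD [ConnectedSpace G] {η : PCochain V W} (h : Inv η) (hη : Sm η) (m : ℤ) :
    Inv (tD m η) :=
  ((((h.dB hη).add h.intD).add (h.dl m)).add (Inv.Phi.cp h 1)).sub ((h.cp Inv.Phi m).smul _)

theorem mem_BSSInvHom_iff {m : ℤ} {η : PCochain V W} :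
    (η : Cochain V W) ∈ BSSInvHom V W m ↔ (Sm η ∧ Dg m η) ∧ Inv η :=
  and_congr mem_BSSHom_iff Iff.rfl

end PCochain

end Categories

/-! ### The two DG categories -/

theorem DGCategory.hoIso_refl {Obj : Type*} {Hom : Obj → Obj → ℤ → Type*}
    [∀ X Y n, AddCommGroup (Hom X Y n)] [∀ X Y n, Module ℝ (Hom X Y n)] (C : DGCategory Obj Hom)
    (X : Obj) : C.HoIso X X := by
  have h1 : C.one X ∈ C.cocycles X X 0 := C.d_one X _
  refine ⟨C.one X, h1, C.one X, h1, ?_, ?_⟩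
  all_goals
    rw [C.one_comp, sub_self]
    exact Submodule.zero_mem _

section Categories

variable {E : Type v} [NormedAddCommGroup E] [NormedSpace ℝ E] [FiniteDimensional ℝ E]
  {G : Type w} [TopologicalSpace G] [ChartedSpace E G] [Group G] [LieGroup 𝓘(ℝ, E) ∞ G]
  [ConnectedSpace G]

namespace PCochain

/-- The conditions on spaces of smooth cochains which make them the morphism spaces of a DG
category with the twisted differential. -/
structure IsClosedFamily (K : (V W : TRep.{u} (E := E) G) → ℤ → Submodule ℝ (Cochain V W)) :
    Prop where
  sm : ∀ {V W m} {η : PCochain V W}, (η : Cochain V W) ∈ K V W m → Sm η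
  tD : ∀ {V W m n} {η : PCochain V W}, m + 1 = n → (η : Cochain V W) ∈ K V W m →
    (tD m η : Cochain V W) ∈ K V W n
  cp : ∀ {V W X m n k} {ψ : PCochain W X} {φ : PCochain V W}, m + n = k →
    (ψ : Cochain W X) ∈ K W X m → (φ : Cochain V W) ∈ K V W n →
    (cp m ψ φ : Cochain V X) ∈ K V X k
  unit : ∀ V, (unit V 0 : Cochain V V) ∈ K V V 0

variable {K : (V W : TRep.{u} (E := E) G) → ℤ → Submodule ℝ (Cochain V W)}

/-- The DG category with morphism spaces `K`. -/
def dgCategory (hK : IsClosedFamily K) :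
    DGCategory (TRep.{u} (E := E) G) fun V W m => K V W m where
  d {V W m _} h :=
    { toFun := fun φ => ⟨tD m (φ.1 : PCochain V W), hK.tD h φ.2⟩
      map_add' := fun φ ψ => Subtype.ext (tD_add m (hK.sm φ.2) (hK.sm ψ.2))
      map_smul' := fun c φ => Subtype.ext (tD_smul m c φ.1) }
  comp {V W X m _ _} h := LinearMap.mk₂ ℝ
    (fun ψ φ => ⟨cp m (ψ.1 : PCochain W X) (φ.1 : PCochain V W), hK.cp h ψ.2 φ.2⟩)
    (fun ψ ψ' φ => Subtype.ext (cp_add_left m ψ.1 ψ'.1 φ.1))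
    (fun c ψ φ => Subtype.ext (cp_smul_left m c ψ.1 φ.1))
    (fun ψ φ φ' => Subtype.ext (cp_add_right m ψ.1 φ.1 φ'.1))
    (fun c ψ φ => Subtype.ext (cp_smul_right m c ψ.1 φ.1))
  one V := ⟨unit V 0, hK.unit V⟩
  d_d {_ _ m _ _} h h' φ := Subtype.ext (by
    subst h
    exact tD_tD m (hK.sm φ.2))
  comp_assoc h₁ _ _ _ a b c := Subtype.ext
    (cp_assoc h₁ (hK.sm a.2) (hK.sm b.2) (hK.sm c.2))
  one_comp _ f := Subtype.ext (unit_cp (hK.sm f.2))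
  comp_one _ f := Subtype.ext (cp_unit _ (hK.sm f.2))
  d_one _ _ := Subtype.ext tD_unit
  leibniz {_ _ _ m _ n _ _ _} h hm _ _ _ _ b a := Subtype.ext (by
    subst h hm
    rw [negOnePow_smul]
    exact tD_cp m n (hK.sm b.2) (hK.sm a.2))

theorem isBSSCategory (hK : IsClosedFamily K) : IsBSSCategory (dgCategory hK) where
  coe_d {_ _ m _} _ φ := (twistedD_eq m (hK.sm φ.2)).symm
  coe_comp {_ _ _ m _ _} _ ψ φ := (cup_eq m ψ.1 φ.1).symm
  coe_one _ := one_eq.symm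

theorem isClosedFamily_BSSHom : IsClosedFamily (BSSHom.{u} (E := E) (G := G)) where
  sm h := (mem_BSSHom_iff.1 h).1
  tD h hη := h ▸ mem_BSSHom_iff.2 ⟨(mem_BSSHom_iff.1 hη).1.tD _,
    (mem_BSSHom_iff.1 hη).2.tD (mem_BSSHom_iff.1 hη).1⟩
  cp h hψ hφ := h ▸ mem_BSSHom_iff.2 ⟨(mem_BSSHom_iff.1 hψ).1.cp (mem_BSSHom_iff.1 hφ).1 _,
    (mem_BSSHom_iff.1 hψ).2.cp (mem_BSSHom_iff.1 hφ).2⟩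
  unit _ := mem_BSSHom_iff.2 ⟨Sm.unit 0, Dg.unit⟩

theorem isClosedFamily_BSSInvHom : IsClosedFamily (BSSInvHom.{u} (E := E) (G := G)) where
  sm h := (mem_BSSInvHom_iff.1 h).1.1
  tD h hη := by
    have h1 := mem_BSSInvHom_iff.1 hη
    exact h ▸ mem_BSSInvHom_iff.2 ⟨⟨h1.1.1.tD _, h1.1.2.tD h1.1.1⟩, h1.2.tD h1.1.1 _⟩
  cp h hψ hφ := by
    have h1 := mem_BSSInvHom_iff.1 hψ
    have h2 := mem_BSSInvHom_iff.1 hφ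
    exact h ▸ mem_BSSInvHom_iff.2 ⟨⟨h1.1.1.cp h2.1.1 _, h1.1.2.cp h2.1.2⟩, h1.2.cp h2.2 _⟩
  unit _ := mem_BSSInvHom_iff.2 ⟨⟨Sm.unit 0, Dg.unit⟩, Inv.unit⟩

/-- The inclusion of the invariant cochains is a quasi-equivalence if every cochain whose
differential is invariant differs from an invariant cochain by a coboundary. -/
theorem isQuasiEquivalence_of_acyclic
    (H : ∀ {V W : TRep.{u} (E := E) G} {m : ℤ} {φ : PCochain V W}, Sm φ → Dg m φ → Inv (tD m φ) →
      ∃ χ : PCochain V W, Sm χ ∧ Dg (m - 1) χ ∧ Inv (φ - tD (m - 1) χ)) :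
    (BSSInclusion (isBSSCategory (isClosedFamily_BSSInvHom.{u} (E := E) (G := G)))
      (isBSSCategory isClosedFamily_BSSHom)).IsQuasiEquivalence := by
  have hz : ∀ {V W : TRep.{u} (E := E) G} {m : ℤ} {χ : PCochain V W}, Sm χ →
      tD m (tD (m - 1) χ) = 0 := fun {V W m χ} h1 => by
    have := tD_tD (m - 1) h1
    rwa [sub_add_cancel] at this
  have hd : ∀ {V W : TRep.{u} (E := E) G} {m : ℤ} {χ : PCochain V W}, Sm χ → Dg (m - 1) χ →
      Dg m (tD (m - 1) χ) := fun {V W m χ} h1 h2 => by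
    have := h2.tD h1
    rwa [sub_add_cancel] at this
  have hs : ∀ {V W : TRep.{u} (E := E) G} {m : ℤ} {g χ : PCochain V W}, Sm g → Sm χ →
      tD m (g - tD (m - 1) χ) = tD m g := fun {V W m g χ} hg h1 => by
    rw [sub_eq_add_neg, ← neg_one_smul', tD_add _ hg ((h1.tD _).smul _), tD_smul, hz h1,
      smul_zero, add_zero]
  refine ⟨fun V W m => ⟨?_, ?_⟩, fun V => ⟨V, (dgCategory isClosedFamily_BSSHom).hoIso_refl V⟩⟩
  -- If `f` is the differential of `g`, then `g` may be replaced by an invariant cochain.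
  · rw [← LinearMap.ker_eq_bot, Submodule.eq_bot_iff]
    intro x hx
    obtain ⟨⟨f, hf⟩, rfl⟩ := Submodule.Quotient.mk_surjective _ x
    have hf' : f.1 ∈ BSSInvHom V W m := f.2
    obtain ⟨g, hg⟩ := (Submodule.Quotient.mk_eq_zero _).1 hx
    obtain ⟨g₀, hg₀⟩ : ∃ g₀ : PCochain V W, g₀ = g.1 := ⟨g.1, rfl⟩
    have hg1 : Sm g₀ ∧ Dg (m - 1) g₀ := by
      rw [hg₀]
      exact mem_BSSHom_iff.1 g.2
    have hgf : tD (m - 1) g₀ = f.1 := by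
      rw [hg₀]
      exact congrArg Subtype.val hg
    have hI : Inv (tD (m - 1) g₀) := by
      rw [hgf]
      exact (mem_BSSInvHom_iff.1 hf').2
    obtain ⟨χ, h1, h2, h3⟩ := H hg1.1 hg1.2 hI
    refine (Submodule.Quotient.mk_eq_zero _).2
      ⟨⟨(g₀ - tD (m - 1 - 1) χ : PCochain V W), mem_BSSInvHom_iff.2
        ⟨⟨hg1.1.sub (h1.tD _), hg1.2.sub (hd h1 h2)⟩, h3⟩⟩, Subtype.ext ?_⟩
    exact (hs hg1.1 h1).trans hgf
  -- A cocycle differs from an invariant one by a coboundary.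
  · intro x
    obtain ⟨⟨f, hf⟩, rfl⟩ := Submodule.Quotient.mk_surjective _ x
    obtain ⟨f₀, hf₀⟩ : ∃ f₀ : PCochain V W, f₀ = f.1 := ⟨f.1, rfl⟩
    have hf1 : Sm f₀ ∧ Dg m f₀ := by
      rw [hf₀]
      exact mem_BSSHom_iff.1 f.2
    have hf0 : tD m f₀ = 0 := by
      rw [hf₀]
      exact congrArg Subtype.val hf
    obtain ⟨χ, h1, h2, h3⟩ := H hf1.1 hf1.2 (by
      rw [hf0]
      exact fun p q a => (tw_zero _ _).symm)
    refine ⟨Submodule.Quotient.mk ⟨⟨(f₀ - tD (m - 1) χ : PCochain V W), mem_BSSInvHom_iff.2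
      ⟨⟨hf1.1.sub (h1.tD _), hf1.2.sub (hd h1 h2)⟩, h3⟩⟩,
      Subtype.ext ((hs hf1.1 h1).trans hf0)⟩, ?_⟩
    refine (Submodule.Quotient.eq _).2 ⟨⟨(-χ : PCochain V W), mem_BSSHom_iff.2
      ⟨h1.neg, by rw [← neg_one_smul']; exact h2.smul _⟩⟩, Subtype.ext ?_⟩
    have h4 : tD (m - 1) (-χ) = (f₀ - tD (m - 1) χ) - f₀ := by
      rw [← neg_one_smul', tD_smul, neg_one_smul']
      abel
    exact h4.trans (congrArg (fun t : PCochain V W => (f₀ - tD (m - 1) χ) - t) hf₀)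

end PCochain

end Categories

/-! ### Reduction to a fixed simplicial degree -/

section Filtration

variable {E : Type v} [NormedAddCommGroup E] [NormedSpace ℝ E] [FiniteDimensional ℝ E]
  {G : Type w} [TopologicalSpace G] [ChartedSpace E G] [Group G] [LieGroup 𝓘(ℝ, E) ∞ G]

variable {V W : TRep.{u} (E := E) G}

namespace TRep

theorem finite_gr_ne_bot (V : TRep.{u} (E := E) G) : {n | V.gr n ≠ ⊥}.Finite :=
  WellFoundedGT.finite_ne_bot_of_iSupIndep V.gr_isInternal.submodule_iSupIndep

/-- There are no nonzero maps of very negative degree. -/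
theorem exists_homDeg_eq_zero (V W : TRep.{u} (E := E) G) :
    ∃ R : ℤ, ∀ r < R, ∀ f ∈ HomDeg V W r, f = 0 := by
  obtain ⟨b, hb⟩ := V.finite_gr_ne_bot.bddAbove
  obtain ⟨c, hc⟩ := W.finite_gr_ne_bot.bddBelow
  refine ⟨c - b, fun r hr f hf => gr_ext fun n v hv => ?_⟩
  rw [zero_apply]
  by_cases hn : V.gr n = ⊥
  · rw [hn, Submodule.mem_bot] at hv
    rw [hv, map_zero]
  · have h1 : n ≤ b := hb hn
    have h2 : W.gr (n + r) = ⊥ := by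
      by_contra h
      have := hc h
      omega
    have := hf n v hv
    rwa [h2, Submodule.mem_bot] at this

end TRep

/-- Families of forms of all degrees on `BG_p`. -/
abbrev PLevel (V W : TRep.{u} (E := E) G) (p : ℕ) : Type _ :=
    (q : ℕ) → PForm E G p q (V.V →L[ℝ] W.V)

namespace PLevel

variable {p : ℕ}

/-- Up to a sign, the exterior derivative of a family of forms. -/
def lvB (α : PLevel V W p) : PLevel V W p := fun q =>
  match q with
  | 0 => 0
  | q + 1 => (-1 : ℝ) ^ p • ed (powModel E p) (α q)

/-- The part of the differential of cochains which preserves the simplicial degree. -/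
def LD (m : ℤ) (α : PLevel V W p) : PLevel V W p := fun q =>
  lvB α q + (-1 : ℝ) ^ (p + q) • PCochain.coeffD (m - p - q) (α q)

/-- Smoothness of all members of a family of forms. -/
def LSm (α : PLevel V W p) : Prop := ∀ q x, SmoothFormAt (powModel E p) (α q) x

/-- The coefficients of a family of forms on `BG_p` of total degree `m` have the complementary
degree. -/
def LDg (m : ℤ) (α : PLevel V W p) : Prop :=
  ∀ (q : ℕ) (g : Fin p → G) (v : Fin q → Fin p → E), α q g v ∈ TRep.HomDeg V W (m - p - q)

/-- Invariance of a family of forms. -/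
def LInv (α : PLevel V W p) : Prop := ∀ (q : ℕ) (a : Fin (p + 1) → G),
  pb (powModel E p) (powModel E p) (zeta a) (α q) = PCochain.tw (a 0) (a (Fin.last p)) (α q)

end PLevel

namespace PCochain

open PLevel

theorem lvB_eq (η : PCochain V W) (p q : ℕ) : dB η p q = lvB (η p) q := by
  cases q <;> rfl

theorem LD_zero (m : ℤ) {p : ℕ} : LD m (0 : PLevel V W p) = 0 := by
  funext q
  cases q with
  | zero =>
    simp only [LD, lvB, Pi.zero_apply, coeffD_zero, smul_zero, add_zero]
  | succ q =>
    have : ed (powModel E p) (0 : PForm E G p q (V.V →L[ℝ] W.V)) = 0 := ed_zero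
    simp only [LD, lvB, Pi.zero_apply, this, coeffD_zero, smul_zero, add_zero]

/-- The twisted differential on the leading components of a cochain. -/
theorem tD_leading (m : ℤ) {φ : PCochain V W} {s : ℕ} (h : ∀ p < s, φ p = 0) {p : ℕ} (hp : p ≤ s) :
    tD m φ p = LD m (φ p) := by
  funext q
  have hv : ∀ i, i < p → ∀ j, φ i j = 0 := fun i hi j => congrFun (h i (by omega)) j
  have h1 : intD φ p q = 0 := by
    cases p with
    | zero => rfl
    | succ p =>
      change intFace (φ p q) = 0
      rw [hv p (by omega), intFace_zero]
  have h2 : cp 1 (Phi W) φ p q = 0 := by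
    cases p with
    | zero => exact cp_Phi_left_zero _ _ _
    | succ p =>
      rw [cp_Phi_left]
      refine Finset.sum_eq_zero fun t _ => ?_
      rw [hv p (by omega), blk_zero_right, smul_zero]
  have h3 : cp m φ (Phi V) p q = 0 := by
    cases p with
    | zero => exact cp_Phi_right_zero _ _ _
    | succ p =>
      rw [cp_Phi_right]
      refine Finset.sum_eq_zero fun t _ => ?_
      rw [hv p (by omega), blk_zero_left, smul_zero]
  change dB φ p q + intD φ p q + dl m φ p q + cp 1 (Phi W) φ p q - sgn m • cp m φ (Phi V) p q = _
  rw [h1, h2, h3, lvB_eq, smul_zero, sub_zero, add_zero, add_zero]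
  rfl

/-- The cochain concentrated on `BG_p` with components `α`. -/
def emb (p : ℕ) (α : PLevel V W p) : PCochain V W := Pi.single p α

theorem emb_same (p : ℕ) (α : PLevel V W p) : emb p α p = α := by simp [emb]

theorem emb_ne {p p' : ℕ} (h : p' ≠ p) (α : PLevel V W p) : emb p α p' = 0 := by simp [emb, h]

theorem Sm.emb {p : ℕ} {α : PLevel V W p} (h : LSm α) : Sm (emb p α) := fun p' q x => by
  by_cases hp : p' = p
  · subst hp
    rw [emb_same]
    exact h q x
  · rw [emb_ne hp]
    exact SmoothFormAt.zero x

theorem Dg.emb {p : ℕ} {m : ℤ} {α : PLevel V W p} (h : LDg m α) : Dg m (emb p α) :=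
  fun p' q g v => by
    by_cases hp : p' = p
    · subst hp
      rw [emb_same]
      exact h q g v
    · rw [emb_ne hp]
      exact Submodule.zero_mem _

theorem Inv.emb {p : ℕ} {α : PLevel V W p} (h : LInv α) : Inv (emb p α) := fun p' q a => by
  by_cases hp : p' = p
  · subst hp
    rw [emb_same]
    exact h q a
  · rw [emb_ne hp]
    exact (tw_zero _ _).symm

variable [ConnectedSpace G]

/-- The acyclicity of the quotient of all cochains by the invariant ones follows from the
corresponding statement for a fixed simplicial degree, by induction on the filtration by the
simplicial degree. -/
theorem acyclic_of_level
    (H : ∀ (p : ℕ) (m : ℤ) (α : PLevel V W p), LSm α → LDg m α → LInv (LD m α) →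
      ∃ ψ χ : PLevel V W p, (LSm ψ ∧ LDg m ψ ∧ LInv ψ) ∧ LSm χ ∧ LDg (m - 1) χ ∧
        α = ψ + LD (m - 1) χ) {m : ℤ} {φ : PCochain V W} (hs : Sm φ) (hd : Dg m φ)
    (hi : Inv (tD m φ)) :
    ∃ χ : PCochain V W, Sm χ ∧ Dg (m - 1) χ ∧ Inv (φ - tD (m - 1) χ) := by
  -- The components on `BG_p` have coefficients of degree at most `m - p`, and vanish for large `p`.
  obtain ⟨R, hR⟩ := TRep.exists_homDeg_eq_zero V W
  obtain ⟨N, hN⟩ : ∃ N : ℕ, ∀ p, N ≤ p → ∀ φ : PCochain V W, Dg m φ → φ p = 0 := by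
    refine ⟨(m - R + 1).toNat, fun p hp φ hφ => ?_⟩
    funext q g
    ext1 v
    refine hR _ ?_ _ (hφ p q g v)
    omega
  have key : ∀ n s, N ≤ n + s → ∀ φ : PCochain V W, Sm φ → Dg m φ → Inv (tD m φ) →
      (∀ p < s, φ p = 0) → ∃ χ : PCochain V W, Sm χ ∧ Dg (m - 1) χ ∧ Inv (φ - tD (m - 1) χ) := by
    intro n
    induction n with
    | zero =>
      intro s hns φ hs hd hi h0
      have hφ : φ = 0 := by
        funext p
        by_cases hp : p < s
        · exact h0 p hp
        · exact hN p (by omega) φ hd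
      refine ⟨0, Sm.zero, fun _ _ _ _ => Submodule.zero_mem _, ?_⟩
      have h1 : tD (m - 1) (0 : PCochain V W) = 0 := by
        have := tD_smul (m - 1) 0 (0 : PCochain V W)
        rwa [zero_smul, zero_smul] at this
      rw [h1, hφ, sub_self]
      exact fun p q a => (tw_zero _ _).symm
    | succ n ih =>
      intro s hns φ hs hd hi h0
      -- On the leading component `φ s` the twisted differential is `LD`. Subtracting an invariant
      -- cochain and a coboundary removes this component.
      obtain ⟨ψ, χ, ⟨h1, h2, h3⟩, h4, h5, h6⟩ := H s m (φ s) (hs s) (hd s) (by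
        rw [← tD_leading m h0 le_rfl]
        exact hi s)
      have hχs : Sm (emb s χ) := Sm.emb h4
      have hψs : Sm (emb s ψ) := Sm.emb h1
      have hχd : Dg (m - 1) (emb s χ) := Dg.emb h5
      have hχt : Dg m (tD (m - 1) (emb s χ)) := by
        have := hχd.tD hχs
        rwa [sub_add_cancel] at this
      have hz : tD m (tD (m - 1) (emb s χ)) = 0 := by
        have := tD_tD (m - 1) hχs
        rwa [sub_add_cancel] at this
      have hsub : ∀ {a b : PCochain V W}, Sm a → Sm b → tD m (a - b) = tD m a - tD m b :=
        fun {a b} ha hb => by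
          rw [sub_eq_add_neg, ← neg_one_smul', tD_add _ ha (hb.smul _), tD_smul, neg_one_smul',
            sub_eq_add_neg]
      obtain ⟨χ', h7, h8, h9⟩ := ih (s + 1) (by omega) (φ - emb s ψ - tD (m - 1) (emb s χ))
        ((hs.sub hψs).sub (hχs.tD _)) ((hd.sub (Dg.emb h2)).sub hχt) (by
          rw [hsub (hs.sub hψs) (hχs.tD _), hsub hs hψs, hz, sub_zero]
          exact hi.sub ((Inv.emb h3).tD hψs m)) (fun p hp => by
          have e : ∀ i < s, emb s χ i = 0 := fun i hi => emb_ne (by omega) χ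
          change φ p - emb s ψ p - tD (m - 1) (emb s χ) p = 0
          rw [tD_leading (m - 1) e (by omega)]
          by_cases hps : p = s
          · subst hps
            rw [emb_same, emb_same, h6]
            abel
          · rw [emb_ne hps, emb_ne hps, h0 p (by omega), LD_zero]
            simp)
      refine ⟨χ' + emb s χ, h7.add hχs, h8.add hχd, ?_⟩
      have h10 := h9.add (Inv.emb h3)
      rw [tD_add _ h7 hχs]
      have e : φ - (tD (m - 1) χ' + tD (m - 1) (emb s χ)) =
        φ - emb s ψ - tD (m - 1) (emb s χ) - tD (m - 1) χ' + emb s ψ := by abel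
      rw [e]
      exact h10
  exact key N 0 (by omega) φ hs hd hi fun p hp => absurd hp (Nat.not_lt_zero p)

end PCochain

end Filtration

/-! ### Integrals of smooth families of forms -/

section ParametricIntegral

open MeasureTheory

variable {P : Type*} [NormedAddCommGroup P] [NormedSpace ℝ P] [FiniteDimensional ℝ P]
  [MeasurableSpace P] [BorelSpace P] {C : Set P} {ν : Measure P} [IsFiniteMeasure ν]
  {X : Type*} [NormedAddCommGroup X] [NormedSpace ℝ X]

/-- A function which is continuous at all points of a compact set is bounded near it, uniformly in
the parameters. -/
theorem eventually_forall_norm_le {F : Type*} [NormedAddCommGroup F] (hC : IsCompact C)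
    {g : P × X → F} {x₀ : X} (hg : ∀ k ∈ C, ContinuousAt g (k, x₀)) :
    ∃ B : ℝ, ∀ᶠ x in 𝓝 x₀, ∀ k ∈ C, ‖g (k, x)‖ ≤ B := by
  have hcont : ContinuousOn (fun k => ‖g (k, x₀)‖) C := fun k hk =>
    (ContinuousAt.comp (f := fun k => (k, x₀)) (hg k hk)
      (by fun_prop)).norm.continuousWithinAt
  obtain ⟨B, hB⟩ := hC.bddAbove_image hcont
  refine ⟨B + 1, ?_⟩
  refine hC.eventually_forall_of_forall_eventually fun k hk => ?_
  have h1 : ‖g (k, x₀)‖ < B + 1 := by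
    have h : ‖g (k, x₀)‖ ≤ B := hB (Set.mem_image_of_mem _ hk)
    linarith
  have h2 : ∀ᶠ z in 𝓝 (x₀, k), ‖g (z.2, z.1)‖ < B + 1 := by
    have h3 : ContinuousAt (fun z : X × P => ‖g (z.2, z.1)‖) (x₀, k) :=
      (ContinuousAt.comp (f := fun z : X × P => (z.2, z.1)) (hg k hk)
        (by fun_prop)).norm
    exact h3.eventually_lt continuousAt_const h1
  exact h2.mono fun z hz => hz.le

theorem eventually_forall_contDiffAt {F : Type*} [NormedAddCommGroup F] [NormedSpace ℝ F]
    (hC : IsCompact C) {g : P × X → F} {x₀ : X} {n : ℕ} (hg : ∀ k ∈ C, ContDiffAt ℝ n g (k, x₀)) :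
    ∀ᶠ x in 𝓝 x₀, ∀ k ∈ C, ContDiffAt ℝ n g (k, x) := by
  refine hC.eventually_forall_of_forall_eventually fun k hk => ?_
  have h1 := (hg k hk).eventually (by simp)
  have h2 : Filter.Tendsto (fun z : X × P => (z.2, z.1)) (𝓝 (x₀, k)) (𝓝 (k, x₀)) :=
    (Continuous.continuousAt (by fun_prop))
  exact h2.eventually h1

theorem ae_mem_of_compl_null (hν : ν Cᶜ = 0) : ∀ᵐ k ∂ν, k ∈ C := by
  rw [ae_iff]
  exact hν

theorem aestronglyMeasurable_of_continuousOn {F : Type*} [NormedAddCommGroup F] (hC : IsCompact C)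
    (hν : ν Cᶜ = 0) {f : P → F} (hf : ContinuousOn f C) : AEStronglyMeasurable f ν := by
  have := FiniteDimensional.proper_real P
  have h1 : ν.restrict C = ν := Measure.restrict_eq_self_of_ae_mem (ae_mem_of_compl_null hν)
  rw [← h1]
  exact hf.aestronglyMeasurable hC.measurableSet

theorem integrable_of_continuousOn {F : Type*} [NormedAddCommGroup F] (hC : IsCompact C)
    (hν : ν Cᶜ = 0) {f : P → F} (hf : ContinuousOn f C) : Integrable f ν := by
  obtain ⟨B, hB⟩ := hC.bddAbove_image hf.norm
  refine Integrable.of_bound (aestronglyMeasurable_of_continuousOn hC hν hf) B ?_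
  filter_upwards [ae_mem_of_compl_null hν] with k hk using hB (Set.mem_image_of_mem _ hk)

theorem continuousOn_left_of_continuousAt {F : Type*} [TopologicalSpace F] {g : P × X → F} {x : X}
    (hg : ∀ k ∈ C, ContinuousAt g (k, x)) : ContinuousOn (fun k => g (k, x)) C := fun k hk =>
  (ContinuousAt.comp (f := fun k => (k, x)) (hg k hk) (by fun_prop)).continuousWithinAt

/-- Differentiation under the integral sign. -/
theorem hasFDerivAt_integral_param {F : Type*} [NormedAddCommGroup F] [NormedSpace ℝ F]
    (hC : IsCompact C) (hν : ν Cᶜ = 0) {g : P × X → F} {x₀ : X}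
    (hg : ∀ k ∈ C, ContDiffAt ℝ 1 g (k, x₀)) :
    HasFDerivAt (fun x => ∫ k, g (k, x) ∂ν)
      (∫ k, (fderiv ℝ g (k, x₀)).comp (ContinuousLinearMap.inr ℝ P X) ∂ν) x₀ := by
  have hg1 : ∀ k ∈ C, ContDiffAt ℝ (1 : ℕ) g (k, x₀) := hg
  have hder : ∀ k ∈ C, ContinuousAt (fun z => (fderiv ℝ g z).comp (ContinuousLinearMap.inr ℝ P X))
      (k, x₀) := fun k hk =>
    (((hg k hk).fderiv_right (m := 0) (by simp)).clm_comp contDiffAt_const).continuousAt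
  obtain ⟨B, hB⟩ := eventually_forall_norm_le hC hder
  have h1 := eventually_forall_contDiffAt hC hg1
  obtain ⟨ε, hε, hball⟩ := Metric.eventually_nhds_iff_ball.1 (hB.and h1)
  refine hasFDerivAt_integral_of_dominated_of_fderiv_le (bound := fun _ => B)
    (F' := fun x k => (fderiv ℝ g (k, x)).comp (ContinuousLinearMap.inr ℝ P X))
    (Metric.ball_mem_nhds x₀ hε) ?_ ?_ ?_ ?_ (integrable_const B) ?_
  · filter_upwards [h1] with x hx
    exact aestronglyMeasurable_of_continuousOn hC hν
      (continuousOn_left_of_continuousAt fun k hk => (hx k hk).continuousAt)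
  · exact integrable_of_continuousOn hC hν
      (continuousOn_left_of_continuousAt fun k hk => (hg k hk).continuousAt)
  · exact aestronglyMeasurable_of_continuousOn hC hν (continuousOn_left_of_continuousAt hder)
  · filter_upwards [ae_mem_of_compl_null hν] with k hk x hx
    exact (hball x hx).1 k hk
  · filter_upwards [ae_mem_of_compl_null hν] with k hk x hx
    have h2 : DifferentiableAt ℝ g (k, x) :=
      ((hball x hx).2 k hk).differentiableAt (by simp)
    exact h2.hasFDerivAt.comp x (hasFDerivAt_prodMk_right k x)

theorem clm_fderiv_integral_param {F F' : Type*} [NormedAddCommGroup F] [NormedSpace ℝ F]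
    [NormedAddCommGroup F'] [NormedSpace ℝ F'] [FiniteDimensional ℝ F] [FiniteDimensional ℝ X]
    [FiniteDimensional ℝ F']
    (hC : IsCompact C) (hν : ν Cᶜ = 0) {g : P × X → F} {x₀ : X}
    (hg : ∀ k ∈ C, ContDiffAt ℝ 1 g (k, x₀)) (A : (X →L[ℝ] F) →L[ℝ] F') :
    A (fderiv ℝ (fun x => ∫ k, g (k, x) ∂ν) x₀) =
      ∫ k, A (fderiv ℝ (fun x => g (k, x)) x₀) ∂ν := by
  have hD : ContinuousOn (fun k => (fderiv ℝ g (k, x₀)).comp (ContinuousLinearMap.inr ℝ P X)) C :=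
    continuousOn_left_of_continuousAt
      (g := fun z => (fderiv ℝ g z).comp (ContinuousLinearMap.inr ℝ P X)) fun k hk =>
        (((hg k hk).fderiv_right (m := 0) (by simp)).clm_comp contDiffAt_const).continuousAt
  rw [(hasFDerivAt_integral_param hC hν hg).fderiv,
    ← A.integral_comp_comm (integrable_of_continuousOn hC hν hD)]
  refine integral_congr_ae ?_
  filter_upwards [ae_mem_of_compl_null hν] with k hk
  rw [← (HasFDerivAt.comp (g := g) (f := fun y => (k, y)) x₀
      ((hg k hk).differentiableAt (by simp)).hasFDerivAt (hasFDerivAt_prodMk_right k _)).fderiv]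
  rfl

theorem contDiffAt_integral_param_nat {X : Type v} [NormedAddCommGroup X] [NormedSpace ℝ X]
    (hC : IsCompact C) (hν : ν Cᶜ = 0) (n : ℕ) {F : Type (max v w)} [NormedAddCommGroup F]
    [NormedSpace ℝ F] {g : P × X → F} {x₀ : X} (hg : ∀ k ∈ C, ContDiffAt ℝ (n + 1 : ℕ) g (k, x₀)) :
    ContDiffAt ℝ n (fun x => ∫ k, g (k, x) ∂ν) x₀ := by
  induction n generalizing F with
  | zero =>
    refine contDiffAt_zero.2 ?_
    obtain ⟨u, hu, hu'⟩ := (eventually_forall_contDiffAt hC hg).exists_mem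
    exact ⟨u, hu, fun x hx => (hasFDerivAt_integral_param hC hν
      (hu' x hx)).continuousAt.continuousWithinAt⟩
  | succ n ih =>
    obtain ⟨u, hu, hu'⟩ := (eventually_forall_contDiffAt hC hg).exists_mem
    refine (contDiffAt_succ_iff_hasFDerivAt (n := n)).2 ⟨fun x => ∫ k, (fderiv ℝ g (k, x)).comp
      (ContinuousLinearMap.inr ℝ P X) ∂ν, ⟨u, hu, fun x hx => ?_⟩, ?_⟩
    · exact hasFDerivAt_integral_param hC hν fun k hk =>
        (hu' x hx k hk).of_le (by exact_mod_cast (by omega : 1 ≤ n + 1 + 1))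
    · refine ih (g := fun z => (fderiv ℝ g z).comp (ContinuousLinearMap.inr ℝ P X)) fun k hk => ?_
      exact ((hg k hk).fderiv_right (m := (n + 1 : ℕ)) (by push_cast; exact le_rfl)).clm_comp
        contDiffAt_const

/-- Integrals of smooth functions with respect to parameters in a compact set are smooth. -/
theorem contDiffAt_integral_param {X : Type v} [NormedAddCommGroup X] [NormedSpace ℝ X]
    (hC : IsCompact C) (hν : ν Cᶜ = 0) {F : Type (max v w)} [NormedAddCommGroup F]
    [NormedSpace ℝ F] {g : P × X → F} {x₀ : X}
    (hg : ∀ k ∈ C, ContDiffAt ℝ ∞ g (k, x₀)) : ContDiffAt ℝ ∞ (fun x => ∫ k, g (k, x) ∂ν) x₀ :=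
  contDiffAt_infty.2 fun n => contDiffAt_integral_param_nat.{v, w} hC hν n fun k hk =>
    (hg k hk).of_le (by exact_mod_cast le_top)

end ParametricIntegral

section SmoothFamilies

open MeasureTheory

variable {P : Type*} [NormedAddCommGroup P] [NormedSpace ℝ P]
  {E : Type v} [NormedAddCommGroup E] [NormedSpace ℝ E] [FiniteDimensional ℝ E]
  {H : Type*} [TopologicalSpace H] {I : ModelWithCorners ℝ E H} [I.Boundaryless]
  {M : Type*} [TopologicalSpace M] [ChartedSpace H M] [IsManifold I ∞ M]
  {F : Type u} [NormedAddCommGroup F] [NormedSpace ℝ F] [FiniteDimensional ℝ F] {q : ℕ}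

variable (I) in
/-- Joint smoothness of a family of forms `β k` in the parameter and the point, tested in the
preferred chart at the point. -/
def SmoothFamilyAt (β : P → M → E [⋀^Fin q]→L[ℝ] F) (k : P) (x : M) : Prop :=
  ContDiffAt ℝ ∞ (fun z : P × E => chartForm I (β z.1) x z.2) (k, extChartAt I x x)

theorem SmoothFamilyAt.continuousAt {β : P → M → E [⋀^Fin q]→L[ℝ] F} {k : P} {x : M}
    (h : SmoothFamilyAt I β k x) : ContinuousAt (fun k => β k x) k := by
  have h1 : ContinuousAt (fun k => chartForm I (β k) x (extChartAt I x x)) k :=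
    ContinuousAt.comp (g := fun z : P × E => chartForm I (β z.1) x z.2)
      (f := fun k => (k, extChartAt I x x)) (ContDiffAt.continuousAt h) (by fun_prop)
  have h2 := (ContinuousAlternatingMap.compContinuousLinearMapCLM (F := F) (ι := Fin q)
    (tmap I 𝓘(ℝ, E) (extChartAt I x) x)).continuous.continuousAt.comp h1
  exact h2.congr (.of_forall fun k => chartForm_comp_tmap (β k) x)

variable [FiniteDimensional ℝ P] [MeasurableSpace P] [BorelSpace P] {C : Set P}
  {ν : Measure P} [IsFiniteMeasure ν]

variable (ν) in
/-- The pointwise integral of a family of forms. -/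
def formIntegral (β : P → M → E [⋀^Fin q]→L[ℝ] F) : M → E [⋀^Fin q]→L[ℝ] F := fun x =>
  ∫ k, β k x ∂ν

variable {β : P → M → E [⋀^Fin q]→L[ℝ] F}

theorem integrable_of_smoothFamily (hC : IsCompact C) (hν : ν Cᶜ = 0)
    (hβ : ∀ k ∈ C, ∀ x, SmoothFamilyAt I β k x) (x : M) : Integrable (fun k => β k x) ν :=
  integrable_of_continuousOn hC hν fun k hk => (hβ k hk x).continuousAt.continuousWithinAt

theorem chartForm_formIntegral (hC : IsCompact C) (hν : ν Cᶜ = 0)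
    (hβ : ∀ k ∈ C, ∀ x, SmoothFamilyAt I β k x) (x : M) :
    chartForm I (formIntegral ν β) x = fun y => ∫ k, chartForm I (β k) x y ∂ν := by
  funext y
  exact ((ContinuousAlternatingMap.compContinuousLinearMapCLM (F := F) (ι := Fin q)
    (tmap 𝓘(ℝ, E) I (extChartAt I x).symm y)).integral_comp_comm
      (integrable_of_smoothFamily hC hν hβ _)).symm

theorem SmoothFormAt.formIntegral (hC : IsCompact C) (hν : ν Cᶜ = 0)
    (hβ : ∀ k ∈ C, ∀ x, SmoothFamilyAt I β k x) (x : M) :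
    SmoothFormAt I (formIntegral ν β) x := by
  rw [SmoothFormAt, chartForm_formIntegral hC hν hβ]
  exact contDiffAt_integral_param.{v, u} (g := fun z : P × E => chartForm I (β z.1) x z.2) hC hν
    fun k hk => hβ k hk x

theorem ed_formIntegral (hC : IsCompact C) (hν : ν Cᶜ = 0)
    (hβ : ∀ k ∈ C, ∀ x, SmoothFamilyAt I β k x) (x : M) :
    ed I (formIntegral ν β) x = ∫ k, ed I (β k) x ∂ν := by
  have h := clm_fderiv_integral_param (g := fun z : P × E => chartForm I (β z.1) x z.2) hC hν
    (fun k hk => ContDiffAt.of_le (hβ k hk x) (by simp))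
    ((ContinuousAlternatingMap.compContinuousLinearMapCLM (F := F) (ι := Fin (q + 1))
      (tmap I 𝓘(ℝ, E) (extChartAt I x) x)).comp
        (ContinuousAlternatingMap.alternatizeUncurryFinCLM ℝ E F (n := q)))
  rw [← chartForm_formIntegral hC hν hβ] at h
  rw [ed_apply]
  refine Eq.trans h ?_
  simp only [ed_apply]
  rfl

theorem formIntegral_mem (hC : IsCompact C) (hν : ν Cᶜ = 0)
    (hβ : ∀ k ∈ C, ∀ x, SmoothFamilyAt I β k x) {S : Submodule ℝ F}
    (hS : ∀ k x v, β k x v ∈ S) (x : M) (v : Fin q → E) : formIntegral ν β x v ∈ S := by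
  have h1 : formIntegral ν β x v = ∫ k, β k x v ∂ν :=
    ((ContinuousAlternatingMap.apply ℝ E F v).integral_comp_comm
      (integrable_of_smoothFamily hC hν hβ x)).symm
  obtain ⟨A, hA⟩ := PCochain.exists_clm_ker S
  have h2 : Integrable (fun k => β k x v) ν :=
    (ContinuousAlternatingMap.apply ℝ E F v).integrable_comp
      (integrable_of_smoothFamily hC hν hβ x)
  rw [h1, ← hA, ← A.integral_comp_comm h2]
  simp only [(hA _).2 (hS _ x v), integral_zero]

end SmoothFamilies

/-! ### The action on forms of the group of arrows -/

section Action

variable {E : Type v} [NormedAddCommGroup E] [NormedSpace ℝ E] [FiniteDimensional ℝ E]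
  {G : Type w} [TopologicalSpace G] [ChartedSpace E G] [Group G] [LieGroup 𝓘(ℝ, E) ∞ G]
  {V W : TRep.{u} (E := E) G} {p q : ℕ}

open PCochain

theorem zeta_one : zeta (1 : Fin (p + 1) → G) = id := by
  funext g j
  simp [zeta]

theorem zeta_mul (a b : Fin (p + 1) → G) : zeta a ∘ zeta b = zeta (a * b) := by
  funext g j
  simp [zeta, mul_assoc]

/-- The left action of `G^(p+1)` on the forms on `BG_p` with values in the maps `V → W`. The
invariance of morphisms is the invariance under this action. -/
def act (a : Fin (p + 1) → G) (α : PForm E G p q (V.V →L[ℝ] W.V)) :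
    PForm E G p q (V.V →L[ℝ] W.V) :=
  tw (a 0) (a (Fin.last p)) (pb (powModel E p) (powModel E p) (zeta a⁻¹) α)

theorem tw_tw (a b a' b' : G) (α : PForm E G p q (V.V →L[ℝ] W.V)) :
    tw a b (tw a' b' α) = tw (a * a') (b * b') α := by
  funext x
  ext v y
  simp [tw, mc, TRep.rho_mul, mul_inv_rev]

theorem tw_one (α : PForm E G p q (V.V →L[ℝ] W.V)) : tw (1 : G) 1 α = α := by
  funext x
  ext v y
  simp [tw, mc]

theorem act_act (a b : Fin (p + 1) → G) (α : PForm E G p q (V.V →L[ℝ] W.V)) :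
    act a (act b α) = act (a * b) α := by
  rw [act, act, pb_tw, tw_tw, pb_comp (contMDiff_zeta E _).mdiff (contMDiff_zeta E _).mdiff,
    zeta_mul, ← mul_inv_rev]
  rfl

theorem act_one (α : PForm E G p q (V.V →L[ℝ] W.V)) : act 1 α = α := by
  rw [act, inv_one, zeta_one, pb_id]
  exact tw_one α

theorem act_add (a : Fin (p + 1) → G) (α β : PForm E G p q (V.V →L[ℝ] W.V)) :
    act a (α + β) = act a α + act a β := by
  have h : pb (powModel E p) (powModel E p) (zeta a⁻¹) (α + β) =
      pb (powModel E p) (powModel E p) (zeta a⁻¹) α +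
      pb (powModel E p) (powModel E p) (zeta a⁻¹) β := rfl
  rw [act, h, tw_add]
  rfl

theorem act_sub (a : Fin (p + 1) → G) (α β : PForm E G p q (V.V →L[ℝ] W.V)) :
    act a (α - β) = act a α - act a β := by
  have h : pb (powModel E p) (powModel E p) (zeta a⁻¹) (α - β) =
      pb (powModel E p) (powModel E p) (zeta a⁻¹) α -
      pb (powModel E p) (powModel E p) (zeta a⁻¹) β := rfl
  rw [act, h, tw_sub]
  rfl

theorem act_smul (a : Fin (p + 1) → G) (c : ℝ) (α : PForm E G p q (V.V →L[ℝ] W.V)) :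
    act a (c • α) = c • act a α := by
  have h : pb (powModel E p) (powModel E p) (zeta a⁻¹) (c • α) =
      c • pb (powModel E p) (powModel E p) (zeta a⁻¹) α := rfl
  rw [act, h, tw_smul]
  rfl

theorem act_sum (a : Fin (p + 1) → G) {ι : Type*} (s : Finset ι)
    (α : ι → PForm E G p q (V.V →L[ℝ] W.V)) : act a (∑ i ∈ s, α i) = ∑ i ∈ s, act a (α i) := by
  rw [act, pb_sum, tw_sum]
  rfl

theorem SmoothFormAt.act (a : Fin (p + 1) → G) {α : PForm E G p q (V.V →L[ℝ] W.V)}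
    (hα : ∀ x, SmoothFormAt (powModel E p) α x) (x : Fin p → G) :
    SmoothFormAt (powModel E p) (act a α) x :=
  (((hα _).pb (contMDiff_zeta E _ x)).mc _).mc _

theorem act_mem [ConnectedSpace G] (a : Fin (p + 1) → G) {α : PForm E G p q (V.V →L[ℝ] W.V)}
    {r : ℤ} (h : ∀ g v, α g v ∈ TRep.HomDeg V W r) (g : Fin p → G) (v : Fin q → Fin p → E) :
    act a α g v ∈ TRep.HomDeg V W r :=
  comp_mem_homDeg (add_zero r) (comp_mem_homDeg (zero_add r) (rho_mem_homDeg _) (h _ _))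
    (rho_mem_homDeg _)

theorem ed_act (a : Fin (p + 1) → G) {α : PForm E G p q (V.V →L[ℝ] W.V)}
    (hα : ∀ x, SmoothFormAt (powModel E p) α x) :
    ed (powModel E p) (act a α) = act a (ed (powModel E p) α) := by
  rw [act, ed_tw _ _ fun x => (hα _).pb (contMDiff_zeta E _ x), ed_pb_zeta _ hα]
  rfl

theorem coeffD_act [ConnectedSpace G] (r : ℤ) (a : Fin (p + 1) → G)
    (α : PForm E G p q (V.V →L[ℝ] W.V)) : coeffD r (act a α) = act a (coeffD r α) := by
  rw [act, coeffD_tw]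
  rfl

theorem LD_act [ConnectedSpace G] (m : ℤ) (a : Fin (p + 1) → G) {α : PLevel V W p}
    (hα : PLevel.LSm α) (q : ℕ) :
    PLevel.LD m (fun q => act a (α q)) q = act a (PLevel.LD m α q) := by
  cases q with
  | zero =>
    simp only [PLevel.LD, PLevel.lvB, zero_add, coeffD_act, act_smul]
  | succ q =>
    simp only [PLevel.LD, PLevel.lvB, coeffD_act, act_smul, act_add, ed_act a (hα q)]

theorem LInv_iff {α : PLevel V W p} : PLevel.LInv α ↔ ∀ q a, act a (α q) = α q := by
  constructor
  · intro h q a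
    rw [act, h, tw_tw]
    simp only [Pi.inv_apply, mul_inv_cancel]
    exact tw_one _
  · intro h q a
    have h1 := congrArg (tw (a 0) (a (Fin.last p))) (h q a⁻¹)
    rw [act, tw_tw, inv_inv] at h1
    simp only [Pi.inv_apply, mul_inv_cancel] at h1
    rw [← h1]
    exact (tw_one _).symm

/-- The value at `x` of a translated form, as a function of the value of the form. -/
theorem exists_act_clm (a : Fin (p + 1) → G) (x : Fin p → G) :
    ∃ T : ((Fin p → E) [⋀^Fin q]→L[ℝ] (V.V →L[ℝ] W.V)) →L[ℝ]
      ((Fin p → E) [⋀^Fin q]→L[ℝ] (V.V →L[ℝ] W.V)),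
      ∀ α : PForm E G p q (V.V →L[ℝ] W.V), act a α x = T (α (zeta a⁻¹ x)) :=
  ⟨(ContinuousLinearMap.compContinuousAlternatingMapCLM ℝ _ _ _ (ι := Fin q)
    ((ContinuousLinearMap.compL ℝ V.V V.V W.V).flip (V.ρ (a (Fin.last p))⁻¹))).comp
      ((ContinuousLinearMap.compContinuousAlternatingMapCLM ℝ _ _ _ (ι := Fin q)
        (ContinuousLinearMap.compL ℝ V.V W.V W.V (W.ρ (a 0)))).comp
        (ContinuousAlternatingMap.compContinuousLinearMapCLM
          (tmap (powModel E p) (powModel E p) (zeta a⁻¹) x))), fun _ => rfl⟩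

/-- Translations of a smooth form by a smooth family of group elements form a smooth family. -/
theorem smoothFamilyAt_act {P : Type*} [NormedAddCommGroup P] [NormedSpace ℝ P]
    [FiniteDimensional ℝ P] {γ : P → Fin (p + 1) → G} {k : P}
        (hγ : ∀ i, ContMDiffAt 𝓘(ℝ, P) 𝓘(ℝ, E) ∞ (fun k => γ k i) k)
    {c : P → ℝ} (hc : ContDiffAt ℝ ∞ c k) {α : PForm E G p q (V.V →L[ℝ] W.V)}
    (hα : ∀ x, SmoothFormAt (powModel E p) α x) (x : Fin p → G) :
    SmoothFamilyAt (powModel E p) (fun k => c k • act (γ k) α) k x := by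
  let I := powModel E p
  let z₀ : P × (Fin p → E) := (k, extChartAt I x x)
  let u : P × (Fin p → E) → Fin p → G := fun z => zeta (γ z.1)⁻¹ ((extChartAt I x).symm z.2)
  have hγ' : ∀ i, ContMDiffAt 𝓘(ℝ, P × (Fin p → E)) 𝓘(ℝ, E) ∞ (fun z => γ z.1 i) z₀ := fun i =>
    ContMDiffAt.comp_of_eq (hγ i) (contMDiffAt_iff_contDiffAt.2 contDiffAt_fst) rfl
  have hs : ∀ i, ContMDiffAt 𝓘(ℝ, P × (Fin p → E)) 𝓘(ℝ, E) ∞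
      (fun z => (extChartAt I x).symm z.2 i) z₀ := contMDiffAt_pow_iff.1
    (ContMDiffAt.comp_of_eq (contMDiffAt_extChartAt_symm (mem_extChartAt_target x))
      (contMDiffAt_iff_contDiffAt.2 contDiffAt_snd) rfl)
  have hu : ContMDiffAt 𝓘(ℝ, P × (Fin p → E)) I ∞ u z₀ := contMDiffAt_pow_iff.2 fun i =>
    ((hγ' i.castSucc).inv.mul (hs i)).mul (hγ' i.succ).inv.inv
  have h1 : ∀ᶠ z in 𝓝 z₀, ContMDiffAt 𝓘(ℝ, P × (Fin p → E)) I 1 u z :=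
    (contMDiffAt_iff_contMDiffAt_nhds (by simp)).1 (hu.of_le (by simp))
  have h2 : ∀ᶠ z : P × (Fin p → E) in 𝓝 z₀, z.2 ∈ (extChartAt I x).target :=
    continuous_snd.continuousAt.eventually (extChartAt_target_mem_nhds (I := I) x)
  have hpb : ContDiffAt ℝ ∞ (fun z => (pb 𝓘(ℝ, P × (Fin p → E)) I u α z).compContinuousLinearMap
      (ContinuousLinearMap.inr ℝ P (Fin p → E))) z₀ :=
    ContDiffAt.alt_comp ((hα _).contDiffAt_pb hu) contDiffAt_const
  have hρ : ∀ i, ContDiffAt ℝ ∞ (fun z : P × (Fin p → E) => W.ρ (γ z.1 i)) z₀ := fun i =>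
    contMDiffAt_iff_contDiffAt.1 (ContMDiffAt.comp z₀ (W.ρ_smooth _) (hγ' i))
  have hρ' : ∀ i, ContDiffAt ℝ ∞ (fun z : P × (Fin p → E) => V.ρ (γ z.1 i)⁻¹) z₀ := fun i =>
    contMDiffAt_iff_contDiffAt.1 (ContMDiffAt.comp z₀ (V.ρ_smooth _) (hγ' i).inv)
  have hc' : ContDiffAt ℝ ∞ (fun z : P × (Fin p → E) => c z.1) z₀ :=
    ContDiffAt.comp z₀ (g := c) (f := Prod.fst) hc contDiffAt_fst
  let f : P × (Fin p → E) → (Fin p → E) [⋀^Fin q]→L[ℝ] (V.V →L[ℝ] W.V) := fun z =>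
    c z.1 • ((ContinuousLinearMap.compL ℝ V.V V.V W.V).flip
      (V.ρ (γ z.1 (Fin.last p))⁻¹)).compContinuousAlternatingMap
        ((ContinuousLinearMap.compL ℝ V.V W.V W.V
          (W.ρ (γ z.1 0))).compContinuousAlternatingMap
            ((pb 𝓘(ℝ, P × (Fin p → E)) I u α z).compContinuousLinearMap
              (ContinuousLinearMap.inr ℝ P (Fin p → E))))
  have hf : ContDiffAt ℝ ∞ f z₀ := contDiffAt_alt_iff.2 fun v => hc'.smul
    (((hρ 0).clm_comp (contDiffAt_alt_iff.1 hpb v)).clm_comp (hρ' (Fin.last p)))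
  refine hf.congr_of_eventuallyEq ?_
  filter_upwards [h1, h2] with z hz hz'
  have h3 : MDifferentiableAt 𝓘(ℝ, Fin p → E) I (extChartAt I x).symm z.2 :=
    (contMDiffAt_extChartAt_symm hz').mdifferentiableAt (by simp)
  have h4 := tmap_comp' (g := zeta (γ z.1)⁻¹) ((contMDiff_zeta E _).mdiff _) h3
  have hr : HasFDerivAt (fun y : Fin p → E => (z.1, y)) (ContinuousLinearMap.inr ℝ P (Fin p → E))
      z.2 := hasFDerivAt_prodMk_right _ _
  have h5 := tmap_comp' (g := u) (f := fun y : Fin p → E => (z.1, y)) (x := z.2)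
    (hz.mdifferentiableAt (by simp)) hr.differentiableAt.mdifferentiableAt
  rw [tmap_eq_fderiv, hr.fderiv] at h5
  have h6 := h4.symm.trans h5
  ext1 v
  change c z.1 • ((W.ρ (γ z.1 0) ∘L α (u z) (fun i => ((tmap I I (zeta (γ z.1)⁻¹) _).comp
    (tmap 𝓘(ℝ, Fin p → E) I (extChartAt I x).symm z.2)) (v i))) ∘L V.ρ (γ z.1 (Fin.last p))⁻¹) = _
  rw [h6]
  rfl

end Action

/-! ### The infinitesimal homotopy -/

section Homotopy

variable {E : Type v} [NormedAddCommGroup E] [NormedSpace ℝ E] [FiniteDimensional ℝ E]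
  {G : Type w} [TopologicalSpace G] [ChartedSpace E G] [Group G] [LieGroup 𝓘(ℝ, E) ∞ G]
  {V W : TRep.{u} (E := E) G} {p q : ℕ}

open PCochain PLevel

theorem hasDerivAt_alt {F : Type*} [NormedAddCommGroup F] [NormedSpace ℝ F] [FiniteDimensional ℝ F]
    {f : ℝ → E [⋀^Fin q]→L[ℝ] F} {D : E [⋀^Fin q]→L[ℝ] F} {t : ℝ}
    (h : ∀ v, HasDerivAt (fun t => f t v) (D v) t) : HasDerivAt f D t := by
  obtain ⟨ι, _, e, L, hL⟩ := exists_alt_coeff E F q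
  have h1 : HasDerivAt (fun t => L fun j => f t (e j)) (L fun j => D (e j)) t :=
    L.hasFDerivAt.comp_hasDerivAt t (hasDerivAt_pi.2 fun j => h (e j))
  simpa only [hL] using h1

/-- The vector field on `BG_p` generated by a tangent vector of `G^(p+1)`. -/
def vel (e : Fin (p + 1) → E) (z : Fin p → G) : Fin p → E :=
  tmap (powModel E (p + 1)) (powModel E p) (fun a : Fin (p + 1) → G => zeta a⁻¹ z) 1 e

/-- Contraction of forms with the vector field generated by a tangent vector of `G^(p+1)`. -/
def contract {F : Type*} [NormedAddCommGroup F] [NormedSpace ℝ F] (e : Fin (p + 1) → E)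
    (α : PForm E G p (q + 1) F) : PForm E G p q F := fun z => (α z).curryLeft (vel e z)

theorem contMDiff_zeta_inv (z : Fin p → G) : ContMDiff (powModel E (p + 1)) (powModel E p) ∞
    (fun a : Fin (p + 1) → G => zeta a⁻¹ z) :=
  contMDiff_pow_iff.2 fun _ =>
    ((contMDiff_pow_proj _).inv.mul contMDiff_const).mul (contMDiff_pow_proj _).inv.inv

section Curves

variable {c : ℝ → Fin (p + 1) → G}

/-- The velocity at time zero of a curve in `G^(p+1)`. -/
def initialVelocity (c : ℝ → Fin (p + 1) → G) : Fin (p + 1) → E := fun i =>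
  tmap 𝓘(ℝ, ℝ) 𝓘(ℝ, E) (fun t => c t i) 0 1

theorem tmap_zeta_curve (hc : ∀ i, ContMDiffAt 𝓘(ℝ, ℝ) 𝓘(ℝ, E) ∞ (fun t => c t i) 0)
    (h0 : c 0 = 1) (z : Fin p → G) :
    tmap 𝓘(ℝ, ℝ) (powModel E p) (fun t => zeta (c t)⁻¹ z) 0 1 = vel (initialVelocity c) z := by
  have hd : MDifferentiableAt 𝓘(ℝ, ℝ) (powModel E (p + 1)) c 0 :=
    (contMDiffAt_pow_iff.2 hc).mdifferentiableAt (by simp)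
  have h1 := tmap_comp' (f := c) ((contMDiff_zeta_inv (E := E) z).mdiff (c 0)) hd
  rw [h1, h0]
  have h2 : tmap 𝓘(ℝ, ℝ) (powModel E (p + 1)) c 0 1 = initialVelocity c :=
    funext fun i => tmap_pow_apply hd 1 i
  change tmap _ _ _ _ (tmap 𝓘(ℝ, ℝ) (powModel E (p + 1)) c 0 1) = _
  rw [h2]
  rfl

theorem contMDiffAt_famChart_zeta
    (hc : ∀ i, ContMDiffAt 𝓘(ℝ, ℝ) 𝓘(ℝ, E) ∞ (fun t => c t i) 0) (x : Fin p → G) :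
    ContMDiffAt 𝓘(ℝ, ℝ × (Fin p → E)) (powModel E p) ∞
      (famChart (powModel E p) (fun t => zeta (c t)⁻¹) x) (0, extChartAt (powModel E p) x x) := by
  have hc' : ∀ i, ContMDiffAt 𝓘(ℝ, ℝ × (Fin p → E)) 𝓘(ℝ, E) ∞ (fun z => c z.1 i)
      ((0 : ℝ), extChartAt (powModel E p) x x) := fun i =>
    ContMDiffAt.comp_of_eq (hc i) (contMDiffAt_iff_contDiffAt.2 contDiffAt_fst) rfl
  have hs := contMDiffAt_pow_iff.1 (ContMDiffAt.comp_of_eq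
    (x := ((0 : ℝ), extChartAt (powModel E p) x x)) (f := Prod.snd)
    (contMDiffAt_extChartAt_symm (mem_extChartAt_target (I := powModel E p) x))
    (contMDiffAt_iff_contDiffAt.2 contDiffAt_snd) rfl)
  exact contMDiffAt_pow_iff.2 fun i =>
    ((hc' i.castSucc).inv.mul (hs i)).mul (hc' i.succ).inv.inv

end Curves

/-- The exterior derivative of the contraction, the second term in Cartan's formula. -/
def dContract {F : Type*} [NormedAddCommGroup F] [NormedSpace ℝ F] (e : Fin (p + 1) → E)
    (α : (q : ℕ) → PForm E G p q F) (q : ℕ) : PForm E G p q F :=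
  match q with
  | 0 => 0
  | q + 1 => ed (powModel E p) (contract e (α (q + 1)))

theorem SmoothFormAt.contract {F : Type*} [NormedAddCommGroup F] [NormedSpace ℝ F]
    [FiniteDimensional ℝ F] (e : Fin (p + 1) → E) {α : PForm E G p (q + 1) F}
    (hα : ∀ x, SmoothFormAt (powModel E p) α x) (x : Fin p → G) :
    SmoothFormAt (powModel E p) (contract e α) x := by
  let c : ℝ → Fin (p + 1) → G := fun t i => TRep.curve G (e i) t
  have hc : ∀ i, ContMDiffAt 𝓘(ℝ, ℝ) 𝓘(ℝ, E) ∞ (fun t => c t i) 0 := fun i =>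
    TRep.contMDiffAt_curve (e i) (0 : ℝ) contDiffAt_id rfl
  have h0 : c 0 = 1 := funext fun i => TRep.curve_zero (e i)
  have he : initialVelocity c = e := funext fun i => TRep.tmap_curve (e i)
  have h1 := SmoothFormAt.velocity (contMDiffAt_famChart_zeta hc x)
    (fun z => by rw [h0, inv_one, zeta_one]; rfl) hα
  simp only [tmap_zeta_curve hc h0, he] at h1
  exact h1

/-- The contracting homotopy for the infinitesimal action of a tangent vector of `G^(p+1)`, on
families of total degree `m`. -/
def homot (m : ℤ) (e : Fin (p + 1) → E) (α : PLevel V W p) : PLevel V W p := fun q =>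
  (-1 : ℝ) ^ p • contract e (α (q + 1)) +
    (-1 : ℝ) ^ (p + q) • mc (ContinuousLinearMap.compL ℝ V.V W.V W.V (W.iE (e 0))) (α q) +
    (-sgn m) • mc ((ContinuousLinearMap.compL ℝ V.V V.V W.V).flip (V.iE (e (Fin.last p)))) (α q)

theorem homot_smooth (m : ℤ) (e : Fin (p + 1) → E) {α : PLevel V W p} (hα : LSm α) :
    LSm (homot m e α) := fun q x =>
  (((SmoothFormAt.contract e (hα (q + 1)) x).smul _).add (((hα q x).mc _).smul _)).add
    (((hα q x).mc _).smul _)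

theorem iE_mem (x : E) : V.iE x ∈ TRep.HomDeg V V (-1) := fun n v hv => V.i_mem x n v hv

theorem homot_degree (m : ℤ) (e : Fin (p + 1) → E) {α : PLevel V W p} (hα : LDg m α) :
    LDg (m - 1) (homot m e α) := fun q g v => by
  refine Submodule.add_mem _ (Submodule.add_mem _ (Submodule.smul_mem _ _ ?_)
    (Submodule.smul_mem _ _ ?_)) (Submodule.smul_mem _ _ ?_)
  · have := hα (q + 1) g (Fin.cons (vel e g) v)
    rwa [show m - p - (q + 1 : ℕ) = m - 1 - p - q by push_cast; ring] at this
  · exact comp_mem_homDeg (by ring) (iE_mem _) (hα q g v)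
  · exact comp_mem_homDeg (by ring) (hα q g v) (iE_mem _)

theorem homot_linear (m : ℤ) {ι : Type*} (s : Finset ι) (c : ι → ℝ) (e : ι → Fin (p + 1) → E)
    (α : PLevel V W p) (q : ℕ) :
    homot m (∑ i ∈ s, c i • e i) α q = ∑ i ∈ s, c i • homot m (e i) α q := by
  let A : (Fin (p + 1) → E) →ₗ[ℝ] PForm E G p q (V.V →L[ℝ] W.V) :=
    { toFun := fun e => homot m e α q
      map_add' := fun e e' => by
        funext x
        ext1 v
        simp only [homot, contract, vel, mc, Pi.add_apply, Pi.smul_apply, map_add,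
          ContinuousAlternatingMap.add_apply, ContinuousAlternatingMap.smul_apply,
          ContinuousLinearMap.compContinuousAlternatingMap_coe, Function.comp_apply,
          add_apply, smul_add]
        abel
      map_smul' := fun r e => by
        funext x
        ext1 v
        simp only [homot, contract, vel, mc, Pi.add_apply, Pi.smul_apply, map_smul,
          ContinuousAlternatingMap.add_apply, ContinuousAlternatingMap.smul_apply,
          ContinuousLinearMap.compContinuousAlternatingMap_coe, Function.comp_apply,
          smul_apply, smul_add, RingHom.id_apply, smul_comm r] }
  change A _ = ∑ i ∈ s, c i • A (e i)
  simp only [map_sum, map_smul]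

/-- The cancellation of signs in Cartan's formula with coefficients. -/
theorem homotopy_signs {V W : Type*} [NormedAddCommGroup V] [NormedSpace ℝ V]
    [NormedAddCommGroup W] [NormedSpace ℝ W] {iV δV : V →L[ℝ] V} {iW δW : W →L[ℝ] W}
    {A B C D Z : V →L[ℝ] W} {P Q S : ℝ} (hP : P = 1 ∨ P = -1) (hQ : Q = 1 ∨ Q = -1)
    (hS : S = 1 ∨ S = -1)
    (hB : P • B + (-(P * Q)) • (δW ∘L A - (-(S * P * Q)) • (A ∘L δV)) = 0)
    (hZ : P • Z + (P * Q) • (δW ∘L C - (S * P * Q) • (C ∘L δV)) = 0) :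
    (iW ∘L δW + δW ∘L iW) ∘L A + (Z + D) - A ∘L (iV ∘L δV + δV ∘L iV) =
      P • (P • D + (P * Q) • (iW ∘L B) + (-S) • (B ∘L iV)) + (-(P * Q)) •
        (δW ∘L (P • C + (-(P * Q)) • (iW ∘L A) + (-S) • (A ∘L iV)) -
          (S * P * Q) • ((P • C + (-(P * Q)) • (iW ∘L A) + (-S) • (A ∘L iV)) ∘L δV)) := by
  ext y
  -- The hypotheses, which express that the forms are closed, eliminate `B` and `Z`.
  have key : ∀ w : V, P • B w = (P * Q) • (δW (A w) + (S * P * Q) • A (δV w)) := fun w => by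
    have h := congrArg (fun T : V →L[ℝ] W => T w) hB
    simp only [add_apply, smul_apply, sub_apply, ContinuousLinearMap.comp_apply, zero_apply] at h
    linear_combination (norm := module) h
  have hZ' := congrArg (fun T : V →L[ℝ] W => T y) hZ
  have hB1 := congrArg iW (key y)
  have hB2 := key (iV y)
  simp only [add_apply, smul_apply, sub_apply, ContinuousLinearMap.comp_apply, zero_apply,
    map_add, map_smul] at hZ' hB1 ⊢
  rcases hP with rfl | rfl <;> rcases hQ with rfl | rfl <;> rcases hS with rfl | rfl
  · linear_combination (norm := module) hZ' - hB1 + hB2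
  · linear_combination (norm := module) hZ' - hB1 - hB2
  · linear_combination (norm := module) hZ' + hB1 + hB2
  · linear_combination (norm := module) hZ' + hB1 - hB2
  · linear_combination (norm := module) (-1 : ℝ) • hZ' + hB1 + hB2
  · linear_combination (norm := module) (-1 : ℝ) • hZ' + hB1 - hB2
  · linear_combination (norm := module) (-1 : ℝ) • hZ' - hB1 + hB2
  · linear_combination (norm := module) (-1 : ℝ) • hZ' - hB1 - hB2

theorem ed_homot (m : ℤ) (e : Fin (p + 1) → E) {α : PLevel V W p} (hα : LSm α) (q : ℕ)
    (x : Fin p → G) (v : Fin (q + 1) → Fin p → E) :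
    ed (powModel E p) (homot m e α q) x v =
      (-1 : ℝ) ^ p • ed (powModel E p) (contract e (α (q + 1))) x v +
      ((-1 : ℝ) ^ p * (-1) ^ q) • (W.iE (e 0) ∘L ed (powModel E p) (α q) x v) +
      (-sgn m) • (ed (powModel E p) (α q) x v ∘L V.iE (e (Fin.last p))) := by
  have h1 := SmoothFormAt.contract e (hα (q + 1)) x
  have h2 := (hα q x).mc (ContinuousLinearMap.compL ℝ V.V W.V W.V (W.iE (e 0)))
  have h3 := (hα q x).mc ((ContinuousLinearMap.compL ℝ V.V V.V W.V).flip (V.iE (e (Fin.last p))))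
  rw [homot, ed_add ((h1.smul _).add (h2.smul _)) (h3.smul _), ed_add (h1.smul _) (h2.smul _),
    ed_smul, ed_smul, ed_smul, ed_mc (hα q x), ed_mc (hα q x), pow_add]
  rfl

theorem sgn_eq_or (m : ℤ) : sgn m = 1 ∨ sgn m = -1 := mul_self_eq_one_iff.1 (sgn_mul_self m)

/-- Cartan's formula with coefficients: the infinitesimal action on closed families of forms is the
differential of the homotopy. -/
theorem LD_homot {m : ℤ} (e : Fin (p + 1) → E) {α : PLevel V W p} (hα : LSm α) (hcl : LD m α = 0)
    (q : ℕ) (x : Fin p → G) (v : Fin q → Fin p → E) :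
    LD (m - 1) (homot m e α) q x v = W.LE (e 0) ∘L α q x v +
      (ed (powModel E p) (α q) x (Fin.cons (vel e x) v) + dContract e α q x v) -
      α q x v ∘L V.LE (e (Fin.last p)) := by
  have hLW : W.LE (e 0) = W.iE (e 0) ∘L W.δ + W.δ ∘L W.iE (e 0) := (W.i_δ (e 0)).symm
  have hLV : V.LE (e (Fin.last p)) = V.iE (e (Fin.last p)) ∘L V.δ + V.δ ∘L V.iE (e (Fin.last p)) :=
    (V.i_δ _).symm
  have hcl' : ∀ q v, LD m α q x v = 0 := fun q v => by rw [hcl]; rfl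
  have hP : ((-1 : ℝ) ^ p = 1 ∨ (-1 : ℝ) ^ p = -1) := neg_one_pow_eq_or ℝ p
  rw [hLW, hLV]
  have hs : ∀ n : ℕ, sgn (m - p - n) = sgn m * (-1) ^ p * (-1) ^ n := fun n => by
    rw [← sgn_natCast, ← sgn_natCast, ← sgn_add, ← sgn_add]
    refine sgn_congr ⟨m, by ring⟩
  have hs' : ∀ n : ℕ, sgn (m - 1 - p - n) = -(sgn m * (-1) ^ p * (-1) ^ n) := fun n => by
    rw [← hs, ← sgn_add_one]
    refine sgn_congr ⟨m - p - n, by ring⟩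
  cases q with
  | zero =>
    have hB : (0 : (Fin p → E) [⋀^Fin 0]→L[ℝ] (V.V →L[ℝ] W.V)) v + (-1 : ℝ) ^ (p + 0) •
        (W.δ ∘L α 0 x v - sgn (m - p - (0 : ℕ)) • (α 0 x v ∘L V.δ)) = 0 := hcl' 0 v
    have hZ : (-1 : ℝ) ^ p • ed (powModel E p) (α 0) x (Fin.cons (vel e x) v) +
        (-1 : ℝ) ^ (p + 1) • (W.δ ∘L α 1 x (Fin.cons (vel e x) v) -
          sgn (m - p - (1 : ℕ)) • (α 1 x (Fin.cons (vel e x) v) ∘L V.δ)) = 0 :=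
      hcl' 1 (Fin.cons (vel e x) v)
    have key := homotopy_signs (iV := V.iE (e (Fin.last p))) (δV := V.δ) (iW := W.iE (e 0))
      (δW := W.δ) (A := α 0 x v) (B := 0) (C := α 1 x (Fin.cons (vel e x) v)) (D := 0)
      (Z := ed (powModel E p) (α 0) x (Fin.cons (vel e x) v)) hP (Or.inr rfl : (-1 : ℝ) = 1 ∨ _)
      (sgn_eq_or m) (by
        refine Eq.trans ?_ hB
        rw [hs]
        simp) (by
        refine Eq.trans ?_ hZ
        rw [hs]
        simp [pow_succ])
    refine Eq.trans ?_ key.symm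
    change (0 : (Fin p → E) [⋀^Fin 0]→L[ℝ] (V.V →L[ℝ] W.V)) v + (-1 : ℝ) ^ (p + 0) •
      (W.δ ∘L homot m e α 0 x v - sgn (m - 1 - p - (0 : ℕ)) • (homot m e α 0 x v ∘L V.δ)) = _
    have h1 : homot m e α 0 x v = (-1 : ℝ) ^ p • α 1 x (Fin.cons (vel e x) v) +
      (-1 : ℝ) ^ p • (W.iE (e 0) ∘L α 0 x v) +
      (-sgn m) • (α 0 x v ∘L V.iE (e (Fin.last p))) := rfl
    rw [h1, hs']
    simp
  | succ q =>
    have hB : (-1 : ℝ) ^ p • ed (powModel E p) (α q) x v + (-1 : ℝ) ^ (p + (q + 1)) •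
        (W.δ ∘L α (q + 1) x v - sgn (m - p - (q + 1 : ℕ)) • (α (q + 1) x v ∘L V.δ)) = 0 :=
      hcl' (q + 1) v
    have hZ : (-1 : ℝ) ^ p • ed (powModel E p) (α (q + 1)) x (Fin.cons (vel e x) v) +
        (-1 : ℝ) ^ (p + (q + 2)) • (W.δ ∘L α (q + 2) x (Fin.cons (vel e x) v) -
          sgn (m - p - (q + 2 : ℕ)) • (α (q + 2) x (Fin.cons (vel e x) v) ∘L V.δ)) = 0 :=
      hcl' (q + 2) (Fin.cons (vel e x) v)
    have key := homotopy_signs (iV := V.iE (e (Fin.last p))) (δV := V.δ) (iW := W.iE (e 0))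
      (δW := W.δ) (A := α (q + 1) x v) (B := ed (powModel E p) (α q) x v)
      (C := α (q + 2) x (Fin.cons (vel e x) v))
      (D := ed (powModel E p) (contract e (α (q + 1))) x v)
      (Z := ed (powModel E p) (α (q + 1)) x (Fin.cons (vel e x) v)) hP (neg_one_pow_eq_or ℝ q)
      (sgn_eq_or m) (by
        refine Eq.trans ?_ hB
        rw [hs]
        simp [pow_add, pow_succ]) (by
        refine Eq.trans ?_ hZ
        rw [hs]
        simp [pow_add])
    refine Eq.trans ?_ key.symm
    change (-1 : ℝ) ^ p • ed (powModel E p) (homot m e α q) x v + (-1 : ℝ) ^ (p + (q + 1)) •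
      (W.δ ∘L homot m e α (q + 1) x v -
        sgn (m - 1 - p - (q + 1 : ℕ)) • (homot m e α (q + 1) x v ∘L V.δ)) = _
    have h1 : homot m e α (q + 1) x v = (-1 : ℝ) ^ p • α (q + 2) x (Fin.cons (vel e x) v) +
      (-1 : ℝ) ^ (p + (q + 1)) • (W.iE (e 0) ∘L α (q + 1) x v) +
      (-sgn m) • (α (q + 1) x v ∘L V.iE (e (Fin.last p))) := rfl
    rw [h1, hs', ed_homot m e hα]
    simp [pow_add, pow_succ]

theorem hasDerivAt_pb_zeta {F : Type*} [NormedAddCommGroup F] [NormedSpace ℝ F]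
    [FiniteDimensional ℝ F] {c : ℝ → Fin (p + 1) → G}
    (hc : ∀ i, ContMDiffAt 𝓘(ℝ, ℝ) 𝓘(ℝ, E) ∞ (fun t => c t i) 0) (h0 : c 0 = 1)
    {α : (q : ℕ) → PForm E G p q F} (hα : ∀ q x, SmoothFormAt (powModel E p) (α q) x) (q : ℕ)
    (x : Fin p → G) (v : Fin q → Fin p → E) :
    HasDerivAt (fun t => pb (powModel E p) (powModel E p) (zeta (c t)⁻¹) (α q) x v)
      (ed (powModel E p) (α q) x (Fin.cons (vel (initialVelocity c) x) v) +
        dContract (initialVelocity c) α q x v) 0 := by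
  have hu := contMDiffAt_famChart_zeta hc x
  have hf0 : ∀ z, (fun t => zeta (c t)⁻¹) 0 z = z := fun z => by
    simp only [h0, inv_one, zeta_one, id]
  have hev : ∀ D,
      HasDerivAt (fun t => pb (powModel E p) (powModel E p) (zeta (c t)⁻¹) (α q) x) D 0 →
      HasDerivAt (fun t => pb (powModel E p) (powModel E p) (zeta (c t)⁻¹) (α q) x v)
        (D v) 0 :=
    fun D h => (ContinuousAlternatingMap.apply ℝ _ F v).hasFDerivAt.comp_hasDerivAt (0 : ℝ) h
  cases q with
  | zero =>
    have h1 := hev _ (hasDerivAt_pb_zero hu hf0 (hα 0))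
    rw [tmap_zeta_curve hc h0] at h1
    exact h1.congr_deriv (add_zero _).symm
  | succ q =>
    have h1 := hev _ (hasDerivAt_pb_succ hu hf0 (hα (q + 1)))
    simp only [tmap_zeta_curve hc h0] at h1
    exact h1

/-- The derivative of the action along a curve through the identity, on closed families of forms,
is the differential of the homotopy for the velocity of the curve. -/
theorem hasDerivAt_act {m : ℤ} {c : ℝ → Fin (p + 1) → G}
    (hc : ∀ i, ContMDiffAt 𝓘(ℝ, ℝ) 𝓘(ℝ, E) ∞ (fun t => c t i) 0) (h0 : c 0 = 1)
    {α : PLevel V W p} (hα : LSm α) (hcl : LD m α = 0) (q : ℕ) (x : Fin p → G) :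
    HasDerivAt (fun t => act (c t) (α q) x)
      (LD (m - 1) (homot m (initialVelocity c) α) q x) 0 := by
  refine hasDerivAt_alt fun v => ?_
  have h1 := hasDerivAt_pb_zeta hc h0 hα q x v
  have hd : ∀ i, MDifferentiableAt 𝓘(ℝ, ℝ) 𝓘(ℝ, E) (fun t => c t i) 0 := fun i =>
    (hc i).mdifferentiableAt (by simp)
  have h2 := W.hasDerivAt_rho (hd 0) (congrFun h0 0)
  have h3 := V.hasDerivAt_rho_inv (hd (Fin.last p)) (congrFun h0 (Fin.last p))
  have h4 := (h2.clm_comp h1).clm_comp h3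
  rw [LD_homot _ hα hcl]
  refine h4.congr_deriv ?_
  have h5 : pb (powModel E p) (powModel E p) (zeta (c 0)⁻¹) (α q) x v = α q x v := by
    rw [h0, inv_one, zeta_one, pb_id]
  rw [h5, h0]
  simp only [Pi.one_apply, inv_one, TRep.rho_one, ContinuousLinearMap.comp_id,
    ContinuousLinearMap.id_comp, ContinuousLinearMap.comp_neg, ← sub_eq_add_neg]
  rfl

end Homotopy

/-! ### Averages of translates -/

section Translations

open MeasureTheory PCochain PLevel

variable {E : Type v} [NormedAddCommGroup E] [NormedSpace ℝ E] [FiniteDimensional ℝ E]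
  {G : Type w} [TopologicalSpace G] [ChartedSpace E G] [Group G] [LieGroup 𝓘(ℝ, E) ∞ G]
  {V W : TRep.{u} (E := E) G} {p : ℕ}

theorem integral_clm_alt {Ω E₁ E₂ F₁ F₂ : Type*} [MeasurableSpace Ω] {μ : Measure Ω}
    [NormedAddCommGroup E₁] [NormedSpace ℝ E₁] [NormedAddCommGroup E₂] [NormedSpace ℝ E₂]
    [NormedAddCommGroup F₁] [NormedSpace ℝ F₁] [CompleteSpace F₁] [NormedAddCommGroup F₂]
    [NormedSpace ℝ F₂] [CompleteSpace F₂] {q q' : ℕ}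
    (T : (E₁ [⋀^Fin q]→L[ℝ] F₁) →L[ℝ] (E₂ [⋀^Fin q']→L[ℝ] F₂)) {f : Ω → E₁ [⋀^Fin q]→L[ℝ] F₁}
    (hf : Integrable f μ) : ∫ k, T (f k) ∂μ = T (∫ k, f k ∂μ) :=
  ContinuousLinearMap.integral_comp_comm (𝕜 := ℝ) (E := E₁ [⋀^Fin q]→L[ℝ] F₁)
    (Fₗ := E₂ [⋀^Fin q']→L[ℝ] F₂) T hf

theorem LD_add (m : ℤ) {β β' : PLevel V W p} (hβ : LSm β) (hβ' : LSm β') :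
    LD m (β + β') = LD m β + LD m β' := by
  funext q
  cases q with
  | zero =>
    simp only [LD, lvB, Pi.add_apply, coeffD_add, smul_add, zero_add]
  | succ q =>
    have h : ed (powModel E p) (β q + β' q) = ed (powModel E p) (β q) + ed (powModel E p) (β' q) :=
      funext fun x => ed_add (hβ q x) (hβ' q x)
    simp only [LD, lvB, Pi.add_apply, coeffD_add, smul_add, h]
    abel

theorem LD_smul (m : ℤ) (c : ℝ) (β : PLevel V W p) : LD m (c • β) = c • LD m β := by
  funext q
  cases q with
  | zero =>
    simp only [LD, lvB, Pi.smul_apply, coeffD_smul, zero_add, smul_comm c]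
  | succ q =>
    have h : ed (powModel E p) (c • β q) = c • ed (powModel E p) (β q) :=
      funext fun x => ed_smul (β q) x c
    simp only [LD, lvB, Pi.smul_apply, coeffD_smul, smul_add, h, smul_comm c]

theorem LSm_sum {ι : Type*} {s : Finset ι} {β : ι → PLevel V W p} (hβ : ∀ i ∈ s, LSm (β i)) :
    LSm (∑ i ∈ s, β i) := fun q x => by
  rw [Finset.sum_apply]
  exact SmoothFormAt.sum fun i hi => hβ i hi q x

theorem LD_sum (m : ℤ) {ι : Type*} (s : Finset ι) {β : ι → PLevel V W p}
    (hβ : ∀ i ∈ s, LSm (β i)) : LD m (∑ i ∈ s, β i) = ∑ i ∈ s, LD m (β i) := by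
  classical
  induction s using Finset.induction_on with
  | empty => exact LD_zero m
  | insert i s hi ih =>
    have h := fun j hj => hβ j (Finset.mem_insert_of_mem hj)
    rw [Finset.sum_insert hi, Finset.sum_insert hi,
      LD_add m (hβ i (Finset.mem_insert_self i s)) (LSm_sum h), ih h]

theorem LD_smooth (m : ℤ) {β : PLevel V W p} (hβ : LSm β) : LSm (LD m β) := fun q x => by
  refine SmoothFormAt.add ?_ ((smooth_coeffD _ (hβ q x)).smul _)
  cases q with
  | zero => exact SmoothFormAt.zero x
  | succ q => exact (SmoothFormAt.ed (hβ q) x).smul _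

variable {P : Type*} [NormedAddCommGroup P] [NormedSpace ℝ P] [FiniteDimensional ℝ P]
  [MeasurableSpace P] [BorelSpace P] {C : Set P} {ν : Measure P} [IsFiniteMeasure ν]
  {c : P → ℝ} {γ : P → Fin (p + 1) → G}

theorem coeffD_formIntegral (hC : IsCompact C) (hν : ν Cᶜ = 0) (r : ℤ) {q : ℕ}
    {β : P → PForm E G p q (V.V →L[ℝ] W.V)}
    (hβ : ∀ k ∈ C, ∀ x, SmoothFamilyAt (powModel E p) β k x) (x : Fin p → G) :
    coeffD r (formIntegral ν β) x = ∫ k, coeffD r (β k) x ∂ν := by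
  let T : ((Fin p → E) [⋀^Fin q]→L[ℝ] (V.V →L[ℝ] W.V)) →L[ℝ]
      ((Fin p → E) [⋀^Fin q]→L[ℝ] (V.V →L[ℝ] W.V)) :=
    ContinuousLinearMap.compContinuousAlternatingMapCLM ℝ _ _ _ (ι := Fin q)
      (ContinuousLinearMap.compL ℝ V.V W.V W.V W.δ) -
    sgn r • ContinuousLinearMap.compContinuousAlternatingMapCLM ℝ _ _ _ (ι := Fin q)
      ((ContinuousLinearMap.compL ℝ V.V V.V W.V).flip V.δ)
  have hT : ∀ α : PForm E G p q (V.V →L[ℝ] W.V), coeffD r α x = T (α x) := fun _ => rfl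
  simp only [hT]
  exact (integral_clm_alt T (integrable_of_smoothFamily hC hν hβ x)).symm

/-- Data for smooth averages of translates: a finite measure carried by a compact set, near which
the weights and the group elements depend smoothly on the parameter. -/
structure SmoothWeight (C : Set P) (ν : Measure P) (c : P → ℝ) (γ : P → Fin (p + 1) → G) :
    Prop where
  isCompact : IsCompact C
  null : ν Cᶜ = 0
  weight : ∀ k ∈ C, ContDiffAt ℝ ∞ c k
  group : ∀ k ∈ C, ∀ i, ContMDiffAt 𝓘(ℝ, P) 𝓘(ℝ, E) ∞ (fun k => γ k i) k

variable (ν c γ) in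
/-- The weighted integral of the translates of a family of forms. -/
def translates (β : PLevel V W p) : PLevel V W p := fun q =>
  formIntegral ν fun k => c k • act (γ k) (β q)

namespace SmoothWeight

variable {β : PLevel V W p}

theorem family (h : SmoothWeight (E := E) C ν c γ) {q : ℕ} {α : PForm E G p q (V.V →L[ℝ] W.V)}
    (hα : ∀ x, SmoothFormAt (powModel E p) α x) (k : P) (hk : k ∈ C) (x : Fin p → G) :
    SmoothFamilyAt (powModel E p) (fun k => c k • act (γ k) α) k x :=
  smoothFamilyAt_act (h.group k hk) (h.weight k hk) hα x

theorem integrable (h : SmoothWeight (E := E) C ν c γ) {q : ℕ}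
    {α : PForm E G p q (V.V →L[ℝ] W.V)} (hα : ∀ x, SmoothFormAt (powModel E p) α x)
    (x : Fin p → G) : Integrable (fun k => c k • act (γ k) α x) ν :=
  integrable_of_smoothFamily h.isCompact h.null (h.family hα) x

theorem smooth (h : SmoothWeight (E := E) C ν c γ) (hβ : LSm β) : LSm (translates ν c γ β) :=
  fun q x => SmoothFormAt.formIntegral h.isCompact h.null (h.family (hβ q)) x

theorem degree [ConnectedSpace G] (h : SmoothWeight (E := E) C ν c γ) {m : ℤ} (hβ : LSm β)
    (hm : LDg m β) : LDg m (translates ν c γ β) := fun q g v =>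
  formIntegral_mem h.isCompact h.null (h.family (hβ q))
    (fun k x v => Submodule.smul_mem _ _ (act_mem (γ k) (hm q) x v)) g v

theorem coeffD_translates [ConnectedSpace G] (h : SmoothWeight (E := E) C ν c γ) (r : ℤ)
    (hβ : LSm β) (q : ℕ) (x : Fin p → G) :
    coeffD r (translates ν c γ β q) x = ∫ k, c k • act (γ k) (coeffD r (β q)) x ∂ν := by
  rw [translates, coeffD_formIntegral h.isCompact h.null r (h.family (hβ q))]
  simp only [coeffD_smul, coeffD_act]
  rfl

theorem ed_translates (h : SmoothWeight (E := E) C ν c γ) (hβ : LSm β) (q : ℕ) (x : Fin p → G) :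
    ed (powModel E p) (translates ν c γ β q) x =
      ∫ k, c k • act (γ k) (ed (powModel E p) (β q)) x ∂ν := by
  rw [translates, ed_formIntegral h.isCompact h.null (h.family (hβ q))]
  simp only [ed_smul, ed_act _ (hβ q)]

theorem LD_translates [ConnectedSpace G] (h : SmoothWeight (E := E) C ν c γ) (m : ℤ)
    (hβ : LSm β) : LD m (translates ν c γ β) = translates ν c γ (LD m β) := by
  have h0 : ∀ β : PLevel V W p, LD m β 0 = (-1 : ℝ) ^ (p + 0) • coeffD (m - p - (0 : ℕ)) (β 0) :=
    fun β => zero_add _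
  have h1 : ∀ (β : PLevel V W p) (q : ℕ), LD m β (q + 1) = (-1 : ℝ) ^ p • ed (powModel E p) (β q) +
      (-1 : ℝ) ^ (p + (q + 1)) • coeffD (m - p - (q + 1 : ℕ)) (β (q + 1)) := fun β q => rfl
  funext q x
  change _ = ∫ k, c k • act (γ k) (LD m β q) x ∂ν
  cases q with
  | zero =>
    rw [h0, h0, Pi.smul_apply, h.coeffD_translates _ hβ, ← integral_smul]
    simp only [act_smul, Pi.smul_apply, smul_comm (c _)]
  | succ q =>
    rw [h1, h1, Pi.add_apply, Pi.smul_apply, Pi.smul_apply, h.coeffD_translates _ hβ,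
      h.ed_translates hβ, ← integral_smul, ← integral_smul]
    have i1 : Integrable (fun k => (-1 : ℝ) ^ p • c k • act (γ k) (ed (powModel E p) (β q)) x) ν :=
      (h.integrable (SmoothFormAt.ed (hβ q)) x).fun_smul _
    have i2 : Integrable (fun k => (-1 : ℝ) ^ (p + (q + 1)) • c k •
        act (γ k) (coeffD (m - p - (q + 1 : ℕ)) (β (q + 1))) x) ν :=
      (h.integrable (fun x => smooth_coeffD _ (hβ (q + 1) x)) x).fun_smul _
    rw [← integral_add i1 i2]
    simp only [act_add, act_smul, Pi.add_apply, Pi.smul_apply, smul_add, smul_comm (c _)]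

end SmoothWeight

end Translations

/-! ### Translations along short paths -/

section ShortPaths

open MeasureTheory PCochain PLevel

variable {E : Type v} [NormedAddCommGroup E] [NormedSpace ℝ E] [FiniteDimensional ℝ E]
  {G : Type w} [TopologicalSpace G] [ChartedSpace E G] [Group G] [LieGroup 𝓘(ℝ, E) ∞ G]
  {V W : TRep.{u} (E := E) G} {p : ℕ}

variable (G) in
/-- The path in `G^(p+1)` which is the segment from zero to `k` in the chart at the identity. -/
def path (k : Fin (p + 1) → E) (t : ℝ) : Fin (p + 1) → G := fun i => TRep.curve G (k i) t

theorem path_zero (k : Fin (p + 1) → E) : path G k 0 = 1 := funext fun i => TRep.curve_zero (k i)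

variable (E G p) in
/-- The segments to the points of the ball of radius `r` stay in the domain of the chart. -/
def IsChartRadius (r : ℝ) : Prop := ∀ k ∈ Metric.closedBall (0 : Fin (p + 1) → E) r,
  ∀ t ∈ Set.Icc (0 : ℝ) 1, ∀ i, ContMDiffAt 𝓘(ℝ, (Fin (p + 1) → E) × ℝ) 𝓘(ℝ, E) ∞
    (fun z => path G z.1 z.2 i) (k, t)

variable (E G p) in
theorem exists_isChartRadius : ∃ r > 0, IsChartRadius E G p r := by
  obtain ⟨ε, hε, h⟩ := Metric.eventually_nhds_iff_ball.1
      (eventually_contMDiffAt_par (E := E) (1 : G))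
  refine ⟨ε / 2, half_pos hε, fun k hk t ht i => ?_⟩
  have h1 : ‖k i‖ ≤ ε / 2 := (norm_le_pi_norm k i).trans (mem_closedBall_zero_iff.1 hk)
  have h2 : ‖t • k i‖ < ε := by
    rw [norm_smul, Real.norm_of_nonneg ht.1]
    nlinarith [norm_nonneg (k i), ht.2]
  refine ContMDiffAt.comp_of_eq (g := par E (1 : G))
    (f := fun z : (Fin (p + 1) → E) × ℝ => cen E G + z.2 • z.1 i)
    (h (cen E G + t • k i) (by simpa [Metric.mem_ball, dist_eq_norm] using h2)) ?_ rfl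
  have h3 : ContDiff ℝ ∞ (fun z : (Fin (p + 1) → E) × ℝ => cen E G + z.2 • z.1 i) := by fun_prop
  exact contMDiffAt_iff_contDiffAt.2 h3.contDiffAt

/-- The velocity of a path, translated back to the identity. -/
def pathVelocity (z : (Fin (p + 1) → E) × ℝ) : Fin (p + 1) → E :=
  initialVelocity fun s => (path G z.1 z.2)⁻¹ * path G z.1 (z.2 + s)

/-- The translates of a path back to the identity are smooth. -/
theorem contMDiffAt_path_translate {r : ℝ} (hr : IsChartRadius E G p r) {k : Fin (p + 1) → E}
    (hk : k ∈ Metric.closedBall 0 r) {t : ℝ} (ht : t ∈ Set.Icc (0 : ℝ) 1) (i : Fin (p + 1)) :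
    ContMDiffAt 𝓘(ℝ, ((Fin (p + 1) → E) × ℝ) × ℝ) 𝓘(ℝ, E) ∞
      (fun z => ((path G z.1.1 z.1.2)⁻¹ * path G z.1.1 (z.1.2 + z.2)) i) ((k, t), 0) := by
  have h1 : ContDiff ℝ ∞ (fun z : ((Fin (p + 1) → E) × ℝ) × ℝ => (z.1.1, z.1.2 + z.2)) := by
      fun_prop
  exact (ContMDiffAt.comp_of_eq (g := fun z : (Fin (p + 1) → E) × ℝ => path G z.1 z.2 i)
    (f := Prod.fst) (hr k hk t ht i) (contMDiffAt_iff_contDiffAt.2 contDiffAt_fst) rfl).inv.mul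
      (ContMDiffAt.comp_of_eq (g := fun z : (Fin (p + 1) → E) × ℝ => path G z.1 z.2 i)
        (hr k hk t ht i) (contMDiffAt_iff_contDiffAt.2 h1.contDiffAt) (by simp))

theorem contDiffAt_pathVelocity {r : ℝ} (hr : IsChartRadius E G p r) {k : Fin (p + 1) → E}
    (hk : k ∈ Metric.closedBall 0 r) {t : ℝ} (ht : t ∈ Set.Icc (0 : ℝ) 1) :
    ContDiffAt ℝ ∞ (pathVelocity (G := G)) (k, t) := by
  refine contDiffAt_pi.2 fun i => ?_
  let u : ((Fin (p + 1) → E) × ℝ) × ℝ → G := fun z =>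
    ((path G z.1.1 z.1.2)⁻¹ * path G z.1.1 (z.1.2 + z.2)) i
  have hu : ContMDiffAt 𝓘(ℝ, ((Fin (p + 1) → E) × ℝ) × ℝ) 𝓘(ℝ, E) ∞ u ((k, t), 0) :=
    contMDiffAt_path_translate hr hk ht i
  have hu0 : ∀ z, u (z, 0) = 1 := fun z => by simp [u]
  have hZ : ContDiffAt ℝ ∞ (fun z => cha E (1 : G) (u z)) ((k, t), 0) :=
    hu.contDiffAt_cha (hu0 _)
  have h1 : ContDiffAt ℝ ∞ (fun z => fderiv ℝ (fun z => cha E (1 : G) (u z)) (z, 0) (0, 1))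
      (k, t) :=
    (ContDiffAt.comp (k, t) (g := fderiv ℝ (fun z => cha E (1 : G) (u z)))
      (f := fun z : (Fin (p + 1) → E) × ℝ => (z, (0 : ℝ)))
      (hZ.fderiv_right (by simp)) (contDiffAt_id.prodMk contDiffAt_const)).clm_apply
          contDiffAt_const
  refine h1.congr_of_eventuallyEq ?_
  have h2 : ∀ᶠ z in 𝓝 ((k, t), (0 : ℝ)),
      ContMDiffAt 𝓘(ℝ, ((Fin (p + 1) → E) × ℝ) × ℝ) 𝓘(ℝ, E) 1 u z :=
    (contMDiffAt_iff_contMDiffAt_nhds (by simp)).1 (hu.of_le (by simp))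
  have h3 : ∀ᶠ z in 𝓝 (k, t), ContMDiffAt 𝓘(ℝ, ((Fin (p + 1) → E) × ℝ) × ℝ) 𝓘(ℝ, E) 1 u (z, 0) :=
    (Continuous.prodMk_left (0 : ℝ)).continuousAt.eventually h2
  filter_upwards [h3] with z hz
  have hc : MDifferentiableAt 𝓘(ℝ, E) 𝓘(ℝ, E) (extChartAt 𝓘(ℝ, E) (1 : G)) (u (z, 0)) := by
    rw [hu0]
    exact (contMDiffAt_extChartAt (n := ∞)).mdifferentiableAt (by simp)
  have hi : HasFDerivAt (fun s : ℝ => (z, s)) (ContinuousLinearMap.inr ℝ _ ℝ) 0 :=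
    hasFDerivAt_prodMk_right z 0
  have hd := hz.mdifferentiableAt (by simp)
  have h4 := tmap_comp' (f := fun s : ℝ => (z, s)) hd hi.differentiableAt.mdifferentiableAt
  have h5 := tmap_comp' (f := u) hc hd
  rw [hu0, tmap_extChartAt_self, ContinuousLinearMap.id_comp, tmap_eq_fderiv] at h5
  rw [tmap_eq_fderiv, hi.fderiv, ← h5] at h4
  change tmap 𝓘(ℝ, ℝ) 𝓘(ℝ, E) (fun s => u (z, s)) 0 1 = _
  rw [h4, ContinuousLinearMap.comp_apply, ContinuousLinearMap.inr_apply]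

theorem hasDerivAt_clm_alt {E₁ E₂ F₁ F₂ : Type*}
    [NormedAddCommGroup E₁] [NormedSpace ℝ E₁] [NormedAddCommGroup E₂] [NormedSpace ℝ E₂]
    [NormedAddCommGroup F₁] [NormedSpace ℝ F₁] [NormedAddCommGroup F₂] [NormedSpace ℝ F₂] {q q' : ℕ}
    (T : (E₁ [⋀^Fin q]→L[ℝ] F₁) →L[ℝ] (E₂ [⋀^Fin q']→L[ℝ] F₂)) {f : ℝ → E₁ [⋀^Fin q]→L[ℝ] F₁}
    {D : E₁ [⋀^Fin q]→L[ℝ] F₁} {t : ℝ} (hf : HasDerivAt f D t) :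
    HasDerivAt (fun t => T (f t)) (T D) t :=
  HasFDerivAt.comp_hasDerivAt (E := E₂ [⋀^Fin q']→L[ℝ] F₂) (F := E₁ [⋀^Fin q]→L[ℝ] F₁) t
    (ContinuousLinearMap.hasFDerivAt (𝕜 := ℝ) (E := E₁ [⋀^Fin q]→L[ℝ] F₁)
      (F := E₂ [⋀^Fin q']→L[ℝ] F₂) T) hf

/-- The derivative of the translates of a closed family of forms along a path. -/
theorem hasDerivAt_act_path {r : ℝ} (hr : IsChartRadius E G p r) {k : Fin (p + 1) → E}
    (hk : k ∈ Metric.closedBall 0 r) {t : ℝ} (ht : t ∈ Set.Icc (0 : ℝ) 1) {m : ℤ}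
    {α : PLevel V W p} (hα : LSm α) (hcl : LD m α = 0) (q : ℕ) (x : Fin p → G) :
    HasDerivAt (fun t => act (path G k t) (α q) x)
      (act (path G k t) (LD (m - 1) (homot m (pathVelocity (G := G) (k, t)) α) q) x) t := by
  obtain ⟨T, hT⟩ := exists_act_clm (V := V) (W := W) (q := q) (path G k t) x
  have h1 := hasDerivAt_act (c := fun s => (path G k t)⁻¹ * path G k (t + s)) (fun i =>
    ContMDiffAt.comp_of_eq (f := fun s : ℝ => ((k, t), s))
      (contMDiffAt_path_translate hr hk ht i) (contMDiffAt_iff_contDiffAt.2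
        (contDiffAt_const.prodMk contDiffAt_id)) rfl) (by simp) hα hcl q (zeta (path G k t)⁻¹ x)
  have h2 := hasDerivAt_clm_alt T h1
  rw [← hT] at h2
  have h3 : HasDerivAt (fun s => act (path G k (t + s)) (α q) x)
      (act (path G k t) (LD (m - 1) (homot m (pathVelocity (G := G) (k, t)) α) q) x) 0 := by
    refine h2.congr_of_eventuallyEq (.of_forall fun s => ?_)
    change _ = T (act _ (α q) (zeta (path G k t)⁻¹ x))
    rw [← hT, act_act, mul_inv_cancel_left]
  rw [← sub_self t] at h3
  refine (h3.comp_sub_const t t).congr_of_eventuallyEq (.of_forall fun s => ?_)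
  simp

end ShortPaths

/-! ### Averages over short paths -/

section PathHomotopy

open MeasureTheory PCochain PLevel

variable {E : Type v} [NormedAddCommGroup E] [NormedSpace ℝ E] [FiniteDimensional ℝ E]
  {G : Type w} [TopologicalSpace G] [ChartedSpace E G] [Group G] [LieGroup 𝓘(ℝ, E) ∞ G]
  {V W : TRep.{u} (E := E) G} {p : ℕ}

/-- The product of a measure with the Lebesgue measure of the unit interval. -/
def timesInterval {P : Type*} [MeasurableSpace P] (ν : Measure P) : Measure (P × ℝ) :=
  ν.prod (volume.restrict (Set.Icc 0 1))

instance {P : Type*} [MeasurableSpace P] (ν : Measure P) [IsFiniteMeasure ν] :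
    IsFiniteMeasure (timesInterval ν) :=
  inferInstanceAs (IsFiniteMeasure (ν.prod (volume.restrict (Set.Icc 0 1))))

theorem timesInterval_compl {P : Type*} [MeasurableSpace P] {ν : Measure P} [IsFiniteMeasure ν]
    {C : Set P} (hν : ν Cᶜ = 0) : timesInterval ν (C ×ˢ Set.Icc 0 1)ᶜ = 0 := by
  have h1 : (C ×ˢ Set.Icc (0 : ℝ) 1)ᶜ ⊆ Cᶜ ×ˢ Set.univ ∪ Set.univ ×ˢ (Set.Icc (0 : ℝ) 1)ᶜ := by
    rintro ⟨k, t⟩ h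
    by_cases hk : k ∈ C
    · exact Or.inr ⟨trivial, fun ht => h ⟨hk, ht⟩⟩
    · exact Or.inl ⟨hk, trivial⟩
  refine measure_mono_null h1 (measure_union_null ?_ ?_)
  · rw [timesInterval, Measure.prod_prod, hν, zero_mul]
  · rw [timesInterval, Measure.prod_prod, Measure.restrict_apply measurableSet_Icc.compl,
      Set.compl_inter_self, measure_empty, mul_zero]

/-- The fundamental theorem of calculus for a family of curves. -/
theorem integral_timesInterval {P : Type*} [NormedAddCommGroup P] [NormedSpace ℝ P]
    [FiniteDimensional ℝ P] [MeasurableSpace P] [BorelSpace P] {C : Set P} (hC : IsCompact C)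
    {ν : Measure P} [IsFiniteMeasure ν] (hν : ν Cᶜ = 0) {F : Type*} [NormedAddCommGroup F]
    [NormedSpace ℝ F] [CompleteSpace F] {Φ : P → ℝ → F} {f : P × ℝ → F}
    (hf : ∀ z ∈ C ×ˢ Set.Icc (0 : ℝ) 1, ContinuousAt f z)
    (hΦ : ∀ k ∈ C, ∀ t ∈ Set.Icc (0 : ℝ) 1, HasDerivAt (Φ k) (f (k, t)) t) :
    ∫ z, f z ∂timesInterval ν = ∫ k, (Φ k 1 - Φ k 0) ∂ν := by
  have := FiniteDimensional.proper_real P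
  have hint : Integrable f (timesInterval ν) :=
    integrable_of_continuousOn (hC.prod isCompact_Icc) (timesInterval_compl hν)
      fun z hz => (hf z hz).continuousWithinAt
  rw [timesInterval, integral_prod f hint]
  refine integral_congr_ae ?_
  filter_upwards [ae_mem_of_compl_null hν] with k hk
  have h1 : ∀ t ∈ Set.Icc (0 : ℝ) 1, ContinuousAt (fun t => f (k, t)) t := fun t ht =>
    ContinuousAt.comp (f := fun t => (k, t)) (hf (k, t) ⟨hk, ht⟩) (by fun_prop)
  rw [← Set.uIcc_of_le zero_le_one] at h1
  rw [integral_Icc_eq_integral_Ioc, ← intervalIntegral.integral_of_le zero_le_one]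
  refine intervalIntegral.integral_eq_sub_of_hasDerivAt (fun t ht => hΦ k hk t ?_)
    (ContinuousOn.intervalIntegrable fun t ht => (h1 t ht).continuousWithinAt)
  rwa [Set.uIcc_of_le zero_le_one] at ht

/-- A family of forms is exact if it is the differential of a smooth family of total degree
`m - 1`. -/
def IsExact (m : ℤ) (β : PLevel V W p) : Prop :=
  ∃ χ : PLevel V W p, LSm χ ∧ LDg (m - 1) χ ∧ LD (m - 1) χ = β

theorem homot_eq_sum (m : ℤ) {ι : Type*} [Fintype ι] (b : Module.Basis ι ℝ (Fin (p + 1) → E))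
    (e : Fin (p + 1) → E) (α : PLevel V W p) :
    homot m e α = ∑ j, b.coord j e • homot m (b j) α := by
  funext q
  rw [Finset.sum_apply]
  conv_lhs => rw [← b.sum_repr e]
  rw [homot_linear]
  rfl

/-- Averaging the differences of a closed family of forms and its translates by the end points of
short paths gives an exact family. -/
theorem isExact_integral_path [ConnectedSpace G] [MeasurableSpace (Fin (p + 1) → E)]
    [BorelSpace (Fin (p + 1) → E)] {r : ℝ} (hr : IsChartRadius E G p r)
    {ν : Measure (Fin (p + 1) → E)} [IsFiniteMeasure ν] (hν : ν (Metric.closedBall 0 r)ᶜ = 0)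
    {m : ℤ} {α : PLevel V W p} (hα : LSm α) (hm : LDg m α) (hcl : LD m α = 0) :
    IsExact m fun q x => ∫ k, (act (path G k 1) (α q) x - α q x) ∂ν := by
  have := FiniteDimensional.proper_real (Fin (p + 1) → E)
  -- The difference is the integral over `[0, 1]` of the translates by `path k t` of the
  -- differential of `homot (pathVelocity (k, t)) α`. Expanding the velocity in a basis turns this
  -- into averages of translates of the fixed families `homot (b j) α`, with weights `ξ j`.
  let b := Module.finBasis ℝ (Fin (p + 1) → E)
  let C : Set ((Fin (p + 1) → E) × ℝ) := Metric.closedBall 0 r ×ˢ Set.Icc 0 1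
  let μ := timesInterval ν
  have hμ : μ Cᶜ = 0 := timesInterval_compl hν
  let γ : (Fin (p + 1) → E) × ℝ → Fin (p + 1) → G := fun z => path G z.1 z.2
  let ξ := fun (j : Fin (Module.finrank ℝ (Fin (p + 1) → E))) z =>
    b.coord j (pathVelocity (G := G) z)
  have hw : ∀ j, SmoothWeight (E := E) C μ (ξ j) γ := fun j =>
    { isCompact := (isCompact_closedBall _ _).prod isCompact_Icc
      null := hμ
      weight := fun k hk => ContDiffAt.comp k (g := b.coord j)
        (LinearMap.toContinuousLinearMap (b.coord j)).contDiff.contDiffAt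
        (contDiffAt_pathVelocity hr hk.1 hk.2)
      group := fun k hk i => hr k.1 hk.1 k.2 hk.2 i }
  have hs := fun j => homot_smooth m (b j) hα
  have hLs := fun j => LD_smooth (m - 1) (hs j)
  refine ⟨∑ j, translates μ (ξ j) γ (homot m (b j) α), LSm_sum fun j _ => (hw j).smooth (hs j),
    fun q g v => ?_, ?_⟩
  · have h1 : (∑ j, translates μ (ξ j) γ (homot m (b j) α)) q g v =
        ∑ j, translates μ (ξ j) γ (homot m (b j) α) q g v := by
      simp
    rw [h1]
    exact Submodule.sum_mem _ fun j _ => (hw j).degree (hs j) (homot_degree m (b j) hm) q g v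
  rw [LD_sum _ _ fun j _ => (hw j).smooth (hs j)]
  funext q x
  let f := fun z : (Fin (p + 1) → E) × ℝ =>
    act (γ z) (LD (m - 1) (homot m (pathVelocity (G := G) z) α) q) x
  have hf : f = fun z => ∑ j, ξ j z • act (γ z) (LD (m - 1) (homot m (b j) α) q) x := by
    funext z
    simp only [f]
    rw [homot_eq_sum m b, LD_sum (m - 1) Finset.univ
      (β := fun j => b.coord j (pathVelocity (G := G) z) • homot m (b j) α)
      fun j _ q x => (hs j q x).smul _]
    simp only [LD_smul, Finset.sum_apply, Pi.smul_apply, act_sum, act_smul]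
    rfl
  have hfi : ∀ j ∈ Finset.univ, Integrable
      (fun z => ξ j z • act (γ z) (LD (m - 1) (homot m (b j) α) q) x) μ := fun j _ =>
    (hw j).integrable (hLs j q) x
  have h1 : (∑ j, LD (m - 1) (translates μ (ξ j) γ (homot m (b j) α))) q x = ∫ z, f z ∂μ := by
    rw [hf, integral_finsetSum _ hfi]
    simp only [Finset.sum_apply, (hw _).LD_translates (m - 1) (hs _)]
    rfl
  have hcont : ∀ z ∈ C, ContinuousAt f z := fun z hz => by
    rw [hf]
    exact tendsto_finsetSum _ fun j _ => ((hw j).family (hLs j q) z hz x).continuousAt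
  rw [h1]
  refine (integral_timesInterval (isCompact_closedBall _ _) hν hcont
    fun k hk t ht => hasDerivAt_act_path hr hk ht hα hcl q x).trans ?_
  simp only [path_zero, act_one]

end PathHomotopy

/-! ### Translations by arbitrary group elements -/

section Averaging

open MeasureTheory PCochain PLevel

variable {E : Type v} [NormedAddCommGroup E] [NormedSpace ℝ E] [FiniteDimensional ℝ E]
  {G : Type w} [TopologicalSpace G] [ChartedSpace E G] [Group G] [LieGroup 𝓘(ℝ, E) ∞ G]
  {V W : TRep.{u} (E := E) G} {p : ℕ} {m : ℤ}

theorem IsExact.add {β β' : PLevel V W p} (h : IsExact m β) (h' : IsExact m β') :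
    IsExact m (β + β') := by
  obtain ⟨χ, h1, h2, rfl⟩ := h
  obtain ⟨χ', h1', h2', rfl⟩ := h'
  exact ⟨χ + χ', fun q x => (h1 q x).add (h1' q x),
    fun q g v => Submodule.add_mem _ (h2 q g v) (h2' q g v), LD_add _ h1 h1'⟩

theorem IsExact.smul {β : PLevel V W p} (h : IsExact m β) (c : ℝ) : IsExact m (c • β) := by
  obtain ⟨χ, h1, h2, rfl⟩ := h
  exact ⟨c • χ, fun q x => (h1 q x).smul c, fun q g v => Submodule.smul_mem _ c (h2 q g v),
    LD_smul _ _ _⟩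

theorem IsExact.zero : IsExact m (0 : PLevel V W p) :=
  ⟨0, fun _ => SmoothFormAt.zero, fun _ _ _ => Submodule.zero_mem _, LD_zero _⟩

theorem IsExact.act [ConnectedSpace G] {β : PLevel V W p} (h : IsExact m β)
    (a : Fin (p + 1) → G) : IsExact m fun q => act a (β q) := by
  obtain ⟨χ, h1, h2, rfl⟩ := h
  exact ⟨fun q => _root_.act a (χ q), fun q => SmoothFormAt.act a (h1 q),
    fun q => act_mem a (h2 q), funext fun q => LD_act _ a h1 q⟩

variable (E) in
/-- The coordinates of a tuple of group elements in the chart at the identity, relative to the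
coordinates of the identity. -/
def chartCoord (a : Fin (p + 1) → G) : Fin (p + 1) → E := fun i => cha E (1 : G) (a i) - cen E G

theorem exists_isOpen_chartCoord {r : ℝ} (hr : 0 < r) : ∃ O : Set (Fin (p + 1) → G), IsOpen O ∧
    1 ∈ O ∧ ContinuousOn (chartCoord E) O ∧
      ∀ a ∈ O, chartCoord E a ∈ Metric.closedBall 0 r ∧ path G (chartCoord E a) 1 = a := by
  let U : Set (Fin (p + 1) → G) := {a | ∀ i, a i ∈ (extChartAt 𝓘(ℝ, E) (1 : G)).source}
  have hU : IsOpen U := by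
    have : U = ⋂ i, (fun a : Fin (p + 1) → G => a i) ⁻¹' (extChartAt 𝓘(ℝ, E) (1 : G)).source := by
      ext a
      simp [U]
    rw [this]
    exact isOpen_iInter_of_finite fun i =>
      (isOpen_extChartAt_source (I := 𝓘(ℝ, E)) (1 : G)).preimage (continuous_apply i)
  have hc : ContinuousOn (chartCoord E) U := continuousOn_pi.2 fun i =>
    ((continuousOn_extChartAt (I := 𝓘(ℝ, E)) (1 : G)).comp (continuous_apply i).continuousOn
      fun a (ha : a ∈ U) => ha i).sub continuousOn_const
  refine ⟨U ∩ chartCoord E ⁻¹' Metric.ball 0 r, hc.isOpen_inter_preimage hU Metric.isOpen_ball,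
    ⟨fun i => mem_extChartAt_source (I := 𝓘(ℝ, E)) (1 : G), ?_⟩, hc.mono Set.inter_subset_left,
    fun a ha => ⟨Metric.ball_subset_closedBall ha.2, funext fun i => ?_⟩⟩
  · have : chartCoord E (1 : Fin (p + 1) → G) = 0 := funext fun i => sub_self _
    rw [Set.mem_preimage, this]
    exact Metric.mem_ball_self hr
  · have h1 : cen E G + (1 : ℝ) • (cha E (1 : G) (a i) - cen E G) = cha E (1 : G) (a i) := by
      rw [one_smul, add_sub_cancel]
    change par E (1 : G) (cen E G + (1 : ℝ) • (cha E (1 : G) (a i) - cen E G)) = a i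
    rw [h1]
    exact (extChartAt 𝓘(ℝ, E) (1 : G)).left_inv (ha.1 i)

/-- Translations by elements of a connected group act trivially on cohomology. -/
theorem isExact_act_sub [ConnectedSpace G] (a : Fin (p + 1) → G) {α : PLevel V W p} (hα : LSm α)
    (hm : LDg m α) (hcl : LD m α = 0) : IsExact m fun q => act a (α q) - α q := by
  have : IsTopologicalGroup G := topologicalGroup_of_lieGroup 𝓘(ℝ, E) ∞
  -- The elements with this property form a subgroup. It contains the end points of short paths,
  -- hence is open, and it is everything since the group is connected.
  let S : Subgroup (Fin (p + 1) → G) :=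
    { carrier := {a | ∀ (α : PLevel V W p), LSm α → LDg m α → LD m α = 0 →
        IsExact m fun q => act a (α q) - α q}
      one_mem' := fun α _ _ _ => by
        simp only [act_one, sub_self]
        exact IsExact.zero
      mul_mem' := fun {a b} ha hb α h1 h2 h3 => by
        have h := ((hb α h1 h2 h3).act a).add (ha α h1 h2 h3)
        convert h using 1
        funext q
        rw [Pi.add_apply, act_sub, act_act, sub_add_sub_cancel]
      inv_mem' := fun {a} ha α h1 h2 h3 => by
        have h := ((ha α h1 h2 h3).act a⁻¹).smul (-1)
        convert h using 1
        funext q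
        rw [Pi.smul_apply, act_sub, act_act, inv_mul_cancel, act_one]
        funext x
        ext1 v
        change _ = (-1 : ℝ) • (α q x v - act a⁻¹ (α q) x v)
        rw [neg_one_smul, neg_sub]
        rfl }
  obtain ⟨r, hr0, hr⟩ := exists_isChartRadius E G p
  obtain ⟨O, hO, h1O, -, hOr⟩ := exists_isOpen_chartCoord (E := E) (G := G) (p := p) hr0
  have hS : (S : Set (Fin (p + 1) → G)) ∈ 𝓝 1 := by
    filter_upwards [hO.mem_nhds h1O] with a ha α h1 h2 h3
    let _ : MeasurableSpace (Fin (p + 1) → E) := borel _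
    have : BorelSpace (Fin (p + 1) → E) := ⟨rfl⟩
    have h := isExact_integral_path hr (ν := Measure.dirac (chartCoord E a))
      (by
        rw [Measure.dirac_apply' _ Metric.isClosed_closedBall.measurableSet.compl]
        exact Set.indicator_of_notMem
          (fun h : chartCoord E a ∈ (Metric.closedBall 0 r)ᶜ => h (hOr a ha).1) _) h1 h2 h3
    simp only [integral_dirac, (hOr a ha).2] at h
    exact h
  have hop : IsOpen (S : Set (Fin (p + 1) → G)) := S.isOpen_of_mem_nhds hS
  have hcl' : IsClopen (S : Set (Fin (p + 1) → G)) := ⟨S.isClosed_of_isOpen hop, hop⟩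
  have huniv := hcl'.eq_univ ⟨1, S.one_mem⟩
  have ha : a ∈ (S : Set (Fin (p + 1) → G)) := huniv ▸ trivial
  exact ha α hα hm hcl

end Averaging

/-! ### Averaging over the group -/

section HaarAverage

open MeasureTheory PCochain PLevel

variable {E : Type v} [NormedAddCommGroup E] [NormedSpace ℝ E] [FiniteDimensional ℝ E]
  {G : Type w} [TopologicalSpace G] [ChartedSpace E G] [Group G] [LieGroup 𝓘(ℝ, E) ∞ G]
  (V W : TRep.{u} (E := E) G) {p : ℕ} [MeasurableSpace (Fin (p + 1) → G)]

variable {V W} in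
/-- The average of the translates of a family of forms over a measure on `G^(p+1)`. -/
def groupAverage (μ : Measure (Fin (p + 1) → G)) (α : PLevel V W p) : PLevel V W p := fun q x =>
  ∫ a, act a (α q) x ∂μ

/-- The properties of averages which are used: averages of smooth families are smooth, averaging
commutes with the differential, and averages of closed families are cohomologous to multiples of
the family. -/
structure IsAveraging (μ : Measure (Fin (p + 1) → G)) : Prop where
  integrable : ∀ {α : PLevel V W p}, LSm α → ∀ q x, Integrable (fun a => act a (α q) x) μ
  smooth : ∀ {α : PLevel V W p}, LSm α → LSm (groupAverage μ α)
  degree : ∀ {m : ℤ} {α : PLevel V W p}, LSm α → LDg m α → LDg m (groupAverage μ α)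
  LD_groupAverage : ∀ (m : ℤ) {α : PLevel V W p}, LSm α →
    LD m (groupAverage μ α) = groupAverage μ (LD m α)
  exact : ∀ {m : ℤ} {α : PLevel V W p}, LSm α → LDg m α → LD m α = 0 →
    IsExact m fun q x => groupAverage μ α q x - μ.real Set.univ • α q x

variable {V W}

theorem IsAveraging.zero : IsAveraging V W (0 : Measure (Fin (p + 1) → G)) := by
  have h : ∀ α : PLevel V W p, groupAverage (0 : Measure (Fin (p + 1) → G)) α = 0 := fun α =>
    funext fun q => funext fun x => integral_zero_measure _
  refine ⟨fun _ _ _ => integrable_zero_measure, fun _ => ?_, fun _ _ => ?_, fun m α _ => ?_,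
    fun _ _ _ => ?_⟩
  · rw [h]
    exact fun _ => SmoothFormAt.zero
  · rw [h]
    exact fun _ _ _ => Submodule.zero_mem _
  · rw [h, h, LD_zero]
  · rename_i m α h1 h2 h3
    have h4 : (fun q x => groupAverage (0 : Measure (Fin (p + 1) → G)) α q x -
        (0 : Measure (Fin (p + 1) → G)).real Set.univ • α q x) = (0 : PLevel V W p) := by
      funext q x
      rw [h, measureReal_zero_apply, zero_smul]
      exact sub_zero _
    rw [h4]
    exact IsExact.zero

theorem IsAveraging.add {μ μ' : Measure (Fin (p + 1) → G)} [IsFiniteMeasure μ]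
    [IsFiniteMeasure μ'] (hμ : IsAveraging V W μ) (hμ' : IsAveraging V W μ') :
    IsAveraging V W (μ + μ') := by
  have h : ∀ α : PLevel V W p, LSm α →
      groupAverage (μ + μ') α = groupAverage μ α + groupAverage μ' α :=
    fun α hα => funext fun q => funext fun x =>
      integral_add_measure (hμ.integrable hα q x) (hμ'.integrable hα q x)
  refine ⟨fun hα q x => (hμ.integrable hα q x).add_measure (hμ'.integrable hα q x), fun hα => ?_,
    fun hα hm => ?_, fun m α hα => ?_, fun {m α} hα hm hcl => ?_⟩
  · rw [h _ hα]
    exact fun q x => (hμ.smooth hα q x).add (hμ'.smooth hα q x)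
  · rw [h _ hα]
    exact fun q g v => Submodule.add_mem _ (hμ.degree hα hm q g v) (hμ'.degree hα hm q g v)
  · rw [h _ hα, h _ (LD_smooth m hα), LD_add m (hμ.smooth hα) (hμ'.smooth hα),
      hμ.LD_groupAverage m hα, hμ'.LD_groupAverage m hα]
  · convert (hμ.exact hα hm hcl).add (hμ'.exact hα hm hcl) using 1
    funext q x
    rw [h _ hα, measureReal_add_apply, add_smul]
    exact add_sub_add_comm _ _ _ _

variable [BorelSpace (Fin (p + 1) → G)] [ConnectedSpace G]

/-- Measures carried by small sets are averaging. The set is the translate by `b` of a neighborhood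
`O` of the identity, all of whose points are end points of short paths. -/
theorem isAveraging_small {r : ℝ} (hr : IsChartRadius E G p r) {O : Set (Fin (p + 1) → G)}
    (hO : IsOpen O) (hc : ContinuousOn (chartCoord E) O)
    (hOr : ∀ a ∈ O, chartCoord E a ∈ Metric.closedBall 0 r ∧ path G (chartCoord E a) 1 = a)
    (b : Fin (p + 1) → G) {μ : Measure (Fin (p + 1) → G)} [IsFiniteMeasure μ]
    (hμ : μ ((fun a => b⁻¹ * a) ⁻¹' O)ᶜ = 0) : IsAveraging V W μ := by
  have : IsTopologicalGroup G := topologicalGroup_of_lieGroup 𝓘(ℝ, E) ∞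
  let _ : MeasurableSpace (Fin (p + 1) → E) := borel _
  have : BorelSpace (Fin (p + 1) → E) := ⟨rfl⟩
  have := FiniteDimensional.proper_real (Fin (p + 1) → E)
  let O' := (fun a : Fin (p + 1) → G => b⁻¹ * a) ⁻¹' O
  have hO' : MeasurableSet O' := (hO.preimage (continuous_const_mul b⁻¹)).measurableSet
  let κ : (Fin (p + 1) → G) → Fin (p + 1) → E := fun a => chartCoord E (b⁻¹ * a)
  have hmem : ∀ᵐ a ∂μ, a ∈ O' := hμ
  have hκ : AEMeasurable κ μ := by
    rw [← Measure.restrict_eq_self_of_ae_mem hmem]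
    exact ContinuousOn.aemeasurable
      (hc.comp (continuous_const_mul b⁻¹).continuousOn fun a ha => ha) hO'
  let ν := μ.map κ
  have hν : ν (Metric.closedBall 0 r)ᶜ = 0 := by
    rw [Measure.map_apply_of_aemeasurable hκ Metric.isClosed_closedBall.measurableSet.compl]
    exact measure_mono_null (fun a ha h => ha (hOr _ h).1) hμ
  have hνu : ν.real Set.univ = μ.real Set.univ := by
    rw [measureReal_def, measureReal_def, Measure.map_apply_of_aemeasurable hκ MeasurableSet.univ,
      Set.preimage_univ]
  -- Every element of the set is `b` times the end point of a short path, which turns averages over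
  -- the group into averages over the ball of radius `r`.
  let γ : (Fin (p + 1) → E) → Fin (p + 1) → G := fun k => b * path G k 1
  have hp : SmoothWeight (E := E) (Metric.closedBall 0 r) ν (fun _ => 1) fun k => path G k 1 :=
    { isCompact := isCompact_closedBall _ _
      null := hν
      weight := fun _ _ => contDiffAt_const
      group := fun k hk i => ContMDiffAt.comp_of_eq
        (f := fun k : Fin (p + 1) → E => (k, (1 : ℝ))) (hr k hk 1 ⟨zero_le_one, le_rfl⟩ i)
        (contMDiffAt_iff_contDiffAt.2 (contDiffAt_id.prodMk contDiffAt_const)) rfl }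
  have hw : SmoothWeight (E := E) (Metric.closedBall 0 r) ν (fun _ => 1) γ :=
    { hp with group := fun k hk i => contMDiffAt_const.mul (hp.group k hk i) }
  have hγ : ∀ a ∈ O', γ (κ a) = a := fun a ha => by
    change b * path G (chartCoord E (b⁻¹ * a)) 1 = a
    rw [(hOr _ ha).2, mul_inv_cancel_left]
  have hi : ∀ {α : PLevel V W p}, LSm α → ∀ q x, Integrable (fun k => act (γ k) (α q) x) ν :=
    fun hα q x => by simpa only [one_smul] using hw.integrable (hα q) x
  have hae : ∀ (α : PLevel V W p) q x, (fun a => act (γ (κ a)) (α q) x) =ᵐ[μ]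
      fun a => act a (α q) x := fun α q x => by
    filter_upwards [hmem] with a ha
    rw [hγ a ha]
  have hav : ∀ {α : PLevel V W p}, LSm α → groupAverage μ α = translates ν (fun _ => 1) γ α :=
    fun {α} hα => funext fun q => funext fun x => by
      change ∫ a, act a (α q) x ∂μ = ∫ k, (1 : ℝ) • act (γ k) (α q) x ∂ν
      simp only [one_smul]
      rw [integral_map hκ (hi hα q x).aestronglyMeasurable]
      exact (integral_congr_ae (hae α q x)).symm
  refine ⟨fun {α} hα q x => ?_, fun hα => ?_, fun hα hm => ?_, fun m α hα => ?_,
    fun {m α} hα hm hcl => ?_⟩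
  · exact ((integrable_map_measure (hi hα q x).aestronglyMeasurable hκ).1 (hi hα q x)).congr
      (hae α q x)
  · rw [hav hα]
    exact hw.smooth hα
  · rw [hav hα]
    exact hw.degree hα hm
  · rw [hav hα, hav (LD_smooth m hα), hw.LD_translates m hα]
  · have h1 := (isExact_integral_path hr hν hα hm hcl).act b
    have h2 := (isExact_act_sub b hα hm hcl).smul (μ.real Set.univ)
    convert h1.add h2 using 1
    funext q x
    obtain ⟨T, hT⟩ := exists_act_clm (V := V) (W := W) (q := q) b x
    have hi' : Integrable (fun k => act (path G k 1) (α q) (zeta b⁻¹ x)) ν := by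
      simpa only [one_smul] using hp.integrable (hα q) (zeta b⁻¹ x)
    have h3 : act b (fun x => ∫ k, (act (path G k 1) (α q) x - α q x) ∂ν) x =
        groupAverage μ α q x - μ.real Set.univ • act b (α q) x := by
      rw [hT]
      change T (∫ k, (act (path G k 1) (α q) (zeta b⁻¹ x) - α q (zeta b⁻¹ x)) ∂ν) = _
      rw [integral_sub hi' (integrable_const _), map_sub, ← integral_clm_alt T hi', integral_const,
        map_smul, ← hT, hνu, hav hα]
      simp only [← hT, act_act]
      change _ = (∫ k, (1 : ℝ) • act (γ k) (α q) x ∂ν) - _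
      simp only [one_smul]
      rfl
    change _ = act b (fun x => ∫ k, (act (path G k 1) (α q) x - α q x) ∂ν) x +
      μ.real Set.univ • (act b (α q) x - α q x)
    rw [h3, smul_sub]
    abel

end HaarAverage

section QuasiEquivalence

open MeasureTheory PCochain PLevel

variable {E : Type v} [NormedAddCommGroup E] [NormedSpace ℝ E] [FiniteDimensional ℝ E]
  {G : Type w} [TopologicalSpace G] [ChartedSpace E G] [Group G] [LieGroup 𝓘(ℝ, E) ∞ G]
  {V W : TRep.{u} (E := E) G} {p : ℕ}

/-- On a compact connected group all finite measures are averaging, since they are sums of measures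
carried by small sets. -/
theorem isAveraging [ConnectedSpace G] [CompactSpace G] [MeasurableSpace (Fin (p + 1) → G)]
    [BorelSpace (Fin (p + 1) → G)] (μ : Measure (Fin (p + 1) → G)) [IsFiniteMeasure μ] :
    IsAveraging V W μ := by
  have : IsTopologicalGroup G := topologicalGroup_of_lieGroup 𝓘(ℝ, E) ∞
  obtain ⟨r, hr0, hr⟩ := exists_isChartRadius E G p
  obtain ⟨O, hO, h1O, hc, hOr⟩ := exists_isOpen_chartCoord (E := E) (G := G) (p := p) hr0
  -- By compactness, finitely many small sets cover the group. The measures carried by a union are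
  -- sums of measures carried by the members.
  have key : ∃ S : Set (Fin (p + 1) → G), MeasurableSet S ∧ Set.univ ⊆ S ∧
      ∀ (μ : Measure (Fin (p + 1) → G)) [IsFiniteMeasure μ], μ Sᶜ = 0 → IsAveraging V W μ := by
    refine isCompact_univ.induction_on (p := fun s => ∃ S : Set (Fin (p + 1) → G),
      MeasurableSet S ∧ s ⊆ S ∧
      ∀ (μ : Measure (Fin (p + 1) → G)) [IsFiniteMeasure μ], μ Sᶜ = 0 → IsAveraging V W μ)
      ?_ ?_ ?_ ?_
    · refine ⟨∅, MeasurableSet.empty, subset_rfl, fun μ _ h => ?_⟩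
      rw [Set.compl_empty, Measure.measure_univ_eq_zero] at h
      rw [h]
      exact IsAveraging.zero
    · rintro s t hst ⟨S, h1, h2, h3⟩
      exact ⟨S, h1, hst.trans h2, h3⟩
    · rintro s t ⟨S, h1, h2, h3⟩ ⟨T, h1', h2', h3'⟩
      refine ⟨S ∪ T, h1.union h1', Set.union_subset_union h2 h2', fun μ _ h => ?_⟩
      rw [← Measure.restrict_add_restrict_compl (μ := μ) h1]
      refine (h3 _ ?_).add (h3' _ ?_)
      · rw [Measure.restrict_apply h1.compl, Set.compl_inter_self, measure_empty]
      · rw [Measure.restrict_apply h1'.compl, Set.inter_comm, ← Set.compl_union, h]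
    · intro b _
      refine ⟨(fun a => b⁻¹ * a) ⁻¹' O, mem_nhdsWithin_of_mem_nhds ?_, _, ?_, subset_rfl,
        fun μ _ h => isAveraging_small hr hO hc hOr b h⟩
      · refine (hO.preimage (continuous_const_mul b⁻¹)).mem_nhds ?_
        rw [Set.mem_preimage, inv_mul_cancel]
        exact h1O
      · exact (hO.preimage (continuous_const_mul b⁻¹)).measurableSet
  obtain ⟨S, -, hS, h⟩ := key
  refine h μ ?_
  rw [Set.univ_subset_iff.1 hS, Set.compl_univ, measure_empty]

/-- A family of forms with invariant differential is the sum of its average, which is invariant, and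
an exact family. -/
theorem exists_invariant_add_exact [ConnectedSpace G] [CompactSpace G] {m : ℤ} (α : PLevel V W p)
    (hα : LSm α) (hm : LDg m α) (hinv : LInv (LD m α)) : ∃ ψ χ : PLevel V W p,
      (LSm ψ ∧ LDg m ψ ∧ LInv ψ) ∧ LSm χ ∧ LDg (m - 1) χ ∧ α = ψ + LD (m - 1) χ := by
  have : IsTopologicalGroup G := topologicalGroup_of_lieGroup 𝓘(ℝ, E) ∞
  let _ : MeasurableSpace (Fin (p + 1) → G) := borel _
  have : BorelSpace (Fin (p + 1) → G) := ⟨rfl⟩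
  let μ : Measure (Fin (p + 1) → G) := Measure.haarMeasure ⊤
  have : IsProbabilityMeasure μ := ⟨Measure.haarMeasure_self⟩
  have hμ : IsAveraging V W μ := isAveraging μ
  have hfix : ∀ {β : PLevel V W p}, LInv β → groupAverage μ β = β := fun {β} hβ =>
    funext fun q => funext fun x => by
      simp only [groupAverage, LInv_iff.1 hβ, integral_const, probReal_univ, one_smul]
  -- The average is invariant, by the invariance of the Haar measure.
  have hψ : LInv (groupAverage μ α) := LInv_iff.2 fun q b => funext fun x => by
    obtain ⟨T, hT⟩ := exists_act_clm (V := V) (W := W) (q := q) b x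
    rw [hT]
    change T (∫ a, act a (α q) (zeta b⁻¹ x) ∂μ) = ∫ a, act a (α q) x ∂μ
    rw [← integral_clm_alt T (hμ.integrable hα q _)]
    simp only [← hT, act_act]
    exact integral_mul_left_eq_self (fun a => act a (α q) x) b
  have hs := hμ.smooth hα
  have hd := hμ.degree hα hm
  -- The difference of `α` and its average is closed, and its average vanishes. Hence it is exact.
  have hβs : LSm (α + (-1 : ℝ) • groupAverage μ α) := fun q x => (hα q x).add ((hs q x).smul _)
  have hβcl : LD m (α + (-1 : ℝ) • groupAverage μ α) = 0 := by
    rw [LD_add m hα (β' := (-1 : ℝ) • groupAverage μ α) (fun q x => (hs q x).smul _), LD_smul,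
      hμ.LD_groupAverage m hα, hfix hinv]
    funext q x
    ext1 v
    change LD m α q x v + (-1 : ℝ) • LD m α q x v = 0
    rw [neg_one_smul, add_neg_cancel]
  obtain ⟨χ, h1, h2, h3⟩ := hμ.exact hβs (fun q g v => Submodule.add_mem _ (hm q g v)
    (Submodule.smul_mem _ _ (hd q g v))) hβcl
  refine ⟨groupAverage μ α, (-1 : ℝ) • χ, ⟨hs, hd, hψ⟩, fun q x => (h1 q x).smul _,
    fun q g v => Submodule.smul_mem _ _ (h2 q g v), ?_⟩
  rw [LD_smul, h3]
  have h4 : ∀ q x, groupAverage μ (α + (-1 : ℝ) • groupAverage μ α) q x = 0 := fun q x => by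
    have e1 : ∀ a, act a ((α + (-1 : ℝ) • groupAverage μ α) q) x =
        act a (α q) x + (-1 : ℝ) • groupAverage μ α q x := fun a => by
      change act a (α q + (-1 : ℝ) • groupAverage μ α q) x = _
      rw [act_add, act_smul, LInv_iff.1 hψ]
      rfl
    change ∫ a, act a ((α + (-1 : ℝ) • groupAverage μ α) q) x ∂μ = 0
    simp only [e1]
    rw [integral_add (hμ.integrable hα q x) (integrable_const _), integral_const, probReal_univ,
      one_smul]
    ext1 v
    change groupAverage μ α q x v + (-1 : ℝ) • groupAverage μ α q x v = 0
    rw [neg_one_smul, add_neg_cancel]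
  funext q x
  ext1 v
  change α q x v = groupAverage μ α q x v + (-1 : ℝ) •
    ((groupAverage μ (α + (-1 : ℝ) • groupAverage μ α) q x -
      μ.real Set.univ • (α q x + (-1 : ℝ) • groupAverage μ α q x)) v)
  rw [h4, probReal_univ]
  change α q x v = groupAverage μ α q x v + (-1 : ℝ) •
    (0 - (1 : ℝ) • (α q x v + (-1 : ℝ) • groupAverage μ α q x v))
  module

end QuasiEquivalence

end

theorem proposition4p8 {E : Type v} [NormedAddCommGroup E] [NormedSpace ℝ E]
    [FiniteDimensional ℝ E] (G : Type w) [TopologicalSpace G] [ChartedSpace E G] [Group G]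
    [LieGroup 𝓘(ℝ, E) ∞ G] [T2Space G] [CompactSpace G] [ConnectedSpace G] :
    ∃ (BI : DGCategory (TRep.{u} (E := E) G) fun V W m => BSSInvHom V W m)
      (B : DGCategory (TRep.{u} (E := E) G) fun V W m => BSSHom V W m)
      (hBI : IsBSSCategory BI) (hB : IsBSSCategory B),
      (BSSInclusion hBI hB).IsQuasiEquivalence :=
  ⟨PCochain.dgCategory PCochain.isClosedFamily_BSSInvHom,
    PCochain.dgCategory PCochain.isClosedFamily_BSSHom,
    PCochain.isBSSCategory PCochain.isClosedFamily_BSSInvHom,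
    PCochain.isBSSCategory PCochain.isClosedFamily_BSSHom,
    PCochain.isQuasiEquivalence_of_acyclic fun hs hd hi =>
      PCochain.acyclic_of_level (fun _ _ α h1 h2 h3 => exists_invariant_add_exact α h1 h2 h3)
        hs hd hi⟩
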